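/- Let $M$ be a closed oriented smooth 6-manifold, $\rho\in\Omega^3(M)$ a closed 3-form that is stable and positive (at every point it lies in the $GL(6,\mathbb R)$-orbit of $\operatorname{Re}(dz_1\wedge dz_2\wedge dz_3)$), with Hitchin dual $\hat\rho$ (the unique 3-form such that $\rho+i\hat\rho$ is, at each point, a nonzero complex volume form for a complex structure inducing the given orientation), and let $\tau\in\Omega^4(M)$ be a closed 4-form. In particular, $(\rho,\tau)$ may be any closed $G_2$-pair, that is, a pair for which $dt\wedge\rho+\tau$ is a stable 4-form defining a $G_2$-structure on $\mathbb R\times M$. Let $P$ be a closed oriented 3-manifold, $\kappa\in H_3(P;\mathbb Z)$ (for instance its fundamental class) and $A\in H_3(M;\mathbb Z)$. Let $$\mathcal F=\{\iota:P\to M \text{ a smooth embedding}\mid \iota_*\kappa=A,\ \iota^*\hat\rho>0\},$$ fix $\iota_0\in\mathcal F$, and let $\tilde{\mathcal F}$ be the space of smooth maps $\tilde\iota:[0,1]\times P\to M$ with $\tilde\iota(0,\cdot)=\iota_0$ and $\tilde\iota(t,\cdot)\in\mathcal F$ for all $t$. For $\tilde\iota\in\tilde{\mathcal F}$ write $\iota=\tilde\iota(1,\cdot)$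 and put $$f_\tau(\tilde\iota)=\int_{[0,1]\times P}\tilde\iota^*\tau,\qquad \Lambda(\lambda,\tilde\iota)=f_\tau(\tilde\iota)+\int_P\lambda\,\iota^*\rho\qquad(\lambda\in C^\infty(P)).$$ For a $(k+1)$-form $\alpha$ on $M$ let $\alpha_N$ be the $\iota^*T^*M$-valued $k$-form on $P$ given by $\alpha_N(v_1,\dots,v_k)=\alpha(\iota_*v_1,\dots,\iota_*v_k,\cdot)$. Then for every $\tilde\iota\in\tilde{\mathcal F}$ the following hold. 1. For every $\lambda\in C^\infty(P)$, the pair $(\lambda,\tilde\iota)$ is a critical point of $\Lambda$ (the derivative of $\Lambda$ exists and vanishes along every smooth curve in $C^\infty(P)\times\tilde{\mathcal F}$ through $(\lambda,\tilde\iota)$) if and only if the perturbed special Lagrangian equations hold: $$\tau_N+d\lambda\wedge\rho_N=0,\qquad \iota^*\rho=0.$$ 2. The submanifold $L=\iota(P)$ solves the Donaldson--Segal Lagrange multipliers problem if and only if there exists $\lambda\in C^\infty(P)$ such that $(\lambda,\iota)$ satisfies these equations. Here $L$ solves the problem if $\tilde\iota$ is a critical point of $f_\tau$ restricted to $\tilde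 C_\rho=\{\tilde\iota\mid\iota^*\rho=0\}$, that is, $\iota^*\rho=0$ and the derivative of $f_\tau$ vanishes on the tangent space of $\tilde C_\rho$ at $\tilde\iota$ (the kernel of the derivative of $\tilde\iota\mapsto\iota^*\rho$). -/

import Mathlib

open Set Function MeasureTheory Manifold AlgebraicTopology CategoryTheory
open scoped Manifold ContDiff

universe u

namespace SLagrange

noncomputable section

/-! ### Oriented manifolds and differential forms

An `n`-manifold is a Mathlib smooth manifold modelled on `EuclideanSpace ℝ (Fin n)`; it is oriented
by an oriented atlas. The fibre `TangentSpace (𝓡 n) x` is `EuclideanSpace ℝ (Fin n)`, identified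
with the tangent space through the preferred chart at `x`, so for an oriented atlas a frame at `x`
is positively oriented exactly when its determinant in `EuclideanSpace ℝ (Fin n)` is positive. -/

/-- All transition maps of the atlas of `X` preserve the orientation. -/
def IsOrientedAtlas (n : ℕ) (X : Type*) [TopologicalSpace X]
    [ChartedSpace (EuclideanSpace ℝ (Fin n)) X] : Prop :=
  ∀ e ∈ atlas (EuclideanSpace ℝ (Fin n)) X, ∀ e' ∈ atlas (EuclideanSpace ℝ (Fin n)) X,
    ∀ y ∈ (e.symm ≫ₕ e').source, 0 < (fderiv ℝ (e.symm ≫ₕ e') y).det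

/-- The matrix determinant of `n` vectors of `ℝⁿ`, i.e. the value on them of the standard volume
form. -/
def frameDet {n : ℕ} (v : Fin n → EuclideanSpace ℝ (Fin n)) : ℝ :=
  (Matrix.of fun i j => v i j).det

/-- (Not necessarily smooth) `k`-forms on the `n`-manifold `X`. -/
abbrev Form (n : ℕ) (X : Type*) [TopologicalSpace X] [ChartedSpace (EuclideanSpace ℝ (Fin n)) X]
    (k : ℕ) : Type _ :=
  ∀ x : X, TangentSpace (𝓡 n) x [⋀^Fin k]→L[ℝ] ℝ

section Forms

variable {n k : ℕ} {X : Type*} [TopologicalSpace X] [ChartedSpace (EuclideanSpace ℝ (Fin n)) X]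

/-- The coordinate representation of a form in the chart `e`: its pullback by `e.symm`. -/
def chartRep (η : Form n X k) (e : OpenPartialHomeomorph X (EuclideanSpace ℝ (Fin n)))
    (y : EuclideanSpace ℝ (Fin n)) : EuclideanSpace ℝ (Fin n) [⋀^Fin k]→L[ℝ] ℝ :=
  (η (e.symm y)).compContinuousLinearMap
    (mfderiv (𝓡 n) (𝓡 n) e.symm y)

/-- Smooth forms. -/
def IsSmoothForm (η : Form n X k) : Prop :=
  ∀ e ∈ atlas (EuclideanSpace ℝ (Fin n)) X, ContDiffOn ℝ ∞ (chartRep η e) e.target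

/-- Closed forms, `dη = 0`. -/
def IsClosedForm (η : Form n X k) : Prop :=
  ∀ e ∈ atlas (EuclideanSpace ℝ (Fin n)) X, ∀ y ∈ e.target, extDeriv (chartRep η e) y = 0

/-- The pullback `f^* η`. -/
def pullbackForm {m : ℕ} {Y : Type*} [TopologicalSpace Y]
    [ChartedSpace (EuclideanSpace ℝ (Fin m)) Y] (f : Y → X) (η : Form n X k) : Form m Y k :=
  fun y => (η (f y)).compContinuousLinearMap (mfderiv (𝓡 m) (𝓡 n) f y)

end Forms

section Integration

variable (n : ℕ) (X : Type*) [TopologicalSpace X] [ChartedSpace (EuclideanSpace ℝ (Fin n)) X]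
  [IsManifold (𝓡 n) ∞ X] [T2Space X] [CompactSpace X]

/-- A smooth partition of unity on `X` subordinate to the cover by the domains of the preferred
charts. -/
def partitionOfUnity : SmoothPartitionOfUnity X (𝓡 n) X univ :=
  (SmoothPartitionOfUnity.exists_isSubordinate_chartAt_source (𝓡 n) X).choose

variable {n X}

/-- The integral `∫_X η` of an `n`-form over the closed `n`-manifold `X` with oriented atlas. -/
def formIntegral (η : Form n X n) : ℝ :=
  ∑ᶠ i : X, ∫ y in (chartAt (EuclideanSpace ℝ (Fin n)) i).target,
    partitionOfUnity n X i ((chartAt (EuclideanSpace ℝ (Fin n)) i).symm y) *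
      chartRep η (chartAt (EuclideanSpace ℝ (Fin n)) i) y (EuclideanSpace.basisFun (Fin n) ℝ)

/-- The integral `∫_{[0,1] × X} η` of an `(n+1)`-form `η` (a field of alternating forms on the
tangent spaces of `ℝ × X`, of which only the values over `[0,1] × X` matter), computed in the charts
`id × e` for `e` a chart of `X`. The orientation is the product one: `∂/∂t` followed by a positive
frame of `X`. -/
def cylinderIntegral
    (η : ∀ x : ℝ × X, TangentSpace (𝓘(ℝ, ℝ).prod (𝓡 n)) x [⋀^Fin (n + 1)]→L[ℝ] ℝ) : ℝ :=
  ∑ᶠ i : X, ∫ z in Icc (0 : ℝ) 1 ×ˢ (chartAt (EuclideanSpace ℝ (Fin n)) i).target,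
    partitionOfUnity n X i ((chartAt (EuclideanSpace ℝ (Fin n)) i).symm z.2) *
      η (z.1, (chartAt (EuclideanSpace ℝ (Fin n)) i).symm z.2)
        (Fin.cons (((1 : ℝ), (0 : EuclideanSpace ℝ (Fin n))) : ℝ × EuclideanSpace ℝ (Fin n))
          fun j => (((0 : ℝ), mfderiv (𝓡 n) (𝓡 n)
            (chartAt (EuclideanSpace ℝ (Fin n)) i).symm z.2 (EuclideanSpace.basisFun (Fin n) ℝ j)) :
              ℝ × EuclideanSpace ℝ (Fin n)))

end Integration

/-! ### Positive 3-forms in dimension six and their Hitchin duals -/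

/-- `ℝ⁶ → ℂ³`, with `z_j = x_{2j} + i x_{2j+1}`. -/
def toC3 (v : EuclideanSpace ℝ (Fin 6)) : Fin 3 → ℂ :=
  fun j => ⟨v ⟨2 * j, by omega⟩, v ⟨2 * j + 1, by omega⟩⟩

/-- `dz₁ ∧ dz₂ ∧ dz₃` on `ℝ⁶ = ℂ³`. -/
def dz123 (v : Fin 3 → EuclideanSpace ℝ (Fin 6)) : ℂ :=
  (Matrix.of fun i j => toC3 (v i) j).det

/-- `ρ + i σ` is a nonzero complex volume form for some complex structure on `ℝ⁶` inducing the
standard orientation, i.e. it is the pullback of `dz₁ ∧ dz₂ ∧ dz₃` by an orientation-preserving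
linear isomorphism. For given `ρ` there is at most one such `σ`. -/
def IsHitchinDual (ρ σ : EuclideanSpace ℝ (Fin 6) [⋀^Fin 3]→L[ℝ] ℝ) : Prop :=
  ∃ A : EuclideanSpace ℝ (Fin 6) →L[ℝ] EuclideanSpace ℝ (Fin 6), 0 < A.det ∧
    ∀ v : Fin 3 → EuclideanSpace ℝ (Fin 6), (ρ v : ℂ) + (σ v : ℂ) * Complex.I = dz123 (A ∘ v)

/-- Positive (stable) 3-forms on `ℝ⁶`: the open orbit of `Re (dz₁ ∧ dz₂ ∧ dz₃)`, the one with
stabilizer `SL(3, ℂ)`. -/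
def IsPositive (ρ : EuclideanSpace ℝ (Fin 6) [⋀^Fin 3]→L[ℝ] ℝ) : Prop :=
  ∃ σ, IsHitchinDual ρ σ

open Classical in
/-- The Hitchin dual of a positive 3-form on the oriented vector space `ℝ⁶` (zero if the form is not
positive). -/
def hitchinDual (ρ : EuclideanSpace ℝ (Fin 6) [⋀^Fin 3]→L[ℝ] ℝ) :
    EuclideanSpace ℝ (Fin 6) [⋀^Fin 3]→L[ℝ] ℝ :=
  if h : IsPositive ρ then h.choose else 0

/-! ### The Lagrange multipliers problem -/

variable {P M : Type u}
  [TopologicalSpace P] [ChartedSpace (EuclideanSpace ℝ (Fin 3)) P]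
  [TopologicalSpace M] [ChartedSpace (EuclideanSpace ℝ (Fin 6)) M]

/-- Singular homology in degree three with integer coefficients. -/
abbrev H3 (X : Type u) [TopologicalSpace X] : ModuleCat.{u} ℤ :=
  ((singularHomologyFunctor (ModuleCat.{u} ℤ) 3).obj (ModuleCat.of ℤ (ULift.{u} ℤ))).obj
    (TopCat.of X)

/-- The map induced on `H₃` by a continuous map. -/
def H3.map {X Y : Type u} [TopologicalSpace X] [TopologicalSpace Y] (f : C(X, Y)) : H3 X → H3 Y :=
  (((singularHomologyFunctor (ModuleCat.{u} ℤ) 3).obj (ModuleCat.of ℤ (ULift.{u} ℤ))).map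
    (TopCat.ofHom f)).hom

/-- The space `𝓕` of smooth embeddings `ι : P → M` with `ι_* κ = A` and `ι^* ρ̂ > 0`. When `κ` is the
fundamental class of `P`, the condition `ι_* κ = A` says that `ι` represents `A`. -/
structure MemF (ρ : Form 6 M 3) (κ : H3 P) (A : H3 M) (ι : P → M) : Prop where
  embedding : IsSmoothEmbedding (𝓡 3) (𝓡 6) ∞ ι
  homology : H3.map ⟨ι, embedding.isEmbedding.continuous⟩ κ = A
  positive : ∀ (p : P) (v : Fin 3 → EuclideanSpace ℝ (Fin 3)), 0 < frameDet v →
    0 < hitchinDual (ρ (ι p)) (fun i => mfderiv (𝓡 3) (𝓡 6) ι p (v i))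

/-- Elements of `𝓕̃`, given by representatives: smooth paths `Φ : [0,1] × P → M` in `𝓕` starting at
`ι₀`. (Values at times outside `[0,1]` are irrelevant.) -/
structure IsPath (ρ : Form 6 M 3) (κ : H3 P) (A : H3 M) (ι₀ : P → M) (Φ : ℝ → P → M) : Prop where
  smooth : ContMDiffOn (𝓘(ℝ, ℝ).prod (𝓡 3)) (𝓡 6) ∞ (fun x : ℝ × P => Φ x.1 x.2)
    (Icc (0 : ℝ) 1 ×ˢ univ)
  start : Φ 0 = ι₀
  mem : ∀ t ∈ Icc (0 : ℝ) 1, MemF ρ κ A (Φ t)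

/-- Smooth curves `s ↦ Ψ s`, `|s| < ε`, in `𝓕̃` passing through `Φ` at `s = 0`. -/
structure IsVariation (ρ : Form 6 M 3) (κ : H3 P) (A : H3 M) (ι₀ : P → M) (Φ : ℝ → P → M)
    (ε : ℝ) (Ψ : ℝ → ℝ → P → M) : Prop where
  pos : 0 < ε
  smooth : ContMDiffOn ((𝓘(ℝ, ℝ).prod 𝓘(ℝ, ℝ)).prod (𝓡 3)) (𝓡 6) ∞
    (fun x : (ℝ × ℝ) × P => Ψ x.1.1 x.1.2 x.2) ((Ioo (-ε) ε ×ˢ Icc (0 : ℝ) 1) ×ˢ univ)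
  path : ∀ s ∈ Ioo (-ε) ε, IsPath ρ κ A ι₀ (Ψ s)
  center : ∀ t ∈ Icc (0 : ℝ) 1, Ψ 0 t = Φ t

/-- Smooth curves `s ↦ l s`, `|s| < ε`, in `C^∞(P)` passing through `lam` at `s = 0`. -/
structure IsFunctionVariation (lam : P → ℝ) (ε : ℝ) (l : ℝ → P → ℝ) : Prop where
  smooth : ContMDiffOn (𝓘(ℝ, ℝ).prod (𝓡 3)) 𝓘(ℝ, ℝ) ∞ (fun x : ℝ × P => l x.1 x.2)
    (Ioo (-ε) ε ×ˢ univ)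
  center : l 0 = lam

section Functionals

variable [IsManifold (𝓡 3) ∞ P] [T2Space P] [CompactSpace P]

/-- `f_τ(Φ) = ∫_{[0,1] × P} Φ^* τ`. -/
def fTau (τ : Form 6 M 4) (Φ : ℝ → P → M) : ℝ :=
  cylinderIntegral (n := 3) (X := P) fun x : ℝ × P =>
    (τ (Φ x.1 x.2)).compContinuousLinearMap
      (mfderivWithin (𝓘(ℝ, ℝ).prod (𝓡 3)) (𝓡 6) (fun z : ℝ × P => Φ z.1 z.2)
        (Icc (0 : ℝ) 1 ×ˢ univ) x)

/-- The Lagrange functional `Λ(λ, Φ) = ∫_{[0,1] × P} Φ^* τ + ∫_P λ ι^* ρ`, where `ι = Φ(1, ·)`. -/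
def lagrangeFunctional (ρ : Form 6 M 3) (τ : Form 6 M 4) (lam : P → ℝ) (Φ : ℝ → P → M) : ℝ :=
  fTau τ Φ + formIntegral (n := 3) (X := P) fun p => lam p • pullbackForm (Φ 1) ρ p

/-- `(λ, Φ)` is a critical point of `Λ` on `C^∞(P) × 𝓕̃`: the derivative of `Λ` vanishes along every
smooth curve through `(λ, Φ)`. -/
def IsCriticalPoint (ρ : Form 6 M 3) (τ : Form 6 M 4) (κ : H3 P) (A : H3 M) (ι₀ : P → M)
    (lam : P → ℝ) (Φ : ℝ → P → M) : Prop :=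
  ∀ (ε : ℝ) (Ψ : ℝ → ℝ → P → M) (l : ℝ → P → ℝ),
    IsVariation ρ κ A ι₀ Φ ε Ψ → IsFunctionVariation lam ε l →
      HasDerivAt (fun s => lagrangeFunctional ρ τ (l s) (Ψ s)) 0 0

/-- `Φ` solves the Lagrange multipliers problem: it is a critical point of the restriction of `f_τ`
to the constraint set `C̃_ρ = {Φ | ι^* ρ = 0}`, where `ι = Φ(1, ·)`. That is, `Φ` lies in `C̃_ρ` and
the derivative of `f_τ` vanishes on the tangent space of `C̃_ρ` at `Φ`, which consists of the
velocities of curves in `𝓕̃` along which the constraint `Φ ↦ ι^* ρ` has derivative zero. -/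
def SolvesLagrangeMultipliersProblem (ρ : Form 6 M 3) (τ : Form 6 M 4) (κ : H3 P) (A : H3 M)
    (ι₀ : P → M) (Φ : ℝ → P → M) : Prop :=
  pullbackForm (Φ 1) ρ = (0 : Form 3 P 3) ∧
  ∀ (ε : ℝ) (Ψ : ℝ → ℝ → P → M), IsVariation ρ κ A ι₀ Φ ε Ψ →
    (∀ (p : P) (v : Fin 3 → TangentSpace (𝓡 3) p),
      HasDerivAt (fun s => (pullbackForm (Ψ s 1) ρ : Form 3 P 3) p v) 0 0) →
    HasDerivAt (fun s => fTau τ (Ψ s)) 0 0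

end Functionals

/-! ### The perturbed special Lagrangian equations -/

/-- The `ι^* T^*M`-valued `k`-form `α_N` on `P` given by
`α_N(v₁, …, v_k)(w) = α(ι_* v₁, …, ι_* v_k, w)`. -/
def normalForm {k : ℕ} (α : Form 6 M (k + 1)) (ι : P → M) (p : P)
    (v : Fin k → TangentSpace (𝓡 3) p) (w : TangentSpace (𝓡 6) (ι p)) : ℝ :=
  α (ι p) (Fin.snoc (α := fun _ => TangentSpace (𝓡 6) (ι p))
    (fun i => mfderiv (𝓡 3) (𝓡 6) ι p (v i)) w)

/-- The differential `dλ` of a real function at `p`. -/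
def differential (lam : P → ℝ) (p : P) : TangentSpace (𝓡 3) p →L[ℝ] ℝ :=
  mfderiv (𝓡 3) 𝓘(ℝ, ℝ) lam p

/-- The wedge product `dλ ∧ β` of `dλ` with a `k`-form `β` at `p`:
`(dλ ∧ β)(v₀, …, v_k) = ∑ᵢ (-1)ⁱ dλ(vᵢ) β(v₀, …, v̂ᵢ, …, v_k)`. -/
def dWedge {k : ℕ} (lam : P → ℝ) (p : P) (β : (Fin k → TangentSpace (𝓡 3) p) → ℝ)
    (v : Fin (k + 1) → TangentSpace (𝓡 3) p) : ℝ :=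
  ∑ i : Fin (k + 1), (-1 : ℝ) ^ (i : ℕ) * differential lam p (v i) * β (i.removeNth v)

/-- The perturbed special Lagrangian equations `τ_N + dλ ∧ ρ_N = 0`, `ι^* ρ = 0`. -/
structure PerturbedSL (ρ : Form 6 M 3) (τ : Form 6 M 4) (lam : P → ℝ) (ι : P → M) : Prop where
  multiplier : ∀ (p : P) (v : Fin 3 → TangentSpace (𝓡 3) p) (w : TangentSpace (𝓡 6) (ι p)),
    normalForm τ ι p v w + dWedge lam p (fun u => normalForm ρ ι p u w) v = 0
  constraint : pullbackForm ι ρ = (0 : Form 3 P 3)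

end

end SLagrange

namespace SLagrange

noncomputable section

/-! ### Calculus of alternating forms -/

section AlternatingCalculus

variable {E F G W : Type*} [NormedAddCommGroup E] [NormedSpace ℝ E] [NormedAddCommGroup F]
  [NormedSpace ℝ F] [NormedAddCommGroup G] [NormedSpace ℝ G] [NormedAddCommGroup W]
  [NormedSpace ℝ W] {k : ℕ}

/-! Everything rests on the first variation. Let `X` be the velocity of the endpoint `ι` along a
curve of paths. Since `τ` is closed, Cartan's formula on the parameter square shows that `∂ₛ` of the
`∂ₜ`-contraction and `∂ₜ` of the `∂ₛ`-contraction of the pulled back form differ by an exact form on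
`P`. Stokes removes that form, and the starting embedding is fixed, so only the end `t = 1`
contributes: the derivative of `f_τ` is `∫_P ι^*(i_X τ)` (`hasDerivAt_fTau`). Since `ρ` is closed,
`ι^*ρ` varies by `d(ι^* i_X ρ)`. Integration by parts then makes the derivative of `∫ λ ι^*ρ` equal
to `∫ λ' ι^*ρ - ∫ dλ ∧ ι^*(i_X ρ)` (`hasDerivAt_integral_pullback`). Moving the free slot from last
to first turns the multiplier equation into `i_w τ = dλ ∧ i_w ρ` along `ι` (`perturbedSL_iff`), so
solutions are critical.

For the converse, every smooth field along `ι` has to be a velocity in the path space. It is the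
restriction of the velocity of an ambient isotopy (`exists_isotopy_along`). Moving a path by the
isotopy keeps embeddings and homology classes, and for short time also positivity, because the
Hitchin dual is continuous: the orbit of positive forms is open, with a submersive orbit map
(`continuousAt_hitchinDual`, `IsPath.exists_isVariation`). The fundamental lemma of the calculus of
variations then gives the equations.

For the multiplier problem, a tangent variation is one with `ι^*(i_X ρ)` closed, and `∫ dλ ∧ c = 0`
for closed `c`, so solutions of the equations solve the problem. Conversely, positivity of `ι^*ρ̂`
makes `w ↦ ι^*(i_w ρ)` surjective onto 2-forms at each point. If `ι^*ρ = 0`, its kernel is the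
tangent space of `L`, on which the contraction of `τ` vanishes too, hence `ι^*(i_w τ) = θ ∧ ι^*(i_w
ρ)` for a covector field `θ` (`exists_covector`), which is smooth. Every closed 2-form `c` is
`ι^*(i_X ρ)` for some `X` (`exists_contr_eq`), so stationarity says that `∫ θ ∧ c = 0` for all
closed `c`.

Such a `θ` is exact (`exists_potential`), which is a form of Poincaré duality and is proved without
cohomology. The rule `dc ↦ ∫ θ ∧ c` is a well defined functional on exact top-degree forms and
extends linearly to all of them. Locally, an argument of du Bois-Reymond type shows that on forms
with small support it is minus integration against a potential of `θ`. The functional fixes the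
constant of integration, so the local potentials agree on overlaps and glue to the multiplier `λ`.
-/

open ContinuousAlternatingMap in
/-- The wedge product of a covector and an alternating form. -/
def wedge1 (α : E →L[ℝ] ℝ) (β : E [⋀^Fin k]→L[ℝ] ℝ) : E [⋀^Fin (k + 1)]→L[ℝ] ℝ :=
  alternatizeUncurryFin (α.smulRight β)

theorem wedge1_apply (α : E →L[ℝ] ℝ) (β : E [⋀^Fin k]→L[ℝ] ℝ) (v : Fin (k + 1) → E) :
    wedge1 α β v = ∑ i : Fin (k + 1), (-1 : ℝ) ^ (i : ℕ) * α (v i) * β (i.removeNth v) := by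
  simp only [wedge1, ContinuousAlternatingMap.alternatizeUncurryFin_apply]
  refine Finset.sum_congr rfl fun i _ => ?_
  simp [mul_assoc, zsmul_eq_mul]

theorem wedge1_comp (α : F →L[ℝ] ℝ) (β : F [⋀^Fin k]→L[ℝ] ℝ) (g : E →L[ℝ] F) :
    (wedge1 α β).compContinuousLinearMap g =
      wedge1 (α.comp g) (β.compContinuousLinearMap g) := by
  ext v
  simp only [ContinuousAlternatingMap.compContinuousLinearMap_apply, wedge1_apply]
  rfl

theorem wedge1_add_left (α α' : E →L[ℝ] ℝ) (β : E [⋀^Fin k]→L[ℝ] ℝ) :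
    wedge1 (α + α') β = wedge1 α β + wedge1 α' β := by
  ext v
  simp [wedge1_apply, mul_add, add_mul, Finset.sum_add_distrib]

theorem wedge1_add_right (α : E →L[ℝ] ℝ) (β β' : E [⋀^Fin k]→L[ℝ] ℝ) :
    wedge1 α (β + β') = wedge1 α β + wedge1 α β' := by
  ext v
  simp [wedge1_apply, mul_add, Finset.sum_add_distrib]

theorem wedge1_smul_right (c : ℝ) (α : E →L[ℝ] ℝ) (β : E [⋀^Fin k]→L[ℝ] ℝ) :
    wedge1 α (c • β) = c • wedge1 α β := by
  ext v
  simp only [wedge1_apply, ContinuousAlternatingMap.smul_apply, smul_eq_mul, Finset.mul_sum]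
  exact Finset.sum_congr rfl fun i _ => by ring

@[simp]
theorem wedge1_zero_left (β : E [⋀^Fin k]→L[ℝ] ℝ) : wedge1 0 β = 0 := by
  ext v
  simp [wedge1_apply]

@[simp]
theorem wedge1_zero_right (α : E →L[ℝ] ℝ) : wedge1 α (0 : E [⋀^Fin k]→L[ℝ] ℝ) = 0 := by
  ext v
  simp [wedge1_apply]

theorem extDeriv_fun_mul {f : E → ℝ} {ζ : E → E [⋀^Fin k]→L[ℝ] ℝ} {x : E}
    (hf : DifferentiableAt ℝ f x) (hζ : DifferentiableAt ℝ ζ x) :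
    extDeriv (fun y => f y • ζ y) x = wedge1 (fderiv ℝ f x) (ζ x) + f x • extDeriv ζ x := by
  rw [extDeriv, fderiv_fun_smul hf hζ, ContinuousAlternatingMap.alternatizeUncurryFin_add,
    ContinuousAlternatingMap.alternatizeUncurryFin_smul]
  exact add_comm _ _

/-- Induction on the degree: currying off the first argument is a bounded linear operation and
lowers the degree by one. -/
theorem contDiffWithinAt_alternating_apply {n : ℕ∞ω} {k : ℕ} {ζ : W → E [⋀^Fin k]→L[ℝ] ℝ}
    {v : W → Fin k → E} {s : Set W} {x : W} (hζ : ContDiffWithinAt ℝ n ζ s x)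
    (hv : ∀ i, ContDiffWithinAt ℝ n (fun y => v y i) s x) :
    ContDiffWithinAt ℝ n (fun y => ζ y (v y)) s x := by
  induction k with
  | zero =>
    have h : (fun y => ζ y (v y)) = fun y =>
        (ContinuousAlternatingMap.constOfIsEmptyLIE ℝ E ℝ (Fin 0)).symm (ζ y) := by
      funext y
      have : v y = 0 := Subsingleton.elim _ _
      rw [this]
      rfl
    rw [h]
    exact (ContinuousAlternatingMap.constOfIsEmptyLIE ℝ E ℝ
      (Fin 0)).symm.toContinuousLinearEquiv.contDiff.comp_contDiffWithinAt hζ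
  | succ k ih =>
    have h : (fun y => ζ y (v y)) = fun y => (ζ y).curryLeft (v y 0) (fun i => v y i.succ) := by
      funext y
      rw [ContinuousAlternatingMap.curryLeft_apply_apply]
      congr 1
      exact (Matrix.cons_head_tail (v y)).symm
    rw [h]
    refine ih ?_ fun i => hv i.succ
    refine ContDiffWithinAt.clm_apply ?_ (hv 0)
    have hc : ContDiff ℝ n (fun f : E [⋀^Fin (k + 1)]→L[ℝ] ℝ => f.curryLeft) :=
      IsBoundedLinearMap.contDiff ⟨⟨fun _ _ => rfl, fun _ _ => rfl⟩, 1, one_pos, fun f => by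
        rw [ContinuousAlternatingMap.norm_curryLeft, one_mul]⟩
    exact hc.comp_contDiffWithinAt hζ

instance finiteDimensional_alternating [FiniteDimensional ℝ E] :
    FiniteDimensional ℝ (E [⋀^Fin k]→L[ℝ] ℝ) := by
  let b := Module.finBasis ℝ E
  let L : (E [⋀^Fin k]→L[ℝ] ℝ) →ₗ[ℝ] ((Fin k → Fin (Module.finrank ℝ E)) → ℝ) :=
    { toFun := fun ζ s => ζ (fun i => b (s i))
      map_add' := fun _ _ => rfl
      map_smul' := fun _ _ => rfl }
  refine FiniteDimensional.of_injective L fun ζ ζ' h => ?_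
  apply ContinuousAlternatingMap.toAlternatingMap_injective
  refine AlternatingMap.coe_multilinearMap_injective (Module.Basis.ext_multilinear (fun _ => b) ?_)
  intro s
  exact congrFun h s

theorem contDiffWithinAt_alternating_of_apply [FiniteDimensional ℝ E] {n : ℕ∞ω}
    {ζ : W → E [⋀^Fin k]→L[ℝ] ℝ} {s : Set W} {x : W}
    (h : ∀ v : Fin k → E, ContDiffWithinAt ℝ n (fun y => ζ y v) s x) :
    ContDiffWithinAt ℝ n ζ s x := by
  let b := Module.finBasis ℝ E
  let L : (E [⋀^Fin k]→L[ℝ] ℝ) →ₗ[ℝ] ((Fin k → Fin (Module.finrank ℝ E)) → ℝ) :=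
    { toFun := fun ζ s => ζ (fun i => b (s i))
      map_add' := fun _ _ => rfl
      map_smul' := fun _ _ => rfl }
  have hL : LinearMap.ker L = ⊥ := by
    rw [LinearMap.ker_eq_bot]
    intro ζ ζ' h
    apply ContinuousAlternatingMap.toAlternatingMap_injective
    refine AlternatingMap.coe_multilinearMap_injective
      (Module.Basis.ext_multilinear (fun _ => b) ?_)
    intro s
    exact congrFun h s
  -- The values on tuples of basis vectors embed the forms linearly in a finite product, and a
  -- linear left inverse recovers the form from these smooth values.
  obtain ⟨R, hR⟩ := LinearMap.exists_leftInverse_of_injective L hL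
  have h1 : ContDiffWithinAt ℝ n (fun y => L (ζ y)) s x := by
    rw [contDiffWithinAt_pi]
    intro i
    exact h _
  have h2 := R.toContinuousLinearMap.contDiff.comp_contDiffWithinAt (g := R.toContinuousLinearMap) h1
  refine h2.congr (fun y _ => ?_) ?_ <;> exact (LinearMap.congr_fun hR _).symm

theorem contDiffWithinAt_alternating_comp [FiniteDimensional ℝ E] {n : ℕ∞ω}
    {ζ : W → F [⋀^Fin k]→L[ℝ] ℝ} {g : W → E →L[ℝ] F} {s : Set W} {x : W}
    (hζ : ContDiffWithinAt ℝ n ζ s x) (hg : ContDiffWithinAt ℝ n g s x) :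
    ContDiffWithinAt ℝ n (fun y => (ζ y).compContinuousLinearMap (g y)) s x :=
  contDiffWithinAt_alternating_of_apply fun v =>
    contDiffWithinAt_alternating_apply (v := fun y i => g y (v i)) hζ
      fun _ => hg.clm_apply contDiffWithinAt_const

theorem contDiff_alternatizeUncurryFin {n : ℕ∞ω} :
    ContDiff ℝ n (fun f : E →L[ℝ] E [⋀^Fin k]→L[ℝ] ℝ =>
      ContinuousAlternatingMap.alternatizeUncurryFin f) :=
  IsBoundedLinearMap.contDiff ⟨⟨ContinuousAlternatingMap.alternatizeUncurryFin_add,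
    ContinuousAlternatingMap.alternatizeUncurryFin_smul⟩, k + 1, by positivity, fun f =>
      ContinuousAlternatingMap.norm_alternatizeUncurryFin_le f⟩

theorem contDiffWithinAt_wedge1 {n : ℕ∞ω} {α : W → E →L[ℝ] ℝ} {ζ : W → E [⋀^Fin k]→L[ℝ] ℝ}
    {s : Set W} {x : W} (hα : ContDiffWithinAt ℝ n α s x) (hζ : ContDiffWithinAt ℝ n ζ s x) :
    ContDiffWithinAt ℝ n (fun y => wedge1 (α y) (ζ y)) s x :=
  have hc : ContDiff ℝ n (fun f : E →L[ℝ] E [⋀^Fin k]→L[ℝ] ℝ =>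
      ContinuousAlternatingMap.alternatizeUncurryFin f) :=
    contDiff_alternatizeUncurryFin
  hc.comp_contDiffWithinAt (hα.smulRight hζ)

theorem contDiffOn_extDeriv [FiniteDimensional ℝ E] {ζ : E → E [⋀^Fin k]→L[ℝ] ℝ} {s : Set E}
    (hs : IsOpen s) (h : ContDiffOn ℝ ∞ ζ s) : ContDiffOn ℝ ∞ (extDeriv ζ) s :=
  have hc : ContDiff ℝ ∞ (fun f : E →L[ℝ] E [⋀^Fin k]→L[ℝ] ℝ =>
      ContinuousAlternatingMap.alternatizeUncurryFin f) :=
    contDiff_alternatizeUncurryFin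
  hc.comp_contDiffOn (h.fderiv_of_isOpen hs (by simp))

end AlternatingCalculus

/-- The determinant rule for top-degree forms. -/
theorem topForm_comp {n : ℕ} (η : EuclideanSpace ℝ (Fin n) [⋀^Fin n]→L[ℝ] ℝ)
    (g : EuclideanSpace ℝ (Fin n) →L[ℝ] EuclideanSpace ℝ (Fin n)) :
    η.compContinuousLinearMap g = g.det • η := by
  let b := (EuclideanSpace.basisFun (Fin n) ℝ).toBasis
  have h := AlternatingMap.eq_smul_basis_det b η.toAlternatingMap
  ext v
  have h1 : η (fun i => g (v i)) = η b * b.det (fun i => g (v i)) := by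
    have := congrArg (fun f => f (fun i => g (v i))) h
    simpa using this
  have h2 : η v = η b * b.det v := by
    have := congrArg (fun f => f v) h
    simpa using this
  have h3 := b.det_comp (g : EuclideanSpace ℝ (Fin n) →ₗ[ℝ] EuclideanSpace ℝ (Fin n)) v
  have h4 : b.det (fun i => g (v i)) = g.det * b.det v := h3
  simp only [ContinuousAlternatingMap.compContinuousLinearMap_apply,
    ContinuousAlternatingMap.smul_apply, smul_eq_mul]
  change η (fun i => g (v i)) = _
  rw [h1, h2, h4]
  ring

theorem topForm_apply {n : ℕ} (η : EuclideanSpace ℝ (Fin n) [⋀^Fin n]→L[ℝ] ℝ)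
    (v : Fin n → EuclideanSpace ℝ (Fin n)) :
    η v = frameDet v * η (EuclideanSpace.basisFun (Fin n) ℝ) := by
  let b := (EuclideanSpace.basisFun (Fin n) ℝ).toBasis
  have h := AlternatingMap.eq_smul_basis_det b η.toAlternatingMap
  have h2 : η v = η b * b.det v := by
    have := congrArg (fun f => f v) h
    simpa using this
  have h3 : b.det v = frameDet v := by
    -- The determinant relative to a basis has the vectors as columns, `frameDet` has them as rows.
    rw [Module.Basis.det_apply, frameDet, ← Matrix.det_transpose]
    congr 1
  rw [h2, h3, mul_comm]
  simp [b]

theorem frameDet_basisFun {n : ℕ} : frameDet (EuclideanSpace.basisFun (Fin n) ℝ) = 1 := by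
  rw [frameDet, ← Matrix.det_one (n := Fin n)]
  congr 1
  ext i j
  simp [Matrix.one_apply, eq_comm]

/-! ### Derivatives of maps between manifolds, as linear maps of model spaces -/

section Derivative

variable {E E' E'' : Type*} [NormedAddCommGroup E] [NormedSpace ℝ E] [NormedAddCommGroup E']
  [NormedSpace ℝ E'] [NormedAddCommGroup E''] [NormedSpace ℝ E''] {H H' H'' : Type*}
  [TopologicalSpace H] [TopologicalSpace H'] [TopologicalSpace H'']
  (I : ModelWithCorners ℝ E H) (J : ModelWithCorners ℝ E' H') (K : ModelWithCorners ℝ E'' H'')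
  {X Y Z : Type*} [TopologicalSpace X] [ChartedSpace H X] [TopologicalSpace Y] [ChartedSpace H' Y]
  [TopologicalSpace Z] [ChartedSpace H'' Z]

/-- The derivative of `f` within `s` at `x`, as a linear map between the model spaces. -/
def tder (f : X → Y) (s : Set X) (x : X) : E →L[ℝ] E' := mfderivWithin I J f s x

variable {I J K}

/-- The chain rule, in the form used throughout: the type of `tder` mentions only the model spaces,
so equations between derivatives at equal base points can be rewritten without transport along
tangent spaces. -/
theorem tder_comp {g : Y → Z} {f : X → Y} {s : Set X} {t : Set Y} {x : X}
    (hg : MDifferentiableWithinAt J K g t (f x)) (hf : MDifferentiableWithinAt I J f s x)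
    (h : MapsTo f s t) (hs : UniqueMDiffWithinAt I s x) :
    tder I K (fun y => g (f y)) s x = (tder J K g t (f x)).comp (tder I J f s x) :=
  mfderivWithin_comp x hg hf h hs

theorem tder_univ (f : X → Y) (x : X) : tder I J f univ x = mfderiv I J f x :=
  congrFun mfderivWithin_univ x

theorem tder_of_mem_nhds {f : X → Y} {s : Set X} {x : X} (h : s ∈ nhds x) :
    tder I J f s x = tder I J f univ x := by
  have h1 := mfderivWithin_of_mem_nhds (I := I) (I' := J) (f := f) h
  rw [tder_univ]
  exact h1

theorem tder_eventuallyEq {f g : X → Y} {s : Set X} {x : X} (h : f =ᶠ[nhdsWithin x s] g)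
    (hx : f x = g x) : tder I J f s x = tder I J g s x := by
  have h1 := Filter.EventuallyEq.mfderivWithin_eq (I := I) (I' := J) h hx
  exact h1

theorem tder_eq_fderivWithin {f : E → E'} {s : Set E} {x : E} :
    tder 𝓘(ℝ, E) 𝓘(ℝ, E') f s x = fderivWithin ℝ f s x :=
  mfderivWithin_eq_fderivWithin

theorem tder_id {s : Set X} {x : X} (hs : UniqueMDiffWithinAt I s x) :
    tder I I (fun y => y) s x = ContinuousLinearMap.id ℝ E :=
  mfderivWithin_id hs

end Derivative

/-! ### Change of charts for forms and orientation. -/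

section Charts

variable {n k : ℕ} {X : Type*} [TopologicalSpace X] [ChartedSpace (EuclideanSpace ℝ (Fin n)) X]

/-- The value of a form at a point, as an alternating form on the model space. -/
def Form.val (η : Form n X k) (x : X) : EuclideanSpace ℝ (Fin n) [⋀^Fin k]→L[ℝ] ℝ := η x

theorem chartRep_eq (η : Form n X k) (e : OpenPartialHomeomorph X (EuclideanSpace ℝ (Fin n)))
    (y : EuclideanSpace ℝ (Fin n)) :
    chartRep η e y = (η.val (e.symm y)).compContinuousLinearMap
      (tder (𝓡 n) (𝓡 n) e.symm univ y) := by
  rw [tder_univ]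
  rfl

variable [IsManifold (𝓡 n) ∞ X] {e e' : OpenPartialHomeomorph X (EuclideanSpace ℝ (Fin n))}

theorem contMDiffAt_chart (he : e ∈ atlas (EuclideanSpace ℝ (Fin n)) X) {x : X}
    (hx : x ∈ e.source) : ContMDiffAt (𝓡 n) (𝓡 n) ∞ e x :=
  contMDiffAt_of_mem_maximalAtlas (IsManifold.subset_maximalAtlas he) hx

theorem contMDiffAt_chart_symm (he : e ∈ atlas (EuclideanSpace ℝ (Fin n)) X)
    {y : EuclideanSpace ℝ (Fin n)} (hy : y ∈ e.target) : ContMDiffAt (𝓡 n) (𝓡 n) ∞ e.symm y :=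
  contMDiffAt_symm_of_mem_maximalAtlas (IsManifold.subset_maximalAtlas he) hy

theorem mdifferentiableAt_chart (he : e ∈ atlas (EuclideanSpace ℝ (Fin n)) X) {x : X}
    (hx : x ∈ e.source) : MDifferentiableAt (𝓡 n) (𝓡 n) e x :=
  (contMDiffAt_chart he hx).mdifferentiableAt (by simp)

theorem mdifferentiableAt_chart_symm (he : e ∈ atlas (EuclideanSpace ℝ (Fin n)) X)
    {y : EuclideanSpace ℝ (Fin n)} (hy : y ∈ e.target) : MDifferentiableAt (𝓡 n) (𝓡 n) e.symm y :=
  (contMDiffAt_chart_symm he hy).mdifferentiableAt (by simp)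

theorem contDiffAt_transition (he : e ∈ atlas (EuclideanSpace ℝ (Fin n)) X)
    (he' : e' ∈ atlas (EuclideanSpace ℝ (Fin n)) X) {y : EuclideanSpace ℝ (Fin n)}
    (hy : y ∈ (e.symm ≫ₕ e').source) : ContDiffAt ℝ ∞ (e.symm ≫ₕ e') y := by
  rw [OpenPartialHomeomorph.trans_source] at hy
  rw [← contMDiffAt_iff_contDiffAt]
  exact (contMDiffAt_chart he' hy.2).comp y (contMDiffAt_chart_symm he hy.1)

/-- Near `y` the inverse chart `e.symm` is `e'.symm` after the transition map, so this is the chain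
rule. -/
theorem tder_chart_symm (he : e ∈ atlas (EuclideanSpace ℝ (Fin n)) X)
    (he' : e' ∈ atlas (EuclideanSpace ℝ (Fin n)) X) {y : EuclideanSpace ℝ (Fin n)}
    (hy : y ∈ (e.symm ≫ₕ e').source) :
    tder (𝓡 n) (𝓡 n) e.symm univ y = (tder (𝓡 n) (𝓡 n) e'.symm univ (e' (e.symm y))).comp
      (fderiv ℝ (e.symm ≫ₕ e') y) := by
  have hy' := hy
  rw [OpenPartialHomeomorph.trans_source] at hy'
  have hd := (contDiffAt_transition he he' hy).differentiableAt (by simp)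
  have h1 : tder (𝓡 n) (𝓡 n) (fun z => e'.symm ((e.symm ≫ₕ e') z)) univ y =
      (tder (𝓡 n) (𝓡 n) e'.symm univ ((e.symm ≫ₕ e') y)).comp
        (tder (𝓡 n) (𝓡 n) (e.symm ≫ₕ e') univ y) := by
    refine tder_comp (J := 𝓡 n) ?_ ?_ (mapsTo_univ _ _) (uniqueMDiffWithinAt_univ _)
    · exact (mdifferentiableAt_chart_symm he' (e'.map_source hy'.2)).mdifferentiableWithinAt
    · exact hd.mdifferentiableAt.mdifferentiableWithinAt
  rw [tder_eq_fderivWithin, fderivWithin_univ] at h1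
  have h2 : tder (𝓡 n) (𝓡 n) (fun z => e'.symm ((e.symm ≫ₕ e') z)) univ y =
      tder (𝓡 n) (𝓡 n) e.symm univ y := by
    refine tder_eventuallyEq ?_ (e'.left_inv hy'.2)
    rw [nhdsWithin_univ]
    filter_upwards [(e.symm ≫ₕ e').open_source.mem_nhds hy] with z hz
    rw [OpenPartialHomeomorph.trans_source] at hz
    exact e'.left_inv hz.2
  rw [← h2, h1]
  rfl

theorem chartRep_transition (η : Form n X k) (he : e ∈ atlas (EuclideanSpace ℝ (Fin n)) X)
    (he' : e' ∈ atlas (EuclideanSpace ℝ (Fin n)) X) {y : EuclideanSpace ℝ (Fin n)}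
    (hy : y ∈ (e.symm ≫ₕ e').source) :
    chartRep η e y = (chartRep η e' ((e.symm ≫ₕ e') y)).compContinuousLinearMap
      (fderiv ℝ (e.symm ≫ₕ e') y) := by
  have hy' := hy
  rw [OpenPartialHomeomorph.trans_source] at hy'
  rw [chartRep_eq, chartRep_eq, tder_chart_symm he he' hy]
  have h : e'.symm ((e.symm ≫ₕ e') y) = e.symm y := e'.left_inv hy'.2
  rw [h]
  rfl

/-- The tangent space at `x` is identified with the model space through the preferred chart at `x`,
so in this chart the derivative is trivial at the centre. -/
theorem tder_chartAt_symm_self (x : X) :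
    tder (𝓡 n) (𝓡 n) (chartAt (EuclideanSpace ℝ (Fin n)) x).symm univ
      (chartAt (EuclideanSpace ℝ (Fin n)) x x) = ContinuousLinearMap.id ℝ _ := by
  have hm : MDifferentiableAt (𝓡 n) (𝓡 n) (chartAt (EuclideanSpace ℝ (Fin n)) x).symm
      (chartAt (EuclideanSpace ℝ (Fin n)) x x) :=
    mdifferentiableAt_chart_symm (chart_mem_atlas _ x) (mem_chart_target _ x)
  have h1 := hm.mfderiv
  rw [tder_univ]
  refine Eq.trans h1 ?_
  rw [ModelWithCorners.range_eq_univ, fderivWithin_univ]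
  have h2 : writtenInExtChartAt (𝓡 n) (𝓡 n) (chartAt (EuclideanSpace ℝ (Fin n)) x x)
      (chartAt (EuclideanSpace ℝ (Fin n)) x).symm =ᶠ[nhds (chartAt (EuclideanSpace ℝ (Fin n)) x x)]
      fun z => z := by
    filter_upwards [(chartAt (EuclideanSpace ℝ (Fin n)) x).open_target.mem_nhds
      (mem_chart_target _ x)] with z hz
    simp only [writtenInExtChartAt, extChartAt_model_space_eq_id, comp_apply]
    simp [mem_chart_source, OpenPartialHomeomorph.left_inv, hz]
  have h3 := h2.fderiv_eq (𝕜 := ℝ)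
  simp only [extChartAt_model_space_eq_id]
  exact h3.trans fderiv_fun_id

/-- Comparing `e` with the preferred chart at `e.symm y`, whose own derivative there is the
identity, the determinant becomes that of a transition map. -/
theorem tder_chart_symm_det_pos (hX : IsOrientedAtlas n X)
    (he : e ∈ atlas (EuclideanSpace ℝ (Fin n)) X) {y : EuclideanSpace ℝ (Fin n)}
    (hy : y ∈ e.target) : 0 < (tder (𝓡 n) (𝓡 n) e.symm univ y).det := by
  have hs : y ∈ (e.symm ≫ₕ chartAt (EuclideanSpace ℝ (Fin n)) (e.symm y)).source := by
    rw [OpenPartialHomeomorph.trans_source]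
    exact ⟨hy, mem_chart_source _ _⟩
  rw [tder_chart_symm he (chart_mem_atlas _ (e.symm y)) hs, tder_chartAt_symm_self]
  exact hX _ he _ (chart_mem_atlas _ _) y hs

theorem tder_chart_comp_symm (he : e ∈ atlas (EuclideanSpace ℝ (Fin n)) X)
    {y : EuclideanSpace ℝ (Fin n)} (hy : y ∈ e.target) :
    (tder (𝓡 n) (𝓡 n) e univ (e.symm y)).comp (tder (𝓡 n) (𝓡 n) e.symm univ y) =
      ContinuousLinearMap.id ℝ _ := by
  rw [← tder_comp (mdifferentiableAt_chart he (e.map_target hy)).mdifferentiableWithinAt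
    (mdifferentiableAt_chart_symm he hy).mdifferentiableWithinAt (mapsTo_univ _ _)
    (uniqueMDiffWithinAt_univ _)]
  rw [← tder_id (I := 𝓡 n) (s := univ) (x := y) (uniqueMDiffWithinAt_univ _)]
  refine tder_eventuallyEq ?_ (e.right_inv hy)
  rw [nhdsWithin_univ]
  filter_upwards [e.open_target.mem_nhds hy] with z hz using e.right_inv hz

theorem tder_chart_symm_comp (he : e ∈ atlas (EuclideanSpace ℝ (Fin n)) X) {x : X}
    (hx : x ∈ e.source) :
    (tder (𝓡 n) (𝓡 n) e.symm univ (e x)).comp (tder (𝓡 n) (𝓡 n) e univ x) =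
      ContinuousLinearMap.id ℝ _ := by
  rw [← tder_comp (mdifferentiableAt_chart_symm he (e.map_source hx)).mdifferentiableWithinAt
    (mdifferentiableAt_chart he hx).mdifferentiableWithinAt (mapsTo_univ _ _)
    (uniqueMDiffWithinAt_univ _)]
  rw [← tder_id (I := 𝓡 n) (s := univ) (x := x) (uniqueMDiffWithinAt_univ _)]
  refine tder_eventuallyEq ?_ (e.left_inv hx)
  rw [nhdsWithin_univ]
  filter_upwards [e.open_source.mem_nhds hx] with z hz using e.left_inv hz

/-- A form vanishes at a point as soon as its coordinate representation does. -/
theorem form_val_eq (η : Form n X k) (he : e ∈ atlas (EuclideanSpace ℝ (Fin n)) X) {x : X}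
    (hx : x ∈ e.source) :
    η.val x = (chartRep η e (e x)).compContinuousLinearMap (tder (𝓡 n) (𝓡 n) e univ x) := by
  have h := tder_chart_symm_comp he hx
  rw [chartRep_eq, e.left_inv hx]
  ext v
  simp only [ContinuousAlternatingMap.compContinuousLinearMap_apply]
  congr 1
  funext i
  exact (DFunLike.congr_fun h (v i)).symm

end Charts

/-! ### Integration of forms -/

section Euclidean

variable {E F : Type*} [NormedAddCommGroup E] [NormedSpace ℝ E] [NormedAddCommGroup F]
  [NormedSpace ℝ F]

theorem integrableOn_of_eq_zero_off_compact [MeasurableSpace E] [BorelSpace E] {μ : Measure E}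
    [IsFiniteMeasureOnCompacts μ] {T K : Set E} (hT : MeasurableSet T) (hK : IsCompact K)
    (hKT : K ⊆ T) {g : E → F} (hg : ContinuousOn g T) (h0 : ∀ y ∈ T, y ∉ K → g y = 0) :
    IntegrableOn g T μ := by
  have h1 : IntegrableOn g K μ := (hg.mono hKT).integrableOn_compact hK
  exact h1.of_forall_sdiff_eq_zero hT fun y hy => h0 y hy.1 hy.2

/-- Extending by zero a function which is smooth on an open set and vanishes off a compact
subset. -/
theorem contDiff_indicator {T K : Set E} (hT : IsOpen T) (hK : IsClosed K) (hKT : K ⊆ T)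
    {g : E → F} {n : ℕ∞ω} (hg : ContDiffOn ℝ n g T) (h0 : ∀ y ∈ T, y ∉ K → g y = 0) :
    ContDiff ℝ n (T.indicator g) := by
  rw [contDiff_iff_contDiffAt]
  intro y
  by_cases hy : y ∈ T
  · refine (hg.contDiffAt (hT.mem_nhds hy)).congr_of_eventuallyEq ?_
    filter_upwards [hT.mem_nhds hy] with z hz using indicator_of_mem hz _
  · refine (contDiffAt_const (c := (0 : F))).congr_of_eventuallyEq ?_
    filter_upwards [hK.isOpen_compl.mem_nhds fun h => hy (hKT h)] with z hz
    by_cases hzT : z ∈ T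
    · rw [indicator_of_mem hzT, h0 z hzT hz]
    · rw [indicator_of_notMem hzT]

variable [FiniteDimensional ℝ E] [MeasurableSpace E] [BorelSpace E] {μ : Measure E}
  [μ.IsAddHaarMeasure]

/-- Integration by parts against the constant function `1`. -/
theorem integral_fderiv_eq_zero {f : E → ℝ} (hf : ContDiff ℝ 1 f) (hc : HasCompactSupport f)
    (v : E) : ∫ y, fderiv ℝ f y v ∂μ = 0 := by
  have hi : Integrable (fun y => fderiv ℝ f y v) μ := by
    refine Continuous.integrable_of_hasCompactSupport ?_ (hc.fderiv_apply ℝ v)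
    exact (hf.continuous_fderiv (by simp)).clm_apply continuous_const
  have h := integral_mul_fderiv_eq_neg_fderiv_mul_of_integrable (μ := μ) (f := fun _ : E => (1 : ℝ))
    (g := f) (v := v) (by simp) (by simpa using hi)
    (by simpa using hf.continuous.integrable_of_hasCompactSupport hc) (by simp)
    fun y _ => hf.contDiffAt.differentiableAt (by simp)
  simpa using h

/-- Each term of the alternating sum is a directional derivative of a compactly supported
coefficient. -/
theorem integral_extDeriv_eq_zero {k : ℕ} {g : E → E [⋀^Fin k]→L[ℝ] ℝ} (hg : ContDiff ℝ 1 g)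
    (hc : HasCompactSupport g) (v : Fin (k + 1) → E) : ∫ y, extDeriv g y v ∂μ = 0 := by
  have hgv : ∀ w : Fin k → E, ContDiff ℝ 1 fun y => g y w := fun w => by
    rw [contDiff_iff_contDiffAt]
    intro y
    exact contDiffWithinAt_alternating_apply (v := fun _ => w) hg.contDiffAt
      fun _ => contDiffWithinAt_const
  have hcv : ∀ w : Fin k → E, HasCompactSupport fun y => g y w := fun w =>
    hc.comp_left (g := fun ζ : E [⋀^Fin k]→L[ℝ] ℝ => ζ w) rfl
  have h1 : ∀ y, extDeriv g y v = ∑ i : Fin (k + 1), (-1 : ℝ) ^ (i : ℕ) *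
      fderiv ℝ (fun z => g z (i.removeNth v)) y (v i) := fun y => by
    rw [extDeriv_apply (hg.contDiffAt.differentiableAt (by simp))]
    refine Finset.sum_congr rfl fun i _ => ?_
    simp [zsmul_eq_mul]
  simp_rw [h1]
  rw [integral_finsetSum]
  · refine Finset.sum_eq_zero fun i _ => ?_
    rw [integral_const_mul, integral_fderiv_eq_zero (hgv _) (hcv _), mul_zero]
  · intro i _
    refine Integrable.const_mul ?_ _
    refine Continuous.integrable_of_hasCompactSupport ?_ ((hcv _).fderiv_apply ℝ _)
    exact ((hgv _).continuous_fderiv (by simp)).clm_apply continuous_const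

end Euclidean

/-! ### Linearity of the integral and its independence of charts. -/

section Integral

variable {n k : ℕ} {X : Type*} [TopologicalSpace X] [ChartedSpace (EuclideanSpace ℝ (Fin n)) X]

/-- The integral of a top-degree form over the domain of a chart. -/
def chartIntegral (e : OpenPartialHomeomorph X (EuclideanSpace ℝ (Fin n))) (η : Form n X n) : ℝ :=
  ∫ y in e.target, chartRep η e y (EuclideanSpace.basisFun (Fin n) ℝ)

/-- Forms with continuous coordinate representations. -/
def IsContForm (η : Form n X k) : Prop :=
  ∀ e ∈ atlas (EuclideanSpace ℝ (Fin n)) X, ContinuousOn (chartRep η e) e.target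

theorem IsSmoothForm.isContForm {η : Form n X k} (h : IsSmoothForm η) : IsContForm η :=
  fun e he => (h e he).continuousOn

theorem chartRep_zero_of {η : Form n X k} {e : OpenPartialHomeomorph X (EuclideanSpace ℝ (Fin n))}
    {y : EuclideanSpace ℝ (Fin n)} (h : η.val (e.symm y) = 0) : chartRep η e y = 0 := by
  rw [chartRep_eq, h]
  rfl

/-- The product of a form with a function. -/
def fmul (f : X → ℝ) (η : Form n X k) : Form n X k := fun x => f x • η x

theorem chartRep_fmul (f : X → ℝ) (η : Form n X k)
    (e : OpenPartialHomeomorph X (EuclideanSpace ℝ (Fin n))) (y : EuclideanSpace ℝ (Fin n)) :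
    chartRep (fmul f η) e y = f (e.symm y) • chartRep η e y := rfl

theorem chartRep_add (η η' : Form n X k)
    (e : OpenPartialHomeomorph X (EuclideanSpace ℝ (Fin n))) (y : EuclideanSpace ℝ (Fin n)) :
    chartRep (η + η') e y = chartRep η e y + chartRep η' e y := rfl

theorem chartRep_smul (c : ℝ) (η : Form n X k)
    (e : OpenPartialHomeomorph X (EuclideanSpace ℝ (Fin n))) (y : EuclideanSpace ℝ (Fin n)) :
    chartRep (c • η) e y = c • chartRep η e y := rfl

theorem fmul_val (f : X → ℝ) (η : Form n X k) (x : X) : (fmul f η).val x = f x • η.val x := rfl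

theorem IsContForm.fmul {f : X → ℝ} {η : Form n X k} (hη : IsContForm η) (hf : Continuous f) :
    IsContForm (fmul f η) := fun e he =>
  (hf.comp_continuousOn e.continuousOn_symm).smul (hη e he)

theorem IsContForm.add {η η' : Form n X k} (hη : IsContForm η) (hη' : IsContForm η') :
    IsContForm (η + η') := fun e he => (hη e he).add (hη' e he)

theorem IsContForm.smul {η : Form n X k} (c : ℝ) (hη : IsContForm η) :
    IsContForm (c • η) := fun e he => (hη e he).const_smul c

theorem isContForm_zero : IsContForm (0 : Form n X k) := fun e _ => by
  have : chartRep (0 : Form n X k) e = fun _ => 0 := by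
    funext y
    exact chartRep_zero_of rfl
  rw [this]
  exact continuousOn_const

theorem isContForm_sum {ι : Type*} (s : Finset ι) {η : ι → Form n X k}
    (h : ∀ i ∈ s, IsContForm (η i)) : IsContForm (∑ i ∈ s, η i) := by
  classical
  induction s using Finset.induction_on with
  | empty => exact isContForm_zero
  | insert a s ha ih =>
    rw [Finset.sum_insert ha]
    exact (h a (Finset.mem_insert_self a s)).add
      (ih fun i hi => h i (Finset.mem_insert_of_mem hi))

theorem continuousOn_alternating_apply {E W : Type*} [NormedAddCommGroup E] [NormedSpace ℝ E]
    [TopologicalSpace W] {g : W → E [⋀^Fin k]→L[ℝ] ℝ} {s : Set W} (hg : ContinuousOn g s)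
    (v : Fin k → E) : ContinuousOn (fun y => g y v) s := by
  have hc : Continuous fun ζ : E [⋀^Fin k]→L[ℝ] ℝ => ζ v := by fun_prop
  exact hc.comp_continuousOn hg

theorem integrableOn_chartRep {e : OpenPartialHomeomorph X (EuclideanSpace ℝ (Fin n))}
    {η : Form n X n} (hη : ContinuousOn (chartRep η e) e.target) {K : Set X} (hK : IsCompact K)
    (hKe : K ⊆ e.source) (h0 : ∀ x, x ∉ K → η.val x = 0) :
    IntegrableOn (fun y => chartRep η e y (EuclideanSpace.basisFun (Fin n) ℝ)) e.target := by
  refine integrableOn_of_eq_zero_off_compact (K := e '' K) e.open_target.measurableSet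
    (hK.image_of_continuousOn (e.continuousOn.mono hKe)) ?_
    (continuousOn_alternating_apply hη _) ?_
  · rintro _ ⟨x, hx, rfl⟩
    exact e.map_source (hKe hx)
  · intro y hy hyK
    rw [chartRep_zero_of (h0 _ fun h => hyK ⟨_, h, e.right_inv hy⟩)]
    rfl

variable [IsManifold (𝓡 n) ∞ X]

/-- The change of variables formula. -/
theorem chartIntegral_eq (hX : IsOrientedAtlas n X)
    {e e' : OpenPartialHomeomorph X (EuclideanSpace ℝ (Fin n))}
    (he : e ∈ atlas (EuclideanSpace ℝ (Fin n)) X) (he' : e' ∈ atlas (EuclideanSpace ℝ (Fin n)) X)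
    (η : Form n X n) (h : ∀ x, η.val x ≠ 0 → x ∈ e.source ∧ x ∈ e'.source) :
    chartIntegral e η = chartIntegral e' η := by
  -- Since the form vanishes off the domain of the second chart, each chart integral only sees the
  -- overlap.
  have key : ∀ e₁ e₂ : OpenPartialHomeomorph X (EuclideanSpace ℝ (Fin n)),
      (∀ x, η.val x ≠ 0 → x ∈ e₂.source) →
      chartIntegral e₁ η = ∫ y in (e₁.symm ≫ₕ e₂).source,
        chartRep η e₁ y (EuclideanSpace.basisFun (Fin n) ℝ) := by
    intro e₁ e₂ h2
    refine setIntegral_eq_of_subset_of_forall_sdiff_eq_zero e₁.open_target.measurableSet ?_ ?_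
    · rw [OpenPartialHomeomorph.trans_source]
      exact inter_subset_left
    · rintro y ⟨hy, hy'⟩
      rw [OpenPartialHomeomorph.trans_source] at hy'
      rw [chartRep_zero_of]
      · rfl
      · by_contra hne
        exact hy' ⟨hy, h2 _ hne⟩
  rw [key e e' fun x hx => (h x hx).2, key e' e fun x hx => (h x hx).1]
  have himg : (e.symm ≫ₕ e') '' (e.symm ≫ₕ e').source = (e'.symm ≫ₕ e).source := by
    rw [OpenPartialHomeomorph.image_source_eq_target]
    rfl
  rw [← himg, integral_image_eq_integral_abs_det_fderiv_smul volume
    (e.symm ≫ₕ e').open_source.measurableSet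
    (f' := fun y => fderiv ℝ (e.symm ≫ₕ e') y) _ (e.symm ≫ₕ e').injOn]
  · refine setIntegral_congr_fun (e.symm ≫ₕ e').open_source.measurableSet fun y hy => ?_
    -- The orientation makes the Jacobian positive, which removes the absolute value in the change
    -- of variables.
    have hpos := hX e he e' he' y hy
    rw [chartRep_transition η he he' hy, topForm_comp, abs_of_pos hpos]
    rfl
  · intro y hy
    exact ((contDiffAt_transition he he' hy).differentiableAt (by simp)).hasFDerivAt.hasFDerivWithinAt

variable [T2Space X] [CompactSpace X]

variable (n X) in
/-- The finitely many indices of the partition of unity with a nonzero function. -/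
def ptnIndex : Finset X :=
  ((partitionOfUnity n X).locallyFinite.finite_nonempty_of_compact).toFinset

theorem partitionOfUnity_eq_zero {i : X} (hi : i ∉ ptnIndex n X) (x : X) :
    partitionOfUnity n X i x = 0 := by
  by_contra h
  exact hi (by
    rw [ptnIndex, Set.Finite.mem_toFinset]
    exact ⟨x, h⟩)

theorem sum_partitionOfUnity (x : X) : ∑ i ∈ ptnIndex n X, partitionOfUnity n X i x = 1 := by
  rw [← (partitionOfUnity n X).sum_eq_one (mem_univ x)]
  symm
  apply finsum_eq_sum_of_support_subset
  intro i hi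
  by_contra h
  exact hi (partitionOfUnity_eq_zero h x)

theorem partitionOfUnity_tsupport (i : X) :
    tsupport (partitionOfUnity n X i) ⊆ (chartAt (EuclideanSpace ℝ (Fin n)) i).source :=
  (SmoothPartitionOfUnity.exists_isSubordinate_chartAt_source (𝓡 n) X).choose_spec i

theorem formIntegral_eq_sum (η : Form n X n) :
    formIntegral η = ∑ i ∈ ptnIndex n X,
      chartIntegral (chartAt (EuclideanSpace ℝ (Fin n)) i) (fmul (partitionOfUnity n X i) η) := by
  rw [formIntegral]
  apply finsum_eq_sum_of_support_subset
  intro i hi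
  by_contra h
  refine hi ?_
  simp [partitionOfUnity_eq_zero h]

theorem integrableOn_ptn {η : Form n X n} (hη : IsContForm η) (i : X)
    {e : OpenPartialHomeomorph X (EuclideanSpace ℝ (Fin n))}
    (he : e ∈ atlas (EuclideanSpace ℝ (Fin n)) X) {K : Set X} (hK : IsCompact K)
    (hKe : K ⊆ e.source) (h0 : ∀ x, x ∉ K → (fmul (partitionOfUnity n X i) η).val x = 0) :
    IntegrableOn (fun y => chartRep (fmul (partitionOfUnity n X i) η) e y
      (EuclideanSpace.basisFun (Fin n) ℝ)) e.target :=
  integrableOn_chartRep ((hη.fmul (partitionOfUnity n X i).contMDiff.continuous) e he) hK hKe h0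

theorem fmul_ptn_val_eq_zero (η : Form n X k) (i : X) {x : X}
    (hx : x ∉ tsupport (partitionOfUnity n X i)) :
    (fmul (partitionOfUnity n X i) η).val x = 0 := by
  rw [fmul_val, image_eq_zero_of_notMem_tsupport hx, zero_smul]

theorem integrableOn_ptn_self {η : Form n X n} (hη : IsContForm η) (i : X) :
    IntegrableOn (fun y => chartRep (fmul (partitionOfUnity n X i) η)
      (chartAt (EuclideanSpace ℝ (Fin n)) i) y (EuclideanSpace.basisFun (Fin n) ℝ))
      (chartAt (EuclideanSpace ℝ (Fin n)) i).target :=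
  integrableOn_ptn hη i (chart_mem_atlas _ i) (isClosed_tsupport _).isCompact
    (partitionOfUnity_tsupport i) fun _ hx => fmul_ptn_val_eq_zero η i hx

theorem formIntegral_add {η η' : Form n X n} (hη : IsContForm η) (hη' : IsContForm η') :
    formIntegral (η + η') = formIntegral η + formIntegral η' := by
  rw [formIntegral_eq_sum, formIntegral_eq_sum, formIntegral_eq_sum, ← Finset.sum_add_distrib]
  refine Finset.sum_congr rfl fun i _ => ?_
  rw [chartIntegral, chartIntegral, chartIntegral,
    ← integral_add (integrableOn_ptn_self hη i) (integrableOn_ptn_self hη' i)]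
  refine integral_congr_ae (Filter.Eventually.of_forall fun y => ?_)
  simp only [chartRep_fmul, chartRep_add, smul_add, ContinuousAlternatingMap.add_apply]

theorem formIntegral_smul (c : ℝ) (η : Form n X n) :
    formIntegral (c • η) = c * formIntegral η := by
  rw [formIntegral_eq_sum, formIntegral_eq_sum, Finset.mul_sum]
  refine Finset.sum_congr rfl fun i _ => ?_
  rw [chartIntegral, chartIntegral, ← integral_const_mul]
  refine integral_congr_ae (Filter.Eventually.of_forall fun y => ?_)
  simp only [chartRep_fmul, chartRep_smul, ContinuousAlternatingMap.smul_apply, smul_eq_mul]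
  ring

theorem formIntegral_zero : formIntegral (0 : Form n X n) = 0 := by
  have := formIntegral_smul (0 : ℝ) (0 : Form n X n)
  rwa [zero_smul, zero_mul] at this

theorem formIntegral_finset_sum {ι : Type*} (s : Finset ι) {η : ι → Form n X n}
    (h : ∀ i ∈ s, IsContForm (η i)) :
    formIntegral (∑ i ∈ s, η i) = ∑ i ∈ s, formIntegral (η i) := by
  classical
  induction s using Finset.induction_on with
  | empty => simpa using formIntegral_zero
  | insert a s ha ih =>
    rw [Finset.sum_insert ha, Finset.sum_insert ha,
      formIntegral_add (h a (Finset.mem_insert_self a s))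
        (isContForm_sum s fun i hi => h i (Finset.mem_insert_of_mem hi)),
      ih fun i hi => h i (Finset.mem_insert_of_mem hi)]

/-- The integral of a form supported in a chart can be computed in this chart. -/
theorem formIntegral_eq_chartIntegral (hX : IsOrientedAtlas n X)
    {e : OpenPartialHomeomorph X (EuclideanSpace ℝ (Fin n))}
    (he : e ∈ atlas (EuclideanSpace ℝ (Fin n)) X) {η : Form n X n} (hη : IsContForm η)
    {K : Set X} (hK : IsCompact K) (hKe : K ⊆ e.source) (h0 : ∀ x, x ∉ K → η.val x = 0) :
    formIntegral η = chartIntegral e η := by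
  have h1 : ∀ i x, x ∉ K → (fmul (partitionOfUnity n X i) η).val x = 0 := fun i x hx => by
    rw [fmul_val, h0 x hx, smul_zero]
  rw [formIntegral_eq_sum]
  -- Each piece of the form is supported both in its own chart and in `e`. After moving all pieces
  -- to `e`, the partition functions sum to one.
  have h2 : ∀ i ∈ ptnIndex n X, chartIntegral (chartAt (EuclideanSpace ℝ (Fin n)) i)
      (fmul (partitionOfUnity n X i) η) = chartIntegral e (fmul (partitionOfUnity n X i) η) := by
    intro i _
    refine chartIntegral_eq hX (chart_mem_atlas _ i) he _ fun x hx => ⟨?_, ?_⟩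
    · by_contra h
      exact hx (fmul_ptn_val_eq_zero η i fun h' => h (partitionOfUnity_tsupport i h'))
    · by_contra h
      exact hx (h1 i x fun h' => h (hKe h'))
  rw [Finset.sum_congr rfl h2]
  simp only [chartIntegral]
  rw [← integral_finsetSum _ fun i _ => integrableOn_ptn hη i he hK hKe (h1 i)]
  refine integral_congr_ae (Filter.Eventually.of_forall fun y => ?_)
  simp only [chartRep_fmul, ContinuousAlternatingMap.smul_apply, smul_eq_mul]
  rw [← Finset.sum_mul, sum_partitionOfUnity, one_mul]

end Integral

/-! ### Covector fields and Stokes' theorem -/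

section Stokes

variable {n k : ℕ} {X : Type*} [TopologicalSpace X] [ChartedSpace (EuclideanSpace ℝ (Fin n)) X]

variable (n X) in
/-- Covector fields. -/
abbrev CovectorField : Type _ := X → EuclideanSpace ℝ (Fin n) →L[ℝ] ℝ

/-- The coordinate representation of a covector field. -/
def coRep (α : CovectorField n X) (e : OpenPartialHomeomorph X (EuclideanSpace ℝ (Fin n)))
    (y : EuclideanSpace ℝ (Fin n)) : EuclideanSpace ℝ (Fin n) →L[ℝ] ℝ :=
  (α (e.symm y)).comp (tder (𝓡 n) (𝓡 n) e.symm univ y)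

/-- Smooth covector fields. -/
def IsSmoothCov (α : CovectorField n X) : Prop :=
  ∀ e ∈ atlas (EuclideanSpace ℝ (Fin n)) X, ContDiffOn ℝ ∞ (coRep α e) e.target

/-- The wedge product of a covector field with a form. -/
def wedgeForm (α : CovectorField n X) (β : Form n X k) : Form n X (k + 1) :=
  fun x => wedge1 (α x) (β.val x)

theorem wedgeForm_val (α : CovectorField n X) (β : Form n X k) (x : X) :
    (wedgeForm α β).val x = wedge1 (α x) (β.val x) := rfl

theorem chartRep_wedgeForm (α : CovectorField n X) (β : Form n X k)
    (e : OpenPartialHomeomorph X (EuclideanSpace ℝ (Fin n))) (y : EuclideanSpace ℝ (Fin n)) :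
    chartRep (wedgeForm α β) e y = wedge1 (coRep α e y) (chartRep β e y) := by
  rw [chartRep_eq, wedgeForm_val, wedge1_comp, chartRep_eq]
  rfl

/-- The differential of a function, as a covector field. -/
def dfun (f : X → ℝ) : CovectorField n X := fun x => tder (𝓡 n) 𝓘(ℝ, ℝ) f univ x

theorem IsSmoothForm.add {η η' : Form n X k} (h : IsSmoothForm η) (h' : IsSmoothForm η') :
    IsSmoothForm (η + η') := fun e he => (h e he).add (h' e he)

theorem IsSmoothForm.smul {η : Form n X k} (c : ℝ) (h : IsSmoothForm η) :
    IsSmoothForm (c • η) := fun e he => (h e he).const_smul c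

theorem isSmoothForm_zero : IsSmoothForm (0 : Form n X k) := fun e _ => by
  have : chartRep (0 : Form n X k) e = fun _ => 0 := by
    funext y
    exact chartRep_zero_of rfl
  rw [this]
  exact contDiffOn_const

theorem isSmoothForm_wedgeForm {α : CovectorField n X} {β : Form n X k} (hα : IsSmoothCov α)
    (hβ : IsSmoothForm β) : IsSmoothForm (wedgeForm α β) := fun e he => by
  have : chartRep (wedgeForm α β) e = fun y => wedge1 (coRep α e y) (chartRep β e y) :=
    funext fun y => chartRep_wedgeForm α β e y
  rw [this]
  exact fun y hy => contDiffWithinAt_wedge1 (hα e he y hy) (hβ e he y hy)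

variable [IsManifold (𝓡 n) ∞ X] {e : OpenPartialHomeomorph X (EuclideanSpace ℝ (Fin n))}

theorem contDiffOn_comp_chart_symm {F : Type*} [NormedAddCommGroup F] [NormedSpace ℝ F] {f : X → F}
    (hf : ContMDiff (𝓡 n) 𝓘(ℝ, F) ∞ f)
    (he : e ∈ atlas (EuclideanSpace ℝ (Fin n)) X) :
    ContDiffOn ℝ ∞ (fun y => f (e.symm y)) e.target := fun y hy =>
  ((contMDiffAt_iff_contDiffAt.mp
    (hf.contMDiffAt.comp y (contMDiffAt_chart_symm he hy))).contDiffWithinAt)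

theorem coRep_dfun {f : X → ℝ} (he : e ∈ atlas (EuclideanSpace ℝ (Fin n)) X)
    {y : EuclideanSpace ℝ (Fin n)} (hy : y ∈ e.target)
    (hf : MDifferentiableAt (𝓡 n) 𝓘(ℝ, ℝ) f (e.symm y)) :
    coRep (dfun f) e y = fderiv ℝ (fun z => f (e.symm z)) y := by
  rw [coRep, dfun, ← tder_comp hf.mdifferentiableWithinAt
    (mdifferentiableAt_chart_symm he hy).mdifferentiableWithinAt (mapsTo_univ _ _)
    (uniqueMDiffWithinAt_univ _), tder_eq_fderivWithin, fderivWithin_univ]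

theorem isSmoothCov_dfun {f : X → ℝ} (hf : ContMDiff (𝓡 n) 𝓘(ℝ, ℝ) ∞ f) :
    IsSmoothCov (dfun (n := n) f) := fun e he => by
  have h := (contDiffOn_comp_chart_symm hf he).fderiv_of_isOpen (m := ∞) e.open_target (by simp)
  exact h.congr fun y hy => coRep_dfun he hy (hf.mdifferentiableAt (by simp))

theorem cov_eq (α : CovectorField n X) (he : e ∈ atlas (EuclideanSpace ℝ (Fin n)) X) {x : X}
    (hx : x ∈ e.source) : α x = (coRep α e (e x)).comp (tder (𝓡 n) (𝓡 n) e univ x) := by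
  rw [coRep, e.left_inv hx, ContinuousLinearMap.comp_assoc, tder_chart_symm_comp he hx,
    ContinuousLinearMap.comp_id]

theorem IsSmoothForm.fmul {f : X → ℝ} {η : Form n X k} (h : IsSmoothForm η)
    (hf : ContMDiff (𝓡 n) 𝓘(ℝ, ℝ) ∞ f) : IsSmoothForm (fmul f η) := fun e he =>
  (contDiffOn_comp_chart_symm hf he).smul (h e he)

theorem dfun_eq_zero {f : X → ℝ} {x : X} (hx : x ∉ tsupport f) : dfun (n := n) f x = 0 := by
  have h : f =ᶠ[nhdsWithin x univ] fun _ => (0 : ℝ) := by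
    rw [nhdsWithin_univ]
    filter_upwards [(isClosed_tsupport f).isOpen_compl.mem_nhds hx] with z hz
    exact image_eq_zero_of_notMem_tsupport hz
  rw [dfun, tder_eventuallyEq h (image_eq_zero_of_notMem_tsupport hx), tder_univ]
  exact mfderiv_const

/-- Differentiating a product of a cut-off function with a form in a chart and integrating. -/
theorem integral_wedge_add_eq_zero {m : ℕ} {X : Type*} [TopologicalSpace X]
    [ChartedSpace (EuclideanSpace ℝ (Fin (m + 1))) X] [IsManifold (𝓡 (m + 1)) ∞ X] [T2Space X]
    [CompactSpace X] {e : OpenPartialHomeomorph X (EuclideanSpace ℝ (Fin (m + 1)))}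
    (he : e ∈ atlas (EuclideanSpace ℝ (Fin (m + 1))) X) {f : X → ℝ}
    (hf : ContMDiff (𝓡 (m + 1)) 𝓘(ℝ, ℝ) ∞ f) (hfe : tsupport f ⊆ e.source)
    {b : Form (m + 1) X m} (hb : IsSmoothForm b) :
    chartIntegral e (wedgeForm (dfun f) b) + ∫ y in e.target, f (e.symm y) *
      extDeriv (chartRep b e) y (EuclideanSpace.basisFun (Fin (m + 1)) ℝ) = 0 := by
  set B := (EuclideanSpace.basisFun (Fin (m + 1)) ℝ : Fin (m + 1) → _) with hB
  let K := e '' tsupport f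
  have hKc : IsCompact K := (isClosed_tsupport f).isCompact.image_of_continuousOn
    (e.continuousOn.mono hfe)
  have hKT : K ⊆ e.target := by
    rintro _ ⟨x, hx, rfl⟩
    exact e.map_source (hfe hx)
  have hfc := contDiffOn_comp_chart_symm hf he
  have hf0 : ∀ y ∈ e.target, y ∉ K → f (e.symm y) = 0 := fun y hy hyK =>
    image_eq_zero_of_notMem_tsupport fun h => hyK ⟨_, h, e.right_inv hy⟩
  -- The coordinate form `f b` extends by zero to a compactly supported form on the whole model
  -- space. The integral of its exterior derivative vanishes, and the Leibniz rule splits that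
  -- integral into the two terms.
  let g := fun y => f (e.symm y) • chartRep b e y
  have hg0 : ∀ y ∈ e.target, y ∉ K → g y = 0 := fun y hy hyK => by
    simp only [g]
    rw [hf0 y hy hyK, zero_smul]
  have hgc : ContDiffOn ℝ ∞ g e.target := hfc.smul (hb e he)
  have hG : ContDiff ℝ ∞ (e.target.indicator g) :=
    contDiff_indicator e.open_target hKc.isClosed hKT hgc hg0
  have hGs : HasCompactSupport (e.target.indicator g) := by
    refine HasCompactSupport.intro hKc fun y hy => ?_
    by_cases hyT : y ∈ e.target
    · rw [indicator_of_mem hyT, hg0 y hyT hy]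
    · rw [indicator_of_notMem hyT]
  have h1 := integral_extDeriv_eq_zero (μ := volume) (hG.of_le (by simp)) hGs B
  have h2 : ∫ y, extDeriv (e.target.indicator g) y B =
      ∫ y in e.target, extDeriv (e.target.indicator g) y B := by
    rw [← setIntegral_univ]
    refine setIntegral_eq_of_subset_of_forall_sdiff_eq_zero MeasurableSet.univ (subset_univ _) ?_
    rintro y ⟨-, hy⟩
    have : e.target.indicator g =ᶠ[nhds y] fun _ => 0 := by
      filter_upwards [hKc.isClosed.isOpen_compl.mem_nhds fun h => hy (hKT h)] with z hz
      by_cases hzT : z ∈ e.target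
      · rw [indicator_of_mem hzT, hg0 z hzT hz]
      · rw [indicator_of_notMem hzT]
    rw [this.extDeriv_eq, extDeriv, fderiv_fun_const]
    simp [ContinuousAlternatingMap.alternatizeUncurryFin_apply]
  have h3 : ∀ y ∈ e.target, extDeriv (e.target.indicator g) y B =
      chartRep (wedgeForm (dfun f) b) e y B + f (e.symm y) * extDeriv (chartRep b e) y B := by
    intro y hy
    have : e.target.indicator g =ᶠ[nhds y] g := by
      filter_upwards [e.open_target.mem_nhds hy] with z hz using indicator_of_mem hz _
    rw [this.extDeriv_eq, extDeriv_fun_mul, chartRep_wedgeForm,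
      coRep_dfun he hy (hf.mdifferentiableAt (by simp))]
    · rfl
    · exact (hfc.contDiffAt (e.open_target.mem_nhds hy)).differentiableAt (by simp)
    · exact ((hb e he).contDiffAt (e.open_target.mem_nhds hy)).differentiableAt (by simp)
  rw [h2, setIntegral_congr_fun e.open_target.measurableSet h3, integral_add] at h1
  · exact h1
  · refine integrableOn_chartRep (K := tsupport f) ?_ (isClosed_tsupport f).isCompact hfe ?_
    · exact (isSmoothForm_wedgeForm (isSmoothCov_dfun hf) hb).isContForm e he
    · intro x hx
      rw [wedgeForm_val, dfun_eq_zero hx, wedge1_zero_left]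
  · refine integrableOn_of_eq_zero_off_compact e.open_target.measurableSet hKc hKT ?_ ?_
    · exact hfc.continuousOn.mul (continuousOn_alternating_apply
        (contDiffOn_extDeriv e.open_target (hb e he)).continuousOn _)
    · intro y hy hyK
      simp only [hf0 y hy hyK, zero_mul]

/-- Differentiate the identity `∑ χᵢ = 1`, read in the preferred chart at `x`. -/
theorem sum_dfun_partitionOfUnity [T2Space X] [CompactSpace X] (x : X) :
    ∑ i ∈ ptnIndex n X, dfun (n := n) (partitionOfUnity n X i) x = 0 := by
  have he := chart_mem_atlas (EuclideanSpace ℝ (Fin n)) x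
  have hx := mem_chart_source (EuclideanSpace ℝ (Fin n)) x
  have hd : ∀ i : X, MDifferentiableAt (𝓡 n) 𝓘(ℝ, ℝ) (partitionOfUnity n X i)
      ((chartAt (EuclideanSpace ℝ (Fin n)) x).symm (chartAt (EuclideanSpace ℝ (Fin n)) x x)) :=
    fun i => (partitionOfUnity n X i).contMDiff.mdifferentiableAt (by simp)
  have h1 : ∀ i ∈ ptnIndex n X, dfun (n := n) (partitionOfUnity n X i) x =
      (fderiv ℝ (fun z => partitionOfUnity n X i
        ((chartAt (EuclideanSpace ℝ (Fin n)) x).symm z))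
        (chartAt (EuclideanSpace ℝ (Fin n)) x x)).comp
        (tder (𝓡 n) (𝓡 n) (chartAt (EuclideanSpace ℝ (Fin n)) x) univ x) := fun i _ => by
    rw [cov_eq (dfun (partitionOfUnity n X i)) he hx,
      coRep_dfun he (mem_chart_target _ x) (hd i)]
  have h2 : ∑ i ∈ ptnIndex n X, fderiv ℝ (fun z => partitionOfUnity n X i
        ((chartAt (EuclideanSpace ℝ (Fin n)) x).symm z))
        (chartAt (EuclideanSpace ℝ (Fin n)) x x) = 0 := by
    rw [← fderiv_fun_sum]
    · have : (fun z => ∑ i ∈ ptnIndex n X, partitionOfUnity n X i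
          ((chartAt (EuclideanSpace ℝ (Fin n)) x).symm z)) = fun _ => 1 :=
        funext fun z => sum_partitionOfUnity _
      rw [this, fderiv_fun_const]
      rfl
    · intro i _
      exact ((contDiffOn_comp_chart_symm (partitionOfUnity n X i).contMDiff he).contDiffAt
        ((chartAt (EuclideanSpace ℝ (Fin n)) x).open_target.mem_nhds
          (mem_chart_target _ x))).differentiableAt (by simp)
  rw [Finset.sum_congr rfl h1]
  ext v
  have h3 := DFunLike.congr_fun h2 (tder (𝓡 n) (𝓡 n) (chartAt (EuclideanSpace ℝ (Fin n)) x) univ x v)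
  simpa [_root_.sum_apply] using h3

/-- Stokes' theorem on a closed oriented manifold. -/
theorem stokes {m : ℕ} {X : Type*} [TopologicalSpace X]
    [ChartedSpace (EuclideanSpace ℝ (Fin (m + 1))) X] [IsManifold (𝓡 (m + 1)) ∞ X] [T2Space X]
    [CompactSpace X] (hX : IsOrientedAtlas (m + 1) X) {b : Form (m + 1) X m}
    (hb : IsSmoothForm b) :
    ∑ i ∈ ptnIndex (m + 1) X, ∫ y in (chartAt (EuclideanSpace ℝ (Fin (m + 1))) i).target,
      partitionOfUnity (m + 1) X i ((chartAt (EuclideanSpace ℝ (Fin (m + 1))) i).symm y) *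
        extDeriv (chartRep b (chartAt (EuclideanSpace ℝ (Fin (m + 1))) i)) y
          (EuclideanSpace.basisFun (Fin (m + 1)) ℝ) = 0 := by
  have hW : ∀ i : X, IsContForm (wedgeForm (dfun (partitionOfUnity (m + 1) X i)) b) := fun i =>
    (isSmoothForm_wedgeForm (isSmoothCov_dfun (partitionOfUnity (m + 1) X i).contMDiff)
      hb).isContForm
  -- Integrating by parts in each chart trades `χᵢ db` for `-dχᵢ ∧ b`, and the sum of the `dχᵢ` is
  -- zero. The statement uses chart integrals of `extDeriv`, so no global exterior derivative is
  -- required.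
  have h1 : ∀ i ∈ ptnIndex (m + 1) X,
      ∫ y in (chartAt (EuclideanSpace ℝ (Fin (m + 1))) i).target,
      partitionOfUnity (m + 1) X i ((chartAt (EuclideanSpace ℝ (Fin (m + 1))) i).symm y) *
        extDeriv (chartRep b (chartAt (EuclideanSpace ℝ (Fin (m + 1))) i)) y
          (EuclideanSpace.basisFun (Fin (m + 1)) ℝ) =
      - formIntegral (wedgeForm (dfun (partitionOfUnity (m + 1) X i)) b) := by
    intro i _
    rw [formIntegral_eq_chartIntegral hX (chart_mem_atlas _ i) (hW i)
      (isClosed_tsupport (partitionOfUnity (m + 1) X i)).isCompact (partitionOfUnity_tsupport i)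
      fun x hx => by rw [wedgeForm_val, dfun_eq_zero hx, wedge1_zero_left]]
    have := integral_wedge_add_eq_zero (chart_mem_atlas _ i)
      (partitionOfUnity (m + 1) X i).contMDiff (partitionOfUnity_tsupport i) hb
    linarith
  rw [Finset.sum_congr rfl h1, Finset.sum_neg_distrib,
    ← formIntegral_finset_sum _ fun i _ => hW i]
  have h2 : ∑ i ∈ ptnIndex (m + 1) X, wedgeForm (dfun (partitionOfUnity (m + 1) X i)) b = 0 := by
    funext x
    have : ∀ s : Finset X, (∑ i ∈ s, wedgeForm (dfun (partitionOfUnity (m + 1) X i)) b) x =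
        wedge1 (∑ i ∈ s, dfun (n := m + 1) (partitionOfUnity (m + 1) X i) x) (b.val x) := by
      classical
      intro s
      induction s using Finset.induction_on with
      | empty =>
        rw [Finset.sum_empty, Finset.sum_empty, wedge1_zero_left]
        rfl
      | insert a s ha ih =>
        rw [Finset.sum_insert ha, Finset.sum_insert ha, wedge1_add_left, ← ih]
        rfl
    rw [this, sum_dfun_partitionOfUnity, wedge1_zero_left]
    rfl
  rw [h2, formIntegral_zero, neg_zero]

variable [T2Space X] [CompactSpace X]

/-- All chart contributions are nonnegative because the charts are oriented. A chart whose partition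
function is positive at `x₀` contributes strictly, since its integrand is positive on a nonempty
open set. -/
theorem formIntegral_pos (hX : IsOrientedAtlas n X) {η : Form n X n} (hη : IsContForm η)
    (h0 : ∀ x, 0 ≤ η.val x (EuclideanSpace.basisFun (Fin n) ℝ)) {x₀ : X}
    (hx₀ : 0 < η.val x₀ (EuclideanSpace.basisFun (Fin n) ℝ)) : 0 < formIntegral η := by
  have hrep : ∀ e ∈ atlas (EuclideanSpace ℝ (Fin n)) X, ∀ y,
      chartRep η e y (EuclideanSpace.basisFun (Fin n) ℝ) =
      (tder (𝓡 n) (𝓡 n) e.symm univ y).det *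
        η.val (e.symm y) (EuclideanSpace.basisFun (Fin n) ℝ) := fun e _ y => by
    rw [chartRep_eq, topForm_comp]
    rfl
  have hnn : ∀ i : X, ∀ y ∈ (chartAt (EuclideanSpace ℝ (Fin n)) i).target,
      0 ≤ chartRep (fmul (partitionOfUnity n X i) η) (chartAt (EuclideanSpace ℝ (Fin n)) i) y
        (EuclideanSpace.basisFun (Fin n) ℝ) := by
    intro i y hy
    rw [chartRep_fmul, ContinuousAlternatingMap.smul_apply, hrep _ (chart_mem_atlas _ i)]
    exact mul_nonneg ((partitionOfUnity n X).nonneg i _)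
      (mul_nonneg (tder_chart_symm_det_pos hX (chart_mem_atlas _ i) hy).le (h0 _))
  rw [formIntegral_eq_sum]
  obtain ⟨i, hi, hpos⟩ : ∃ i ∈ ptnIndex n X, 0 < partitionOfUnity n X i x₀ := by
    by_contra hcon
    push Not at hcon
    have := sum_partitionOfUnity (n := n) x₀
    have h2 := Finset.sum_nonpos hcon
    linarith
  refine Finset.sum_pos' (fun j _ => setIntegral_nonneg
    (chartAt (EuclideanSpace ℝ (Fin n)) j).open_target.measurableSet (hnn j)) ⟨i, hi, ?_⟩
  have hc : ContinuousOn (fun y => chartRep (fmul (partitionOfUnity n X i) η)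
      (chartAt (EuclideanSpace ℝ (Fin n)) i) y (EuclideanSpace.basisFun (Fin n) ℝ))
      (chartAt (EuclideanSpace ℝ (Fin n)) i).target :=
    continuousOn_alternating_apply ((hη.fmul (partitionOfUnity n X i).contMDiff.continuous) _
      (chart_mem_atlas _ i)) _
  have hxs : x₀ ∈ (chartAt (EuclideanSpace ℝ (Fin n)) i).source :=
    partitionOfUnity_tsupport i (subset_tsupport _ hpos.ne')
  rw [chartIntegral, setIntegral_pos_iff_support_of_nonneg_ae]
  · have ho := hc.isOpen_inter_preimage
      (chartAt (EuclideanSpace ℝ (Fin n)) i).open_target (isOpen_Ioi (a := (0 : ℝ)))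
    refine lt_of_lt_of_le (ho.measure_pos volume
      ⟨chartAt (EuclideanSpace ℝ (Fin n)) i x₀,
        (chartAt (EuclideanSpace ℝ (Fin n)) i).map_source hxs, ?_⟩) (measure_mono ?_)
    · rw [mem_preimage, mem_Ioi, chartRep_fmul, ContinuousAlternatingMap.smul_apply,
        hrep _ (chart_mem_atlas _ i),
        (chartAt (EuclideanSpace ℝ (Fin n)) i).left_inv hxs]
      exact mul_pos hpos (mul_pos (tder_chart_symm_det_pos hX (chart_mem_atlas _ i)
        ((chartAt (EuclideanSpace ℝ (Fin n)) i).map_source hxs)) hx₀)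
    · intro y hy
      exact ⟨ne_of_gt hy.2, hy.1⟩
  · exact (ae_restrict_iff' (chartAt (EuclideanSpace ℝ (Fin n)) i).open_target.measurableSet).mpr
      (Filter.Eventually.of_forall (hnn i))
  · exact integrableOn_ptn_self hη i

end Stokes

/-! ### Cartan's formula for constant vector fields -/

section Cartan

variable {E W V : Type*} [NormedAddCommGroup E] [NormedSpace ℝ E] [NormedAddCommGroup W]
  [NormedSpace ℝ W] [NormedAddCommGroup V] [NormedSpace ℝ V] {k : ℕ}

/-- Contraction with a fixed vector, as a continuous linear map. -/
def contractCLM (v : E) : (E [⋀^Fin (k + 1)]→L[ℝ] ℝ) →L[ℝ] (E [⋀^Fin k]→L[ℝ] ℝ) :=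
  LinearMap.mkContinuous
    { toFun := fun ζ => ζ.curryLeft v
      map_add' := fun _ _ => rfl
      map_smul' := fun _ _ => rfl } ‖v‖ fun ζ => by
    have := ζ.curryLeft.le_opNorm v
    rw [ContinuousAlternatingMap.norm_curryLeft, mul_comm] at this
    exact this

/-- Pullback by a fixed linear map, as a continuous linear map. -/
def compCLM (g : W →L[ℝ] E) : (E [⋀^Fin k]→L[ℝ] ℝ) →L[ℝ] (W [⋀^Fin k]→L[ℝ] ℝ) :=
  LinearMap.mkContinuous
    { toFun := fun ζ => ζ.compContinuousLinearMap g
      map_add' := fun _ _ => rfl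
      map_smul' := fun _ _ => rfl } (‖g‖ ^ k) fun ζ => by
    have := ζ.norm_compContinuousLinearMap_le g
    rw [Fintype.card_fin, mul_comm] at this
    exact this

theorem compCLM_apply (g : W →L[ℝ] E) (ζ : E [⋀^Fin k]→L[ℝ] ℝ) :
    compCLM g ζ = ζ.compContinuousLinearMap g := rfl

/-- The Lie derivative along a constant field is the directional derivative. In the alternating sum
for `dζ (v, w)` it is the leading term, and the remaining terms are those of `d(i_v ζ)` with the
opposite sign. -/
theorem extDeriv_curryLeft {ζ : E → E [⋀^Fin (k + 1)]→L[ℝ] ℝ} {x : E}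
    (h : DifferentiableAt ℝ ζ x) (v : E) :
    (extDeriv ζ x).curryLeft v = fderiv ℝ ζ x v - extDeriv (fun y => (ζ y).curryLeft v) x := by
  have h1 : HasFDerivAt (fun y => (ζ y).curryLeft v) ((contractCLM v).comp (fderiv ℝ ζ x)) x :=
    (contractCLM v).hasFDerivAt.comp x h.hasFDerivAt
  ext w
  rw [ContinuousAlternatingMap.curryLeft_apply_apply, ContinuousAlternatingMap.sub_apply,
    extDeriv, extDeriv, h1.fderiv, ContinuousAlternatingMap.alternatizeUncurryFin_apply,
    ContinuousAlternatingMap.alternatizeUncurryFin_apply, Fin.sum_univ_succ, sub_eq_add_neg,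
    ← Finset.sum_neg_distrib]
  congr 1
  · simp [Matrix.vecCons]
  · refine Finset.sum_congr rfl fun i _ => ?_
    have h2 : i.succ.removeNth (Matrix.vecCons v w : Fin (k + 2) → E) =
        Matrix.vecCons v (i.removeNth w) := by
      funext j
      refine Fin.cases ?_ (fun j => ?_) j
      · simp [Fin.removeNth]
      · simp [Fin.removeNth]
    rw [Fin.val_succ, h2, pow_succ, Matrix.cons_val_succ]
    simp only [mul_neg, mul_one, neg_smul]
    congr 1

/-- Restriction of a form on a product to the second factor. -/
def restr (ζ : (W × V) [⋀^Fin k]→L[ℝ] ℝ) : V [⋀^Fin k]→L[ℝ] ℝ :=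
  ζ.compContinuousLinearMap (ContinuousLinearMap.inr ℝ W V)

theorem restr_comp_prodMap (ζ : (W × V) [⋀^Fin k]→L[ℝ] ℝ) (A : V →L[ℝ] V) :
    restr (ζ.compContinuousLinearMap ((ContinuousLinearMap.id ℝ W).prodMap A)) =
      (restr ζ).compContinuousLinearMap A := by
  ext v
  simp only [restr, ContinuousAlternatingMap.compContinuousLinearMap_apply]
  refine congrArg ζ (funext fun i => ?_)
  simp

theorem curryLeft_comp_prodMap (ζ : (W × V) [⋀^Fin (k + 1)]→L[ℝ] ℝ) (A : V →L[ℝ] V) (w : W) :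
    (ζ.compContinuousLinearMap ((ContinuousLinearMap.id ℝ W).prodMap A)).curryLeft (w, 0) =
      (ζ.curryLeft (w, 0)).compContinuousLinearMap ((ContinuousLinearMap.id ℝ W).prodMap A) := by
  rw [ContinuousAlternatingMap.curryLeft_compContinuousLinearMap]
  congr 2
  simp

/-- Exterior differentiation commutes with pullback along the affine inclusion of the fibre over
`u`. -/
theorem extDeriv_restr {ζ : W × V → (W × V) [⋀^Fin k]→L[ℝ] ℝ} {u : W} {z : V}
    (h : DifferentiableAt ℝ ζ (u, z)) :
    extDeriv (fun y => restr (ζ (u, y))) z = restr (extDeriv ζ (u, z)) := by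
  have h0 : HasFDerivAt (fun y : V => (u, y)) (ContinuousLinearMap.inr ℝ W V) z :=
    hasFDerivAt_prodMk_right u z
  have h1 : HasFDerivAt (fun y => restr (ζ (u, y)))
      ((compCLM (ContinuousLinearMap.inr ℝ W V)).comp
        ((fderiv ℝ ζ (u, z)).comp (ContinuousLinearMap.inr ℝ W V))) z :=
    (compCLM (ContinuousLinearMap.inr ℝ W V)).hasFDerivAt.comp z (h.hasFDerivAt.comp z h0)
  ext v
  rw [extDeriv, h1.fderiv, restr, ContinuousAlternatingMap.compContinuousLinearMap_apply, extDeriv,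
    ContinuousAlternatingMap.alternatizeUncurryFin_apply,
    ContinuousAlternatingMap.alternatizeUncurryFin_apply]
  rfl

/-- Cartan's formula for the restriction of a closed form to the second factor. -/
theorem fderiv_restr_of_closed {ζ : W × V → (W × V) [⋀^Fin (k + 1)]→L[ℝ] ℝ} {u : W} {z : V}
    (h : DifferentiableAt ℝ ζ (u, z)) (hd : extDeriv ζ (u, z) = 0) (w : W) :
    restr (fderiv ℝ ζ (u, z) (w, 0)) =
      extDeriv (fun y => restr ((ζ (u, y)).curryLeft (w, 0))) z := by
  have h1 := extDeriv_curryLeft h ((w, 0) : W × V)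
  rw [hd] at h1
  have h2 : fderiv ℝ ζ (u, z) (w, 0) = extDeriv (fun y => (ζ y).curryLeft (w, 0)) (u, z) :=
    (sub_eq_zero.mp h1.symm)
  rw [h2, extDeriv_restr (ζ := fun y => (ζ y).curryLeft (w, 0))]
  exact (contractCLM (w, 0)).differentiableAt.comp (u, z) h

/-- The second order version of Cartan's formula. -/
theorem fderiv_restr_curryLeft_of_closed {ζ : W × V → (W × V) [⋀^Fin (k + 2)]→L[ℝ] ℝ} {u : W}
    {z : V} (h : DifferentiableAt ℝ ζ (u, z)) (hd : extDeriv ζ (u, z) = 0) (w w' : W) :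
    restr ((fderiv ℝ ζ (u, z) (w, 0)).curryLeft (w', 0)) =
      restr ((fderiv ℝ ζ (u, z) (w', 0)).curryLeft (w, 0)) -
        extDeriv (fun y => restr (((ζ (u, y)).curryLeft (w, 0)).curryLeft (w', 0))) z := by
  have h1 := extDeriv_curryLeft h ((w, 0) : W × V)
  rw [hd] at h1
  have h2 : fderiv ℝ ζ (u, z) (w, 0) = extDeriv (fun y => (ζ y).curryLeft (w, 0)) (u, z) :=
    (sub_eq_zero.mp h1.symm)
  have hc : HasFDerivAt (fun y => (ζ y).curryLeft (w, 0))
      ((contractCLM (w, 0)).comp (fderiv ℝ ζ (u, z))) (u, z) :=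
    HasFDerivAt.comp (g := contractCLM (w, 0)) (u, z) (contractCLM (w, 0)).hasFDerivAt h.hasFDerivAt
  -- Closedness has replaced the derivative along `w` by `d(i_w ζ)`. Cartan's formula is now applied
  -- to `i_w ζ` and `w'`, and the result is restricted to the fibre.
  rw [h2, extDeriv_curryLeft hc.differentiableAt, hc.fderiv,
    extDeriv_restr (ζ := fun y => ((ζ y).curryLeft (w, 0)).curryLeft (w', 0))]
  · rfl
  · exact (contractCLM (w', 0)).differentiableAt.comp (u, z) hc.differentiableAt

end Cartan

/-! ### Pulling back forms by families of maps -/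

section Pullback

variable {E : Type*} [NormedAddCommGroup E] [NormedSpace ℝ E] {m k : ℕ} {M : Type*}
  [TopologicalSpace M] [ChartedSpace (EuclideanSpace ℝ (Fin m)) M]

/-- The pullback of a form by a map defined on a subset of a vector space. -/
def pullE (α : Form m M k) (ψ : E → M) (S : Set E) (x : E) : E [⋀^Fin k]→L[ℝ] ℝ :=
  (α.val (ψ x)).compContinuousLinearMap (tder 𝓘(ℝ, E) (𝓡 m) ψ S x)

variable [IsManifold (𝓡 m) ∞ M]

theorem contDiffWithinAt_chart_comp {ψ : E → M} {S : Set E} {x : E}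
    (hψ : ContMDiffWithinAt 𝓘(ℝ, E) (𝓡 m) ∞ ψ S x)
    {e : OpenPartialHomeomorph M (EuclideanSpace ℝ (Fin m))}
    (he : e ∈ atlas (EuclideanSpace ℝ (Fin m)) M) (hx : ψ x ∈ e.source) :
    ContDiffWithinAt ℝ ∞ (fun y => e (ψ y)) S x :=
  contMDiffWithinAt_iff_contDiffWithinAt.mp
    ((contMDiffAt_chart he hx).comp_contMDiffWithinAt x hψ)

/-- The domain `S` is only required to have unique derivatives, because it will contain the closed
interval `[0,1]` as a factor. -/
theorem tder_eq_chart {ψ : E → M} {S : Set E} (hS : UniqueDiffOn ℝ S)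
    (hψ : ContMDiffOn 𝓘(ℝ, E) (𝓡 m) ∞ ψ S) {x : E} (hx : x ∈ S)
    {e : OpenPartialHomeomorph M (EuclideanSpace ℝ (Fin m))}
    (he : e ∈ atlas (EuclideanSpace ℝ (Fin m)) M) (hxe : ψ x ∈ e.source) :
    tder 𝓘(ℝ, E) (𝓡 m) ψ S x = (tder (𝓡 m) (𝓡 m) e.symm univ (e (ψ x))).comp
      (fderivWithin ℝ (fun y => e (ψ y)) S x) := by
  have h1 : tder 𝓘(ℝ, E) (𝓡 m) (fun y => e.symm (e (ψ y))) S x =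
      (tder (𝓡 m) (𝓡 m) e.symm univ (e (ψ x))).comp
        (tder 𝓘(ℝ, E) (𝓡 m) (fun y => e (ψ y)) S x) := by
    refine tder_comp (J := 𝓡 m) ?_ ?_ (mapsTo_univ _ _) (hS x hx).uniqueMDiffWithinAt
    · exact (mdifferentiableAt_chart_symm he (e.map_source hxe)).mdifferentiableWithinAt
    · exact ((contDiffWithinAt_chart_comp (hψ x hx) he hxe).differentiableWithinAt
        (by simp)).mdifferentiableWithinAt
  rw [tder_eq_fderivWithin] at h1
  rw [← h1]
  refine tder_eventuallyEq ?_ (e.left_inv hxe).symm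
  filter_upwards [(hψ x hx).continuousWithinAt (e.open_source.mem_nhds hxe)] with y hy
  exact (e.left_inv hy).symm

theorem pullE_eq_chart {α : Form m M k} {ψ : E → M} {S : Set E} (hS : UniqueDiffOn ℝ S)
    (hψ : ContMDiffOn 𝓘(ℝ, E) (𝓡 m) ∞ ψ S) {x : E} (hx : x ∈ S)
    {e : OpenPartialHomeomorph M (EuclideanSpace ℝ (Fin m))}
    (he : e ∈ atlas (EuclideanSpace ℝ (Fin m)) M) (hxe : ψ x ∈ e.source) :
    pullE α ψ S x = (chartRep α e (e (ψ x))).compContinuousLinearMap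
      (fderivWithin ℝ (fun y => e (ψ y)) S x) := by
  rw [pullE, tder_eq_chart hS hψ hx he hxe, chartRep_eq, e.left_inv hxe]
  rfl

/-- In a chart of the target the pullback is a smooth coordinate form composed with a smooth map and
with the derivative of that map within `S`. -/
theorem contDiffOn_pullE [FiniteDimensional ℝ E] {α : Form m M k} (hα : IsSmoothForm α) {ψ : E → M}
    {S : Set E} (hS : UniqueDiffOn ℝ S) (hψ : ContMDiffOn 𝓘(ℝ, E) (𝓡 m) ∞ ψ S) :
    ContDiffOn ℝ ∞ (pullE α ψ S) S := by
  intro x hx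
  have he := chart_mem_atlas (EuclideanSpace ℝ (Fin m)) (ψ x)
  have hxe := mem_chart_source (EuclideanSpace ℝ (Fin m)) (ψ x)
  have hF := contDiffWithinAt_chart_comp (hψ x hx) he hxe
  have h1 : ContDiffWithinAt ℝ ∞ (fun y => chartRep α (chartAt (EuclideanSpace ℝ (Fin m)) (ψ x))
      (chartAt (EuclideanSpace ℝ (Fin m)) (ψ x) (ψ y))) S x :=
    ContDiffAt.comp_contDiffWithinAt (g := chartRep α (chartAt (EuclideanSpace ℝ (Fin m)) (ψ x)))
      x ((hα _ he).contDiffAt ((chartAt (EuclideanSpace ℝ (Fin m)) (ψ x)).open_target.mem_nhds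
      (mem_chart_target _ _))) hF
  have h2 := hF.fderivWithin_right (m := ∞) hS (by simp) hx
  refine (contDiffWithinAt_alternating_comp h1 h2).congr_of_eventuallyEq ?_
    (pullE_eq_chart hS hψ hx he hxe)
  filter_upwards [(hψ x hx).continuousWithinAt
    ((chartAt (EuclideanSpace ℝ (Fin m)) (ψ x)).open_source.mem_nhds hxe), self_mem_nhdsWithin]
    with y hy hyS
  exact pullE_eq_chart hS hψ hyS he hy

/-- Naturality of the exterior derivative. It is available only at interior points, since `extDeriv`
is built from the unrestricted derivative. -/
theorem extDeriv_pullE {α : Form m M k} (hα : IsSmoothForm α) (hd : IsClosedForm α) {ψ : E → M}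
    {S : Set E} (hS : UniqueDiffOn ℝ S) (hψ : ContMDiffOn 𝓘(ℝ, E) (𝓡 m) ∞ ψ S) {x : E}
    (hx : x ∈ interior S) : extDeriv (pullE α ψ S) x = 0 := by
  have hxS := interior_subset hx
  have he := chart_mem_atlas (EuclideanSpace ℝ (Fin m)) (ψ x)
  have hxe := mem_chart_source (EuclideanSpace ℝ (Fin m)) (ψ x)
  have hSx : S ∈ nhds x := mem_interior_iff_mem_nhds.mp hx
  have hF : ContDiffAt ℝ ∞ (fun y => chartAt (EuclideanSpace ℝ (Fin m)) (ψ x) (ψ y)) x :=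
    (contDiffWithinAt_chart_comp (hψ x hxS) he hxe).contDiffAt hSx
  have h1 : pullE α ψ S =ᶠ[nhds x] fun y =>
      (chartRep α (chartAt (EuclideanSpace ℝ (Fin m)) (ψ x))
        (chartAt (EuclideanSpace ℝ (Fin m)) (ψ x) (ψ y))).compContinuousLinearMap
        (fderiv ℝ (fun y => chartAt (EuclideanSpace ℝ (Fin m)) (ψ x) (ψ y)) y) := by
    filter_upwards [((hψ x hxS).continuousWithinAt.continuousAt hSx)
      ((chartAt (EuclideanSpace ℝ (Fin m)) (ψ x)).open_source.mem_nhds hxe),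
      isOpen_interior.mem_nhds hx] with y hy hyS
    rw [pullE_eq_chart hS hψ (interior_subset hyS) he hy,
      fderivWithin_of_mem_nhds (mem_interior_iff_mem_nhds.mp hyS)]
  have h2 : DifferentiableAt ℝ (chartRep α (chartAt (EuclideanSpace ℝ (Fin m)) (ψ x)))
      (chartAt (EuclideanSpace ℝ (Fin m)) (ψ x) (ψ x)) :=
    ((hα _ he).contDiffAt ((chartAt (EuclideanSpace ℝ (Fin m)) (ψ x)).open_target.mem_nhds
      (mem_chart_target _ _))).differentiableAt (by simp)
  rw [h1.extDeriv_eq]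
  refine (extDeriv_pullback (r := ∞)
    (f := fun y => chartAt (EuclideanSpace ℝ (Fin m)) (ψ x) (ψ y)) h2 hF
      (by simp only [minSmoothness_of_isRCLikeNormedField]; exact WithTop.coe_le_coe.mpr le_top)).trans ?_
  rw [hd _ he _ (mem_chart_target _ _)]
  rfl

end Pullback

/-! ### Families of maps depending on parameters. -/

section Family

variable {W : Type*} [NormedAddCommGroup W] [NormedSpace ℝ W] {n m k : ℕ} {P M : Type*}
  [TopologicalSpace P] [ChartedSpace (EuclideanSpace ℝ (Fin n)) P]
  [TopologicalSpace M] [ChartedSpace (EuclideanSpace ℝ (Fin m)) M]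

/-- The derivative of a family of maps, with the parameters included. -/
def famDeriv (G : W × P → M) (U : Set W) (x : W × P) :
    W × EuclideanSpace ℝ (Fin n) →L[ℝ] EuclideanSpace ℝ (Fin m) :=
  tder (𝓘(ℝ, W).prod (𝓡 n)) (𝓡 m) G (U ×ˢ univ) x

/-- The pullback of a form by a family of maps. -/
def famPull (α : Form m M k) (G : W × P → M) (U : Set W) (x : W × P) :
    (W × EuclideanSpace ℝ (Fin n)) [⋀^Fin k]→L[ℝ] ℝ :=
  (α.val (G x)).compContinuousLinearMap (famDeriv G U x)

/-- A family of maps in a chart of the source. -/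
def famChart (G : W × P → M) (e : OpenPartialHomeomorph P (EuclideanSpace ℝ (Fin n)))
    (x : W × EuclideanSpace ℝ (Fin n)) : M := G (x.1, e.symm x.2)

theorem uniqueMDiffOn_prod_univ {U : Set W} (hU : UniqueDiffOn ℝ U) :
    UniqueMDiffOn (𝓘(ℝ, W).prod (𝓡 n)) (U ×ˢ (univ : Set P)) :=
  hU.uniqueMDiffOn.prod uniqueMDiffOn_univ

/-- The derivative of a composition with a family of maps. -/
theorem tder_fam_comp {E' : Type*} [NormedAddCommGroup E'] [NormedSpace ℝ E'] {H' : Type*}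
    [TopologicalSpace H'] {I : ModelWithCorners ℝ E' H'} {Y : Type*} [TopologicalSpace Y]
    [ChartedSpace H' Y] {G : W × P → M} {U : Set W}
    (hG : ContMDiffOn (𝓘(ℝ, W).prod (𝓡 n)) (𝓡 m) ∞ G (U ×ˢ univ)) {c : Y → W} {q : Y → P}
    {s : Set Y} {y : Y} (hs : UniqueMDiffWithinAt I s y)
    (hc : MDifferentiableWithinAt I 𝓘(ℝ, W) c s y) (hq : MDifferentiableWithinAt I (𝓡 n) q s y)
    (hy : y ∈ s) (hcU : MapsTo c s U) :
    tder I (𝓡 m) (fun y => G (c y, q y)) s y =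
      (famDeriv G U (c y, q y)).comp ((tder I 𝓘(ℝ, W) c s y).prod (tder I (𝓡 n) q s y)) := by
  have h1 : HasMFDerivWithinAt I (𝓘(ℝ, W).prod (𝓡 n)) (fun y => (c y, q y)) s y
      ((tder I 𝓘(ℝ, W) c s y).prod (tder I (𝓡 n) q s y)) :=
    HasMFDerivWithinAt.prodMk hc.hasMFDerivWithinAt hq.hasMFDerivWithinAt
  have h4 := tder_comp (I := I) (J := 𝓘(ℝ, W).prod (𝓡 n))
    (K := 𝓡 m) (g := G) (f := fun y => (c y, q y))
    (s := s) (t := U ×ˢ univ) (x := y)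
    ((hG (c y, q y) ⟨hcU hy, mem_univ _⟩).mdifferentiableWithinAt (by simp))
    h1.mdifferentiableWithinAt (fun x hx => ⟨hcU hx, mem_univ _⟩) hs
  refine h4.trans ?_
  have h6 : tder I (𝓘(ℝ, W).prod (𝓡 n)) (fun y => (c y, q y)) s y =
    (tder I 𝓘(ℝ, W) c s y).prod (tder I (𝓡 n) q s y) := h1.mfderivWithin hs
  rw [h6]
  rfl

variable [IsManifold (𝓡 n) ∞ P]
  {e : OpenPartialHomeomorph P (EuclideanSpace ℝ (Fin n))}

theorem contMDiffOn_famChart {G : W × P → M} {U : Set W}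
    (hG : ContMDiffOn (𝓘(ℝ, W).prod (𝓡 n)) (𝓡 m) ∞ G (U ×ˢ univ))
    (he : e ∈ atlas (EuclideanSpace ℝ (Fin n)) P) :
    ContMDiffOn 𝓘(ℝ, W × EuclideanSpace ℝ (Fin n)) (𝓡 m) ∞ (famChart G e) (U ×ˢ e.target) := by
  have h1 : ContMDiffOn 𝓘(ℝ, W × EuclideanSpace ℝ (Fin n)) (𝓘(ℝ, W).prod (𝓡 n)) ∞
      (fun x : W × EuclideanSpace ℝ (Fin n) => (x.1, e.symm x.2)) (U ×ˢ e.target) := by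
    refine ContMDiffOn.prodMk contDiff_fst.contMDiff.contMDiffOn fun x hx => ?_
    exact ((contMDiffAt_chart_symm he hx.2).comp x
      contDiff_snd.contMDiff.contMDiffAt).contMDiffWithinAt
  exact hG.comp h1 fun x hx => ⟨hx.1, mem_univ _⟩

theorem tder_famChart {G : W × P → M} {U : Set W} (hU : UniqueDiffOn ℝ U)
    (hG : ContMDiffOn (𝓘(ℝ, W).prod (𝓡 n)) (𝓡 m) ∞ G (U ×ˢ univ))
    (he : e ∈ atlas (EuclideanSpace ℝ (Fin n)) P) {u : W} {z : EuclideanSpace ℝ (Fin n)}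
    (hu : u ∈ U) (hz : z ∈ e.target) :
    tder 𝓘(ℝ, W × EuclideanSpace ℝ (Fin n)) (𝓡 m) (famChart G e) (U ×ˢ e.target) (u, z) =
      (famDeriv G U (u, e.symm z)).comp ((ContinuousLinearMap.id ℝ W).prodMap
        (tder (𝓡 n) (𝓡 n) e.symm univ z)) := by
  have hud : UniqueMDiffWithinAt 𝓘(ℝ, W × EuclideanSpace ℝ (Fin n)) (U ×ˢ e.target) (u, z) :=
    ((hU.prod e.open_target.uniqueDiffOn) _ ⟨hu, hz⟩).uniqueMDiffWithinAt
  have h1 : HasMFDerivWithinAt 𝓘(ℝ, W × EuclideanSpace ℝ (Fin n)) (𝓘(ℝ, W).prod (𝓡 n))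
      (fun x : W × EuclideanSpace ℝ (Fin n) => (x.1, e.symm x.2)) (U ×ˢ e.target) (u, z)
      ((ContinuousLinearMap.fst ℝ W (EuclideanSpace ℝ (Fin n))).prod
        ((tder (𝓡 n) (𝓡 n) e.symm univ z).comp
          (ContinuousLinearMap.snd ℝ W (EuclideanSpace ℝ (Fin n))))) := by
    refine HasMFDerivWithinAt.prodMk ?_ ?_
    · exact (hasFDerivAt_fst.hasMFDerivAt).hasMFDerivWithinAt
    · have h2 := (mdifferentiableAt_chart_symm he hz).hasMFDerivAt
      have h3 : HasMFDerivAt 𝓘(ℝ, W × EuclideanSpace ℝ (Fin n)) (𝓡 n) Prod.snd (u, z)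
        (ContinuousLinearMap.snd ℝ W (EuclideanSpace ℝ (Fin n))) := hasFDerivAt_snd.hasMFDerivAt
      rw [tder_univ]
      exact (HasMFDerivAt.comp (u, z) h2 h3).hasMFDerivWithinAt
  have h4 := tder_comp (I := 𝓘(ℝ, W × EuclideanSpace ℝ (Fin n))) (J := 𝓘(ℝ, W).prod (𝓡 n))
    (K := 𝓡 m) (g := G) (f := fun x : W × EuclideanSpace ℝ (Fin n) => (x.1, e.symm x.2))
    (s := U ×ˢ e.target) (t := U ×ˢ univ) (x := (u, z))
    ((hG (u, e.symm z) ⟨hu, mem_univ _⟩).mdifferentiableWithinAt (by simp))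
    h1.mdifferentiableWithinAt (fun x hx => ⟨hx.1, mem_univ _⟩) hud
  refine h4.trans ?_
  have h5 := h1.mfderivWithin hud
  have h6 : tder 𝓘(ℝ, W × EuclideanSpace ℝ (Fin n)) (𝓘(ℝ, W).prod (𝓡 n))
      (fun x : W × EuclideanSpace ℝ (Fin n) => (x.1, e.symm x.2)) (U ×ˢ e.target) (u, z) =
      (ContinuousLinearMap.id ℝ W).prodMap (tder (𝓡 n) (𝓡 n) e.symm univ z) := h5
  rw [h6]
  rfl

theorem pullE_famChart {G : W × P → M} {U : Set W} (hU : UniqueDiffOn ℝ U)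
    (hG : ContMDiffOn (𝓘(ℝ, W).prod (𝓡 n)) (𝓡 m) ∞ G (U ×ˢ univ))
    (he : e ∈ atlas (EuclideanSpace ℝ (Fin n)) P) (α : Form m M k) {u : W}
    {z : EuclideanSpace ℝ (Fin n)} (hu : u ∈ U) (hz : z ∈ e.target) :
    pullE α (famChart G e) (U ×ˢ e.target) (u, z) =
      (famPull α G U (u, e.symm z)).compContinuousLinearMap
        ((ContinuousLinearMap.id ℝ W).prodMap (tder (𝓡 n) (𝓡 n) e.symm univ z)) := by
  rw [pullE, tder_famChart hU hG he hu hz]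
  rfl

end Family

/-! ### Differentiation of integrals over compact sets -/

/-- On the compact set `[-ε/2, ε/2] × C` the derivative is bounded by continuity, so the dominated
differentiation theorem applies with a constant bound. -/
theorem hasDerivAt_setIntegral_of_continuousOn {Y : Type*} [TopologicalSpace Y]
    [TopologicalSpace.PseudoMetrizableSpace Y] [MeasurableSpace Y] [BorelSpace Y] {μ : Measure Y}
    [IsFiniteMeasureOnCompacts μ] {C : Set Y} (hC : IsCompact C) (hCm : MeasurableSet C)
    {f f' : ℝ → Y → ℝ} {ε : ℝ} (hε : 0 < ε)
    (hf : ContinuousOn (fun x : ℝ × Y => f x.1 x.2) (Ioo (-ε) ε ×ˢ C))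
    (hf' : ContinuousOn (fun x : ℝ × Y => f' x.1 x.2) (Ioo (-ε) ε ×ˢ C))
    (hd : ∀ s ∈ Ioo (-ε) ε, ∀ y ∈ C, HasDerivAt (fun s => f s y) (f' s y) s) :
    HasDerivAt (fun s => ∫ y in C, f s y ∂μ) (∫ y in C, f' 0 y ∂μ) 0 := by
  have hsub : ∀ s ∈ Icc (-(ε / 2)) (ε / 2), s ∈ Ioo (-ε) ε := fun s hs =>
    ⟨by linarith [hs.1], by linarith [hs.2]⟩
  have h0 : (0 : ℝ) ∈ Ioo (-ε) ε := ⟨by linarith, hε⟩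
  have hsl : ∀ g : ℝ → Y → ℝ, ContinuousOn (fun x : ℝ × Y => g x.1 x.2) (Ioo (-ε) ε ×ˢ C) →
      ∀ s ∈ Ioo (-ε) ε, ContinuousOn (g s) C := fun g hg s hs =>
    hg.comp (f := fun y => (s, y)) (by fun_prop) fun y hy => ⟨hs, hy⟩
  obtain ⟨b, hb⟩ := (isCompact_Icc.prod hC).exists_bound_of_continuousOn
    (hf'.mono (prod_mono (fun s hs => hsub s hs) (Subset.refl C)))
  have hfin : IsFiniteMeasure (μ.restrict C) := ⟨by
    rw [Measure.restrict_apply_univ]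
    exact hC.measure_lt_top⟩
  refine (hasDerivAt_integral_of_dominated_loc_of_deriv_le (bound := fun _ => b)
    (F' := f') (s := Icc (-(ε / 2)) (ε / 2)) (Icc_mem_nhds (by linarith) (by linarith))
    ?_ ?_ ?_ ?_ (integrable_const b) ?_).2
  · filter_upwards [isOpen_Ioo.mem_nhds h0] with s hs
    exact (hsl f hf s hs).aestronglyMeasurable_of_isCompact hC hCm
  · exact (hsl f hf 0 h0).integrableOn_compact' hC hCm
  · exact (hsl f' hf' 0 h0).aestronglyMeasurable_of_isCompact hC hCm
  · refine (ae_restrict_iff' hCm).mpr (Filter.Eventually.of_forall fun y hy s hs => ?_)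
    exact hb (s, y) ⟨hs, hy⟩
  · refine (ae_restrict_iff' hCm).mpr (Filter.Eventually.of_forall fun y hy s hs => ?_)
    exact hd s (hsub s hs) y hy

/-- Differentiating along a straight line inside the domain. -/
theorem hasDerivAt_comp_line {E F : Type*} [NormedAddCommGroup E] [NormedSpace ℝ E]
    [NormedAddCommGroup F] [NormedSpace ℝ F] {g : E → F} {S : Set E} {c : ℝ → E} {v : E} {s : ℝ}
    (hg : DifferentiableWithinAt ℝ g S (c s)) (hc : HasDerivAt c v s)
    (hS : ∀ᶠ r in nhds s, c r ∈ S) :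
    HasDerivAt (fun r => g (c r)) (fderivWithin ℝ g S (c s) v) s := by
  have h1 : HasDerivWithinAt (fun r => g (c r)) (fderivWithin ℝ g S (c s) v) (c ⁻¹' S) s :=
    hg.hasFDerivWithinAt.comp_hasDerivWithinAt s hc.hasDerivWithinAt (mapsTo_preimage c S)
  exact h1.hasDerivAt hS

/-! ### Integrals over the product of the unit interval and a chart domain. -/

section Square

variable {V : Type*} [NormedAddCommGroup V] [NormedSpace ℝ V] [FiniteDimensional ℝ V]
  [MeasurableSpace V] [BorelSpace V] {μ : Measure V} [IsFiniteMeasureOnCompacts μ] [SFinite μ]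
  {ε : ℝ} {T K : Set V} {χ : V → ℝ} {A : (ℝ × ℝ) × V → ℝ}

theorem uniqueDiffOn_square (hT : IsOpen T) :
    UniqueDiffOn ℝ ((Ioo (-ε) ε ×ˢ Icc (0 : ℝ) 1) ×ˢ T) :=
  (isOpen_Ioo.uniqueDiffOn.prod (uniqueDiffOn_Icc zero_lt_one)).prod hT.uniqueDiffOn

theorem continuousOn_fderivWithin_square (hT : IsOpen T)
    (hA : ContDiffOn ℝ ∞ A ((Ioo (-ε) ε ×ˢ Icc (0 : ℝ) 1) ×ˢ T)) (w : (ℝ × ℝ) × V) :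
    ContinuousOn (fun x => fderivWithin ℝ A ((Ioo (-ε) ε ×ˢ Icc (0 : ℝ) 1) ×ˢ T) x w)
      ((Ioo (-ε) ε ×ˢ Icc (0 : ℝ) 1) ×ˢ T) :=
  (hA.continuousOn_fderivWithin (uniqueDiffOn_square hT) (by simp)).clm_apply continuousOn_const

theorem setIntegral_square_eq (hT : IsOpen T) (hKT : K ⊆ T)
    (h0 : ∀ z ∈ T, z ∉ K → χ z = 0) (g : ℝ × V → ℝ) :
    ∫ z in Icc (0 : ℝ) 1 ×ˢ T, χ z.2 * g z ∂(volume.prod μ) =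
      ∫ z in Icc (0 : ℝ) 1 ×ˢ K, χ z.2 * g z ∂(volume.prod μ) := by
  refine setIntegral_eq_of_subset_of_forall_sdiff_eq_zero (measurableSet_Icc.prod hT.measurableSet)
    (prod_mono (Subset.refl _) hKT) ?_
  rintro z ⟨hz, hz'⟩
  rw [h0 z.2 hz.2 fun h => hz' ⟨hz.1, h⟩, zero_mul]

theorem setIntegral_eq_compact (hT : IsOpen T) (hKT : K ⊆ T)
    (h0 : ∀ z ∈ T, z ∉ K → χ z = 0) (g : V → ℝ) :
    ∫ z in T, χ z * g z ∂μ = ∫ z in K, χ z * g z ∂μ := by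
  refine setIntegral_eq_of_subset_of_forall_sdiff_eq_zero hT.measurableSet hKT ?_
  rintro z ⟨hz, hz'⟩
  rw [h0 z hz hz', zero_mul]

theorem integrableOn_square (hK : IsCompact K) (hKT : K ⊆ T) (hχ : ContinuousOn χ T)
    {g : ℝ × V → ℝ} (hg : ContinuousOn g (Icc (0 : ℝ) 1 ×ˢ T)) :
    IntegrableOn (fun z => χ z.2 * g z) (Icc (0 : ℝ) 1 ×ˢ K) (volume.prod μ) := by
  refine ContinuousOn.integrableOn_compact (isCompact_Icc.prod hK) ?_
  exact (hχ.comp continuousOn_snd fun z hz => hKT hz.2).mul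
    (hg.mono (prod_mono (Subset.refl _) hKT))

/-- The cut-off `χ` confines the integral to the compact set `[0,1] × K`. The derivative is taken
within the square, because the points with `t = 0` or `t = 1` lie on its boundary. -/
theorem hasDerivAt_integral_square (hε : 0 < ε) (hT : IsOpen T) (hK : IsCompact K) (hKT : K ⊆ T)
    (hχ : ContinuousOn χ T) (h0 : ∀ z ∈ T, z ∉ K → χ z = 0)
    (hA : ContDiffOn ℝ ∞ A ((Ioo (-ε) ε ×ˢ Icc (0 : ℝ) 1) ×ˢ T)) :
    HasDerivAt (fun s => ∫ z in Icc (0 : ℝ) 1 ×ˢ T, χ z.2 * A ((s, z.1), z.2) ∂(volume.prod μ))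
      (∫ z in Icc (0 : ℝ) 1 ×ˢ T, χ z.2 * fderivWithin ℝ A ((Ioo (-ε) ε ×ˢ Icc (0 : ℝ) 1) ×ˢ T)
        ((0, z.1), z.2) ((1, 0), 0) ∂(volume.prod μ)) 0 := by
  have h1 : ∀ s, ∫ z in Icc (0 : ℝ) 1 ×ˢ T, χ z.2 * A ((s, z.1), z.2) ∂(volume.prod μ) =
      ∫ z in Icc (0 : ℝ) 1 ×ˢ K, χ z.2 * A ((s, z.1), z.2) ∂(volume.prod μ) := fun s =>
    setIntegral_square_eq hT hKT h0 fun z => A ((s, z.1), z.2)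
  simp_rw [h1]
  rw [setIntegral_square_eq hT hKT h0]
  have hmap : MapsTo (fun x : ℝ × (ℝ × V) => ((x.1, x.2.1), x.2.2))
      (Ioo (-ε) ε ×ˢ (Icc (0 : ℝ) 1 ×ˢ K)) ((Ioo (-ε) ε ×ˢ Icc (0 : ℝ) 1) ×ˢ T) :=
    fun x hx => ⟨⟨hx.1, hx.2.1⟩, hKT hx.2.2⟩
  have hχ' : ContinuousOn (fun x : ℝ × (ℝ × V) => χ x.2.2)
      (Ioo (-ε) ε ×ˢ (Icc (0 : ℝ) 1 ×ˢ K)) :=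
    hχ.comp (f := fun x : ℝ × (ℝ × V) => x.2.2) (by fun_prop) fun x hx => hKT hx.2.2
  refine hasDerivAt_setIntegral_of_continuousOn (isCompact_Icc.prod hK)
    (measurableSet_Icc.prod hK.measurableSet) hε
    (f := fun s z => χ z.2 * A ((s, z.1), z.2))
    (f' := fun s z => χ z.2 * fderivWithin ℝ A ((Ioo (-ε) ε ×ˢ Icc (0 : ℝ) 1) ×ˢ T)
        ((s, z.1), z.2) ((1, 0), 0)) ?_ ?_ ?_
  · exact hχ'.mul (hA.continuousOn.comp (by fun_prop) hmap)
  · exact hχ'.mul ((continuousOn_fderivWithin_square hT hA ((1, 0), 0)).comp (by fun_prop) hmap)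
  · intro s hs z hz
    refine HasDerivAt.const_mul _ ?_
    refine hasDerivAt_comp_line (c := fun r => ((r, z.1), z.2))
      ((hA.differentiableOn (by simp)) _ ⟨⟨hs, hz.1⟩, hKT hz.2⟩) ?_ ?_
    · exact ((hasDerivAt_id s).prodMk (hasDerivAt_const s z.1)).prodMk (hasDerivAt_const s z.2)
    · filter_upwards [isOpen_Ioo.mem_nhds hs] with r hr using ⟨⟨hr, hz.1⟩, hKT hz.2⟩

theorem integral_square_deriv (hε : 0 < ε) (hT : IsOpen T) (hK : IsCompact K) (hKT : K ⊆ T)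
    (hχ : ContinuousOn χ T) (h0 : ∀ z ∈ T, z ∉ K → χ z = 0)
    (hA : ContDiffOn ℝ ∞ A ((Ioo (-ε) ε ×ˢ Icc (0 : ℝ) 1) ×ˢ T)) :
    ∫ z in Icc (0 : ℝ) 1 ×ˢ T, χ z.2 * fderivWithin ℝ A ((Ioo (-ε) ε ×ˢ Icc (0 : ℝ) 1) ×ˢ T)
        ((0, z.1), z.2) ((0, 1), 0) ∂(volume.prod μ) =
      ∫ z in T, χ z * (A ((0, 1), z) - A ((0, 0), z)) ∂μ := by
  have hs : (0 : ℝ) ∈ Ioo (-ε) ε := ⟨by linarith, hε⟩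
  have hg : ContinuousOn (fun z : ℝ × V => fderivWithin ℝ A
      ((Ioo (-ε) ε ×ˢ Icc (0 : ℝ) 1) ×ˢ T) ((0, z.1), z.2) ((0, 1), 0)) (Icc (0 : ℝ) 1 ×ˢ T) :=
    (continuousOn_fderivWithin_square hT hA ((0, 1), 0)).comp (by fun_prop)
      fun z hz => ⟨⟨hs, hz.1⟩, hz.2⟩
  have hi := integrableOn_square (μ := μ) hK hKT hχ hg
  rw [setIntegral_square_eq hT hKT h0, setIntegral_eq_compact hT hKT h0]
  -- By Fubini the `t`-integral comes first, and there the fundamental theorem of calculus leaves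
  -- the two end values.
  have h1 := integral_prod_symm (μ := volume.restrict (Icc (0 : ℝ) 1)) (ν := μ.restrict K)
    (f := fun z : ℝ × V => χ z.2 * fderivWithin ℝ A
      ((Ioo (-ε) ε ×ˢ Icc (0 : ℝ) 1) ×ˢ T) ((0, z.1), z.2) ((0, 1), 0))
    (by rw [Measure.prod_restrict]; exact hi)
  rw [Measure.prod_restrict] at h1
  rw [h1]
  refine setIntegral_congr_fun hK.measurableSet fun z hz => ?_
  simp only
  rw [integral_const_mul]
  congr 1
  rw [integral_Icc_eq_integral_Ioc, ← intervalIntegral.integral_of_le zero_le_one]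
  have hgz : ContinuousOn (fun t : ℝ => fderivWithin ℝ A
      ((Ioo (-ε) ε ×ˢ Icc (0 : ℝ) 1) ×ˢ T) ((0, t), z) ((0, 1), 0)) (Icc (0 : ℝ) 1) :=
    hg.comp (f := fun t => (t, z)) (by fun_prop) fun t ht => ⟨ht, hKT hz⟩
  refine intervalIntegral.integral_eq_sub_of_hasDerivAt_of_le zero_le_one
    (f := fun t => A ((0, t), z)) ?_ ?_ ?_
  · exact hA.continuousOn.comp (f := fun t : ℝ => (((0 : ℝ), t), z)) (by fun_prop)
      fun t ht => ⟨⟨hs, ht⟩, hKT hz⟩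
  · intro t ht
    refine hasDerivAt_comp_line (c := fun r : ℝ => (((0 : ℝ), r), z))
      ((hA.differentiableOn (by simp)) _ ⟨⟨hs, Ioo_subset_Icc_self ht⟩, hKT hz⟩) ?_ ?_
    · exact ((hasDerivAt_const t (0 : ℝ)).prodMk (hasDerivAt_id t)).prodMk (hasDerivAt_const t z)
    · filter_upwards [isOpen_Ioo.mem_nhds ht] with r hr using
        ⟨⟨hs, Ioo_subset_Icc_self hr⟩, hKT hz⟩
  · rw [intervalIntegrable_iff_integrableOn_Icc_of_le zero_le_one]
    exact hgz.integrableOn_compact isCompact_Icc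

end Square

/-! ### Forms obtained from families of maps -/

section FamForm

variable {W : Type*} [NormedAddCommGroup W] [NormedSpace ℝ W] {n m k : ℕ} {P M : Type*}
  [TopologicalSpace P] [ChartedSpace (EuclideanSpace ℝ (Fin n)) P]
  [TopologicalSpace M] [ChartedSpace (EuclideanSpace ℝ (Fin m)) M]

/-- The pullback of the contraction of `α` with a vector field along `ι`. -/
def contr (α : Form m M (k + 1)) (ι : P → M) (X : P → EuclideanSpace ℝ (Fin m)) : Form n P k :=
  fun p => ((α.val (ι p)).curryLeft (X p)).compContinuousLinearMap (tder (𝓡 n) (𝓡 m) ι univ p)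

theorem contr_val (α : Form m M (k + 1)) (ι : P → M) (X : P → EuclideanSpace ℝ (Fin m)) (p : P) :
    (contr (n := n) α ι X).val p = ((α.val (ι p)).curryLeft (X p)).compContinuousLinearMap
      (tder (𝓡 n) (𝓡 m) ι univ p) := rfl

/-- The restriction to the fibre over `u` of the contraction with the parameter direction `w`. -/
def famForm1 (α : Form m M (k + 1)) (G : W × P → M) (U : Set W) (u w : W) : Form n P k :=
  fun p => restr ((famPull α G U (u, p)).curryLeft (w, 0))

/-- The restriction to the fibre over `u` of the contraction with two parameter directions. -/
def famForm2 (α : Form m M (k + 2)) (G : W × P → M) (U : Set W) (u w w' : W) : Form n P k :=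
  fun p => restr (((famPull α G U (u, p)).curryLeft (w, 0)).curryLeft (w', 0))

theorem famDeriv_comp_inr {G : W × P → M} {U : Set W}
    (hG : ContMDiffOn (𝓘(ℝ, W).prod (𝓡 n)) (𝓡 m) ∞ G (U ×ˢ univ)) {u : W} (hu : u ∈ U) (p : P) :
    (famDeriv G U (u, p)).comp (ContinuousLinearMap.inr ℝ W (EuclideanSpace ℝ (Fin n))) =
      tder (𝓡 n) (𝓡 m) (fun q => G (u, q)) univ p := by
  rw [tder_fam_comp (c := fun _ => u) (q := fun q => q) hG (uniqueMDiffWithinAt_univ _)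
    mdifferentiableWithinAt_const mdifferentiableWithinAt_id (mem_univ _) (fun _ _ => hu),
    tder_id (uniqueMDiffWithinAt_univ _)]
  have : tder (𝓡 n) 𝓘(ℝ, W) (fun _ : P => u) univ p = 0 := by
    rw [tder_univ]
    exact mfderiv_const
  rw [this]
  rfl

/-- The parameter set need not be a neighbourhood of the point, as at the edge `t = 1` of the
square. A curve that stays in it still determines the derivative in its own direction. -/
theorem famDeriv_apply_left {G : W × P → M} {U : Set W}
    (hG : ContMDiffOn (𝓘(ℝ, W).prod (𝓡 n)) (𝓡 m) ∞ G (U ×ˢ univ)) {c : ℝ → W} {s : ℝ} {w : W}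
    (hc : HasDerivAt c w s) (hU : ∀ᶠ r in nhds s, c r ∈ U) (p : P) :
    famDeriv (n := n) (m := m) G U (c s, p) (w, 0) = tder 𝓘(ℝ, ℝ) (𝓡 m) (fun r => G (c r, p)) univ s 1 := by
  have hn : c ⁻¹' U ∈ nhds s := hU
  have hss : s ∈ c ⁻¹' U := mem_of_mem_nhds hn
  have hu : UniqueMDiffWithinAt 𝓘(ℝ, ℝ) (c ⁻¹' U) s := by
    rw [uniqueMDiffWithinAt_iff_uniqueDiffWithinAt]
    exact uniqueDiffWithinAt_of_mem_nhds hn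
  have h2 : tder 𝓘(ℝ, ℝ) 𝓘(ℝ, W) c (c ⁻¹' U) s =
      ContinuousLinearMap.toSpanSingleton ℝ w := by
    rw [tder_of_mem_nhds hn, tder_eq_fderivWithin, fderivWithin_univ]
    exact hc.hasFDerivAt.fderiv
  have h3 : tder 𝓘(ℝ, ℝ) (𝓡 n) (fun _ : ℝ => p) (c ⁻¹' U) s = 0 := by
    rw [tder_of_mem_nhds hn, tder_univ]
    exact mfderiv_const
  rw [← tder_of_mem_nhds hn, tder_fam_comp (c := c) (q := fun _ => p) hG hu
    hc.differentiableAt.mdifferentiableAt.mdifferentiableWithinAt mdifferentiableWithinAt_const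
    hss (fun _ h => h), h2, h3]
  simp

theorem famForm1_eq_contr {G : W × P → M} {U : Set W}
    (hG : ContMDiffOn (𝓘(ℝ, W).prod (𝓡 n)) (𝓡 m) ∞ G (U ×ˢ univ)) {u : W} (hu : u ∈ U) (w : W)
    (α : Form m M (k + 1)) :
    famForm1 (n := n) α G U u w = contr α (fun q => G (u, q)) fun p => famDeriv (n := n) G U (u, p) (w, 0) := by
  funext p
  have h1 : famForm1 (n := n) α G U u w p = restr ((famPull α G U (u, p)).curryLeft (w, 0)) := rfl
  rw [h1, contr, ← famDeriv_comp_inr hG hu p, famPull,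
    ContinuousAlternatingMap.curryLeft_compContinuousLinearMap]
  rfl

variable [IsManifold (𝓡 n) ∞ P] [IsManifold (𝓡 m) ∞ M]
  {e : OpenPartialHomeomorph P (EuclideanSpace ℝ (Fin n))}

theorem chartRep_famForm1 {G : W × P → M} {U : Set W} (hU : UniqueDiffOn ℝ U)
    (hG : ContMDiffOn (𝓘(ℝ, W).prod (𝓡 n)) (𝓡 m) ∞ G (U ×ˢ univ))
    (he : e ∈ atlas (EuclideanSpace ℝ (Fin n)) P) (α : Form m M (k + 1)) {u : W} (w : W)
    {z : EuclideanSpace ℝ (Fin n)} (hu : u ∈ U) (hz : z ∈ e.target) :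
    chartRep (famForm1 α G U u w) e z =
      restr ((pullE α (famChart G e) (U ×ˢ e.target) (u, z)).curryLeft (w, 0)) := by
  rw [pullE_famChart hU hG he α hu hz, curryLeft_comp_prodMap, restr_comp_prodMap, chartRep_eq]
  rfl

theorem chartRep_famForm2 {G : W × P → M} {U : Set W} (hU : UniqueDiffOn ℝ U)
    (hG : ContMDiffOn (𝓘(ℝ, W).prod (𝓡 n)) (𝓡 m) ∞ G (U ×ˢ univ))
    (he : e ∈ atlas (EuclideanSpace ℝ (Fin n)) P) (α : Form m M (k + 2)) {u : W} (w w' : W)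
    {z : EuclideanSpace ℝ (Fin n)} (hu : u ∈ U) (hz : z ∈ e.target) :
    chartRep (famForm2 α G U u w w') e z =
      restr (((pullE α (famChart G e) (U ×ˢ e.target) (u, z)).curryLeft (w, 0)).curryLeft
        (w', 0)) := by
  rw [pullE_famChart hU hG he α hu hz, curryLeft_comp_prodMap, curryLeft_comp_prodMap,
    restr_comp_prodMap, chartRep_eq]
  rfl

theorem contDiffOn_pullE_famChart [FiniteDimensional ℝ W] {G : W × P → M} {U : Set W}
    (hU : UniqueDiffOn ℝ U)
    (hG : ContMDiffOn (𝓘(ℝ, W).prod (𝓡 n)) (𝓡 m) ∞ G (U ×ˢ univ))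
    (he : e ∈ atlas (EuclideanSpace ℝ (Fin n)) P) {α : Form m M k} (hα : IsSmoothForm α) :
    ContDiffOn ℝ ∞ (pullE α (famChart G e) (U ×ˢ e.target)) (U ×ˢ e.target) :=
  contDiffOn_pullE hα (hU.prod e.open_target.uniqueDiffOn) (contMDiffOn_famChart hG he)

theorem contDiffOn_slice {F E : Type*} [NormedAddCommGroup F] [NormedSpace ℝ F]
    [NormedAddCommGroup E] [NormedSpace ℝ E] {f : W × E → F} {U : Set W} {T : Set E}
    (hf : ContDiffOn ℝ ∞ f (U ×ˢ T)) {u : W} (hu : u ∈ U) : ContDiffOn ℝ ∞ (fun z => f (u, z)) T :=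
  hf.comp (contDiff_const.prodMk contDiff_id).contDiffOn fun _ hz => ⟨hu, hz⟩

theorem isSmoothForm_famForm1 [FiniteDimensional ℝ W] {G : W × P → M} {U : Set W}
    (hU : UniqueDiffOn ℝ U)
    (hG : ContMDiffOn (𝓘(ℝ, W).prod (𝓡 n)) (𝓡 m) ∞ G (U ×ˢ univ)) {α : Form m M (k + 1)}
    (hα : IsSmoothForm α) {u : W} (hu : u ∈ U) (w : W) : IsSmoothForm (famForm1 (n := n) α G U u w) := by
  intro e he
  refine ContDiffOn.congr ?_ fun z hz => chartRep_famForm1 hU hG he α w hu hz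
  exact ((compCLM (ContinuousLinearMap.inr ℝ W (EuclideanSpace ℝ (Fin n)))).comp
    (contractCLM ((w, 0) : W × EuclideanSpace ℝ (Fin n)))).contDiff.comp_contDiffOn
      (contDiffOn_slice (contDiffOn_pullE_famChart hU hG he hα) hu)

theorem isSmoothForm_famForm2 [FiniteDimensional ℝ W] {G : W × P → M} {U : Set W}
    (hU : UniqueDiffOn ℝ U)
    (hG : ContMDiffOn (𝓘(ℝ, W).prod (𝓡 n)) (𝓡 m) ∞ G (U ×ˢ univ)) {α : Form m M (k + 2)}
    (hα : IsSmoothForm α) {u : W} (hu : u ∈ U) (w w' : W) :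
    IsSmoothForm (famForm2 (n := n) α G U u w w') := by
  intro e he
  refine ContDiffOn.congr ?_ fun z hz => chartRep_famForm2 hU hG he α w w' hu hz
  exact ((compCLM (ContinuousLinearMap.inr ℝ W (EuclideanSpace ℝ (Fin n)))).comp
    ((contractCLM ((w', 0) : W × EuclideanSpace ℝ (Fin n))).comp
      (contractCLM ((w, 0) : W × EuclideanSpace ℝ (Fin n))))).contDiff.comp_contDiffOn
      (contDiffOn_slice (contDiffOn_pullE_famChart hU hG he hα) hu)

theorem chartRep_pullback_fam {G : W × P → M} {U : Set W} (hU : UniqueDiffOn ℝ U)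
    (hG : ContMDiffOn (𝓘(ℝ, W).prod (𝓡 n)) (𝓡 m) ∞ G (U ×ˢ univ))
    (he : e ∈ atlas (EuclideanSpace ℝ (Fin n)) P) (α : Form m M k) {u : W}
    {z : EuclideanSpace ℝ (Fin n)} (hu : u ∈ U) (hz : z ∈ e.target) :
    chartRep (pullbackForm (fun q => G (u, q)) α) e z =
      restr (pullE α (famChart G e) (U ×ˢ e.target) (u, z)) := by
  rw [pullE_famChart hU hG he α hu hz, restr_comp_prodMap, chartRep_eq]
  congr 1
  have h1 : (pullbackForm (fun q => G (u, q)) α).val (e.symm z) =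
      (α.val (G (u, e.symm z))).compContinuousLinearMap
        (tder (𝓡 n) (𝓡 m) (fun q => G (u, q)) univ (e.symm z)) := by
    rw [tder_univ]
    rfl
  rw [h1, ← famDeriv_comp_inr hG hu]
  rfl

end FamForm

/-! ### The first variation of the functionals -/

section FirstVariation

variable {P M : Type u}
  [TopologicalSpace P] [ChartedSpace (EuclideanSpace ℝ (Fin 3)) P]
  [TopologicalSpace M] [ChartedSpace (EuclideanSpace ℝ (Fin 6)) M]

/-- The parameter square of a variation. -/
def paramSquare (ε : ℝ) : Set (ℝ × ℝ) := Ioo (-ε) ε ×ˢ Icc (0 : ℝ) 1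

theorem uniqueDiffOn_paramSquare (ε : ℝ) : UniqueDiffOn ℝ (paramSquare ε) :=
  isOpen_Ioo.uniqueDiffOn.prod (uniqueDiffOn_Icc zero_lt_one)

/-- The total map of a two-parameter family. -/
def totalMap (Ψ : ℝ → ℝ → P → M) (x : (ℝ × ℝ) × P) : M := Ψ x.1.1 x.1.2 x.2

/-- The velocity at `s = 0` of the endpoints of a curve of paths. -/
def velocity (Ψ : ℝ → ℝ → P → M) (p : P) : EuclideanSpace ℝ (Fin 6) :=
  tder 𝓘(ℝ, ℝ) (𝓡 6) (fun s => Ψ s 1 p) univ 0 1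

theorem contMDiffOn_totalMap {Ψ : ℝ → ℝ → P → M} {ε : ℝ}
    (h : ContMDiffOn ((𝓘(ℝ, ℝ).prod 𝓘(ℝ, ℝ)).prod (𝓡 3)) (𝓡 6) ∞
      (fun x : (ℝ × ℝ) × P => Ψ x.1.1 x.1.2 x.2) ((Ioo (-ε) ε ×ˢ Icc (0 : ℝ) 1) ×ˢ univ)) :
    ContMDiffOn (𝓘(ℝ, ℝ × ℝ).prod (𝓡 3)) (𝓡 6) ∞ (totalMap Ψ) (paramSquare ε ×ˢ univ) := by
  have h1 : ContMDiff (𝓘(ℝ, ℝ × ℝ).prod (𝓡 3)) ((𝓘(ℝ, ℝ).prod 𝓘(ℝ, ℝ)).prod (𝓡 3)) ∞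
      (fun x : (ℝ × ℝ) × P => (((x.1.1, x.1.2) : ℝ × ℝ), x.2)) := by
    refine ContMDiff.prodMk (ContMDiff.prodMk ?_ ?_) contMDiff_snd
    · exact contDiff_fst.contMDiff.comp contMDiff_fst
    · exact contDiff_snd.contMDiff.comp contMDiff_fst
  exact h.comp h1.contMDiffOn fun x hx => hx

variable [IsManifold (𝓡 3) ∞ P] [IsManifold (𝓡 6) ∞ M]
  {e : OpenPartialHomeomorph P (EuclideanSpace ℝ (Fin 3))}

/-- The functional is defined through the derivative of the slice with `s` fixed. Its integrand is
recognised as the `∂ₜ`-contraction of one form pulled back by the whole family, so that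
differentiation in `s` and closedness can be used together. -/
theorem cylinder_integrand {G : (ℝ × ℝ) × P → M} {ε : ℝ}
    (hG : ContMDiffOn (𝓘(ℝ, ℝ × ℝ).prod (𝓡 3)) (𝓡 6) ∞ G (paramSquare ε ×ˢ univ))
    (he : e ∈ atlas (EuclideanSpace ℝ (Fin 3)) P) (τ : Form 6 M 4) {s t : ℝ}
    {z : EuclideanSpace ℝ (Fin 3)} (hs : s ∈ Ioo (-ε) ε) (ht : t ∈ Icc (0 : ℝ) 1)
    (hz : z ∈ e.target) :
    (τ.val (G ((s, t), e.symm z))).compContinuousLinearMap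
      (tder (𝓘(ℝ, ℝ).prod (𝓡 3)) (𝓡 6) (fun y : ℝ × P => G ((s, y.1), y.2))
        (Icc (0 : ℝ) 1 ×ˢ univ) (t, e.symm z))
      (Fin.cons (((1 : ℝ), (0 : EuclideanSpace ℝ (Fin 3))) : ℝ × EuclideanSpace ℝ (Fin 3))
          fun j => (((0 : ℝ), tder (𝓡 3) (𝓡 3) e.symm univ z (EuclideanSpace.basisFun (Fin 3) ℝ j)) :
              ℝ × EuclideanSpace ℝ (Fin 3))) =
    restr ((pullE τ (famChart G e) (paramSquare ε ×ˢ e.target) ((s, t), z)).curryLeft ((0, 1), 0))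
      (EuclideanSpace.basisFun (Fin 3) ℝ) := by
  have hu : UniqueMDiffWithinAt (𝓘(ℝ, ℝ).prod (𝓡 3)) (Icc (0 : ℝ) 1 ×ˢ (univ : Set P))
      (t, e.symm z) :=
    uniqueMDiffOn_prod_univ (uniqueDiffOn_Icc zero_lt_one) _ ⟨ht, mem_univ _⟩
  have hc1 : HasMFDerivAt (𝓘(ℝ, ℝ).prod (𝓡 3)) 𝓘(ℝ, ℝ × ℝ) (fun y : ℝ × P => (s, y.1))
      (t, e.symm z) ((ContinuousLinearMap.inr ℝ ℝ ℝ).comp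
        (ContinuousLinearMap.fst ℝ ℝ (EuclideanSpace ℝ (Fin 3)))) :=
    HasMFDerivAt.comp (I' := 𝓘(ℝ, ℝ)) (g := fun r : ℝ => (s, r)) (f := fun y : ℝ × P => y.1)
      (t, e.symm z) (hasFDerivAt_prodMk_right s t).hasMFDerivAt (hasMFDerivAt_fst _)
  have hc := hc1.hasMFDerivWithinAt (s := Icc (0 : ℝ) 1 ×ˢ (univ : Set P))
  have hq : HasMFDerivWithinAt (𝓘(ℝ, ℝ).prod (𝓡 3)) (𝓡 3) (fun y : ℝ × P => y.2)
      (Icc (0 : ℝ) 1 ×ˢ (univ : Set P)) (t, e.symm z)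
      (ContinuousLinearMap.snd ℝ ℝ (EuclideanSpace ℝ (Fin 3))) :=
    (hasMFDerivAt_snd (t, e.symm z)).hasMFDerivWithinAt
  have h3 : tder (𝓘(ℝ, ℝ).prod (𝓡 3)) 𝓘(ℝ, ℝ × ℝ) (fun y : ℝ × P => (s, y.1))
      (Icc (0 : ℝ) 1 ×ˢ (univ : Set P)) (t, e.symm z) = (ContinuousLinearMap.inr ℝ ℝ ℝ).comp
        (ContinuousLinearMap.fst ℝ ℝ (EuclideanSpace ℝ (Fin 3))) := hc.mfderivWithin hu
  have h4 : tder (𝓘(ℝ, ℝ).prod (𝓡 3)) (𝓡 3) (fun y : ℝ × P => y.2)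
      (Icc (0 : ℝ) 1 ×ˢ (univ : Set P)) (t, e.symm z) =
        ContinuousLinearMap.snd ℝ ℝ (EuclideanSpace ℝ (Fin 3)) := hq.mfderivWithin hu
  rw [tder_fam_comp (c := fun y : ℝ × P => (s, y.1)) (q := fun y : ℝ × P => y.2) hG hu
    hc.mdifferentiableWithinAt hq.mdifferentiableWithinAt ⟨ht, mem_univ _⟩
    (fun y hy => ⟨hs, hy.1⟩), h3, h4,
    pullE_famChart (uniqueDiffOn_paramSquare ε) hG he τ ⟨hs, ht⟩ hz, curryLeft_comp_prodMap,
    restr_comp_prodMap]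
  refine congrArg (τ.val (G ((s, t), e.symm z))) (funext fun i => ?_)
  refine Fin.cases ?_ (fun j => ?_) i
  · rfl
  · rfl

variable [T2Space P] [CompactSpace P]

theorem fTau_eq_sum {Ψ : ℝ → ℝ → P → M} {ε : ℝ}
    (hG : ContMDiffOn (𝓘(ℝ, ℝ × ℝ).prod (𝓡 3)) (𝓡 6) ∞ (totalMap Ψ) (paramSquare ε ×ˢ univ))
    (τ : Form 6 M 4) {s : ℝ} (hs : s ∈ Ioo (-ε) ε) :
    fTau τ (Ψ s) = ∑ i ∈ ptnIndex 3 P,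
      ∫ z in Icc (0 : ℝ) 1 ×ˢ (chartAt (EuclideanSpace ℝ (Fin 3)) i).target,
        partitionOfUnity 3 P i ((chartAt (EuclideanSpace ℝ (Fin 3)) i).symm z.2) *
          restr ((pullE τ (famChart (totalMap Ψ) (chartAt (EuclideanSpace ℝ (Fin 3)) i))
            (paramSquare ε ×ˢ (chartAt (EuclideanSpace ℝ (Fin 3)) i).target)
              ((s, z.1), z.2)).curryLeft ((0, 1), 0)) (EuclideanSpace.basisFun (Fin 3) ℝ) := by
  rw [fTau, cylinderIntegral, finsum_eq_sum_of_support_subset (s := ptnIndex 3 P)]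
  · refine Finset.sum_congr rfl fun i _ => setIntegral_congr_fun
      (measurableSet_Icc.prod (chartAt (EuclideanSpace ℝ (Fin 3)) i).open_target.measurableSet) ?_
    intro z hz
    refine congrArg (fun r => partitionOfUnity 3 P i
      ((chartAt (EuclideanSpace ℝ (Fin 3)) i).symm z.2) * r) ?_
    rw [← cylinder_integrand hG (chart_mem_atlas (EuclideanSpace ℝ (Fin 3)) i) τ hs hz.1 hz.2]
    simp_rw [tder_univ]
    rfl
  · intro i hi
    by_contra h
    apply hi
    simp only [partitionOfUnity_eq_zero h, zero_mul, integral_zero]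

end FirstVariation

section FirstVariation

/-- Evaluation on the standard frame of the fibre of the contraction with a parameter direction. -/
def fiberCLM {W : Type*} [NormedAddCommGroup W] [NormedSpace ℝ W] {n : ℕ} (w : W) :
    ((W × EuclideanSpace ℝ (Fin n)) [⋀^Fin (n + 1)]→L[ℝ] ℝ) →L[ℝ] ℝ :=
  (ContinuousAlternatingMap.apply ℝ (EuclideanSpace ℝ (Fin n)) ℝ
    (EuclideanSpace.basisFun (Fin n) ℝ)).comp
    ((compCLM (ContinuousLinearMap.inr ℝ W (EuclideanSpace ℝ (Fin n)))).comp
      (contractCLM ((w, 0) : W × EuclideanSpace ℝ (Fin n))))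

theorem fiberCLM_apply {W : Type*} [NormedAddCommGroup W] [NormedSpace ℝ W] {n : ℕ} (w : W)
    (ζ : (W × EuclideanSpace ℝ (Fin n)) [⋀^Fin (n + 1)]→L[ℝ] ℝ) :
    fiberCLM w ζ = restr (ζ.curryLeft (w, 0)) (EuclideanSpace.basisFun (Fin n) ℝ) := rfl

theorem integrableOn_square_of_open {V : Type*} [NormedAddCommGroup V] [NormedSpace ℝ V]
    [FiniteDimensional ℝ V] [MeasurableSpace V] [BorelSpace V] {μ : Measure V}
    [IsFiniteMeasureOnCompacts μ] [SFinite μ] {T K : Set V} {χ : V → ℝ} (hT : IsOpen T)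
    (hK : IsCompact K) (hKT : K ⊆ T) (hχ : ContinuousOn χ T) (h0 : ∀ z ∈ T, z ∉ K → χ z = 0)
    {g : ℝ × V → ℝ} (hg : ContinuousOn g (Icc (0 : ℝ) 1 ×ˢ T)) :
    IntegrableOn (fun z => χ z.2 * g z) (Icc (0 : ℝ) 1 ×ˢ T) (volume.prod μ) := by
  refine (integrableOn_square hK hKT hχ hg).of_forall_sdiff_eq_zero
    (measurableSet_Icc.prod hT.measurableSet) ?_
  rintro z ⟨hz, hz'⟩
  rw [h0 z.2 hz.2 fun h => hz' ⟨hz.1, h⟩, zero_mul]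

theorem ptn_chart_data {n : ℕ} {X : Type*} [TopologicalSpace X]
    [ChartedSpace (EuclideanSpace ℝ (Fin n)) X] [IsManifold (𝓡 n) ∞ X] [T2Space X] [CompactSpace X]
    (i : X) : ∃ K ⊆ (chartAt (EuclideanSpace ℝ (Fin n)) i).target, IsCompact K ∧
      ContinuousOn (fun z => partitionOfUnity n X i
        ((chartAt (EuclideanSpace ℝ (Fin n)) i).symm z))
        (chartAt (EuclideanSpace ℝ (Fin n)) i).target ∧
      ∀ z ∈ (chartAt (EuclideanSpace ℝ (Fin n)) i).target, z ∉ K →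
        partitionOfUnity n X i ((chartAt (EuclideanSpace ℝ (Fin n)) i).symm z) = 0 := by
  set e := chartAt (EuclideanSpace ℝ (Fin n)) i
  refine ⟨e '' tsupport (partitionOfUnity n X i), ?_, ?_, ?_, ?_⟩
  · rintro _ ⟨x, hx, rfl⟩
    exact e.map_source (partitionOfUnity_tsupport i hx)
  · exact (isClosed_tsupport _).isCompact.image_of_continuousOn
      (e.continuousOn.mono (partitionOfUnity_tsupport i))
  · exact (partitionOfUnity n X i).contMDiff.continuous.comp_continuousOn e.continuousOn_symm
  · intro z hz hzK
    by_contra h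
    exact hzK ⟨e.symm z, subset_tsupport _ h, e.right_inv hz⟩

variable {P M : Type u}
  [TopologicalSpace P] [ChartedSpace (EuclideanSpace ℝ (Fin 3)) P]
  [TopologicalSpace M] [ChartedSpace (EuclideanSpace ℝ (Fin 6)) M]
  [IsManifold (𝓡 3) ∞ P] [IsManifold (𝓡 6) ∞ M] [T2Space P] [CompactSpace P]

/-- The failure of the mixed derivatives to commute is an exact form on the fibre. -/
theorem mixed_deriv_sub {G : (ℝ × ℝ) × P → M} {ε : ℝ} (hε : 0 < ε)
    (hG : ContMDiffOn (𝓘(ℝ, ℝ × ℝ).prod (𝓡 3)) (𝓡 6) ∞ G (paramSquare ε ×ˢ univ))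
    {τ : Form 6 M 4} (hτ : IsSmoothForm τ) (hτc : IsClosedForm τ)
    {e : OpenPartialHomeomorph P (EuclideanSpace ℝ (Fin 3))}
    (he : e ∈ atlas (EuclideanSpace ℝ (Fin 3)) P) {t : ℝ} (ht : t ∈ Ioo (0 : ℝ) 1)
    {z : EuclideanSpace ℝ (Fin 3)} (hz : z ∈ e.target) :
    fderivWithin ℝ (fun x => fiberCLM ((0, 1) : ℝ × ℝ)
        (pullE τ (famChart G e) (paramSquare ε ×ˢ e.target) x)) (paramSquare ε ×ˢ e.target)
        ((0, t), z) ((1, 0), 0) -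
      fderivWithin ℝ (fun x => fiberCLM ((1, 0) : ℝ × ℝ)
        (pullE τ (famChart G e) (paramSquare ε ×ˢ e.target) x)) (paramSquare ε ×ˢ e.target)
        ((0, t), z) ((0, 1), 0) =
    -extDeriv (chartRep (famForm2 τ G (paramSquare ε) (0, t) (1, 0) (0, 1)) e) z
      (EuclideanSpace.basisFun (Fin 3) ℝ) := by
  have hs : (0 : ℝ) ∈ Ioo (-ε) ε := ⟨by linarith, hε⟩
  have htm : ((0, t) : ℝ × ℝ) ∈ paramSquare ε := ⟨hs, Ioo_subset_Icc_self ht⟩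
  have hN : paramSquare ε ×ˢ e.target ∈ nhds (((0, t) : ℝ × ℝ), z) :=
    prod_mem_nhds (prod_mem_nhds (isOpen_Ioo.mem_nhds hs)
      (Icc_mem_nhds ht.1 ht.2)) (e.open_target.mem_nhds hz)
  have hU := uniqueDiffOn_paramSquare ε
  have hd : DifferentiableAt ℝ (pullE τ (famChart G e) (paramSquare ε ×ˢ e.target))
      (((0, t) : ℝ × ℝ), z) :=
    ((contDiffOn_pullE_famChart hU hG he hτ).contDiffAt hN).differentiableAt (by simp)
  have hcl : extDeriv (pullE τ (famChart G e) (paramSquare ε ×ˢ e.target))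
      (((0, t) : ℝ × ℝ), z) = 0 :=
    extDeriv_pullE hτ hτc (hU.prod e.open_target.uniqueDiffOn) (contMDiffOn_famChart hG he)
      (mem_interior_iff_mem_nhds.mpr hN)
  have h1 : ∀ w : ℝ × ℝ, fderivWithin ℝ (fun x => fiberCLM w
        (pullE τ (famChart G e) (paramSquare ε ×ˢ e.target) x)) (paramSquare ε ×ˢ e.target)
        (((0, t) : ℝ × ℝ), z) = (fiberCLM w).comp
          (fderiv ℝ (pullE τ (famChart G e) (paramSquare ε ×ˢ e.target)) ((0, t), z)) := fun w => by
    rw [fderivWithin_of_mem_nhds hN]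
    exact (HasFDerivAt.comp (g := fiberCLM w) _ (fiberCLM w).hasFDerivAt hd.hasFDerivAt).fderiv
  -- This is the second order Cartan formula with `w = ∂ₛ` and `w' = ∂ₜ`. The restriction to `0 < t
  -- < 1` places the point in the interior, where the pulled back form is closed.
  rw [h1, h1, ContinuousLinearMap.comp_apply, ContinuousLinearMap.comp_apply, fiberCLM_apply,
    fiberCLM_apply, fderiv_restr_curryLeft_of_closed hd hcl (1, 0) (0, 1),
    ContinuousAlternatingMap.sub_apply, sub_sub_cancel_left]
  congr 2
  refine Filter.EventuallyEq.extDeriv_eq ?_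
  filter_upwards [e.open_target.mem_nhds hz] with y hy
  exact (chartRep_famForm2 hU hG he τ (1, 0) (0, 1) htm hy).symm

/-- The `s`-derivative of the `∂ₜ`-contraction is replaced by the `t`-derivative of the
`∂ₛ`-contraction. The exact difference integrates to zero over `P` for each `t`, and the integral in
`t` leaves boundary terms, of which only the one at `t = 1` survives. -/
theorem hasDerivAt_fTau (hP : IsOrientedAtlas 3 P) {Ψ : ℝ → ℝ → P → M} {ε : ℝ} (hε : 0 < ε)
    (hG : ContMDiffOn (𝓘(ℝ, ℝ × ℝ).prod (𝓡 3)) (𝓡 6) ∞ (totalMap Ψ) (paramSquare ε ×ˢ univ))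
    (h0 : ∀ s ∈ Ioo (-ε) ε, Ψ s 0 = Ψ 0 0)
    {τ : Form 6 M 4} (hτ : IsSmoothForm τ) (hτc : IsClosedForm τ) :
    HasDerivAt (fun s => fTau τ (Ψ s)) (formIntegral (contr τ (Ψ 0 1) (velocity Ψ))) 0 := by
  have hs : (0 : ℝ) ∈ Ioo (-ε) ε := ⟨by linarith, hε⟩
  have hU := uniqueDiffOn_paramSquare ε
  have he := fun i : P => chart_mem_atlas (EuclideanSpace ℝ (Fin 3)) i
  choose K hKT hK hχ hχ0 using fun i : P => ptn_chart_data (n := 3) (X := P) i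
  have hA : ∀ (w : ℝ × ℝ) (i : P), ContDiffOn ℝ ∞ (fun x => fiberCLM w (pullE τ
      (famChart (totalMap Ψ) (chartAt (EuclideanSpace ℝ (Fin 3)) i))
      (paramSquare ε ×ˢ (chartAt (EuclideanSpace ℝ (Fin 3)) i).target) x))
      (paramSquare ε ×ˢ (chartAt (EuclideanSpace ℝ (Fin 3)) i).target) := fun w i =>
    (fiberCLM w).contDiff.comp_contDiffOn (contDiffOn_pullE_famChart hU hG (he i) hτ)
  have h1 : HasDerivAt (fun s => fTau τ (Ψ s)) (∑ i ∈ ptnIndex 3 P,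
      ∫ z in Icc (0 : ℝ) 1 ×ˢ (chartAt (EuclideanSpace ℝ (Fin 3)) i).target,
        partitionOfUnity 3 P i ((chartAt (EuclideanSpace ℝ (Fin 3)) i).symm z.2) *
          fderivWithin ℝ (fun x => fiberCLM ((0, 1) : ℝ × ℝ) (pullE τ
      (famChart (totalMap Ψ) (chartAt (EuclideanSpace ℝ (Fin 3)) i))
      (paramSquare ε ×ˢ (chartAt (EuclideanSpace ℝ (Fin 3)) i).target) x))
      (paramSquare ε ×ˢ (chartAt (EuclideanSpace ℝ (Fin 3)) i).target)
        ((0, z.1), z.2) ((1, 0), 0)) 0 := by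
    refine HasDerivAt.congr_of_eventuallyEq (HasDerivAt.fun_sum fun i _ =>
      hasDerivAt_integral_square (μ := volume) hε
      (chartAt (EuclideanSpace ℝ (Fin 3)) i).open_target (hK i) (hKT i) (hχ i) (hχ0 i)
      (hA (0, 1) i)) ?_
    filter_upwards [isOpen_Ioo.mem_nhds hs] with s hs'
    exact fTau_eq_sum hG τ hs'
  convert h1 using 1
  have hcont : ∀ (w w' : ℝ × ℝ) (i : P), ContinuousOn (fun z : ℝ × EuclideanSpace ℝ (Fin 3) =>
      fderivWithin ℝ (fun x => fiberCLM w (pullE τ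
      (famChart (totalMap Ψ) (chartAt (EuclideanSpace ℝ (Fin 3)) i))
      (paramSquare ε ×ˢ (chartAt (EuclideanSpace ℝ (Fin 3)) i).target) x))
      (paramSquare ε ×ˢ (chartAt (EuclideanSpace ℝ (Fin 3)) i).target)
        ((0, z.1), z.2) (w', 0)) (Icc (0 : ℝ) 1 ×ˢ
          (chartAt (EuclideanSpace ℝ (Fin 3)) i).target) := fun w w' i =>
    (continuousOn_fderivWithin_square (chartAt (EuclideanSpace ℝ (Fin 3)) i).open_target (hA w i)
      (w', 0)).comp (by fun_prop) fun z hz => ⟨⟨hs, hz.1⟩, hz.2⟩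
  -- The difference of the two mixed derivatives contributes nothing to the total.
  have h2 : ∑ i ∈ ptnIndex 3 P,
      ∫ z in Icc (0 : ℝ) 1 ×ˢ (chartAt (EuclideanSpace ℝ (Fin 3)) i).target,
        partitionOfUnity 3 P i ((chartAt (EuclideanSpace ℝ (Fin 3)) i).symm z.2) *
          (fderivWithin ℝ (fun x => fiberCLM ((0, 1) : ℝ × ℝ) (pullE τ
      (famChart (totalMap Ψ) (chartAt (EuclideanSpace ℝ (Fin 3)) i))
      (paramSquare ε ×ˢ (chartAt (EuclideanSpace ℝ (Fin 3)) i).target) x))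
      (paramSquare ε ×ˢ (chartAt (EuclideanSpace ℝ (Fin 3)) i).target)
        ((0, z.1), z.2) ((1, 0), 0) - fderivWithin ℝ (fun x => fiberCLM ((1, 0) : ℝ × ℝ) (pullE τ
      (famChart (totalMap Ψ) (chartAt (EuclideanSpace ℝ (Fin 3)) i))
      (paramSquare ε ×ˢ (chartAt (EuclideanSpace ℝ (Fin 3)) i).target) x))
      (paramSquare ε ×ˢ (chartAt (EuclideanSpace ℝ (Fin 3)) i).target)
        ((0, z.1), z.2) ((0, 1), 0)) = 0 := by
    have hint := fun i : P => integrableOn_square_of_open (μ := volume)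
      (chartAt (EuclideanSpace ℝ (Fin 3)) i).open_target (hK i) (hKT i) (hχ i) (hχ0 i)
      ((hcont (0, 1) (1, 0) i).fun_sub (hcont (1, 0) (0, 1) i))
    refine (Finset.sum_congr rfl fun i _ => setIntegral_prod _ (hint i)).trans ?_
    rw [← integral_finsetSum]
    -- The two ends of the interval are null and may be discarded. For each remaining `t` the sum
    -- over the charts is the integral over `P` of an exact form, which vanishes by `stokes`.
    · rw [integral_Icc_eq_integral_Ioo]
      refine setIntegral_eq_zero_of_forall_eq_zero fun t ht => ?_
      have h3 := stokes hP (isSmoothForm_famForm2 (n := 3) (u := (0, t)) hU hG hτ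
        ⟨hs, Ioo_subset_Icc_self ht⟩ (1, 0) (0, 1))
      have h4 := congrArg Neg.neg h3
      rw [neg_zero, ← Finset.sum_neg_distrib] at h4
      refine Eq.trans (Finset.sum_congr rfl fun i _ => ?_) h4
      rw [← integral_neg]
      refine setIntegral_congr_fun
        (chartAt (EuclideanSpace ℝ (Fin 3)) i).open_target.measurableSet fun z hz => ?_
      have h5 := mixed_deriv_sub hε hG hτ hτc (he i) ht hz
      simp only
      rw [← mul_neg, ← h5]
    · intro i _
      have := hint i
      rw [IntegrableOn, ← Measure.prod_restrict] at this
      exact this.integral_prod_left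
  have h3 : ∀ i : P,
      ∫ z in Icc (0 : ℝ) 1 ×ˢ (chartAt (EuclideanSpace ℝ (Fin 3)) i).target,
        partitionOfUnity 3 P i ((chartAt (EuclideanSpace ℝ (Fin 3)) i).symm z.2) *
          fderivWithin ℝ (fun x => fiberCLM ((1, 0) : ℝ × ℝ) (pullE τ
      (famChart (totalMap Ψ) (chartAt (EuclideanSpace ℝ (Fin 3)) i))
      (paramSquare ε ×ˢ (chartAt (EuclideanSpace ℝ (Fin 3)) i).target) x))
      (paramSquare ε ×ˢ (chartAt (EuclideanSpace ℝ (Fin 3)) i).target)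
        ((0, z.1), z.2) ((0, 1), 0) =
      chartIntegral (chartAt (EuclideanSpace ℝ (Fin 3)) i)
        (fmul (partitionOfUnity 3 P i) (contr τ (Ψ 0 1) (velocity Ψ))) := fun i => by
    refine (integral_square_deriv (μ := volume) hε
      (chartAt (EuclideanSpace ℝ (Fin 3)) i).open_target (hK i) (hKT i) (hχ i) (hχ0 i)
      (hA (1, 0) i)).trans ?_
    have hend : ∀ (t : ℝ), t ∈ Icc (0 : ℝ) 1 →
        ∀ z ∈ (chartAt (EuclideanSpace ℝ (Fin 3)) i).target,
        fiberCLM ((1, 0) : ℝ × ℝ) (pullE τ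
        (famChart (totalMap Ψ) (chartAt (EuclideanSpace ℝ (Fin 3)) i))
        (paramSquare ε ×ˢ (chartAt (EuclideanSpace ℝ (Fin 3)) i).target) ((0, t), z)) =
        chartRep (contr τ (Ψ 0 t) (fun p => tder 𝓘(ℝ, ℝ) (𝓡 6) (fun s => Ψ s t p) univ 0 1))
          (chartAt (EuclideanSpace ℝ (Fin 3)) i) z (EuclideanSpace.basisFun (Fin 3) ℝ) := by
      intro t ht z hz
      have htm : ((0, t) : ℝ × ℝ) ∈ paramSquare ε := ⟨hs, ht⟩
      rw [fiberCLM_apply, ← chartRep_famForm1 hU hG (he i) τ (1, 0) htm hz,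
        famForm1_eq_contr hG htm]
      congr 3
      funext p
      exact famDeriv_apply_left (n := 3) hG (c := fun r => (r, t)) (s := 0) (w := (1, 0))
        ((hasDerivAt_id (0 : ℝ)).prodMk (hasDerivAt_const 0 t))
        (by filter_upwards [isOpen_Ioo.mem_nhds hs] with r hr using ⟨hr, ht⟩) p
    rw [chartIntegral]
    refine setIntegral_congr_fun
        (chartAt (EuclideanSpace ℝ (Fin 3)) i).open_target.measurableSet fun z hz => ?_
    rw [hend 1 ⟨zero_le_one, le_rfl⟩ z hz, hend 0 ⟨le_rfl, zero_le_one⟩ z hz, chartRep_fmul]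
    -- At `t = 0` all paths agree with the starting embedding, so the velocity there is zero.
    have h6 : chartRep (contr τ (Ψ 0 0) (fun p : P =>
        tder 𝓘(ℝ, ℝ) (𝓡 6) (fun s => Ψ s 0 p) univ 0 1))
          (chartAt (EuclideanSpace ℝ (Fin 3)) i) z = 0 := by
      refine chartRep_zero_of ?_
      rw [contr_val]
      have h7 : tder 𝓘(ℝ, ℝ) (𝓡 6) (fun s => Ψ s 0
          ((chartAt (EuclideanSpace ℝ (Fin 3)) i).symm z)) univ 0 = 0 := by
        have h8 : (fun s => Ψ s 0 ((chartAt (EuclideanSpace ℝ (Fin 3)) i).symm z)) =ᶠ[nhdsWithin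
            (0 : ℝ) univ] fun _ => Ψ 0 0 ((chartAt (EuclideanSpace ℝ (Fin 3)) i).symm z) := by
          rw [nhdsWithin_univ]
          filter_upwards [isOpen_Ioo.mem_nhds hs] with s hs'
          rw [h0 s hs']
        rw [tder_eventuallyEq h8 rfl, tder_univ]
        exact mfderiv_const
      rw [h7]
      ext v
      simp
    rw [h6, show (0 : EuclideanSpace ℝ (Fin 3) [⋀^Fin 3]→L[ℝ] ℝ)
      (EuclideanSpace.basisFun (Fin 3) ℝ) = 0 from rfl, sub_zero]
    rfl
  rw [formIntegral_eq_sum, ← sub_eq_zero, ← Finset.sum_sub_distrib]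
  refine neg_eq_zero.mp (Eq.trans ?_ h2)
  rw [← Finset.sum_neg_distrib]
  refine Finset.sum_congr rfl fun i _ => ?_
  rw [← h3 i, neg_sub, ← integral_sub]
  · refine integral_congr_ae (Filter.Eventually.of_forall fun z => ?_)
    simp only
    ring
  · exact integrableOn_square_of_open (μ := volume)
      (chartAt (EuclideanSpace ℝ (Fin 3)) i).open_target (hK i) (hKT i) (hχ i) (hχ0 i)
      (hcont (0, 1) (1, 0) i)
  · exact integrableOn_square_of_open (μ := volume)
      (chartAt (EuclideanSpace ℝ (Fin 3)) i).open_target (hK i) (hKT i) (hχ i) (hχ0 i)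
      (hcont (1, 0) (0, 1) i)

end FirstVariation

theorem hasDerivAt_integral_line {V : Type*} [NormedAddCommGroup V] [NormedSpace ℝ V]
    [FiniteDimensional ℝ V] [MeasurableSpace V] [BorelSpace V] {μ : Measure V}
    [IsFiniteMeasureOnCompacts μ] {ε : ℝ} {T K : Set V} {χ : V → ℝ} {A : ℝ × V → ℝ}
    (hε : 0 < ε) (hT : IsOpen T) (hK : IsCompact K) (hKT : K ⊆ T)
    (hχ : ContinuousOn χ T) (h0 : ∀ z ∈ T, z ∉ K → χ z = 0)
    (hA : ContDiffOn ℝ ∞ A (Ioo (-ε) ε ×ˢ T)) :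
    HasDerivAt (fun s => ∫ z in T, χ z * A (s, z) ∂μ)
      (∫ z in T, χ z * fderiv ℝ A (0, z) (1, 0) ∂μ) 0 := by
  have h1 : ∀ g : V → ℝ, ∫ z in T, χ z * g z ∂μ = ∫ z in K, χ z * g z ∂μ := fun g => by
    refine setIntegral_eq_of_subset_of_forall_sdiff_eq_zero hT.measurableSet hKT ?_
    rintro z ⟨hz, hz'⟩
    rw [h0 z hz hz', zero_mul]
  rw [funext fun s => h1 fun z => A (s, z), h1]
  have hmap : Ioo (-ε) ε ×ˢ K ⊆ Ioo (-ε) ε ×ˢ T := prod_mono (Subset.refl _) hKT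
  have hχ' : ContinuousOn (fun x : ℝ × V => χ x.2) (Ioo (-ε) ε ×ˢ K) :=
    hχ.comp (f := fun x : ℝ × V => x.2) (by fun_prop) fun x hx => hKT hx.2
  have hO : IsOpen (Ioo (-ε) ε ×ˢ T) := isOpen_Ioo.prod hT
  refine hasDerivAt_setIntegral_of_continuousOn hK hK.measurableSet hε
    (f := fun s z => χ z * A (s, z)) (f' := fun s z => χ z * fderiv ℝ A (s, z) (1, 0))
    (hχ'.mul (hA.continuousOn.mono hmap)) (hχ'.mul ?_) ?_
  · exact ((hA.continuousOn_fderiv_of_isOpen hO (by simp)).mono hmap).clm_apply continuousOn_const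
  · intro s hs z hz
    refine HasDerivAt.const_mul _ ?_
    have hd : DifferentiableAt ℝ A (s, z) :=
      ((hA.contDiffAt (hO.mem_nhds ⟨hs, hKT hz⟩)).differentiableAt (by simp))
    exact hd.hasFDerivAt.comp_hasDerivAt (f := fun r => (r, z)) s
      ((hasDerivAt_id s).prodMk (hasDerivAt_const s z))

/-! ### Variation of the pullback of a closed form. -/

section Constraint

variable {n m k : ℕ} {P M : Type*}
  [TopologicalSpace P] [ChartedSpace (EuclideanSpace ℝ (Fin n)) P]
  [TopologicalSpace M] [ChartedSpace (EuclideanSpace ℝ (Fin m)) M]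
  [IsManifold (𝓡 n) ∞ P] [IsManifold (𝓡 m) ∞ M]
  {e : OpenPartialHomeomorph P (EuclideanSpace ℝ (Fin n))}

/-- Cartan's formula for the closed form obtained by pulling back to the product of the parameter
line and a chart. -/
theorem hasDerivAt_restr_pullE {G : ℝ × P → M} {U : Set ℝ} (hU : IsOpen U)
    (hG : ContMDiffOn (𝓘(ℝ, ℝ).prod (𝓡 n)) (𝓡 m) ∞ G (U ×ˢ univ))
    {α : Form m M (k + 1)} (hα : IsSmoothForm α) (hd : IsClosedForm α)
    (he : e ∈ atlas (EuclideanSpace ℝ (Fin n)) P) {s : ℝ} (hs : s ∈ U)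
    {z : EuclideanSpace ℝ (Fin n)} (hz : z ∈ e.target) (v : Fin (k + 1) → EuclideanSpace ℝ (Fin n)) :
    HasDerivAt (fun r => restr (pullE α (famChart G e) (U ×ˢ e.target) (r, z)) v)
      (extDeriv (chartRep (famForm1 α G U s 1) e) z v) s := by
  have hN : U ×ˢ e.target ∈ nhds (s, z) := (hU.prod e.open_target).mem_nhds ⟨hs, hz⟩
  have hdf : DifferentiableAt ℝ (pullE α (famChart G e) (U ×ˢ e.target)) (s, z) :=
    ((contDiffOn_pullE_famChart hU.uniqueDiffOn hG he hα).contDiffAt hN).differentiableAt (by simp)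
  have hcl : extDeriv (pullE α (famChart G e) (U ×ˢ e.target)) (s, z) = 0 :=
    extDeriv_pullE hα hd (hU.prod e.open_target).uniqueDiffOn (contMDiffOn_famChart hG he)
      (mem_interior_iff_mem_nhds.mpr hN)
  have h1 : extDeriv (chartRep (famForm1 α G U s 1) e) z = extDeriv (fun y =>
      restr ((pullE α (famChart G e) (U ×ˢ e.target) (s, y)).curryLeft ((1 : ℝ), 0))) z := by
    refine Filter.EventuallyEq.extDeriv_eq ?_
    filter_upwards [e.open_target.mem_nhds hz] with y hy
    exact chartRep_famForm1 hU.uniqueDiffOn hG he α 1 hs hy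
  rw [h1, ← fderiv_restr_of_closed hdf hcl (1 : ℝ)]
  have h2 : HasDerivAt (fun r => pullE α (famChart G e) (U ×ˢ e.target) (r, z))
      (fderiv ℝ (pullE α (famChart G e) (U ×ˢ e.target)) (s, z) (1, 0)) s :=
    hdf.hasFDerivAt.comp_hasDerivAt (f := fun r => (r, z)) s
      ((hasDerivAt_id s).prodMk (hasDerivAt_const s z))
  exact ((ContinuousAlternatingMap.apply ℝ (EuclideanSpace ℝ (Fin n)) ℝ v).comp
    (compCLM (ContinuousLinearMap.inr ℝ ℝ (EuclideanSpace ℝ (Fin n))))).hasFDerivAt.comp_hasDerivAt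
      s h2

theorem form_val_eq_chartRep_chartAt (η : Form n P k) (p : P) :
    η.val p = chartRep η (chartAt (EuclideanSpace ℝ (Fin n)) p)
      (chartAt (EuclideanSpace ℝ (Fin n)) p p) := by
  rw [chartRep_eq, tder_chartAt_symm_self,
    (chartAt (EuclideanSpace ℝ (Fin n)) p).left_inv (mem_chart_source _ p)]
  rfl

/-- The derivative of the pullback of a closed form along a curve of maps is exact. -/
theorem hasDerivAt_pullbackForm_apply {G : ℝ × P → M} {U : Set ℝ} (hU : IsOpen U)
    (hG : ContMDiffOn (𝓘(ℝ, ℝ).prod (𝓡 n)) (𝓡 m) ∞ G (U ×ˢ univ))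
    {α : Form m M (k + 1)} (hα : IsSmoothForm α) (hd : IsClosedForm α) {s : ℝ} (hs : s ∈ U)
    (p : P) (v : Fin (k + 1) → EuclideanSpace ℝ (Fin n)) :
    HasDerivAt (fun r => (pullbackForm (fun q => G (r, q)) α : Form n P (k + 1)).val p v)
      (extDeriv (chartRep (famForm1 α G U s 1) (chartAt (EuclideanSpace ℝ (Fin n)) p))
        (chartAt (EuclideanSpace ℝ (Fin n)) p p) v) s := by
  refine (hasDerivAt_restr_pullE hU hG hα hd (chart_mem_atlas _ p) hs
    (mem_chart_target _ p) v).congr_of_eventuallyEq ?_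
  filter_upwards [hU.mem_nhds hs] with r hr
  rw [form_val_eq_chartRep_chartAt,
    chartRep_pullback_fam hU.uniqueDiffOn hG (chart_mem_atlas _ p) α hr (mem_chart_target _ p)]

theorem contDiffOn_family_chart {F : Type*} [NormedAddCommGroup F] [NormedSpace ℝ F]
    {l : ℝ × P → F} {U : Set ℝ}
    (hl : ContMDiffOn (𝓘(ℝ, ℝ).prod (𝓡 n)) 𝓘(ℝ, F) ∞ l (U ×ˢ univ))
    (he : e ∈ atlas (EuclideanSpace ℝ (Fin n)) P) :
    ContDiffOn ℝ ∞ (fun x : ℝ × EuclideanSpace ℝ (Fin n) => l (x.1, e.symm x.2))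
      (U ×ˢ e.target) := by
  have h1 : ContMDiffOn 𝓘(ℝ, ℝ × EuclideanSpace ℝ (Fin n)) (𝓘(ℝ, ℝ).prod (𝓡 n)) ∞
      (fun x : ℝ × EuclideanSpace ℝ (Fin n) => (x.1, e.symm x.2)) (U ×ˢ e.target) := by
    refine ContMDiffOn.prodMk contDiff_fst.contMDiff.contMDiffOn fun x hx => ?_
    exact ((contMDiffAt_chart_symm he hx.2).comp x
      contDiff_snd.contMDiff.contMDiffAt).contMDiffWithinAt
  exact contMDiffOn_iff_contDiffOn.mp (hl.comp h1 fun x hx => ⟨hx.1, mem_univ _⟩)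

end Constraint

/-! ### Variation of the integral of a function times a pulled back form. -/

section ConstraintIntegral

variable {n m : ℕ} {P M : Type*}
  [TopologicalSpace P] [ChartedSpace (EuclideanSpace ℝ (Fin (n + 1))) P]
  [TopologicalSpace M] [ChartedSpace (EuclideanSpace ℝ (Fin m)) M]
  [IsManifold (𝓡 (n + 1)) ∞ P] [IsManifold (𝓡 m) ∞ M] [T2Space P] [CompactSpace P]

theorem extDeriv_chartRep_fmul {f : P → ℝ} (hf : ContMDiff (𝓡 (n + 1)) 𝓘(ℝ, ℝ) ∞ f) {k : ℕ}
    {b : Form (n + 1) P k} (hb : IsSmoothForm b)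
    {e : OpenPartialHomeomorph P (EuclideanSpace ℝ (Fin (n + 1)))}
    (he : e ∈ atlas (EuclideanSpace ℝ (Fin (n + 1))) P) {z : EuclideanSpace ℝ (Fin (n + 1))}
    (hz : z ∈ e.target) :
    extDeriv (chartRep (fmul f b) e) z =
      chartRep (wedgeForm (dfun f) b) e z + f (e.symm z) • extDeriv (chartRep b e) z := by
  have h1 : chartRep (fmul f b) e = fun y => f (e.symm y) • chartRep b e y := rfl
  have hn := e.open_target.mem_nhds hz
  rw [h1, extDeriv_fun_mul (f := fun y => f (e.symm y))
    (((contDiffOn_comp_chart_symm hf he).contDiffAt hn).differentiableAt (by simp))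
    (((hb e he).contDiffAt hn).differentiableAt (by simp)), chartRep_wedgeForm,
    coRep_dfun he hz (hf.mdifferentiableAt (by simp))]

/-- With `c` the contraction with the parameter direction, the integrand has derivative `l' G^*α + l
dc`. Writing `l dc = d(l c) - dl ∧ c` and applying Stokes to `l c` gives the two terms. -/
theorem hasDerivAt_integral_pullback (hP : IsOrientedAtlas (n + 1) P) {G : ℝ × P → M} {ε : ℝ}
    (hε : 0 < ε)
    (hG : ContMDiffOn (𝓘(ℝ, ℝ).prod (𝓡 (n + 1))) (𝓡 m) ∞ G (Ioo (-ε) ε ×ˢ univ))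
    {α : Form m M (n + 1)} (hα : IsSmoothForm α) (hd : IsClosedForm α) {l : ℝ → P → ℝ}
    (hl : ContMDiffOn (𝓘(ℝ, ℝ).prod (𝓡 (n + 1))) 𝓘(ℝ, ℝ) ∞ (fun x : ℝ × P => l x.1 x.2)
      (Ioo (-ε) ε ×ˢ univ)) (hl0 : ContMDiff (𝓡 (n + 1)) 𝓘(ℝ, ℝ) ∞ (l 0)) :
    HasDerivAt (fun s => formIntegral (fmul (l s)
        (pullbackForm (fun q => G (s, q)) α : Form (n + 1) P (n + 1))))
      (formIntegral (fmul (fun p => deriv (fun s => l s p) 0)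
          (pullbackForm (fun q => G (0, q)) α : Form (n + 1) P (n + 1))) -
        formIntegral (wedgeForm (dfun (l 0)) (famForm1 (n := n + 1) α G (Ioo (-ε) ε) 0 1))) 0 := by
  have hs : (0 : ℝ) ∈ Ioo (-ε) ε := ⟨by linarith, hε⟩
  have he := fun i : P => chart_mem_atlas (EuclideanSpace ℝ (Fin (n + 1))) i
  have hU : UniqueDiffOn ℝ (Ioo (-ε) ε) := isOpen_Ioo.uniqueDiffOn
  choose K hKT hK hχ hχ0 using fun i : P => ptn_chart_data (n := n + 1) (X := P) i
  set c : Form (n + 1) P n := famForm1 α G (Ioo (-ε) ε) 0 1 with hc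
  have hcs : IsSmoothForm c := isSmoothForm_famForm1 hU hG hα hs 1
  have hL := fun i : P => contDiffOn_family_chart hl (he i)
  have hR : ∀ i : P, ContDiffOn ℝ ∞ (fun x : ℝ × EuclideanSpace ℝ (Fin (n + 1)) =>
      restr (pullE α (famChart G (chartAt (EuclideanSpace ℝ (Fin (n + 1))) i))
        (Ioo (-ε) ε ×ˢ (chartAt (EuclideanSpace ℝ (Fin (n + 1))) i).target) x)
        (EuclideanSpace.basisFun (Fin (n + 1)) ℝ))
      (Ioo (-ε) ε ×ˢ (chartAt (EuclideanSpace ℝ (Fin (n + 1))) i).target) := fun i =>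
    ((ContinuousAlternatingMap.apply ℝ (EuclideanSpace ℝ (Fin (n + 1))) ℝ
      (EuclideanSpace.basisFun (Fin (n + 1)) ℝ)).comp
    (compCLM (ContinuousLinearMap.inr ℝ ℝ (EuclideanSpace ℝ (Fin (n + 1)))))).contDiff.comp_contDiffOn
      (contDiffOn_pullE_famChart hU hG (he i) hα)
  have hB := fun i : P => (hL i).mul (hR i)
  have hO := fun i : P => (isOpen_Ioo (a := -ε) (b := ε)).prod
    (chartAt (EuclideanSpace ℝ (Fin (n + 1))) i).open_target
  have h1 := HasDerivAt.fun_sum fun (i : P) (_ : i ∈ ptnIndex (n + 1) P) =>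
    hasDerivAt_integral_line (μ := volume) hε
      (chartAt (EuclideanSpace ℝ (Fin (n + 1))) i).open_target (hK i) (hKT i) (hχ i) (hχ0 i) (hB i)
  have hl' : ∀ (i : P), ∀ z ∈ (chartAt (EuclideanSpace ℝ (Fin (n + 1))) i).target,
      HasDerivAt (fun s => l s ((chartAt (EuclideanSpace ℝ (Fin (n + 1))) i).symm z))
        (fderiv ℝ (fun x : ℝ × EuclideanSpace ℝ (Fin (n + 1)) =>
          l x.1 ((chartAt (EuclideanSpace ℝ (Fin (n + 1))) i).symm x.2)) (0, z) (1, 0)) 0 :=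
    fun i z hz => (((hL i).contDiffAt ((hO i).mem_nhds ⟨hs, hz⟩)).differentiableAt
      (by simp)).hasFDerivAt.comp_hasDerivAt (f := fun r => (r, z)) 0
      ((hasDerivAt_id 0).prodMk (hasDerivAt_const 0 z))
  have hcont1 : IsContForm (fmul (fun p => deriv (fun s => l s p) 0)
      (pullbackForm (fun q => G (0, q)) α : Form (n + 1) P (n + 1))) := by
    intro e he
    have hL := contDiffOn_family_chart hl he
    have hO := (isOpen_Ioo (a := -ε) (b := ε)).prod e.open_target
    have h2 : ContinuousOn (fun z => fderiv ℝ (fun x : ℝ × EuclideanSpace ℝ (Fin (n + 1)) =>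
          l x.1 (e.symm x.2)) (0, z) ((1 : ℝ), 0)) e.target :=
      ((hL.continuousOn_fderiv_of_isOpen hO (by simp)).comp (f := fun z => ((0 : ℝ), z))
        (by fun_prop) fun z hz => ⟨hs, hz⟩).clm_apply continuousOn_const
    have h3 : ContinuousOn (fun z => restr (pullE α (famChart G e) (Ioo (-ε) ε ×ˢ e.target) (0, z)))
        e.target :=
      (compCLM (ContinuousLinearMap.inr ℝ ℝ
        (EuclideanSpace ℝ (Fin (n + 1))))).continuous.comp_continuousOn
        (contDiffOn_slice (contDiffOn_pullE_famChart hU hG he hα) hs).continuousOn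
    refine (h2.smul h3).congr fun z hz => ?_
    rw [chartRep_fmul, chartRep_pullback_fam hU hG he α hs hz]
    congr 1
    exact ((((hL.contDiffAt (hO.mem_nhds ⟨hs, hz⟩)).differentiableAt
      (by simp)).hasFDerivAt.comp_hasDerivAt (f := fun r => (r, z)) (0 : ℝ)
      ((hasDerivAt_id 0).prodMk (hasDerivAt_const 0 z)))).deriv
  have hcont2 : IsContForm (wedgeForm (dfun (l 0)) c) :=
    (isSmoothForm_wedgeForm (isSmoothCov_dfun hl0) hcs).isContForm
  have hfc : IsSmoothForm (fmul (l 0) c) := hcs.fmul hl0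
  have key : ∀ (i : P), ∫ z in (chartAt (EuclideanSpace ℝ (Fin (n + 1))) i).target,
      partitionOfUnity (n + 1) P i ((chartAt (EuclideanSpace ℝ (Fin (n + 1))) i).symm z) *
        fderiv ℝ (fun x : ℝ × EuclideanSpace ℝ (Fin (n + 1)) =>
          l x.1 ((chartAt (EuclideanSpace ℝ (Fin (n + 1))) i).symm x.2) *
      restr (pullE α (famChart G (chartAt (EuclideanSpace ℝ (Fin (n + 1))) i))
        (Ioo (-ε) ε ×ˢ (chartAt (EuclideanSpace ℝ (Fin (n + 1))) i).target) x)
        (EuclideanSpace.basisFun (Fin (n + 1)) ℝ)) (0, z) (1, 0) =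
      chartIntegral (chartAt (EuclideanSpace ℝ (Fin (n + 1))) i) (fmul (partitionOfUnity (n + 1) P i)
        (fmul (fun p => deriv (fun s => l s p) 0)
          (pullbackForm (fun q => G (0, q)) α : Form (n + 1) P (n + 1)))) -
      chartIntegral (chartAt (EuclideanSpace ℝ (Fin (n + 1))) i) (fmul (partitionOfUnity (n + 1) P i)
        (wedgeForm (dfun (l 0)) c)) +
      ∫ z in (chartAt (EuclideanSpace ℝ (Fin (n + 1))) i).target,
      partitionOfUnity (n + 1) P i ((chartAt (EuclideanSpace ℝ (Fin (n + 1))) i).symm z) *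
        extDeriv (chartRep (fmul (l 0) c) (chartAt (EuclideanSpace ℝ (Fin (n + 1))) i)) z
          (EuclideanSpace.basisFun (Fin (n + 1)) ℝ) := fun i => by
    rw [chartIntegral, chartIntegral, ← integral_sub (integrableOn_ptn_self hcont1 i)
      (integrableOn_ptn_self hcont2 i)]
    refine Eq.trans ?_ (integral_add ((integrableOn_ptn_self hcont1 i).sub
      (integrableOn_ptn_self hcont2 i)) ?_)
    · refine setIntegral_congr_fun
        (chartAt (EuclideanSpace ℝ (Fin (n + 1))) i).open_target.measurableSet fun z hz => ?_
      have h4 := ((hB i).contDiffAt ((hO i).mem_nhds (mk_mem_prod hs hz))).differentiableAt (by simp)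
      have h5 := h4.hasFDerivAt.comp_hasDerivAt (f := fun r => (r, z)) (0 : ℝ)
        ((hasDerivAt_id 0).prodMk (hasDerivAt_const 0 z))
      have h6 := (hl' i z hz).mul (hasDerivAt_restr_pullE isOpen_Ioo hG hα hd (he i) hs hz
        (EuclideanSpace.basisFun (Fin (n + 1)) ℝ))
      have h7 := h5.unique h6
      -- The derivative has been computed twice, once as that of the product in the chart and once
      -- by the product rule with Cartan's formula. Uniqueness of derivatives identifies the two.
      refine (congrArg (fun r => partitionOfUnity (n + 1) P i
        ((chartAt (EuclideanSpace ℝ (Fin (n + 1))) i).symm z) * r) h7).trans ?_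
      rw [extDeriv_chartRep_fmul hl0 hcs (he i) hz, ContinuousAlternatingMap.add_apply,
        ← (hl' i z hz).deriv]
      have h8 := chartRep_pullback_fam hU hG (he i) α hs hz
      simp only [chartRep_fmul, h8, ContinuousAlternatingMap.smul_apply, smul_eq_mul, ← hc]
      ring
    · refine integrableOn_of_eq_zero_off_compact (K := K i)
        (chartAt (EuclideanSpace ℝ (Fin (n + 1))) i).open_target.measurableSet (hK i) (hKT i)
        ((hχ i).mul (continuousOn_alternating_apply (contDiffOn_extDeriv
          (chartAt (EuclideanSpace ℝ (Fin (n + 1))) i).open_target (hfc _ (he i))).continuousOn _)) ?_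
      intro y hy hyK
      rw [hχ0 i y hy hyK, zero_mul]
  refine (h1.congr_of_eventuallyEq ?_).congr_deriv ?_
  · filter_upwards [isOpen_Ioo.mem_nhds hs] with s hs'
    rw [formIntegral_eq_sum]
    refine Finset.sum_congr rfl fun i _ => setIntegral_congr_fun
        (chartAt (EuclideanSpace ℝ (Fin (n + 1))) i).open_target.measurableSet fun z hz => ?_
    rw [chartRep_fmul, chartRep_fmul, chartRep_pullback_fam hU hG (he i) α hs' hz]
    rfl
  · refine (Finset.sum_congr rfl fun i _ => key i).trans ?_
    rw [Finset.sum_add_distrib, stokes hP hfc, add_zero, Finset.sum_sub_distrib,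
      formIntegral_eq_sum, formIntegral_eq_sum]

end ConstraintIntegral

/-! ### The equations in terms of contractions -/

section Equations

variable {P M : Type u}
  [TopologicalSpace P] [ChartedSpace (EuclideanSpace ℝ (Fin 3)) P]
  [TopologicalSpace M] [ChartedSpace (EuclideanSpace ℝ (Fin 6)) M]

/-- The pullback of the contraction of `α` with a tangent vector at `ι p`. -/
def contrAt {k : ℕ} (α : Form 6 M (k + 1)) (ι : P → M) (p : P) (w : EuclideanSpace ℝ (Fin 6)) :
    EuclideanSpace ℝ (Fin 3) [⋀^Fin k]→L[ℝ] ℝ :=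
  ((α.val (ι p)).curryLeft w).compContinuousLinearMap (tder (𝓡 3) (𝓡 6) ι univ p)

theorem contr_val_eq {k : ℕ} (α : Form 6 M (k + 1)) (ι : P → M) (X : P → EuclideanSpace ℝ (Fin 6))
    (p : P) : (contr (n := 3) α ι X).val p = contrAt α ι p (X p) := rfl

theorem contrAt_apply {k : ℕ} (α : Form 6 M (k + 1)) (ι : P → M) (p : P)
    (w : EuclideanSpace ℝ (Fin 6)) (v : Fin k → EuclideanSpace ℝ (Fin 3)) :
    contrAt α ι p w v =
      α.val (ι p) (Fin.cons w fun i => tder (𝓡 3) (𝓡 6) ι univ p (v i)) := rfl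

/-- Moving the last argument to the front is a cyclic permutation of `k + 1` places, of sign
`(-1)^k`. -/
theorem alternating_snoc {E : Type*} [NormedAddCommGroup E] [NormedSpace ℝ E] {k : ℕ}
    (f : E [⋀^Fin (k + 1)]→L[ℝ] ℝ) (u : Fin k → E) (w : E) :
    f (Fin.snoc (α := fun _ => E) u w) = (-1) ^ k * f (Fin.cons w u) := by
  rw [Fin.snoc_eq_cons_rotate]
  refine (f.toAlternatingMap.map_perm (Fin.cons w u) (finRotate (k + 1))).trans ?_
  rw [sign_finRotate]
  rcases Nat.even_or_odd k with hk | hk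
  · simp [hk.neg_one_pow]
  · simp [hk.neg_one_pow]

theorem normalForm_eq {k : ℕ} (α : Form 6 M (k + 1)) (ι : P → M) (p : P)
    (v : Fin k → EuclideanSpace ℝ (Fin 3)) (w : EuclideanSpace ℝ (Fin 6)) :
    normalForm α ι p v w = (-1) ^ k * contrAt α ι p w v := by
  rw [contrAt_apply, tder_univ]
  exact alternating_snoc (α.val (ι p)) (fun i => mfderiv (𝓡 3) (𝓡 6) ι p (v i)) w

theorem dWedge_eq {k : ℕ} (lam : P → ℝ) (p : P) (α : Form 6 M (k + 1)) (ι : P → M)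
    (v : Fin (k + 1) → EuclideanSpace ℝ (Fin 3)) (w : EuclideanSpace ℝ (Fin 6)) :
    dWedge lam p (fun u => normalForm α ι p u w) v =
      (-1) ^ k * wedge1 (dfun (n := 3) lam p) (contrAt α ι p w) v := by
  rw [wedge1_apply, Finset.mul_sum]
  refine Finset.sum_congr rfl fun i _ => ?_
  have h1 : differential lam p = dfun (n := 3) lam p := (tder_univ lam p).symm
  have h2 := normalForm_eq α ι p (i.removeNth v) w
  refine (congrArg₂ (fun (a : EuclideanSpace ℝ (Fin 3) →L[ℝ] ℝ) b =>
    (-1 : ℝ) ^ (i : ℕ) * a (v i) * b) h1 h2).trans ?_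
  ring

/-- Moving the free slot to the front costs `(-1)^3` for `τ` and `(-1)^2` for `ρ`. This is why a sum
equal to zero becomes an equality of contractions. -/
theorem perturbedSL_iff {ρ : Form 6 M 3} {τ : Form 6 M 4} {lam : P → ℝ} {ι : P → M} :
    PerturbedSL ρ τ lam ι ↔
      (∀ p w, contrAt τ ι p w = wedge1 (dfun (n := 3) lam p) (contrAt ρ ι p w)) ∧
        pullbackForm ι ρ = (0 : Form 3 P 3) := by
  have key : ∀ (p : P) (v : Fin 3 → EuclideanSpace ℝ (Fin 3)) (w : EuclideanSpace ℝ (Fin 6)),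
      normalForm τ ι p v w + dWedge lam p (fun u => normalForm ρ ι p u w) v = 0 ↔
      contrAt τ ι p w v = wedge1 (dfun (n := 3) lam p) (contrAt ρ ι p w) v := fun p v w => by
    rw [normalForm_eq, dWedge_eq]
    constructor
    · intro h
      linarith
    · intro h
      rw [h]
      ring
  constructor
  · rintro ⟨h1, h2⟩
    refine ⟨fun p w => ?_, h2⟩
    ext v
    exact (key p v w).mp (h1 p v w)
  · rintro ⟨h1, h2⟩
    exact ⟨fun p v w => (key p v w).mpr (congrArg (fun f => f v) (h1 p w)), h2⟩

end Equations

/-! ### The first variation along curves of paths -/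

section Variation

variable {P M : Type u}
  [TopologicalSpace P] [ChartedSpace (EuclideanSpace ℝ (Fin 3)) P] [IsManifold (𝓡 3) ∞ P]
  [T2Space P] [CompactSpace P]
  [TopologicalSpace M] [ChartedSpace (EuclideanSpace ℝ (Fin 6)) M] [IsManifold (𝓡 6) ∞ M]
  {ρ : Form 6 M 3} {τ : Form 6 M 4} {κ : H3 P} {A : H3 M} {ι₀ : P → M} {Φ : ℝ → P → M}
  {ε : ℝ} {Ψ : ℝ → ℝ → P → M}

theorem IsVariation.zero_mem (h : IsVariation ρ κ A ι₀ Φ ε Ψ) : (0 : ℝ) ∈ Ioo (-ε) ε :=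
  ⟨by linarith [h.pos], h.pos⟩

theorem IsVariation.endpoint (h : IsVariation ρ κ A ι₀ Φ ε Ψ) : Ψ 0 1 = Φ 1 :=
  h.center 1 ⟨zero_le_one, le_rfl⟩

theorem IsVariation.hasDerivAt_fTau (h : IsVariation ρ κ A ι₀ Φ ε Ψ) (hP : IsOrientedAtlas 3 P)
    (hτ : IsSmoothForm τ) (hτc : IsClosedForm τ) :
    HasDerivAt (fun s => fTau τ (Ψ s)) (formIntegral (contr τ (Φ 1) (velocity Ψ))) 0 := by
  rw [← h.endpoint]
  refine SLagrange.hasDerivAt_fTau hP h.pos (contMDiffOn_totalMap h.smooth) (fun s hs => ?_) hτ hτc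
  rw [(h.path s hs).start, (h.path 0 h.zero_mem).start]

/-- The endpoints of a variation, as a family of maps. -/
def endMap (Ψ : ℝ → ℝ → P → M) (x : ℝ × P) : M := Ψ x.1 1 x.2

theorem IsVariation.contMDiffOn_endMap (h : IsVariation ρ κ A ι₀ Φ ε Ψ) :
    ContMDiffOn (𝓘(ℝ, ℝ).prod (𝓡 3)) (𝓡 6) ∞ (endMap Ψ) (Ioo (-ε) ε ×ˢ univ) := by
  have h1 : ContMDiff (𝓘(ℝ, ℝ).prod (𝓡 3)) ((𝓘(ℝ, ℝ).prod 𝓘(ℝ, ℝ)).prod (𝓡 3)) ∞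
      (fun x : ℝ × P => (((x.1, 1) : ℝ × ℝ), x.2)) :=
    (contMDiff_fst.prodMk contMDiff_const).prodMk contMDiff_snd
  exact h.smooth.comp h1.contMDiffOn fun x hx => ⟨⟨hx.1, zero_le_one, le_rfl⟩, mem_univ _⟩

theorem IsVariation.famForm1_endMap (h : IsVariation ρ κ A ι₀ Φ ε Ψ) {k : ℕ}
    (α : Form 6 M (k + 1)) :
    famForm1 (n := 3) α (endMap Ψ) (Ioo (-ε) ε) 0 1 = contr α (Φ 1) (velocity Ψ) := by
  rw [famForm1_eq_contr h.contMDiffOn_endMap h.zero_mem, ← h.endpoint]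
  congr 1
  funext p
  exact famDeriv_apply_left (n := 3) h.contMDiffOn_endMap (c := fun r => r) (s := 0) (w := 1)
    (hasDerivAt_id 0) (isOpen_Ioo.mem_nhds h.zero_mem) p

theorem IsVariation.isSmoothForm_contr (h : IsVariation ρ κ A ι₀ Φ ε Ψ) {k : ℕ}
    {α : Form 6 M (k + 1)} (hα : IsSmoothForm α) :
    IsSmoothForm (contr (n := 3) α (Φ 1) (velocity Ψ)) := by
  rw [← h.famForm1_endMap α]
  exact isSmoothForm_famForm1 isOpen_Ioo.uniqueDiffOn h.contMDiffOn_endMap hα h.zero_mem 1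

theorem IsVariation.hasDerivAt_pullbackForm (h : IsVariation ρ κ A ι₀ Φ ε Ψ)
    (hρ : IsSmoothForm ρ) (hρc : IsClosedForm ρ) (p : P)
    (v : Fin 3 → EuclideanSpace ℝ (Fin 3)) :
    HasDerivAt (fun s => (pullbackForm (Ψ s 1) ρ : Form 3 P 3).val p v)
      (extDeriv (chartRep (contr ρ (Φ 1) (velocity Ψ)) (chartAt (EuclideanSpace ℝ (Fin 3)) p))
        (chartAt (EuclideanSpace ℝ (Fin 3)) p p) v) 0 := by
  rw [← h.famForm1_endMap ρ]
  exact hasDerivAt_pullbackForm_apply isOpen_Ioo h.contMDiffOn_endMap hρ hρc h.zero_mem p v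

theorem IsVariation.hasDerivAt_lagrangeFunctional (h : IsVariation ρ κ A ι₀ Φ ε Ψ)
    (hP : IsOrientedAtlas 3 P) (hρ : IsSmoothForm ρ) (hρc : IsClosedForm ρ)
    (hτ : IsSmoothForm τ) (hτc : IsClosedForm τ) {lam : P → ℝ}
    (hlam : ContMDiff (𝓡 3) 𝓘(ℝ, ℝ) ∞ lam) {l : ℝ → P → ℝ} (hl : IsFunctionVariation lam ε l) :
    HasDerivAt (fun s => lagrangeFunctional ρ τ (l s) (Ψ s))
      (formIntegral (contr τ (Φ 1) (velocity Ψ)) +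
        (formIntegral (fmul (fun p => deriv (fun s => l s p) 0)
            (pullbackForm (Φ 1) ρ : Form 3 P 3)) -
          formIntegral (wedgeForm (dfun lam) (contr (n := 3) ρ (Φ 1) (velocity Ψ))))) 0 := by
  refine (h.hasDerivAt_fTau hP hτ hτc).add ?_
  have h1 := hasDerivAt_integral_pullback hP h.pos h.contMDiffOn_endMap hρ hρc hl.smooth
    (by rw [hl.center]; exact hlam)
  rw [h.famForm1_endMap, hl.center] at h1
  rw [← h.endpoint] at h1 ⊢
  exact h1

/-- The integrands in the first variation cancel pointwise, whatever the velocity is. -/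
theorem PerturbedSL.isCriticalPoint (hP : IsOrientedAtlas 3 P) (hρ : IsSmoothForm ρ)
    (hρc : IsClosedForm ρ) (hτ : IsSmoothForm τ) (hτc : IsClosedForm τ) {lam : P → ℝ}
    (hlam : ContMDiff (𝓡 3) 𝓘(ℝ, ℝ) ∞ lam) (h : PerturbedSL ρ τ lam (Φ 1)) :
    IsCriticalPoint ρ τ κ A ι₀ lam Φ := by
  intro ε Ψ l hΨ hl
  obtain ⟨h1, h2⟩ := perturbedSL_iff.mp h
  refine (hΨ.hasDerivAt_lagrangeFunctional hP hρ hρc hτ hτc hlam hl).congr_deriv ?_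
  have h3 : contr (n := 3) τ (Φ 1) (velocity Ψ) =
      wedgeForm (dfun lam) (contr (n := 3) ρ (Φ 1) (velocity Ψ)) := by
    funext p
    exact h1 p (velocity Ψ p)
  have h4 : fmul (fun p => deriv (fun s => l s p) 0) (pullbackForm (Φ 1) ρ : Form 3 P 3) = 0 := by
    rw [h2]
    funext p
    exact smul_zero _
  rw [h3, h4, formIntegral_zero]
  ring

end Variation

/-! ### Positive three-forms in dimension six -/

section Complex

/-- The identification `ℝ⁶ = ℂ³`. -/
def toC3Equiv : EuclideanSpace ℝ (Fin 6) ≃ₗ[ℝ] (Fin 3 → ℂ) where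
  toFun := toC3
  map_add' u v := by
    funext j
    apply Complex.ext <;> rfl
  map_smul' c v := by
    funext j
    apply Complex.ext <;> simp [toC3]
  invFun z := WithLp.toLp 2 ![(z 0).re, (z 0).im, (z 1).re, (z 1).im, (z 2).re, (z 2).im]
  left_inv v := by
    ext i
    fin_cases i <;> rfl
  right_inv z := by
    funext j
    fin_cases j <;> apply Complex.ext <;> rfl

theorem toC3Equiv_apply (v : EuclideanSpace ℝ (Fin 6)) : toC3Equiv v = toC3 v := rfl

theorem dz123_eq (v : Fin 3 → EuclideanSpace ℝ (Fin 6)) :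
    dz123 v = (Matrix.of ![toC3 (v 0), toC3 (v 1), toC3 (v 2)]).det := by
  rw [dz123]
  congr 1
  ext i j
  fin_cases i <;> rfl

/-- The complex determinant of three vectors. -/
def det3 (a b c : Fin 3 → ℂ) : ℂ := (Matrix.of ![a, b, c]).det

theorem det3_eq (a b c : Fin 3 → ℂ) : det3 a b c =
    a 0 * b 1 * c 2 - a 0 * b 2 * c 1 - a 1 * b 0 * c 2 + a 1 * b 2 * c 0 + a 2 * b 0 * c 1 -
      a 2 * b 1 * c 0 := by
  rw [det3, Matrix.det_fin_three]
  simp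

/-- A real endomorphism of `ℂ³` that is symmetric with respect to `Re (dz₁ ∧ dz₂ ∧ dz₃)` is
multiplication by a complex number. -/
theorem exists_eq_smul_of_det3 {T : (Fin 3 → ℂ) →ₗ[ℝ] (Fin 3 → ℂ)}
    (hT : ∀ u v w, (det3 (T u) v w).re = (det3 u (T v) w).re) : ∃ c : ℂ, ∀ u, T u = c • u := by
  -- Symmetry together with antisymmetry of the determinant: the number equals its own negative.
  have h0 : ∀ u w, (det3 (T u) u w).re = 0 := fun u w => by
    have h1 := hT u u w
    have h2 : det3 u (T u) w = -det3 (T u) u w := by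
      rw [det3_eq, det3_eq]
      ring
    rw [h2, Complex.neg_re] at h1
    linarith
  -- Replacing `w` by `i w` brings the imaginary part under the same argument.
  have h1 : ∀ u w, det3 (T u) u w = 0 := fun u w => by
    apply Complex.ext
    · exact h0 u w
    · have h2 := h0 u (Complex.I • w)
      have h3 : det3 (T u) u (Complex.I • w) = Complex.I * det3 (T u) u w := by
        rw [det3_eq, det3_eq]
        simp only [Pi.smul_apply, smul_eq_mul]
        ring
      rw [h3, Complex.mul_re, Complex.I_re, Complex.I_im] at h2
      simp only [Complex.zero_im]
      linarith
  -- Since `T u`, `u` and any third vector are dependent, `T u` is parallel to `u`. The coordinate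
  -- vectors as third vector give the three minors.
  have h2 : ∀ u (i j : Fin 3), T u i * u j = T u j * u i := by
    intro u i j
    have a0 := h1 u (Pi.single 0 1)
    have a1 := h1 u (Pi.single 1 1)
    have a2 := h1 u (Pi.single 2 1)
    rw [det3_eq] at a0 a1 a2
    simp at a0 a1 a2
    have e01 : T u 0 * u 1 = T u 1 * u 0 := by linear_combination a2
    have e02 : T u 0 * u 2 = T u 2 * u 0 := by linear_combination -a1
    have e12 : T u 1 * u 2 = T u 2 * u 1 := by linear_combination a0
    fin_cases i <;> fin_cases j
    exacts [rfl, e01, e02, e01.symm, rfl, e12, e02.symm, e12.symm, rfl]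
  have hz : ∀ (i j : Fin 3) (x : ℂ), j ≠ i → x ≠ 0 → T (Pi.single i x) j = 0 := by
    intro i j x hij hx
    have := h2 (Pi.single i x) j i
    rw [Pi.single_eq_same, Pi.single_eq_of_ne hij, mul_zero] at this
    exact (mul_eq_zero.mp this).resolve_right hx
  -- The factors of proportionality on two different axes agree, as seen on the sum of the two
  -- vectors. Since `T` is only real linear, the dependence on the complex coordinate within one
  -- axis must be compared as well, by passing through a second axis.
  have hc : ∀ (i j : Fin 3) (x y : ℂ), j ≠ i → x ≠ 0 → y ≠ 0 →
      T (Pi.single i x) i * y = T (Pi.single j y) j * x := by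
    intro i j x y hij hx hy
    have := h2 (Pi.single i x + Pi.single j y) i j
    rw [map_add] at this
    simp only [Pi.add_apply, Pi.single_eq_same, Pi.single_eq_of_ne hij, Pi.single_eq_of_ne hij.symm,
      hz i j x hij hx, hz j i y hij.symm hy, add_zero, zero_add] at this
    exact this
  have hs : ∀ (i : Fin 3) (x : ℂ), x ≠ 0 → T (Pi.single i x) i = T (Pi.single 0 1) 0 * x := by
    intro i x hx
    by_cases hi : i = 0
    · subst hi
      have e1 := hc 0 1 x 1 (by decide) hx one_ne_zero
      have e2 := hc 0 1 1 1 (by decide) one_ne_zero one_ne_zero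
      linear_combination e1 - x * e2
    · have e1 := hc 0 i 1 x hi one_ne_zero hx
      linear_combination -e1
  refine ⟨T (Pi.single 0 1) 0, fun u => ?_⟩
  have hu : u = Pi.single 0 (u 0) + Pi.single 1 (u 1) + Pi.single 2 (u 2) := by
    funext j
    fin_cases j <;> simp
  have hsing : ∀ (i : Fin 3) (x : ℂ), T (Pi.single i x) = Pi.single i (T (Pi.single 0 1) 0 * x) := by
    intro i x
    by_cases hx : x = 0
    · subst hx
      simp
    · funext j
      by_cases hj : j = i
      · subst hj
        rw [Pi.single_eq_same, hs j x hx]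
      · rw [hz i j x hj hx, Pi.single_eq_of_ne hj]
  conv_lhs => rw [hu]
  rw [map_add, map_add, hsing 0 (u 0), hsing 1 (u 1), hsing 2 (u 2)]
  funext j
  fin_cases j <;> simp

/-- The map is complex linear, and its real determinant is the squared modulus of the complex one.
-/
theorem det_nonneg_of_commute {T : (Fin 3 → ℂ) →ₗ[ℝ] (Fin 3 → ℂ)}
    (hT : ∀ u, T (Complex.I • u) = Complex.I • T u) : 0 ≤ LinearMap.det T := by
  let T' : (Fin 3 → ℂ) →ₗ[ℂ] (Fin 3 → ℂ) :=
    { toFun := T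
      map_add' := map_add T
      map_smul' := fun c u => by
        have h1 : c • u = c.re • u + c.im • (Complex.I • u) := by
          conv_lhs => rw [← Complex.re_add_im c]
          rw [add_smul, mul_smul]
          rfl
        have h2 : c • T u = c.re • T u + c.im • (Complex.I • T u) := by
          conv_lhs => rw [← Complex.re_add_im c]
          rw [add_smul, mul_smul]
          rfl
        rw [h1, map_add, map_smul, map_smul, hT, RingHom.id_apply, h2] }
  have h1 : T = T'.restrictScalars ℝ := rfl
  rw [h1, LinearMap.det_restrictScalars, Algebra.norm_complex_eq]
  exact Complex.normSq_nonneg _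

/-- Complex conjugation on `ℂ³`. -/
def conjC3 : (Fin 3 → ℂ) →ₗ[ℝ] (Fin 3 → ℂ) where
  toFun z j := starRingEnd ℂ (z j)
  map_add' u v := by
    funext j
    simp
  map_smul' c u := by
    funext j
    simp

theorem det_conjC3 : LinearMap.det conjC3 = -1 := by
  have h1 : conjC3 = LinearMap.pi fun i : Fin 3 =>
      (Complex.conjAe.toLinearEquiv.toLinearMap).comp (LinearMap.proj i) := rfl
  rw [h1, LinearMap.det_pi, Finset.prod_const, Complex.det_conjAe]
  norm_num

/-- Composition with complex conjugation, whose determinant on `ℂ³` is `(-1)^3`, reduces this to the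
commuting case. -/
theorem det_neg_of_anticommute {T : (Fin 3 → ℂ) →ₗ[ℝ] (Fin 3 → ℂ)}
    (hT : ∀ u, T (Complex.I • u) = -(Complex.I • T u)) : LinearMap.det T ≤ 0 := by
  have h1 : 0 ≤ LinearMap.det (T ∘ₗ conjC3) := by
    refine det_nonneg_of_commute fun u => ?_
    have h2 : conjC3 (Complex.I • u) = -(Complex.I • conjC3 u) := by
      funext j
      simp [conjC3]
    rw [LinearMap.comp_apply, h2, map_neg, hT, neg_neg]
    rfl
  rw [LinearMap.det_comp, det_conjC3] at h1
  linarith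

theorem det3_smul_left (c : ℂ) (u v w : Fin 3 → ℂ) : det3 (c • u) v w = c * det3 u v w := by
  rw [det3_eq, det3_eq]
  simp only [Pi.smul_apply, smul_eq_mul]
  ring

theorem det3_smul_mid (c : ℂ) (u v w : Fin 3 → ℂ) : det3 u (c • v) w = c * det3 u v w := by
  rw [det3_eq, det3_eq]
  simp only [Pi.smul_apply, smul_eq_mul]
  ring

/-- An orientation-preserving isomorphism preserving `Re (dz₁ ∧ dz₂ ∧ dz₃)` preserves
`Im (dz₁ ∧ dz₂ ∧ dz₃)`. -/
theorem im_det3_eq {T : (Fin 3 → ℂ) ≃ₗ[ℝ] (Fin 3 → ℂ)}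
    (hT : 0 < LinearMap.det (T : (Fin 3 → ℂ) →ₗ[ℝ] (Fin 3 → ℂ)))
    (h : ∀ u v w, (det3 (T u) (T v) (T w)).re = (det3 u v w).re) (u v w : Fin 3 → ℂ) :
    (det3 (T u) (T v) (T w)).im = (det3 u v w).im := by
  let I' : (Fin 3 → ℂ) →ₗ[ℝ] (Fin 3 → ℂ) :=
    { toFun := fun u => Complex.I • u
      map_add' := smul_add _
      map_smul' := fun c u => smul_comm _ _ _ }
  -- The pulled back complex structure is symmetric for `Re (dz₁ ∧ dz₂ ∧ dz₃)`, because `T`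
  -- preserves this form. It is therefore multiplication by some `c` with `c² = -1`.
  let J : (Fin 3 → ℂ) →ₗ[ℝ] (Fin 3 → ℂ) := T.symm.toLinearMap ∘ₗ I' ∘ₗ T.toLinearMap
  have hTJ : ∀ u, T (J u) = Complex.I • T u := fun u => T.apply_symm_apply _
  obtain ⟨c, hc⟩ := exists_eq_smul_of_det3 (T := J) (fun u v w => by
    rw [← h (J u) v w, ← h u (J v) w, hTJ, hTJ, det3_smul_left, det3_smul_mid])
  have hcc : c * c = -1 := by
    have h1 : J (J (Pi.single 0 1)) = -Pi.single 0 1 := by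
      apply T.injective
      rw [hTJ, hTJ, map_neg, smul_smul, Complex.I_mul_I, neg_smul, one_smul]
    rw [hc, hc] at h1
    have h2 := congrFun h1 0
    simpa using h2
  have hcI : c = Complex.I ∨ c = -Complex.I := by
    have : (c - Complex.I) * (c + Complex.I) = 0 := by
      linear_combination hcc - Complex.I_mul_I
    rcases mul_eq_zero.mp this with h1 | h1
    · exact Or.inl (sub_eq_zero.mp h1)
    · exact Or.inr (eq_neg_of_add_eq_zero_left h1)
  rcases hcI with rfl | rfl
  -- If `c = i`, then `T` commutes with `i`, and the real part at `i u` is minus the imaginary part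
  -- at `u`.
  · have h1 := h (Complex.I • u) v w
    rw [← hc u, hTJ, hc u, det3_smul_left, det3_smul_left] at h1
    simp only [Complex.mul_re, Complex.I_re, Complex.I_im] at h1
    linarith
  -- If `c = -i`, then `T` is antilinear, and in complex dimension three it cannot preserve the
  -- orientation.
  · exfalso
    have h1 : ∀ u, T (Complex.I • u) = -(Complex.I • T u) := fun u => by
      have h2 := hTJ u
      rw [hc, neg_smul, map_neg] at h2
      rw [← h2, neg_neg]
    have := det_neg_of_anticommute (T := (T : (Fin 3 → ℂ) →ₗ[ℝ] (Fin 3 → ℂ))) h1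
    linarith

end Complex

/-! ### Uniqueness and equivariance of the Hitchin dual. -/

section Hitchin

theorem toC3_comp (g : EuclideanSpace ℝ (Fin 6) →L[ℝ] EuclideanSpace ℝ (Fin 6))
    (v : Fin 3 → EuclideanSpace ℝ (Fin 6)) :
    dz123 (g ∘ v) = det3 (toC3 (g (v 0))) (toC3 (g (v 1))) (toC3 (g (v 2))) := dz123_eq _

theorem IsHitchinDual.exists_det3 {ρ σ : EuclideanSpace ℝ (Fin 6) [⋀^Fin 3]→L[ℝ] ℝ}
    (h : IsHitchinDual ρ σ) :
    ∃ g : EuclideanSpace ℝ (Fin 6) ≃L[ℝ] EuclideanSpace ℝ (Fin 6),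
      0 < (g : EuclideanSpace ℝ (Fin 6) →L[ℝ] EuclideanSpace ℝ (Fin 6)).det ∧
      ∀ v, ρ v = (det3 (toC3 (g (v 0))) (toC3 (g (v 1))) (toC3 (g (v 2)))).re ∧
        σ v = (det3 (toC3 (g (v 0))) (toC3 (g (v 1))) (toC3 (g (v 2)))).im := by
  obtain ⟨g, hg, h⟩ := h
  refine ⟨g.toContinuousLinearEquivOfDetNeZero hg.ne', ?_, fun v => ?_⟩
  · rwa [ContinuousLinearMap.coe_toContinuousLinearEquivOfDetNeZero]
  · have h1 := h v
    rw [toC3_comp] at h1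
    simp only [ContinuousLinearMap.toContinuousLinearEquivOfDetNeZero_apply]
    rw [← h1]
    simp

/-- Two presentations of the same real part differ by an orientation-preserving isomorphism of `ℂ³`
preserving `Re (dz₁ ∧ dz₂ ∧ dz₃)`, which by `im_det3_eq` preserves the imaginary part. -/
theorem IsHitchinDual.unique {ρ σ σ' : EuclideanSpace ℝ (Fin 6) [⋀^Fin 3]→L[ℝ] ℝ}
    (h : IsHitchinDual ρ σ) (h' : IsHitchinDual ρ σ') : σ = σ' := by
  obtain ⟨g, hg, h⟩ := h.exists_det3
  obtain ⟨g', hg', h'⟩ := h'.exists_det3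
  let T : (Fin 3 → ℂ) ≃ₗ[ℝ] (Fin 3 → ℂ) :=
    toC3Equiv.symm ≪≫ₗ (g.symm.toLinearEquiv ≪≫ₗ g'.toLinearEquiv) ≪≫ₗ toC3Equiv
  have hT : ∀ x, T (toC3 (g x)) = toC3 (g' x) := fun x => by
    change toC3Equiv (g' (g.symm (toC3Equiv.symm (toC3Equiv (g x))))) = _
    rw [LinearEquiv.symm_apply_apply, ContinuousLinearEquiv.symm_apply_apply]
    rfl
  have hdet : 0 < LinearMap.det (T : (Fin 3 → ℂ) →ₗ[ℝ] (Fin 3 → ℂ)) := by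
    have h1 : (T : (Fin 3 → ℂ) →ₗ[ℝ] (Fin 3 → ℂ)) =
        toC3Equiv.toLinearMap ∘ₗ (g'.toLinearEquiv.toLinearMap ∘ₗ
          g.symm.toLinearEquiv.toLinearMap) ∘ₗ toC3Equiv.symm.toLinearMap := rfl
    rw [h1, LinearMap.det_conj, LinearMap.det_comp]
    have h2 : LinearMap.det g.toLinearEquiv.toLinearMap *
        LinearMap.det g.symm.toLinearEquiv.toLinearMap = 1 := by
      rw [← LinearMap.det_comp, ← LinearMap.det_id (A := ℝ) (M := EuclideanSpace ℝ (Fin 6))]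
      congr 1
      ext x
      simp
    have h3 : 0 < LinearMap.det g.toLinearEquiv.toLinearMap := hg
    have h4 : 0 < LinearMap.det g'.toLinearEquiv.toLinearMap := hg'
    exact mul_pos h4 ((pos_iff_pos_of_mul_pos (by rw [h2]; exact one_pos)).mp h3)
  have hs : ∀ z, ∃ x, toC3 (g x) = z := fun z => ⟨g.symm (toC3Equiv.symm z), by
    rw [g.apply_symm_apply]
    exact toC3Equiv.apply_symm_apply z⟩
  have key := im_det3_eq hdet (fun u v w => by
    obtain ⟨u, rfl⟩ := hs u
    obtain ⟨v, rfl⟩ := hs v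
    obtain ⟨w, rfl⟩ := hs w
    rw [hT, hT, hT]
    have h1 := (h ![u, v, w]).1
    have h2 := (h' ![u, v, w]).1
    exact h2.symm.trans h1)
  ext v
  rw [(h v).2, (h' v).2, ← hT, ← hT, ← hT, key]

theorem hitchinDual_eq {ρ σ : EuclideanSpace ℝ (Fin 6) [⋀^Fin 3]→L[ℝ] ℝ}
    (h : IsHitchinDual ρ σ) : hitchinDual ρ = σ := by
  have hp : IsPositive ρ := ⟨σ, h⟩
  rw [hitchinDual, dif_pos hp]
  exact hp.choose_spec.unique h

theorem IsPositive.isHitchinDual {ρ : EuclideanSpace ℝ (Fin 6) [⋀^Fin 3]→L[ℝ] ℝ}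
    (h : IsPositive ρ) : IsHitchinDual ρ (hitchinDual ρ) := by
  obtain ⟨σ, hσ⟩ := h
  rwa [hitchinDual_eq hσ]

theorem IsHitchinDual.comp {ρ σ : EuclideanSpace ℝ (Fin 6) [⋀^Fin 3]→L[ℝ] ℝ}
    (h : IsHitchinDual ρ σ) {g : EuclideanSpace ℝ (Fin 6) →L[ℝ] EuclideanSpace ℝ (Fin 6)}
    (hg : 0 < g.det) :
    IsHitchinDual (ρ.compContinuousLinearMap g) (σ.compContinuousLinearMap g) := by
  obtain ⟨f, hf, h⟩ := h
  refine ⟨f.comp g, ?_, fun v => h (g ∘ v)⟩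
  have h1 : (f.comp g).det = f.det * g.det := LinearMap.det_comp _ _
  rw [h1]
  exact mul_pos hf hg

theorem IsPositive.comp {ρ : EuclideanSpace ℝ (Fin 6) [⋀^Fin 3]→L[ℝ] ℝ} (h : IsPositive ρ)
    {g : EuclideanSpace ℝ (Fin 6) →L[ℝ] EuclideanSpace ℝ (Fin 6)} (hg : 0 < g.det) :
    IsPositive (ρ.compContinuousLinearMap g) := ⟨_, h.isHitchinDual.comp hg⟩

theorem hitchinDual_comp {ρ : EuclideanSpace ℝ (Fin 6) [⋀^Fin 3]→L[ℝ] ℝ} (h : IsPositive ρ)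
    {g : EuclideanSpace ℝ (Fin 6) →L[ℝ] EuclideanSpace ℝ (Fin 6)} (hg : 0 < g.det) :
    hitchinDual (ρ.compContinuousLinearMap g) = (hitchinDual ρ).compContinuousLinearMap g :=
  hitchinDual_eq (h.isHitchinDual.comp hg)

/-- Here `J` is multiplication by `i` in the adapted complex coordinates, and `Re (i z) = -Im z`. -/
theorem IsHitchinDual.exists_rotation {ρ σ : EuclideanSpace ℝ (Fin 6) [⋀^Fin 3]→L[ℝ] ℝ}
    (h : IsHitchinDual ρ σ) : ∃ J : EuclideanSpace ℝ (Fin 6) → EuclideanSpace ℝ (Fin 6),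
      ∀ u v w, ρ ![J u, v, w] = -σ ![u, v, w] := by
  obtain ⟨g, -, h⟩ := h.exists_det3
  refine ⟨fun u => g.symm (toC3Equiv.symm (Complex.I • toC3 (g u))), fun u v w => ?_⟩
  rw [(h _).1, (h _).2]
  have h1 : toC3 (g (g.symm (toC3Equiv.symm (Complex.I • toC3 (g u))))) =
      Complex.I • toC3 (g u) := by
    rw [g.apply_symm_apply]
    exact toC3Equiv.apply_symm_apply _
  simp only [Matrix.cons_val_zero, Matrix.cons_val_one, Matrix.cons_val, h1, det3_smul_left,
    Complex.mul_re, Complex.I_re, Complex.I_im]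
  ring

end Hitchin

/-! ### Continuity of the Hitchin dual -/

section HitchinContinuity

/-- An additive, real-linear functional of the complex determinant as an alternating form. -/
def partDz (L : ℂ →L[ℝ] ℝ) : EuclideanSpace ℝ (Fin 6) [⋀^Fin 3]→L[ℝ] ℝ where
  toFun v := L (dz123 v)
  map_update_add' v i x y := by
    rename_i inst
    obtain rfl : inst = instDecidableEqFin 3 := Subsingleton.elim _ _
    have h1 : ∀ z, dz123 (update v i z) =
        ((Matrix.of fun i j => toC3 (v i) j).updateRow i (toC3 z)).det := fun z => by
      rw [dz123]
      congr 1
      ext a b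
      by_cases hab : a = i
      · subst hab
        simp
      · simp [hab]
    rw [h1, h1, h1, ← map_add,
      ← Matrix.det_updateRow_add]
    congr 2
  map_update_smul' v i c x := by
    rename_i inst
    obtain rfl : inst = instDecidableEqFin 3 := Subsingleton.elim _ _
    have h1 : ∀ z, dz123 (update v i z) =
        ((Matrix.of fun i j => toC3 (v i) j).updateRow i (toC3 z)).det := fun z => by
      rw [dz123]
      congr 1
      ext a b
      by_cases hab : a = i
      · subst hab
        simp
      · simp [hab]
    have h2 : toC3 (c • x) = (c : ℂ) • toC3 x := by
      have := map_smul toC3Equiv c x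
      rw [toC3Equiv_apply, toC3Equiv_apply] at this
      rw [this]
      funext j
      simp
    rw [h1, h1, h2, Matrix.det_updateRow_smul,
      ← map_smul]
    congr 1
  map_eq_zero_of_eq' v i j hij hne := by
    rw [dz123, Matrix.det_zero_of_row_eq hne, map_zero]
    funext a
    change toC3 (v i) a = toC3 (v j) a
    rw [hij]
  cont := by
    have h1 : Continuous fun v : EuclideanSpace ℝ (Fin 6) => toC3 v :=
      LinearMap.continuous_of_finiteDimensional toC3Equiv.toLinearMap
    refine L.continuous.comp (Continuous.matrix_det ?_)
    refine continuous_pi fun i => ?_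
    exact h1.comp (continuous_apply i)

theorem isHitchinDual_partDz {g : EuclideanSpace ℝ (Fin 6) →L[ℝ] EuclideanSpace ℝ (Fin 6)}
    (hg : 0 < g.det) : IsHitchinDual ((partDz Complex.reCLM).compContinuousLinearMap g)
      ((partDz Complex.imCLM).compContinuousLinearMap g) :=
  ⟨g, hg, fun _ => Complex.re_add_im _⟩

theorem IsHitchinDual.eq_partDz {ρ σ : EuclideanSpace ℝ (Fin 6) [⋀^Fin 3]→L[ℝ] ℝ}
    (h : IsHitchinDual ρ σ) : ∃ g : EuclideanSpace ℝ (Fin 6) ≃L[ℝ] EuclideanSpace ℝ (Fin 6),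
      0 < (g : EuclideanSpace ℝ (Fin 6) →L[ℝ] EuclideanSpace ℝ (Fin 6)).det ∧
      ρ = (partDz Complex.reCLM).compContinuousLinearMap
        (g : EuclideanSpace ℝ (Fin 6) →L[ℝ] EuclideanSpace ℝ (Fin 6)) := by
  obtain ⟨g, hg, h⟩ := h.exists_det3
  refine ⟨g, hg, ?_⟩
  ext v
  rw [(h v).1]
  change _ = (dz123 ((g : EuclideanSpace ℝ (Fin 6) →L[ℝ] EuclideanSpace ℝ (Fin 6)) ∘ v)).re
  rw [toC3_comp]
  rfl

theorem contDiff_comp_form (ζ : EuclideanSpace ℝ (Fin 6) [⋀^Fin 3]→L[ℝ] ℝ) :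
    ContDiff ℝ 1 (fun g : EuclideanSpace ℝ (Fin 6) →L[ℝ] EuclideanSpace ℝ (Fin 6) =>
      ζ.compContinuousLinearMap g) := by
  rw [← contDiffOn_univ]
  exact fun g _ => contDiffWithinAt_alternating_comp contDiffWithinAt_const contDiffWithinAt_id

/-- Along the line `id + t B` the determinant is a cubic polynomial in `t`, and the derivative is
its linear coefficient. -/
theorem fderiv_comp_reDz (B : EuclideanSpace ℝ (Fin 6) →L[ℝ] EuclideanSpace ℝ (Fin 6))
    (v : Fin 3 → EuclideanSpace ℝ (Fin 6)) :
    fderiv ℝ (fun g : EuclideanSpace ℝ (Fin 6) →L[ℝ] EuclideanSpace ℝ (Fin 6) =>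
      (partDz Complex.reCLM).compContinuousLinearMap g) (ContinuousLinearMap.id ℝ _) B v =
    (det3 (toC3 (B (v 0))) (toC3 (v 1)) (toC3 (v 2)) +
      det3 (toC3 (v 0)) (toC3 (B (v 1))) (toC3 (v 2)) +
      det3 (toC3 (v 0)) (toC3 (v 1)) (toC3 (B (v 2)))).re := by
  have hd : DifferentiableAt ℝ (fun g : EuclideanSpace ℝ (Fin 6) →L[ℝ] EuclideanSpace ℝ (Fin 6) =>
      (partDz Complex.reCLM).compContinuousLinearMap g) (ContinuousLinearMap.id ℝ _) :=
    (contDiff_comp_form _).differentiable (by simp) _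
  have h0 : ContinuousLinearMap.id ℝ (EuclideanSpace ℝ (Fin 6)) + (0 : ℝ) • B =
      ContinuousLinearMap.id ℝ (EuclideanSpace ℝ (Fin 6)) := by
    ext x i
    change x i + 0 * B x i = x i
    ring
  have hline : HasDerivAt (fun t : ℝ => ContinuousLinearMap.id ℝ (EuclideanSpace ℝ (Fin 6)) + t • B)
      B 0 := by
    simpa using ((hasDerivAt_id (0 : ℝ)).smul_const B).const_add
      (ContinuousLinearMap.id ℝ (EuclideanSpace ℝ (Fin 6)))
  have hd' : DifferentiableAt ℝ (fun g : EuclideanSpace ℝ (Fin 6) →L[ℝ] EuclideanSpace ℝ (Fin 6) =>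
      (partDz Complex.reCLM).compContinuousLinearMap g)
      (ContinuousLinearMap.id ℝ (EuclideanSpace ℝ (Fin 6)) + (0 : ℝ) • B) := by
    rwa [h0]
  have h1 := hd'.hasFDerivAt.comp_hasDerivAt (0 : ℝ) hline
  have h2 := (ContinuousAlternatingMap.apply ℝ (EuclideanSpace ℝ (Fin 6)) ℝ
    v).hasFDerivAt.comp_hasDerivAt (0 : ℝ) h1
  have h3 : ∀ t : ℝ, ∀ x, toC3 (x + t • B x) = toC3 x + (t : ℂ) • toC3 (B x) := fun t x => by
    have h4 := map_add toC3Equiv x (t • B x)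
    rw [map_smul] at h4
    refine h4.trans ?_
    funext j
    simp [toC3Equiv_apply]
  have h5 : ∀ a b c a' b' c' : Fin 3 → ℂ, HasDerivAt (fun t : ℝ =>
      (det3 (a + (t : ℂ) • a') (b + (t : ℂ) • b') (c + (t : ℂ) • c')).re)
      (det3 a' b c + det3 a b' c + det3 a b c').re 0 := by
    intro a b c a' b' c'
    have h6 : ∀ t : ℝ, (det3 (a + (t : ℂ) • a') (b + (t : ℂ) • b') (c + (t : ℂ) • c')).re =
        (det3 a b c).re + t * (det3 a' b c + det3 a b' c + det3 a b c').re +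
        t ^ 2 * (det3 a' b' c + det3 a' b c' + det3 a b' c').re + t ^ 3 * (det3 a' b' c').re := by
      intro t
      rw [← Complex.re_ofReal_mul, ← Complex.re_ofReal_mul, ← Complex.re_ofReal_mul,
        ← Complex.add_re, ← Complex.add_re, ← Complex.add_re]
      congr 1
      simp only [det3_eq, Pi.add_apply, Pi.smul_apply, smul_eq_mul]
      push_cast
      ring
    rw [funext h6]
    have h7 := (((hasDerivAt_const (0 : ℝ) (det3 a b c).re).add
      ((hasDerivAt_id (0 : ℝ)).mul_const (det3 a' b c + det3 a b' c + det3 a b c').re)).add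
      (((hasDerivAt_id (0 : ℝ)).pow 2).mul_const
        (det3 a' b' c + det3 a' b c' + det3 a b' c').re)).add
      (((hasDerivAt_id (0 : ℝ)).pow 3).mul_const (det3 a' b' c').re)
    refine h7.congr_deriv ?_
    simp
  have h8 := h5 (toC3 (v 0)) (toC3 (v 1)) (toC3 (v 2)) (toC3 (B (v 0))) (toC3 (B (v 1)))
    (toC3 (B (v 2)))
  have h9 := h2.unique (h8.congr_of_eventuallyEq (Filter.Eventually.of_forall fun t => by
    simp only [← h3]
    exact congrArg Complex.re (dz123_eq _)))
  rw [← h9, h0]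
  rfl

/-- The complex coordinates of the standard basis of `ℝ⁶`. -/
theorem toC3_basisFun (i : Fin 6) : toC3 (EuclideanSpace.basisFun (Fin 6) ℝ i) =
    (![![1, 0, 0], ![Complex.I, 0, 0], ![0, 1, 0], ![0, Complex.I, 0], ![0, 0, 1],
      ![0, 0, Complex.I]] : Fin 6 → Fin 3 → ℂ) i := by
  funext j
  fin_cases i <;> fin_cases j <;> apply Complex.ext <;> simp [toC3]

/-- An injective tuple of basis indices can be sorted at the cost of a sign, so increasing triples
suffice. -/
theorem alternating_ext_six {f g : EuclideanSpace ℝ (Fin 6) [⋀^Fin 3]→L[ℝ] ℝ}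
    (h : ∀ a b c : Fin 6, a < b → b < c →
      f (fun i => EuclideanSpace.basisFun (Fin 6) ℝ (![a, b, c] i)) =
        g (fun i => EuclideanSpace.basisFun (Fin 6) ℝ (![a, b, c] i))) : f = g := by
  apply ContinuousAlternatingMap.toAlternatingMap_injective
  refine Module.Basis.ext_alternating (EuclideanSpace.basisFun (Fin 6) ℝ).toBasis fun v hv => ?_
  have hm : StrictMono (v ∘ Tuple.sort v) :=
    (Tuple.monotone_sort v).strictMono_of_injective (hv.comp (Tuple.sort v).injective)
  have h1 := h _ _ _ (hm (show (0 : Fin 3) < 1 by decide)) (hm (show (1 : Fin 3) < 2 by decide))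
  have h2 : ∀ i, (![(v ∘ Tuple.sort v) 0, (v ∘ Tuple.sort v) 1, (v ∘ Tuple.sort v) 2] :
      Fin 3 → Fin 6) i = v (Tuple.sort v i) := fun i => by
    fin_cases i <;> rfl
  simp only [h2] at h1
  have hf := f.toAlternatingMap.map_perm (fun i => EuclideanSpace.basisFun (Fin 6) ℝ (v i))
    (Tuple.sort v)
  have hg := g.toAlternatingMap.map_perm (fun i => EuclideanSpace.basisFun (Fin 6) ℝ (v i))
    (Tuple.sort v)
  have h3 : Equiv.Perm.sign (Tuple.sort v) • f.toAlternatingMap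
      (fun i => EuclideanSpace.basisFun (Fin 6) ℝ (v i)) =
      Equiv.Perm.sign (Tuple.sort v) • g.toAlternatingMap
      (fun i => EuclideanSpace.basisFun (Fin 6) ℝ (v i)) := hf.symm.trans (h1.trans hg)
  simpa using smul_left_cancel _ h3

/-- The infinitesimal form of the openness of the orbit. A real 3-form on `ℂ³` is the real part of a
`(3,0)`-form plus the real part of a `(2,1)`-form, of real dimensions 2 and 18. Scaling one
coordinate by `c` reaches the former, and antilinear maps, given by nine complex entries, reach the
latter. -/
theorem range_fderiv_comp_reDz : (fderiv ℝ (fun g : EuclideanSpace ℝ (Fin 6) →L[ℝ]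
      EuclideanSpace ℝ (Fin 6) => (partDz Complex.reCLM).compContinuousLinearMap g)
      (ContinuousLinearMap.id ℝ _)).range = ⊤ := by
  rw [LinearMap.range_eq_top]
  intro η
  set H : Fin 6 → Fin 6 → Fin 6 → ℝ := fun a b c =>
    η (fun i => EuclideanSpace.basisFun (Fin 6) ℝ (![a, b, c] i)) with hH
  set c : ℂ := ⟨(H 0 2 4 - H 1 3 4 - H 1 2 5 - H 0 3 5) / 4,
    -(H 1 2 4 + H 0 3 4 + H 0 2 5 - H 1 3 5) / 4⟩
  set N : Matrix (Fin 3) (Fin 3) ℂ :=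
    !![⟨(H 0 2 4 + H 1 3 4 + H 1 2 5 - H 0 3 5) / 4, -(-H 1 2 4 + H 0 3 4 + H 0 2 5 + H 1 3 5) / 4⟩,
        ⟨-H 2 3 5 / 2, -H 2 3 4 / 2⟩, ⟨H 3 4 5 / 2, H 2 4 5 / 2⟩;
      ⟨H 0 1 5 / 2, H 0 1 4 / 2⟩,
        ⟨(H 0 2 4 + H 1 3 4 - H 1 2 5 + H 0 3 5) / 4, -(H 1 2 4 - H 0 3 4 + H 0 2 5 + H 1 3 5) / 4⟩,
        ⟨-H 1 4 5 / 2, -H 0 4 5 / 2⟩;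
      ⟨-H 0 1 3 / 2, -H 0 1 2 / 2⟩, ⟨H 1 2 3 / 2, H 0 2 3 / 2⟩,
        ⟨(H 0 2 4 - H 1 3 4 + H 1 2 5 + H 0 3 5) / 4,
          -(H 1 2 4 + H 0 3 4 - H 0 2 5 + H 1 3 5) / 4⟩] with hN
  let B' : (Fin 3 → ℂ) →ₗ[ℝ] (Fin 3 → ℂ) :=
    (N.mulVecLin.restrictScalars ℝ) ∘ₗ conjC3 +
      ((LinearMap.single ℂ (fun _ : Fin 3 => ℂ) 0 ∘ₗ (c • LinearMap.proj 0)).restrictScalars ℝ)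
  let B : EuclideanSpace ℝ (Fin 6) →L[ℝ] EuclideanSpace ℝ (Fin 6) :=
    LinearMap.toContinuousLinearMap (toC3Equiv.symm.toLinearMap ∘ₗ B' ∘ₗ toC3Equiv.toLinearMap)
  have hB : ∀ x, toC3 (B x) = B' (toC3 x) := fun x => toC3Equiv.apply_symm_apply _
  have hB' : ∀ z, B' z = ![N 0 0 * starRingEnd ℂ (z 0) + N 0 1 * starRingEnd ℂ (z 1) +
      N 0 2 * starRingEnd ℂ (z 2) + c * z 0, N 1 0 * starRingEnd ℂ (z 0) +
      N 1 1 * starRingEnd ℂ (z 1) + N 1 2 * starRingEnd ℂ (z 2), N 2 0 * starRingEnd ℂ (z 0) +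
      N 2 1 * starRingEnd ℂ (z 1) + N 2 2 * starRingEnd ℂ (z 2)] := fun z => by
    funext j
    fin_cases j <;> simp [B', conjC3, Matrix.mulVec, dotProduct, Fin.sum_univ_three]
  refine ⟨B, alternating_ext_six fun i j k hij hjk => ?_⟩
  refine (fderiv_comp_reDz B _).trans ?_
  change _ = H i j k
  rw [hB, hB, hB]
  simp only [toC3_basisFun, hB', det3_eq]
  -- The entries of `c` and `N` solve the linear system given by the twenty increasing triples,
  -- which is checked triple by triple.
  fin_cases i <;> fin_cases j <;> first | (exfalso; revert hij; decide) | skip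
  all_goals fin_cases k <;> first | (exfalso; revert hjk; decide) | skip
  all_goals
    simp [hN, c, Complex.add_re, Complex.mul_re, Complex.mul_im]
    try ring

/-- Near the model form every form is `g^* Re (dz₁ ∧ dz₂ ∧ dz₃)` with `g` close to the identity, and
its dual `g^* Im (dz₁ ∧ dz₂ ∧ dz₃)` depends continuously on `g`. Equivariance moves this to an
arbitrary positive form. -/
theorem continuousAt_hitchinDual {ρ : EuclideanSpace ℝ (Fin 6) [⋀^Fin 3]→L[ℝ] ℝ}
    (h : IsPositive ρ) : ContinuousAt hitchinDual ρ := by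
  have hdet : Continuous fun g : EuclideanSpace ℝ (Fin 6) →L[ℝ] EuclideanSpace ℝ (Fin 6) =>
      g.det := ContinuousLinearMap.continuous_det
  have hid : (ContinuousLinearMap.id ℝ (EuclideanSpace ℝ (Fin 6))).det = 1 := LinearMap.det_id
  have hmodel : ContinuousAt hitchinDual (partDz Complex.reCLM) := by
    intro S hS
    have h1 := ((contDiff_comp_form (partDz Complex.reCLM)).contDiffAt.hasStrictFDerivAt
      (by simp)).map_nhds_eq_of_surj range_fderiv_comp_reDz
    have h2 : (partDz Complex.reCLM).compContinuousLinearMap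
        (ContinuousLinearMap.id ℝ (EuclideanSpace ℝ (Fin 6))) = partDz Complex.reCLM := rfl
    have h3 : hitchinDual (partDz Complex.reCLM) = (partDz Complex.imCLM).compContinuousLinearMap
        (ContinuousLinearMap.id ℝ (EuclideanSpace ℝ (Fin 6))) := by
      rw [← h2]
      exact hitchinDual_eq (isHitchinDual_partDz (by rw [hid]; exact one_pos))
    rw [h2] at h1
    -- Surjectivity of the derivative makes the neighbourhoods of the model form the images of the
    -- neighbourhoods of the identity, so the dual need only be tested along the orbit map.
    rw [← h1, Filter.map_map, Filter.mem_map]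
    have h4 := (contDiff_comp_form (partDz Complex.imCLM)).continuous.continuousAt
      (x := ContinuousLinearMap.id ℝ (EuclideanSpace ℝ (Fin 6)))
    rw [h3] at hS
    filter_upwards [h4 hS, hdet.continuousAt.eventually
      (lt_mem_nhds (show 0 < (ContinuousLinearMap.id ℝ (EuclideanSpace ℝ (Fin 6))).det by
        rw [hid]; exact one_pos))] with g hg hg'
    rw [mem_preimage, comp_apply, hitchinDual_eq (isHitchinDual_partDz hg')]
    exact hg
  obtain ⟨g, hg, rfl⟩ := h.isHitchinDual.eq_partDz
  have hg' : 0 < (g.symm : EuclideanSpace ℝ (Fin 6) →L[ℝ] EuclideanSpace ℝ (Fin 6)).det := by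
    rw [ContinuousLinearEquiv.det_coe_symm]
    exact inv_pos.mpr hg
  have hgg : ∀ η : EuclideanSpace ℝ (Fin 6) [⋀^Fin 3]→L[ℝ] ℝ,
      (η.compContinuousLinearMap (g.symm : EuclideanSpace ℝ (Fin 6) →L[ℝ] _)).compContinuousLinearMap
        (g : EuclideanSpace ℝ (Fin 6) →L[ℝ] _) = η := fun η => by
    ext v
    simp only [ContinuousAlternatingMap.compContinuousLinearMap_apply]
    congr 1
    funext i
    simp
  have hgg' : ∀ η : EuclideanSpace ℝ (Fin 6) [⋀^Fin 3]→L[ℝ] ℝ,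
      (η.compContinuousLinearMap (g : EuclideanSpace ℝ (Fin 6) →L[ℝ] _)).compContinuousLinearMap
        (g.symm : EuclideanSpace ℝ (Fin 6) →L[ℝ] _) = η := fun η => by
    ext v
    simp only [ContinuousAlternatingMap.compContinuousLinearMap_apply]
    congr 1
    funext i
    simp
  -- Equivariance holds for all forms, because at a form that is not positive both sides take the
  -- default value zero.
  have h1 : hitchinDual = fun η => compCLM (g : EuclideanSpace ℝ (Fin 6) →L[ℝ] _)
      (hitchinDual (compCLM (g.symm : EuclideanSpace ℝ (Fin 6) →L[ℝ] _) η)) := by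
    funext η
    rw [compCLM_apply, compCLM_apply]
    by_cases hη : IsPositive
        (η.compContinuousLinearMap (g.symm : EuclideanSpace ℝ (Fin 6) →L[ℝ] _))
    · rw [← hitchinDual_comp hη hg, hgg]
    · have h2 : ¬ IsPositive η := fun h2 => hη (h2.comp hg')
      rw [hitchinDual, hitchinDual, dif_neg hη, dif_neg h2]
      rfl
  rw [h1]
  have hc : ∀ G : EuclideanSpace ℝ (Fin 6) →L[ℝ] EuclideanSpace ℝ (Fin 6),
      Continuous fun η : EuclideanSpace ℝ (Fin 6) [⋀^Fin 3]→L[ℝ] ℝ => compCLM G η :=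
    fun G => (compCLM G).continuous
  refine (hc _).continuousAt.comp (ContinuousAt.comp (g := hitchinDual) ?_ (hc _).continuousAt)
  rw [compCLM_apply, hgg']
  exact hmodel

end HitchinContinuity

/-! ### Isotopies -/

section Isotopy

variable {n : ℕ} {X : Type*} [TopologicalSpace X] [ChartedSpace (EuclideanSpace ℝ (Fin n)) X]

/-- Isotopies `φ s`, `|s| < ε`, of `X` with `φ 0 = id`. -/
structure IsIsotopy (n : ℕ) {X : Type*} [TopologicalSpace X]
    [ChartedSpace (EuclideanSpace ℝ (Fin n)) X] (ε : ℝ) (φ : ℝ → X → X) : Prop where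
  pos : 0 < ε
  smooth : ContMDiffOn (𝓘(ℝ, ℝ).prod (𝓡 n)) (𝓡 n) ∞ (fun x : ℝ × X => φ x.1 x.2)
    (Ioo (-ε) ε ×ˢ univ)
  diffeo : ∀ s ∈ Ioo (-ε) ε, ∃ D : X ≃ₘ^∞⟮𝓡 n, 𝓡 n⟯ X, ∀ x, D x = φ s x
  zero : ∀ x, φ 0 x = x

/-- The initial velocity of an isotopy. -/
def isotopyVelocity (φ : ℝ → X → X) (x : X) : EuclideanSpace ℝ (Fin n) :=
  tder 𝓘(ℝ, ℝ) (𝓡 n) (fun s => φ s x) univ 0 1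

open Classical in
/-- The map of `X` that is `g` in the chart `e` and the identity elsewhere. -/
def chartConj (e : OpenPartialHomeomorph X (EuclideanSpace ℝ (Fin n)))
    (g : EuclideanSpace ℝ (Fin n) → EuclideanSpace ℝ (Fin n)) (x : X) : X :=
  if x ∈ e.source then e.symm (g (e x)) else x

variable {e : OpenPartialHomeomorph X (EuclideanSpace ℝ (Fin n))}
  {K : Set (EuclideanSpace ℝ (Fin n))}

theorem chartConj_of_mem {g : EuclideanSpace ℝ (Fin n) → EuclideanSpace ℝ (Fin n)} {x : X}
    (hx : x ∈ e.source) : chartConj e g x = e.symm (g (e x)) := if_pos hx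

theorem chartConj_of_notMem {g : EuclideanSpace ℝ (Fin n) → EuclideanSpace ℝ (Fin n)} {x : X}
    (hx : x ∉ e.source) : chartConj e g x = x := if_neg hx

theorem chartConj_comp {g g' : EuclideanSpace ℝ (Fin n) → EuclideanSpace ℝ (Fin n)}
    (hg' : MapsTo g' e.target e.target) (x : X) :
    chartConj e g (chartConj e g' x) = chartConj e (fun y => g (g' y)) x := by
  by_cases hx : x ∈ e.source
  · have h := hg' (e.map_source hx)
    rw [chartConj_of_mem hx, chartConj_of_mem hx, chartConj_of_mem (e.map_target h),
      e.right_inv h]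
  · rw [chartConj_of_notMem hx, chartConj_of_notMem hx, chartConj_of_notMem hx]

theorem chartConj_id {g : EuclideanSpace ℝ (Fin n) → EuclideanSpace ℝ (Fin n)}
    (hg : ∀ y, g y = y) (x : X) : chartConj e g x = x := by
  by_cases hx : x ∈ e.source
  · rw [chartConj_of_mem hx, hg, e.left_inv hx]
  · rw [chartConj_of_notMem hx]

/-- The image of the compact set `K` is closed in the Hausdorff space `X`. Off this image the map is
the identity, which gives smoothness outside the chart domain. -/
theorem contMDiffOn_chartConj [T2Space X] [IsManifold (𝓡 n) ∞ X]
    (he : e ∈ atlas (EuclideanSpace ℝ (Fin n)) X) (hK : IsCompact K) (hKe : K ⊆ e.target)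
    {U : Set ℝ} {g : ℝ → EuclideanSpace ℝ (Fin n) → EuclideanSpace ℝ (Fin n)}
    (hg : ContDiff ℝ ∞ fun x : ℝ × EuclideanSpace ℝ (Fin n) => g x.1 x.2)
    (hoff : ∀ s, ∀ y ∉ K, g s y = y) (hmaps : ∀ s ∈ U, MapsTo (g s) e.target e.target) :
    ContMDiffOn (𝓘(ℝ, ℝ).prod (𝓡 n)) (𝓡 n) ∞ (fun x : ℝ × X => chartConj e (g x.1) x.2)
      (U ×ˢ univ) := by
  rintro ⟨s, x⟩ ⟨hs, -⟩
  refine ContMDiffAt.contMDiffWithinAt ?_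
  by_cases hx : x ∈ e.source
  · have h1 : ContMDiffAt (𝓘(ℝ, ℝ).prod (𝓡 n)) (𝓡 n) ∞
        (fun z : ℝ × X => e.symm (g z.1 (e z.2))) (s, x) := by
      refine ContMDiffAt.comp (s, x) (I' := 𝓡 n) (g := e.symm)
        (f := fun z : ℝ × X => g z.1 (e z.2))
        (contMDiffAt_chart_symm he (hmaps s hs (e.map_source hx))) ?_
      refine ContMDiffAt.comp (s, x) (I' := 𝓘(ℝ, ℝ × EuclideanSpace ℝ (Fin n)))
        (g := fun z : ℝ × EuclideanSpace ℝ (Fin n) => g z.1 z.2)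
        (f := fun z : ℝ × X => (z.1, e z.2)) hg.contMDiff.contMDiffAt ?_
      refine ContMDiffAt.prodMk_space contMDiffAt_fst ?_
      exact (contMDiffAt_chart he hx).comp (s, x) contMDiffAt_snd
    refine h1.congr_of_eventuallyEq ?_
    filter_upwards [(e.open_source.preimage continuous_snd).mem_nhds hx] with z hz
    exact chartConj_of_mem hz
  · refine contMDiffAt_snd.congr_of_eventuallyEq ?_
    have hc : IsClosed (e.symm '' K) :=
      (hK.image_of_continuousOn (e.continuousOn_symm.mono hKe)).isClosed
    have hxK : x ∉ e.symm '' K := by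
      rintro ⟨y, hy, rfl⟩
      exact hx (e.map_target (hKe hy))
    filter_upwards [(hc.isOpen_compl.preimage continuous_snd).mem_nhds hxK] with z hz
    by_cases hze : z.2 ∈ e.source
    · have : e z.2 ∉ K := fun h => hz ⟨e z.2, h, e.left_inv hze⟩
      rw [chartConj_of_mem hze, hoff _ _ this, e.left_inv hze]
    · exact chartConj_of_notMem hze

theorem contMDiff_chartConj [T2Space X] [IsManifold (𝓡 n) ∞ X]
    (he : e ∈ atlas (EuclideanSpace ℝ (Fin n)) X) (hK : IsCompact K) (hKe : K ⊆ e.target)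
    {g : EuclideanSpace ℝ (Fin n) → EuclideanSpace ℝ (Fin n)} (hg : ContDiff ℝ ∞ g)
    (hoff : ∀ y ∉ K, g y = y) (hmaps : MapsTo g e.target e.target) :
    ContMDiff (𝓡 n) (𝓡 n) ∞ (chartConj e g) := by
  have h := contMDiffOn_chartConj (U := univ) (g := fun _ => g) he hK hKe (hg.comp contDiff_snd)
    (fun _ => hoff) (fun _ _ => hmaps)
  rw [univ_prod_univ, contMDiffOn_univ] at h
  exact h.comp ((contMDiff_const (c := (0 : ℝ))).prodMk contMDiff_id)

/-- A small multiple of a compactly supported field is the displacement of a diffeomorphism. -/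
theorem exists_homeomorph_add {E : Type*} [NormedAddCommGroup E] [NormedSpace ℝ E]
    [CompleteSpace E] {η : E → E} (hη : ContDiff ℝ ∞ η) {c : NNReal} (hc : c < 1)
    (hL : LipschitzWith c η) :
    ∃ D : E ≃ₜ E, (∀ y, D y = y + η y) ∧ ContDiff ℝ ∞ D.symm := by
  -- A perturbation of the identity with Lipschitz constant below one is a homeomorphism of the
  -- whole space.
  have happ : ApproximatesLinearOn (fun y => y + η y)
      ((ContinuousLinearEquiv.refl ℝ E : E ≃L[ℝ] E) : E →L[ℝ] E) univ c := by
    intro x _ y _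
    have h := hL.norm_sub_le x y
    simpa [add_sub_add_comm] using h
  have hN : Subsingleton E ∨ c < ‖((ContinuousLinearEquiv.refl ℝ E).symm : E →L[ℝ] E)‖₊⁻¹ := by
    rcases subsingleton_or_nontrivial E with h | h
    · exact Or.inl h
    · refine Or.inr ?_
      have : ‖((ContinuousLinearEquiv.refl ℝ E).symm : E →L[ℝ] E)‖₊ = 1 := by
        rw [← NNReal.coe_inj]
        exact ContinuousLinearMap.norm_id
      rw [this, inv_one]
      exact hc
  refine ⟨happ.toHomeomorph _ hN, fun y => rfl, ?_⟩
  have hcd : ContDiff ℝ ∞ fun y => y + η y := contDiff_id.add hη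
  -- The derivative `id + Dη` is invertible by the Neumann series, so the inverse homeomorphism is
  -- smooth.
  have hbij : ∀ y : E, ∃ f : E ≃L[ℝ] E, HasFDerivAt (fun y => y + η y) (f : E →L[ℝ] E) y := by
    intro y
    have h1 : HasFDerivAt (fun y => y + η y) (ContinuousLinearMap.id ℝ E + fderiv ℝ η y) y :=
      (hasFDerivAt_id y).add (hη.differentiable (by simp) y).hasFDerivAt
    have h2 : ‖-fderiv ℝ η y‖ < 1 := by
      rw [norm_neg]
      exact (norm_fderiv_le_of_lipschitz ℝ hL).trans_lt (by exact_mod_cast hc)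
    refine ⟨ContinuousLinearEquiv.unitsEquiv ℝ E (Units.oneSub _ h2), ?_⟩
    refine h1.congr_fderiv ?_
    ext v
    simp [ContinuousLinearEquiv.unitsEquiv_apply, sub_eq_add_neg]
  refine contDiff_iff_contDiffAt.mpr fun y => ?_
  obtain ⟨f, hf⟩ := hbij ((happ.toHomeomorph _ hN).symm y)
  exact OpenPartialHomeomorph.contDiffAt_symm
    (happ.toHomeomorph _ hN).toOpenPartialHomeomorph (mem_univ y) hf hcd.contDiffAt

end Isotopy

/-! ### Isotopies with prescribed initial velocity. -/

section IsotopyConstructions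

variable {n : ℕ} {X : Type*} [TopologicalSpace X] [ChartedSpace (EuclideanSpace ℝ (Fin n)) X]
  [T2Space X] [IsManifold (𝓡 n) ∞ X] {e : OpenPartialHomeomorph X (EuclideanSpace ℝ (Fin n))}

theorem isotopyVelocity_eq_zero {φ : ℝ → X → X} {x : X} (h : ∀ s, φ s x = x) :
    isotopyVelocity (n := n) φ x = 0 := by
  have h1 : (fun s => φ s x) = fun _ => x := funext h
  rw [isotopyVelocity, h1, tder_univ]
  have h2 : mfderiv 𝓘(ℝ, ℝ) (𝓡 n) (fun _ : ℝ => x) 0 = 0 := mfderiv_const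
  exact congrFun (congrArg DFunLike.coe h2) 1

theorem tder_line {y ζ : EuclideanSpace ℝ (Fin n)} :
    tder 𝓘(ℝ, ℝ) (𝓡 n) (fun s : ℝ => y + s • ζ) univ 0 1 = ζ := by
  rw [tder_eq_fderivWithin, fderivWithin_univ]
  have h : HasDerivAt (fun s : ℝ => y + s • ζ) ((1 : ℝ) • ζ) 0 :=
    ((hasDerivAt_id (0 : ℝ)).smul_const ζ).const_add y
  rw [h.hasFDerivAt.fderiv]
  simp

/-- A compactly supported vector field in a chart is the velocity of an isotopy. -/
theorem exists_isotopy_chart (he : e ∈ atlas (EuclideanSpace ℝ (Fin n)) X)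
    {ζ : EuclideanSpace ℝ (Fin n) → EuclideanSpace ℝ (Fin n)} (hζ : ContDiff ℝ ∞ ζ)
    (hc : HasCompactSupport ζ) (hsub : tsupport ζ ⊆ e.target) :
    ∃ ε φ, IsIsotopy n (X := X) ε φ ∧
      (∀ x ∈ e.source, isotopyVelocity φ x = tder (𝓡 n) (𝓡 n) e.symm univ (e x) (ζ (e x))) ∧
      ∀ x ∉ e.source, isotopyVelocity (n := n) φ x = 0 := by
  obtain ⟨C, hC⟩ := hζ.lipschitzWith_of_hasCompactSupport hc (by simp)
  have hoff : ∀ (s : ℝ), ∀ y ∉ tsupport ζ, y + s • ζ y = y := fun s y hy => by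
    rw [image_eq_zero_of_notMem_tsupport hy, smul_zero, add_zero]
  -- For these `s` the Lipschitz constant `|s| C` of the displacement is below one. The summand `1`
  -- covers the case `C = 0`.
  have hdiffeo : ∀ s ∈ Ioo (-(C + 1 : ℝ)⁻¹) (C + 1 : ℝ)⁻¹,
      ∃ D : EuclideanSpace ℝ (Fin n) ≃ₜ EuclideanSpace ℝ (Fin n), (∀ y, D y = y + s • ζ y) ∧
        ContDiff ℝ ∞ D.symm := by
    intro s hs
    have h1 : ‖s‖₊ * C < 1 := by
      rw [← NNReal.coe_lt_coe]
      have h2 : |s| < (C + 1 : ℝ)⁻¹ := abs_lt.mpr hs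
      have hC0 : (0 : ℝ) ≤ C := C.2
      have h3 : |s| * (C + 1) < 1 := by
        rwa [← one_div, lt_div_iff₀ (by positivity)] at h2
      simp only [NNReal.coe_mul, coe_nnnorm, Real.norm_eq_abs, NNReal.coe_one]
      nlinarith [abs_nonneg s]
    exact exists_homeomorph_add (η := s • ζ) (hζ.const_smul s) h1
      ((lipschitzWith_smul s).comp hC)
  choose! D hD hDs using hdiffeo
  -- Points off the support are fixed, so by injectivity no point of the support can leave it. Hence
  -- the diffeomorphisms and their inverses preserve the chart target.
  have hmem : ∀ s ∈ Ioo (-(C + 1 : ℝ)⁻¹) (C + 1 : ℝ)⁻¹, ∀ y, y ∈ tsupport ζ ↔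
      y + s • ζ y ∈ tsupport ζ := by
    intro s hs y
    constructor
    · intro hy
      by_contra h
      have h1 : D s (y + s • ζ y) = D s y := by
        rw [hD s hs, hD s hs, hoff s _ h]
      have h2 := (D s).injective h1
      rw [h2] at h
      exact h hy
    · intro hy
      by_contra h
      rw [hoff s y h] at hy
      exact h hy
  have hmaps : ∀ s ∈ Ioo (-(C + 1 : ℝ)⁻¹) (C + 1 : ℝ)⁻¹,
      MapsTo (fun y => y + s • ζ y) e.target e.target := by
    intro s hs y hy
    by_cases h : y ∈ tsupport ζ
    · exact hsub ((hmem s hs y).mp h)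
    · show y + s • ζ y ∈ e.target
      rw [hoff s y h]
      exact hy
  have hoff' : ∀ s (hs : s ∈ Ioo (-(C + 1 : ℝ)⁻¹) (C + 1 : ℝ)⁻¹), ∀ y ∉ tsupport ζ,
      (D s).symm y = y := fun s hs y hy => by
    rw [Homeomorph.symm_apply_eq, hD s hs, hoff s y hy]
  have hmaps' : ∀ s (hs : s ∈ Ioo (-(C + 1 : ℝ)⁻¹) (C + 1 : ℝ)⁻¹),
      MapsTo (D s).symm e.target e.target := by
    intro s hs y hy
    by_cases h : y ∈ tsupport ζ
    · refine hsub ((hmem s hs _).mpr ?_)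
      rw [← hD s hs, Homeomorph.apply_symm_apply]
      exact h
    · rw [hoff' s hs y h]
      exact hy
  have hsm : ContDiff ℝ ∞ fun x : ℝ × EuclideanSpace ℝ (Fin n) => x.2 + x.1 • ζ x.2 :=
    contDiff_snd.add (contDiff_fst.smul (hζ.comp contDiff_snd))
  have hzero : (0 : ℝ) ∈ Ioo (-(C + 1 : ℝ)⁻¹) (C + 1 : ℝ)⁻¹ := by
    have : (0 : ℝ) < (C + 1 : ℝ)⁻¹ := by positivity
    exact ⟨neg_lt_zero.mpr this, this⟩
  refine ⟨(C + 1 : ℝ)⁻¹, fun s => chartConj e fun y => y + s • ζ y,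
    ⟨hzero.2, ?_, ?_, ?_⟩, ?_, ?_⟩
  · exact contMDiffOn_chartConj he hc hsub hsm hoff hmaps
  · intro s hs
    refine ⟨⟨⟨chartConj e fun y => y + s • ζ y, chartConj e (D s).symm, fun x => ?_,
      fun x => ?_⟩, ?_, ?_⟩, fun x => rfl⟩
    · rw [chartConj_comp (hmaps s hs)]
      refine chartConj_id (fun y => ?_) x
      rw [← hD s hs, Homeomorph.symm_apply_apply]
    · rw [chartConj_comp (hmaps' s hs)]
      refine chartConj_id (fun y => ?_) x
      rw [← hD s hs, Homeomorph.apply_symm_apply]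
    · exact contMDiff_chartConj he hc hsub (hsm.comp (contDiff_const.prodMk contDiff_id))
        (hoff s) (hmaps s hs)
    · exact contMDiff_chartConj he hc hsub (hDs s hs) (hoff' s hs) (hmaps' s hs)
  · intro x
    exact chartConj_id (fun y => by rw [zero_smul, add_zero]) x
  · intro x hx
    have h1 : (fun s : ℝ => chartConj e (fun y => y + s • ζ y) x) =
        fun s => e.symm (e x + s • ζ (e x)) := funext fun s => chartConj_of_mem hx
    rw [isotopyVelocity, h1, tder_comp (J := 𝓡 n) (g := e.symm)
      (f := fun s : ℝ => e x + s • ζ (e x)) (t := univ) ?_ ?_ (mapsTo_univ _ _)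
      (uniqueMDiffWithinAt_univ _), ContinuousLinearMap.comp_apply, tder_line, zero_smul, add_zero]
    · refine (mdifferentiableAt_chart_symm he ?_).mdifferentiableWithinAt
      rw [zero_smul, add_zero]
      exact e.map_source hx
    · refine DifferentiableWithinAt.mdifferentiableWithinAt ?_
      fun_prop
  · intro x hx
    exact isotopyVelocity_eq_zero fun s => chartConj_of_notMem hx

theorem IsIsotopy.mono {ε δ : ℝ} {φ : ℝ → X → X} (h : IsIsotopy n ε φ) (hδ : 0 < δ) (hle : δ ≤ ε) :
    IsIsotopy n δ φ where
  pos := hδ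
  smooth := h.smooth.mono (prod_mono (Ioo_subset_Ioo (neg_le_neg hle) hle) Subset.rfl)
  diffeo s hs := h.diffeo s (Ioo_subset_Ioo (neg_le_neg hle) hle hs)
  zero := h.zero

theorem IsIsotopy.contMDiffAt {ε : ℝ} {φ : ℝ → X → X} (h : IsIsotopy n ε φ) {s : ℝ}
    (hs : s ∈ Ioo (-ε) ε) (x : X) :
    ContMDiffAt (𝓘(ℝ, ℝ).prod (𝓡 n)) (𝓡 n) ∞ (fun z : ℝ × X => φ z.1 z.2) (s, x) :=
  (h.smooth (s, x) ⟨hs, mem_univ _⟩).contMDiffAt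
    ((isOpen_Ioo.prod isOpen_univ).mem_nhds ⟨hs, mem_univ _⟩)

theorem IsIsotopy.zero_mem {ε : ℝ} {φ : ℝ → X → X} (h : IsIsotopy n ε φ) :
    (0 : ℝ) ∈ Ioo (-ε) ε := ⟨neg_lt_zero.mpr h.pos, h.pos⟩

/-- The derivative of an isotopy along a curve. -/
theorem IsIsotopy.tder_comp_curve {ε : ℝ} {φ : ℝ → X → X} (h : IsIsotopy n ε φ) {c : ℝ → X}
    (hc : MDifferentiableAt 𝓘(ℝ, ℝ) (𝓡 n) c 0) :
    tder 𝓘(ℝ, ℝ) (𝓡 n) (fun s => φ s (c s)) univ 0 1 =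
      isotopyVelocity φ (c 0) + tder 𝓘(ℝ, ℝ) (𝓡 n) c univ 0 1 := by
  have hφ := (h.contMDiffAt h.zero_mem (c 0)).mdifferentiableAt (by simp)
  have hu : (Ioo (-ε) ε ∈ nhds (0 : ℝ)) := isOpen_Ioo.mem_nhds h.zero_mem
  have h0 : UniqueMDiffWithinAt 𝓘(ℝ, ℝ) (univ : Set ℝ) 0 := uniqueMDiffWithinAt_univ _
  -- The derivative along any curve `(a s, q s)` through `(0, c 0)` is one linear map applied to
  -- `(a', q')`. Moving both factors, only the time, or only the point yields the sum of the two
  -- partial derivatives.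
  have key : ∀ q : ℝ → X, MDifferentiableAt 𝓘(ℝ, ℝ) (𝓡 n) q 0 → q 0 = c 0 →
      ∀ a : ℝ → ℝ, DifferentiableAt ℝ a 0 → a 0 = 0 →
      tder 𝓘(ℝ, ℝ) (𝓡 n) (fun s => φ (a s) (q s)) univ 0 1 =
        (tder (𝓘(ℝ, ℝ).prod (𝓡 n)) (𝓡 n) (fun z : ℝ × X => φ z.1 z.2) univ (0, c 0) :
          ℝ × EuclideanSpace ℝ (Fin n) →L[ℝ] EuclideanSpace ℝ (Fin n))
          (deriv a 0, tder 𝓘(ℝ, ℝ) (𝓡 n) q univ 0 1) := by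
    intro q hq hq0 a ha ha0
    have h1 : HasMFDerivWithinAt 𝓘(ℝ, ℝ) (𝓘(ℝ, ℝ).prod (𝓡 n)) (fun s => (a s, q s)) univ 0
        ((tder 𝓘(ℝ, ℝ) 𝓘(ℝ, ℝ) a univ 0).prod (tder 𝓘(ℝ, ℝ) (𝓡 n) q univ 0)) :=
      HasMFDerivWithinAt.prodMk
        ha.mdifferentiableAt.mdifferentiableWithinAt.hasMFDerivWithinAt
        hq.mdifferentiableWithinAt.hasMFDerivWithinAt
    have hφ' : MDifferentiableWithinAt (𝓘(ℝ, ℝ).prod (𝓡 n)) (𝓡 n)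
        (fun z : ℝ × X => φ z.1 z.2) univ ((fun s => (a s, q s)) 0) := by
      rw [mdifferentiableWithinAt_univ]
      simp only [ha0, hq0]
      exact hφ
    have h2 := tder_comp (f := fun s => (a s, q s)) hφ' h1.mdifferentiableWithinAt
      (mapsTo_univ _ _) h0
    have h3 : tder 𝓘(ℝ, ℝ) (𝓘(ℝ, ℝ).prod (𝓡 n)) (fun s => (a s, q s)) univ 0 =
        (tder 𝓘(ℝ, ℝ) 𝓘(ℝ, ℝ) a univ 0).prod (tder 𝓘(ℝ, ℝ) (𝓡 n) q univ 0) :=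
      h1.mfderivWithin h0
    refine (congrFun (congrArg DFunLike.coe h2) 1).trans ?_
    rw [h3, ContinuousLinearMap.comp_apply]
    simp only [ha0, hq0]
    rw [tder_eq_fderivWithin (f := a), fderivWithin_univ]
    rfl
  have k1 := key c hc rfl (fun s => s) differentiableAt_id rfl
  have k2 := key (fun _ => c 0) mdifferentiableAt_const rfl (fun s => s) differentiableAt_id rfl
  have k3 := key c hc rfl (fun _ => 0) (differentiableAt_const _) rfl
  have h4 : tder 𝓘(ℝ, ℝ) (𝓡 n) (fun _ : ℝ => c 0) univ 0 1 = 0 := by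
    rw [tder_univ]
    have h2 : mfderiv 𝓘(ℝ, ℝ) (𝓡 n) (fun _ : ℝ => c 0) 0 = 0 := mfderiv_const
    exact congrFun (congrArg DFunLike.coe h2) 1
  have h5 : (fun s => φ 0 (c s)) = c := funext fun s => h.zero (c s)
  rw [h5] at k3
  rw [k1, isotopyVelocity, k2, h4]
  nth_rewrite 2 [k3]
  rw [← map_add]
  congr 1
  simp

theorem IsIsotopy.comp {ε : ℝ} {φ ψ : ℝ → X → X} (h : IsIsotopy n ε φ) (h' : IsIsotopy n ε ψ) :
    IsIsotopy n ε (fun s x => φ s (ψ s x)) ∧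
      ∀ x, isotopyVelocity (n := n) (fun s x => φ s (ψ s x)) x =
        isotopyVelocity φ x + isotopyVelocity ψ x := by
  refine ⟨⟨h.pos, ?_, fun s hs => ?_, fun x => ?_⟩, fun x => ?_⟩
  · exact h.smooth.comp (contMDiffOn_fst.prodMk h'.smooth) fun z hz => ⟨hz.1, mem_univ _⟩
  · obtain ⟨D, hD⟩ := h.diffeo s hs
    obtain ⟨D', hD'⟩ := h'.diffeo s hs
    refine ⟨D'.trans D, fun x => ?_⟩
    rw [Diffeomorph.coe_trans, comp_apply, hD', hD]
  · rw [h'.zero, h.zero]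
  · have h1 := h.tder_comp_curve (c := fun s => ψ s x) (ContMDiffAt.mdifferentiableAt (n := ∞)
      ((h'.contMDiffAt h'.zero_mem x).comp (0 : ℝ)
        (f := fun s : ℝ => (s, x)) (contMDiffAt_id.prodMk contMDiffAt_const)) (by simp))
    rw [isotopyVelocity, h1, h'.zero]
    rfl

/-- Finite sums of velocities of isotopies are velocities of isotopies. -/
theorem exists_isotopy_sum {ι : Type*} (s : Finset ι) (v : ι → X → EuclideanSpace ℝ (Fin n))
    (hv : ∀ i ∈ s, ∃ ε φ, IsIsotopy n (X := X) ε φ ∧ ∀ x, isotopyVelocity φ x = v i x) :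
    ∃ ε φ, IsIsotopy n (X := X) ε φ ∧ ∀ x, isotopyVelocity φ x = ∑ i ∈ s, v i x := by
  classical
  induction s using Finset.induction_on with
  | empty =>
    refine ⟨1, fun _ x => x, ⟨one_pos, contMDiffOn_snd,
      fun s _ => ⟨Diffeomorph.refl _ _ _, fun x => rfl⟩, fun x => rfl⟩, fun x => ?_⟩
    rw [isotopyVelocity_eq_zero fun _ => rfl, Finset.sum_empty]
  | insert i s hi ih =>
    obtain ⟨ε, φ, hφ, hvφ⟩ := ih fun j hj => hv j (Finset.mem_insert_of_mem hj)
    obtain ⟨δ, ψ, hψ, hvψ⟩ := hv i (Finset.mem_insert_self i s)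
    have hm : 0 < min δ ε := lt_min hψ.pos hφ.pos
    obtain ⟨h1, h2⟩ := (hψ.mono hm (min_le_left _ _)).comp (hφ.mono hm (min_le_right _ _))
    refine ⟨min δ ε, _, h1, fun x => ?_⟩
    rw [h2, hvψ, hvφ, Finset.sum_insert hi]

end IsotopyConstructions

/-! ### Variations induced by isotopies -/

section Immersion

variable {n m : ℕ} {P M : Type*} [TopologicalSpace P] [ChartedSpace (EuclideanSpace ℝ (Fin n)) P]
  [TopologicalSpace M] [ChartedSpace (EuclideanSpace ℝ (Fin m)) M] [IsManifold (𝓡 m) ∞ M]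

/-- Composing the target chart with the inverse diffeomorphism leaves the local normal form of the
immersion unchanged. -/
theorem isSmoothEmbedding_diffeomorph_comp {ι : P → M} (h : IsSmoothEmbedding (𝓡 n) (𝓡 m) ∞ ι)
    (D : M ≃ₘ^∞⟮𝓡 m, 𝓡 m⟯ M) : IsSmoothEmbedding (𝓡 n) (𝓡 m) ∞ (fun p => D (ι p)) := by
  refine ⟨?_, D.toHomeomorph.isEmbedding.comp h.isEmbedding⟩
  obtain ⟨F, hF1, hF2, hι⟩ := h.isImmersion
  refine ⟨F, hF1, hF2, fun p => ?_⟩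
  have hp := hι p
  let c : OpenPartialHomeomorph M (EuclideanSpace ℝ (Fin m)) :=
    D.toHomeomorph.symm.toOpenPartialHomeomorph ≫ₕ hp.codChart
  have hcs : c.source = D.symm ⁻¹' hp.codChart.source := by
    simp only [c, OpenPartialHomeomorph.trans_source]
    exact univ_inter _
  have hct : c.target ⊆ hp.codChart.target := by
    simp only [c, OpenPartialHomeomorph.trans_target]
    exact inter_subset_left
  refine IsImmersionAtOfComplement.mk_of_charts hp.equiv hp.domChart c hp.mem_domChart_source ?_
    hp.domChart_mem_maximalAtlas ?_ ?_ ?_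
  · rw [hcs, mem_preimage, Diffeomorph.symm_apply_apply]
    exact hp.mem_codChart_source
  · refine OpenPartialHomeomorph.mem_maximalAtlas_of_contMDiffOn c ?_ ?_
    · rw [hcs]
      exact (contMDiffOn_of_mem_maximalAtlas hp.codChart_mem_maximalAtlas).comp
        D.symm.contMDiff.contMDiffOn fun x hx => hx
    · exact D.contMDiff.comp_contMDiffOn
        ((contMDiffOn_symm_of_mem_maximalAtlas hp.codChart_mem_maximalAtlas).mono hct)
  · intro q hq
    rw [hcs, mem_preimage, mem_preimage, Diffeomorph.symm_apply_apply]
    exact hp.source_subset_preimage_source hq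
  · intro y hy
    have h1 := hp.writtenInCharts hy
    have h2 : c (D (ι (hp.domChart.symm y))) = hp.codChart (ι (hp.domChart.symm y)) :=
      congrArg hp.codChart (D.symm_apply_apply _)
    exact h2.trans h1

end Immersion

/-! ### Continuity of pullbacks and of the dual form. -/

section Continuity

variable {E : Type*} [NormedAddCommGroup E] [NormedSpace ℝ E] {m k : ℕ} {M : Type*}
  [TopologicalSpace M] [ChartedSpace (EuclideanSpace ℝ (Fin m)) M] [IsManifold (𝓡 m) ∞ M]

/-- The counterpart of `contDiffOn_pullE` for continuous forms, needed for `hitchinForm`, for which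
only continuity is established. -/
theorem continuousOn_pullE [FiniteDimensional ℝ E] {α : Form m M k} (hα : IsContForm α) {ψ : E → M}
    {S : Set E} (hS : UniqueDiffOn ℝ S) (hψ : ContMDiffOn 𝓘(ℝ, E) (𝓡 m) ∞ ψ S) :
    ContinuousOn (pullE α ψ S) S := by
  intro x hx
  have he := chart_mem_atlas (EuclideanSpace ℝ (Fin m)) (ψ x)
  have hxe := mem_chart_source (EuclideanSpace ℝ (Fin m)) (ψ x)
  let e := chartAt (EuclideanSpace ℝ (Fin m)) (ψ x)
  let T := S ∩ ψ ⁻¹' e.source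
  have hT : T ∈ nhdsWithin x S := by
    filter_upwards [(hψ x hx).continuousWithinAt (e.open_source.mem_nhds hxe), self_mem_nhdsWithin]
      with y hy hyS using ⟨hyS, hy⟩
  have hF : ContDiffOn ℝ ∞ (fun y => e (ψ y)) T := fun y hy =>
    (contDiffWithinAt_chart_comp (hψ y hy.1) he hy.2).mono inter_subset_left
  have h1 : ContinuousOn (fun y => chartRep α e (e (ψ y))) T :=
    (hα e he).comp hF.continuousOn fun y hy => e.map_source hy.2
  have h2 : ContinuousOn (fderivWithin ℝ (fun y => e (ψ y)) S) T := fun y hy =>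
    ((contDiffWithinAt_chart_comp (hψ y hy.1) he hy.2).fderivWithin_right (m := ∞) hS (by simp)
      hy.1).continuousWithinAt.mono inter_subset_left
  have h3 : ContinuousOn (fun y => (chartRep α e (e (ψ y))).compContinuousLinearMap
      (fderivWithin ℝ (fun y => e (ψ y)) S y)) T := by
    rw [← contDiffOn_zero (𝕜 := ℝ)] at h1 h2 ⊢
    exact fun y hy => contDiffWithinAt_alternating_comp (h1 y hy) (h2 y hy)
  have h4 : ContinuousOn (pullE α ψ S) T := h3.congr fun y hy => pullE_eq_chart hS hψ hy.1 he hy.2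
  exact (h4 x ⟨hx, hxe⟩).mono_of_mem_nhdsWithin hT

end Continuity

section Hitchin

variable {M : Type*} [TopologicalSpace M] [ChartedSpace (EuclideanSpace ℝ (Fin 6)) M]

/-- The pointwise Hitchin dual of a form. -/
def hitchinForm (ρ : Form 6 M 3) : Form 6 M 3 := fun x => hitchinDual (ρ.val x)

/-- Inverse charts preserve the orientation, so by equivariance the coordinate representation of the
dual is the dual of the coordinate representation. -/
theorem isContForm_hitchinForm [IsManifold (𝓡 6) ∞ M] (hM : IsOrientedAtlas 6 M) {ρ : Form 6 M 3}
    (hρ : IsSmoothForm ρ) (hρ_pos : ∀ x, IsPositive (ρ x)) : IsContForm (hitchinForm ρ) := by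
  intro e he
  have hpos : ∀ y ∈ e.target, IsPositive (chartRep ρ e y) := fun y hy => by
    rw [chartRep_eq]
    exact (hρ_pos _).comp (tder_chart_symm_det_pos hM he hy)
  have h1 : ContinuousOn (fun y => hitchinDual (chartRep ρ e y)) e.target := fun y hy =>
    (continuousAt_hitchinDual (hpos y hy)).comp_continuousWithinAt ((hρ e he).continuousOn y hy)
  refine h1.congr fun y hy => ?_
  simp only [chartRep_eq]
  exact (hitchinDual_comp (hρ_pos (e.symm y)) (tder_chart_symm_det_pos hM he hy)).symm

end Hitchin

section Homology

theorem H3_map_eq_of_homotopy {X Y : Type u} [TopologicalSpace X] [TopologicalSpace Y]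
    {f g : C(X, Y)} (h : ContinuousMap.Homotopy f g) (κ : H3 X) : H3.map f κ = H3.map g κ := by
  have h1 := TopCat.Homotopy.congr_homologyMap_singularChainComplexFunctor
    (f := TopCat.ofHom f) (g := TopCat.ofHom g) h (ModuleCat.of ℤ (ULift.{u} ℤ)) 3
  exact congrArg (fun q => q.hom κ) h1

end Homology

/-! ### Openness of the positivity condition and variations by isotopies. -/

section Positivity

variable {P M : Type u}
  [TopologicalSpace P] [ChartedSpace (EuclideanSpace ℝ (Fin 3)) P] [IsManifold (𝓡 3) ∞ P]
  [TopologicalSpace M] [ChartedSpace (EuclideanSpace ℝ (Fin 6)) M] [IsManifold (𝓡 6) ∞ M]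

/-- A top-degree form scales by the determinant of the frame, so one positive frame decides. -/
theorem positive_iff (σ : Form 6 M 3) (ι : P → M) (p : P) :
    (∀ v : Fin 3 → EuclideanSpace ℝ (Fin 3), 0 < frameDet v →
      0 < (pullbackForm ι σ : Form 3 P 3).val p v) ↔
    0 < (pullbackForm ι σ : Form 3 P 3).val p (EuclideanSpace.basisFun (Fin 3) ℝ) := by
  constructor
  · intro h
    refine h _ ?_
    rw [frameDet_basisFun]
    exact one_pos
  · intro h v hv
    rw [topForm_apply]
    exact mul_pos hv h

/-- Positivity on a compact family of maps persists for nearby parameters. -/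
theorem exists_positive_nhds [CompactSpace P] (hP : IsOrientedAtlas 3 P) {σ : Form 6 M 3}
    (hσ : IsContForm σ) {G : (ℝ × ℝ) × P → M} {ε : ℝ} (hε : 0 < ε)
    (hG : ContMDiffOn (𝓘(ℝ, ℝ × ℝ).prod (𝓡 3)) (𝓡 6) ∞ G (paramSquare ε ×ˢ univ))
    (hpos : ∀ t ∈ Icc (0 : ℝ) 1, ∀ p, 0 < (pullbackForm (fun q => G ((0, t), q)) σ : Form 3 P 3).val p
      (EuclideanSpace.basisFun (Fin 3) ℝ)) :
    ∃ δ, 0 < δ ∧ δ ≤ ε ∧ ∀ s ∈ Ioo (-δ) δ, ∀ t ∈ Icc (0 : ℝ) 1, ∀ p,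
      0 < (pullbackForm (fun q => G ((s, t), q)) σ : Form 3 P 3).val p
        (EuclideanSpace.basisFun (Fin 3) ℝ) := by
  have hrep : ∀ e ∈ atlas (EuclideanSpace ℝ (Fin 3)) P, ∀ z ∈ e.target, ∀ η : Form 3 P 3,
      (0 < chartRep η e z (EuclideanSpace.basisFun (Fin 3) ℝ) ↔
        0 < η.val (e.symm z) (EuclideanSpace.basisFun (Fin 3) ℝ)) := by
    intro e he z hz η
    rw [chartRep_eq, topForm_comp, ContinuousAlternatingMap.smul_apply, smul_eq_mul,
      mul_pos_iff_of_pos_left (tder_chart_symm_det_pos hP he hz)]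
  have h0 : (0 : ℝ) ∈ Ioo (-ε) ε := ⟨neg_lt_zero.mpr hε, hε⟩
  -- Continuity gives a time bound valid on a neighbourhood of each point of `[0,1] × P`, and
  -- compactness then gives a uniform one.
  have hloc : ∀ x ∈ Icc (0 : ℝ) 1 ×ˢ (univ : Set P), ∃ N ∈ nhdsWithin x (Icc (0 : ℝ) 1 ×ˢ univ),
      ∃ δ, 0 < δ ∧ δ ≤ ε ∧ ∀ s ∈ Ioo (-δ) δ, ∀ y ∈ N,
        y.1 ∈ Icc (0 : ℝ) 1 → 0 < (pullbackForm (fun q => G ((s, y.1), q)) σ : Form 3 P 3).val y.2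
          (EuclideanSpace.basisFun (Fin 3) ℝ) := by
    rintro ⟨t₀, p₀⟩ ⟨ht₀, -⟩
    let e := chartAt (EuclideanSpace ℝ (Fin 3)) p₀
    have he : e ∈ atlas (EuclideanSpace ℝ (Fin 3)) P := chart_mem_atlas _ p₀
    have hp₀ : p₀ ∈ e.source := mem_chart_source _ p₀
    have hc : ContinuousOn (fun x => restr (pullE σ (famChart G e) (paramSquare ε ×ˢ e.target) x)
        (EuclideanSpace.basisFun (Fin 3) ℝ)) (paramSquare ε ×ˢ e.target) := by
      have h1 := continuousOn_pullE hσ ((uniqueDiffOn_paramSquare ε).prod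
        e.open_target.uniqueDiffOn) (contMDiffOn_famChart hG he)
      exact continuousOn_alternating_apply
        ((compCLM (ContinuousLinearMap.inr ℝ (ℝ × ℝ) (EuclideanSpace ℝ (Fin 3)))).continuous.comp_continuousOn
          h1) _
    have hmem : (((0, t₀), e p₀) : (ℝ × ℝ) × EuclideanSpace ℝ (Fin 3)) ∈
        paramSquare ε ×ˢ e.target := ⟨⟨h0, ht₀⟩, e.map_source hp₀⟩
    have hval : ∀ u ∈ paramSquare ε, ∀ z ∈ e.target,
        (0 < restr (pullE σ (famChart G e) (paramSquare ε ×ˢ e.target) (u, z))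
          (EuclideanSpace.basisFun (Fin 3) ℝ) ↔
        0 < (pullbackForm (fun q => G (u, q)) σ : Form 3 P 3).val (e.symm z)
          (EuclideanSpace.basisFun (Fin 3) ℝ)) := fun u hu z hz => by
      rw [← chartRep_pullback_fam (uniqueDiffOn_paramSquare ε) hG he σ hu hz]
      exact hrep e he z hz _
    have hpos0 := (hval (0, t₀) hmem.1 (e p₀) hmem.2).mpr (hpos t₀ ht₀ _)
    have hev := (hc _ hmem).eventually (lt_mem_nhds hpos0)
    rw [nhdsWithin_prod_eq] at hev
    obtain ⟨A, hA, B, hB, hAB⟩ := Filter.eventually_prod_iff.mp hev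
    have hA' : ∀ᶠ u in nhdsWithin (0 : ℝ) (Ioo (-ε) ε) ×ˢ nhdsWithin t₀ (Icc (0 : ℝ) 1), A u := by
      rw [← nhdsWithin_prod_eq]
      exact hA
    obtain ⟨A₁, hA₁, A₂, hA₂, hA12⟩ := Filter.eventually_prod_iff.mp hA'
    rw [isOpen_Ioo.nhdsWithin_eq h0] at hA₁
    rw [e.open_target.nhdsWithin_eq (e.map_source hp₀)] at hB
    obtain ⟨δ, hδ, hδA⟩ := Metric.eventually_nhds_iff.mp hA₁
    refine ⟨{y | A₂ y.1 ∧ B (e y.2) ∧ y.2 ∈ e.source}, ?_, min δ ε, lt_min hδ hε,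
      min_le_right _ _, ?_⟩
    · have hBs : ∀ᶠ q in nhdsWithin p₀ univ, B (e q) ∧ q ∈ e.source := by
        rw [nhdsWithin_univ]
        exact ((e.continuousAt hp₀).eventually hB).and (e.open_source.mem_nhds hp₀)
      rw [nhdsWithin_prod_eq]
      exact hA₂.prod_mk hBs
    · rintro s hs ⟨t, p⟩ ⟨h1, h2, h3⟩ ht
      have hs1 : A₁ s := hδA (by
        rw [Real.dist_0_eq_abs]
        exact (abs_lt.mpr hs).trans_le (min_le_left _ _))
      have hs2 : s ∈ Ioo (-ε) ε := abs_lt.mp ((abs_lt.mpr hs).trans_le (min_le_right _ _))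
      have h4 := (hval (s, t) ⟨hs2, ht⟩ (e p) (e.map_source h3)).mp (hAB (hA12 hs1 h1) h2)
      rwa [e.left_inv h3] at h4
  have hcpt : IsCompact (Icc (0 : ℝ) 1 ×ˢ (univ : Set P)) := isCompact_Icc.prod isCompact_univ
  obtain ⟨δ, hδ, hδε, h⟩ := hcpt.induction_on (p := fun S : Set (ℝ × P) => ∃ δ, 0 < δ ∧ δ ≤ ε ∧
      ∀ s ∈ Ioo (-δ) δ, ∀ y ∈ S, y.1 ∈ Icc (0 : ℝ) 1 →
        0 < (pullbackForm (fun q => G ((s, y.1), q)) σ : Form 3 P 3).val y.2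
          (EuclideanSpace.basisFun (Fin 3) ℝ))
    ⟨ε, hε, le_rfl, fun _ _ _ hy => absurd hy (notMem_empty _)⟩
    (fun S T hST ⟨δ, h1, h2, h3⟩ => ⟨δ, h1, h2, fun s hs y hy => h3 s hs y (hST hy)⟩)
    (fun S T ⟨δ, h1, h2, h3⟩ ⟨δ', h1', h2', h3'⟩ => ⟨min δ δ', lt_min h1 h1',
      (min_le_left _ _).trans h2, fun s hs y hy => by
        rcases hy with hy | hy
        · exact h3 s (abs_lt.mp ((abs_lt.mpr hs).trans_le (min_le_left _ _))) y hy
        · exact h3' s (abs_lt.mp ((abs_lt.mpr hs).trans_le (min_le_right _ _))) y hy⟩)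
    hloc
  exact ⟨δ, hδ, hδε, fun s hs t ht p => h s hs (t, p) ⟨ht, mem_univ _⟩ ht⟩

variable [CompactSpace P] {ρ : Form 6 M 3} {κ : H3 P} {A : H3 M} {ι₀ : P → M} {Φ : ℝ → P → M}

/-- An isotopy of the ambient manifold deforms paths of submanifolds. -/
theorem IsPath.exists_isVariation (hP : IsOrientedAtlas 3 P) (hM : IsOrientedAtlas 6 M)
    (hρ : IsSmoothForm ρ) (hρ_pos : ∀ x, IsPositive (ρ x)) (hΦ : IsPath ρ κ A ι₀ Φ) {ε : ℝ}
    {φ : ℝ → M → M} (hφ : IsIsotopy 6 ε φ) :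
    ∃ δ Ψ, IsVariation ρ κ A ι₀ Φ δ Ψ ∧ velocity Ψ = fun p => isotopyVelocity φ (Φ 1 p) := by
  have hst : ∀ s ∈ Ioo (-ε) ε, ∀ t ∈ Icc (0 : ℝ) 1, s * t ∈ Ioo (-ε) ε := fun s hs t ht => by
    have h1 : |s| < ε := abs_lt.mpr hs
    have h2 : |s * t| ≤ |s| := by
      rw [abs_mul, abs_of_nonneg ht.1]
      exact mul_le_of_le_one_right (abs_nonneg _) ht.2
    exact abs_lt.mp (h2.trans_lt h1)
  -- The factor `t` in the isotopy time fixes the starting embedding, while the endpoint moves with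
  -- the full isotopy.
  let Ψ : ℝ → ℝ → P → M := fun s t p => φ (s * t) (Φ t p)
  have hsmooth : ContMDiffOn ((𝓘(ℝ, ℝ).prod 𝓘(ℝ, ℝ)).prod (𝓡 3)) (𝓡 6) ∞
      (fun x : (ℝ × ℝ) × P => Ψ x.1.1 x.1.2 x.2) ((Ioo (-ε) ε ×ˢ Icc (0 : ℝ) 1) ×ˢ univ) := by
    have h1 : ContMDiff ((𝓘(ℝ, ℝ).prod 𝓘(ℝ, ℝ)).prod (𝓡 3)) (𝓘(ℝ, ℝ).prod (𝓡 3)) ∞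
        (fun x : (ℝ × ℝ) × P => (x.1.2, x.2)) :=
      (contMDiff_snd.comp contMDiff_fst).prodMk contMDiff_snd
    have h2 := hΦ.smooth.comp (h1.contMDiffOn (s := (Ioo (-ε) ε ×ˢ Icc (0 : ℝ) 1) ×ˢ univ))
      fun x hx => ⟨hx.1.2, mem_univ _⟩
    have h3 : ContMDiff ((𝓘(ℝ, ℝ).prod 𝓘(ℝ, ℝ)).prod (𝓡 3)) 𝓘(ℝ, ℝ) ∞
        (fun x : (ℝ × ℝ) × P => x.1.1 * x.1.2) :=
      (contMDiff_fst.comp contMDiff_fst).mul (contMDiff_snd.comp contMDiff_fst)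
    exact hφ.smooth.comp (h3.contMDiffOn.prodMk h2)
      fun x hx => ⟨hst _ hx.1.1 _ hx.1.2, mem_univ _⟩
  have hmem : ∀ t ∈ Icc (0 : ℝ) 1, ∀ p, 0 < (pullbackForm (fun q => totalMap Ψ ((0, t), q))
      (hitchinForm ρ) : Form 3 P 3).val p (EuclideanSpace.basisFun (Fin 3) ℝ) := by
    intro t ht p
    have h1 : (fun q => totalMap Ψ ((0, t), q)) = Φ t := by
      funext q
      show φ (0 * t) (Φ t q) = Φ t q
      rw [zero_mul, hφ.zero]
    rw [h1]
    exact (positive_iff _ _ _).mp ((hΦ.mem t ht).positive p)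
  -- Positivity is the only condition that may fail for large `s`, so the time interval is
  -- shortened.
  obtain ⟨δ, hδ, hδε, hpos⟩ := exists_positive_nhds hP (isContForm_hitchinForm hM hρ hρ_pos) hφ.pos
    (contMDiffOn_totalMap hsmooth) hmem
  have hsub : Ioo (-δ) δ ⊆ Ioo (-ε) ε := Ioo_subset_Ioo (neg_le_neg hδε) hδε
  refine ⟨δ, Ψ, ⟨hδ, hsmooth.mono (prod_mono (prod_mono hsub Subset.rfl) Subset.rfl),
    fun s hs => ⟨?_, ?_, fun t ht => ?_⟩, fun t ht => ?_⟩, ?_⟩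
  · have h1 : ContMDiff (𝓘(ℝ, ℝ).prod (𝓡 3)) ((𝓘(ℝ, ℝ).prod 𝓘(ℝ, ℝ)).prod (𝓡 3)) ∞
        (fun x : ℝ × P => (((s, x.1) : ℝ × ℝ), x.2)) :=
      (contMDiff_const.prodMk contMDiff_fst).prodMk contMDiff_snd
    exact hsmooth.comp h1.contMDiffOn fun x hx => ⟨⟨hsub hs, hx.1⟩, mem_univ _⟩
  · funext p
    show φ (s * 0) (Φ 0 p) = ι₀ p
    rw [mul_zero, hφ.zero, hΦ.start]
  · obtain ⟨D, hD⟩ := hφ.diffeo (s * t) (hst s (hsub hs) t ht)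
    have hfun : Ψ s t = fun p => D (Φ t p) := funext fun p => (hD _).symm
    have hemb : IsSmoothEmbedding (𝓡 3) (𝓡 6) ∞ (Ψ s t) := by
      rw [hfun]
      exact isSmoothEmbedding_diffeomorph_comp (hΦ.mem t ht).embedding D
    refine ⟨hemb, ?_, fun p => (positive_iff (hitchinForm ρ) (Ψ s t) p).mpr (hpos s hs t ht p)⟩
    rw [← (hΦ.mem t ht).homology]
    have hΦc := (hΦ.mem t ht).embedding.isEmbedding.continuous
    -- Running the isotopy back to time zero gives a homotopy to `Φ t`, so the homology class does
    -- not change.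
    have hcont : Continuous fun x : unitInterval × P => φ ((1 - x.1) * (s * t)) (Φ t x.2) := by
      refine hφ.smooth.continuousOn.comp_continuous
        (f := fun x : unitInterval × P => ((1 - (x.1 : ℝ)) * (s * t), Φ t x.2)) (by fun_prop)
        fun x => ⟨?_, mem_univ _⟩
      rw [mul_comm]
      refine hst (s * t) (hst s (hsub hs) t ht) _ ⟨?_, ?_⟩
      · linarith [x.1.2.2]
      · linarith [x.1.2.1]
    refine H3_map_eq_of_homotopy (f := ⟨Ψ s t, hemb.isEmbedding.continuous⟩) (g := ⟨Φ t, hΦc⟩)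
      { toFun := fun x => φ ((1 - x.1) * (s * t)) (Φ t x.2)
        continuous_toFun := hcont
        map_zero_left := fun p => ?_
        map_one_left := fun p => ?_ } κ
    · show φ ((1 - (0 : ℝ)) * (s * t)) (Φ t p) = φ (s * t) (Φ t p)
      rw [sub_zero, one_mul]
    · show φ ((1 - (1 : ℝ)) * (s * t)) (Φ t p) = Φ t p
      rw [sub_self, zero_mul, hφ.zero]
  · funext p
    show φ (0 * t) (Φ t p) = Φ t p
    rw [zero_mul, hφ.zero]
  · funext p
    rw [velocity, isotopyVelocity]
    congr 2
    funext s
    show φ (s * 1) (Φ 1 p) = φ s (Φ 1 p)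
    rw [mul_one]

end Positivity

/-! ### Vector fields along an embedding -/

section Extension

variable {n m : ℕ} {P M : Type*} [TopologicalSpace P] [ChartedSpace (EuclideanSpace ℝ (Fin n)) P]
  [TopologicalSpace M] [ChartedSpace (EuclideanSpace ℝ (Fin m)) M] [IsManifold (𝓡 m) ∞ M]
  [IsManifold (𝓡 n) ∞ P]

/-- An embedding has local smooth retractions onto its image. -/
theorem exists_local_retraction {ι : P → M} (h : IsSmoothEmbedding (𝓡 n) (𝓡 m) ∞ ι) (p : P) :
    ∃ U ∈ nhds (ι p), ∃ r : M → P, ContMDiffOn (𝓡 m) (𝓡 n) ∞ r U ∧ ∀ q, ι q ∈ U → r (ι q) = q := by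
  have hp := h.isImmersion.isImmersionAt p
  -- Since `ι` is a topological embedding, `V` meets its image only in points of the chosen source
  -- chart, so no other sheet interferes with the retraction.
  obtain ⟨V, hV, hVs⟩ := h.isEmbedding.isOpen_iff.mp hp.domChart.open_source
  -- In immersion charts `ι` is the inclusion of the first factor, and the projection onto that
  -- factor inverts it.
  let pr : M → EuclideanSpace ℝ (Fin n) := fun x => (hp.equiv.symm (hp.codChart x)).1
  have hpr : ContMDiffOn (𝓡 m) (𝓡 n) ∞ pr hp.codChart.source := by
    refine ContMDiff.comp_contMDiffOn (I' := 𝓡 m)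
      (g := fun z => (hp.equiv.symm z).1) ?_
      (contMDiffOn_of_mem_maximalAtlas hp.codChart_mem_maximalAtlas)
    exact (contDiff_fst.comp hp.equiv.symm.contDiff).contMDiff
  have hι : ∀ q ∈ hp.domChart.source, pr (ι q) = hp.domChart q := by
    intro q hq
    have hq' : hp.domChart q ∈ (hp.domChart.extend (𝓡 n)).target := by
      simpa using hp.domChart.map_source hq
    have h1 := hp.writtenInCharts hq'
    have h2 : hp.codChart (ι (hp.domChart.symm (hp.domChart q))) =
        hp.equiv (hp.domChart q, 0) := h1
    rw [hp.domChart.left_inv hq] at h2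
    simp only [pr, h2, ContinuousLinearEquiv.symm_apply_apply]
  let U := (hp.codChart.source ∩ pr ⁻¹' hp.domChart.target) ∩ V
  have hU1 : IsOpen (hp.codChart.source ∩ pr ⁻¹' hp.domChart.target) :=
    hpr.continuousOn.isOpen_inter_preimage hp.codChart.open_source hp.domChart.open_target
  have hpV : ι p ∈ V := by
    have : p ∈ ι ⁻¹' V := hVs ▸ hp.mem_domChart_source
    exact this
  refine ⟨U, (hU1.inter hV).mem_nhds ⟨⟨hp.mem_codChart_source, ?_⟩, hpV⟩,
    fun x => hp.domChart.symm (pr x), ?_, ?_⟩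
  · rw [mem_preimage, hι p hp.mem_domChart_source]
    exact hp.domChart.map_source hp.mem_domChart_source
  · exact (contMDiffOn_symm_of_mem_maximalAtlas hp.domChart_mem_maximalAtlas).comp
      (hpr.mono fun x hx => hx.1.1) fun x hx => hx.1.2
  · intro q hq
    have h1 : q ∈ hp.domChart.source := hVs ▸ (show q ∈ ι ⁻¹' V from hq.2)
    show hp.domChart.symm (pr (ι q)) = q
    rw [hι q h1, hp.domChart.left_inv h1]

/-- Smooth functions on an embedded compact submanifold extend. -/
theorem exists_extension [CompactSpace P] [T2Space M] [CompactSpace M] {F : Type*}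
    [NormedAddCommGroup F] [NormedSpace ℝ F] {ι : P → M}
    (h : IsSmoothEmbedding (𝓡 n) (𝓡 m) ∞ ι) {H : P → F} (hH : ContMDiff (𝓡 n) 𝓘(ℝ, F) ∞ H) :
    ∃ g : M → F, ContMDiff (𝓡 m) 𝓘(ℝ, F) ∞ g ∧ ∀ p, g (ι p) = H p := by
  have hclosed : IsClosed (range ι) := (isCompact_range h.isEmbedding.continuous).isClosed
  -- The admissible values are prescribed on the image and arbitrary off it. The constraint is
  -- convex, so local solutions can be averaged by a partition of unity.
  let t : M → Set F := fun x => {c : F | ∀ p, ι p = x → c = H p}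
  have ht : ∀ x, Convex ℝ (t x) := fun x a ha b hb s t _ _ hst p hp => by
    rw [ha p hp, hb p hp, ← add_smul, hst, one_smul]
  have hloc : ∀ x : M, ∃ U ∈ nhds x, ∃ g : M → F, ContMDiffOn (𝓡 m) 𝓘(ℝ, F) ∞ g U ∧
      ∀ y ∈ U, g y ∈ t y := by
    intro x
    by_cases hx : x ∈ range ι
    · obtain ⟨p, rfl⟩ := hx
      obtain ⟨U, hU, r, hr, hrι⟩ := exists_local_retraction h p
      refine ⟨U, hU, fun y => H (r y), hH.comp_contMDiffOn hr, fun y hy q hq => ?_⟩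
      subst hq
      exact congrArg H (hrι q hy)
    · exact ⟨(range ι)ᶜ, hclosed.isOpen_compl.mem_nhds hx, fun _ => 0, contMDiffOn_const,
        fun y hy q hq => absurd ⟨q, hq⟩ hy⟩
  obtain ⟨g, hg⟩ := exists_contMDiffMap_forall_mem_convex_of_local (n := ⊤) (𝓡 m) ht hloc
  exact ⟨g, g.contMDiff, fun p => hg (ι p) p rfl⟩

end Extension

/-! ### Cut-off functions and functions supported in a chart. -/

section Bump

variable {m : ℕ} {M : Type*} [TopologicalSpace M] [ChartedSpace (EuclideanSpace ℝ (Fin m)) M]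
  [IsManifold (𝓡 m) ∞ M] [T2Space M] [CompactSpace M]

theorem exists_bump {K U : Set M} (hK : IsClosed K) (hU : IsOpen U) (hKU : K ⊆ U) :
    ∃ b : M → ℝ, ContMDiff (𝓡 m) 𝓘(ℝ, ℝ) ∞ b ∧ (∀ x ∈ K, b x = 1) ∧ tsupport b ⊆ U ∧
      ∀ x, 0 ≤ b x := by
  obtain ⟨f, h0, h1, h01⟩ := exists_contMDiffMap_zero_one_nhds_of_isClosed (n := ⊤) (𝓡 m)
    hU.isClosed_compl hK (disjoint_compl_left_iff_subset.mpr hKU)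
  refine ⟨f, f.contMDiff, fun x hx => h1.self_of_nhdsSet x hx, fun x hx => ?_, fun x => (h01 x).1⟩
  by_contra hxU
  have h2 : ∀ᶠ y in nhds x, f y = 0 := Filter.Eventually.filter_mono (nhds_le_nhdsSet hxU) h0
  exact absurd hx (notMem_tsupport_iff_eventuallyEq.mpr h2)

variable {F : Type*} [NormedAddCommGroup F] [NormedSpace ℝ F]
  {e : OpenPartialHomeomorph M (EuclideanSpace ℝ (Fin m))}

/-- A function with support in the domain of a chart, as a function on the model space. -/
def chartExt (e : OpenPartialHomeomorph M (EuclideanSpace ℝ (Fin m))) (f : M → F) :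
    EuclideanSpace ℝ (Fin m) → F := e.target.indicator fun y => f (e.symm y)

theorem chartExt_apply {f : M → F} {x : M} (hx : x ∈ e.source) : chartExt e f (e x) = f x := by
  rw [chartExt, indicator_of_mem (e.map_source hx), e.left_inv hx]

theorem chartExt_props (he : e ∈ atlas (EuclideanSpace ℝ (Fin m)) M) {f : M → F}
    (hf : ContMDiff (𝓡 m) 𝓘(ℝ, F) ∞ f) (hs : tsupport f ⊆ e.source) :
    ContDiff ℝ ∞ (chartExt e f) ∧ HasCompactSupport (chartExt e f) ∧
      tsupport (chartExt e f) ⊆ e.target := by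
  have hK : IsCompact (e '' tsupport f) :=
    (isClosed_tsupport f).isCompact.image_of_continuousOn (e.continuousOn.mono hs)
  have hKT : e '' tsupport f ⊆ e.target := by
    rintro _ ⟨x, hx, rfl⟩
    exact e.map_source (hs hx)
  have h0 : ∀ y ∈ e.target, y ∉ e '' tsupport f → f (e.symm y) = 0 := fun y hy hn =>
    image_eq_zero_of_notMem_tsupport fun h => hn ⟨_, h, e.right_inv hy⟩
  have hsub : tsupport (chartExt e f) ⊆ e '' tsupport f := by
    refine closure_minimal (fun y hy => ?_) hK.isClosed
    by_contra hn
    refine hy ?_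
    by_cases hyt : y ∈ e.target
    · rw [chartExt, indicator_of_mem hyt, h0 y hyt hn]
    · rw [chartExt, indicator_of_notMem hyt]
  exact ⟨contDiff_indicator e.open_target hK.isClosed hKT (contDiffOn_comp_chart_symm hf he) h0,
    hK.of_isClosed_subset (isClosed_tsupport _) hsub, hsub.trans hKT⟩

end Bump

/-! ### Realisation of fields along an embedding by ambient isotopies. -/

section Realization

variable {n m : ℕ} {P M : Type*} [TopologicalSpace P] [ChartedSpace (EuclideanSpace ℝ (Fin n)) P]
  [IsManifold (𝓡 n) ∞ P] [TopologicalSpace M] [ChartedSpace (EuclideanSpace ℝ (Fin m)) M]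
  [IsManifold (𝓡 m) ∞ M] [T2Space M] [CompactSpace M]

/-- Smooth vector fields along a map. -/
def IsSmoothAlong (ι : P → M) (X : P → EuclideanSpace ℝ (Fin m)) : Prop :=
  ∀ e ∈ atlas (EuclideanSpace ℝ (Fin m)) M, ContMDiffOn (𝓡 n) 𝓘(ℝ, EuclideanSpace ℝ (Fin m)) ∞
    (fun p => tder (𝓡 m) (𝓡 m) e univ (ι p) (X p)) (ι ⁻¹' e.source)

/-- A smooth vector field along an embedding is the restriction of the velocity of an isotopy. -/
theorem exists_isotopy_along [CompactSpace P] {ι : P → M} (h : IsSmoothEmbedding (𝓡 n) (𝓡 m) ∞ ι)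
    {X : P → EuclideanSpace ℝ (Fin m)} (hX : IsSmoothAlong (n := n) ι X) :
    ∃ ε φ, IsIsotopy m (X := M) ε φ ∧ ∀ p, isotopyVelocity φ (ι p) = X p := by
  have hι : ContMDiff (𝓡 n) (𝓡 m) ∞ ι := h.contMDiff
  have key : ∀ i : M, ∃ v : M → EuclideanSpace ℝ (Fin m),
      (∃ ε φ, IsIsotopy m (X := M) ε φ ∧ ∀ x, isotopyVelocity φ x = v x) ∧
      ∀ p, v (ι p) = partitionOfUnity m M i (ι p) • X p := by
    intro i
    let e := chartAt (EuclideanSpace ℝ (Fin m)) i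
    have he : e ∈ atlas (EuclideanSpace ℝ (Fin m)) M := chart_mem_atlas _ i
    let χ := partitionOfUnity m M i
    have hχs : tsupport χ ⊆ e.source := partitionOfUnity_tsupport i
    -- The piece `χ X` in chart coordinates is a vector-valued function on `P`. It extends to `M`,
    -- is cut off inside the chart, and is integrated to an isotopy there.
    let H : P → EuclideanSpace ℝ (Fin m) := fun p =>
      χ (ι p) • tder (𝓡 m) (𝓡 m) e univ (ι p) (X p)
    have hH : ContMDiff (𝓡 n) 𝓘(ℝ, EuclideanSpace ℝ (Fin m)) ∞ H := by
      intro p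
      by_cases hp : ι p ∈ e.source
      · exact ((χ.contMDiff.comp hι).contMDiffAt).smul
          ((hX e he p hp).contMDiffAt ((e.open_source.preimage hι.continuous).mem_nhds hp))
      · refine (contMDiffAt_const (c := (0 : EuclideanSpace ℝ (Fin m)))).congr_of_eventuallyEq ?_
        filter_upwards [((isClosed_tsupport χ).isOpen_compl.preimage hι.continuous).mem_nhds
          (fun hn => hp (hχs hn))] with q hq
        show χ (ι q) • _ = (0 : EuclideanSpace ℝ (Fin m))
        rw [image_eq_zero_of_notMem_tsupport hq, zero_smul]
    obtain ⟨g, hg, hgι⟩ := exists_extension h hH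
    -- The cut-off equals one on the support of `χ`, so it does not change the values on the image
    -- of `ι`.
    obtain ⟨b, hb, hb1, hbs, -⟩ := exists_bump (m := m) (isClosed_tsupport χ) e.open_source hχs
    have hbg : ContMDiff (𝓡 m) 𝓘(ℝ, EuclideanSpace ℝ (Fin m)) ∞ (fun x => b x • g x) := hb.smul hg
    have hbgs : tsupport (fun x => b x • g x) ⊆ e.source :=
      (tsupport_smul_subset_left b g).trans hbs
    obtain ⟨h1, h2, h3⟩ := chartExt_props he hbg hbgs
    obtain ⟨ε, φ, hφ, hv, hv0⟩ := exists_isotopy_chart he h1 h2 h3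
    refine ⟨isotopyVelocity φ, ⟨ε, φ, hφ, fun _ => rfl⟩, fun p => ?_⟩
    by_cases hp : ι p ∈ e.source
    · rw [hv _ hp, chartExt_apply hp, hgι]
      have hbχ : b (ι p) * χ (ι p) = χ (ι p) := by
        by_cases hz : ι p ∈ tsupport χ
        · rw [hb1 _ hz, one_mul]
        · rw [image_eq_zero_of_notMem_tsupport hz, mul_zero]
      simp only [H]
      rw [smul_smul, hbχ, map_smul]
      congr 1
      exact DFunLike.congr_fun (tder_chart_symm_comp he hp) (X p)
    · rw [hv0 _ hp]
      have : χ (ι p) = 0 := image_eq_zero_of_notMem_tsupport fun hn => hp (hχs hn)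
      show 0 = χ (ι p) • X p
      rw [this, zero_smul]
  choose v hv hvι using key
  -- Composition of isotopies adds initial velocities, and the pieces `χᵢ X` add up to `X`.
  obtain ⟨ε, φ, hφ, hφv⟩ := exists_isotopy_sum (ptnIndex m M) v fun i _ => hv i
  refine ⟨ε, φ, hφ, fun p => ?_⟩
  rw [hφv, Finset.sum_congr rfl fun i _ => hvι i p, ← Finset.sum_smul, sum_partitionOfUnity,
    one_smul]

end Realization

/-! ### Smooth fields along a map. -/

section SmoothAlong

variable {n m : ℕ} {P M : Type*} [TopologicalSpace P] [ChartedSpace (EuclideanSpace ℝ (Fin n)) P]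
  [IsManifold (𝓡 n) ∞ P] [TopologicalSpace M] [ChartedSpace (EuclideanSpace ℝ (Fin m)) M]
  [IsManifold (𝓡 m) ∞ M] {ι : P → M} {X Y : P → EuclideanSpace ℝ (Fin m)}

theorem IsSmoothAlong.add (hX : IsSmoothAlong (n := n) ι X) (hY : IsSmoothAlong (n := n) ι Y) :
    IsSmoothAlong (n := n) ι (fun p => X p + Y p) := fun e he =>
  ((hX e he).add (hY e he)).congr fun _ _ => map_add _ _ _

theorem isSmoothAlong_zero : IsSmoothAlong (n := n) (m := m) ι (fun _ => 0) := fun _ _ =>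
  (contMDiffOn_const (c := 0)).congr fun _ _ => map_zero _

theorem IsSmoothAlong.smul {f : P → ℝ} (hf : ContMDiff (𝓡 n) 𝓘(ℝ, ℝ) ∞ f)
    (hX : IsSmoothAlong (n := n) ι X) : IsSmoothAlong (n := n) ι (fun p => f p • X p) := fun e he =>
  (hf.contMDiffOn.smul (hX e he)).congr fun _ _ => map_smul _ _ _

theorem isSmoothAlong_sum {σ : Type*} (s : Finset σ) {X : σ → P → EuclideanSpace ℝ (Fin m)}
    (h : ∀ i ∈ s, IsSmoothAlong (n := n) ι (X i)) :
    IsSmoothAlong (n := n) ι (fun p => ∑ i ∈ s, X i p) := by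
  classical
  induction s using Finset.induction_on with
  | empty => simpa using isSmoothAlong_zero
  | insert a s ha ih =>
    have h1 := (h a (Finset.mem_insert_self a s)).add
      (ih fun j hj => h j (Finset.mem_insert_of_mem hj))
    simpa only [Finset.sum_insert ha] using h1

/-- Fields supported in the domain of a chart of `M`. -/
theorem isSmoothAlong_chart {e : OpenPartialHomeomorph M (EuclideanSpace ℝ (Fin m))}
    (he : e ∈ atlas (EuclideanSpace ℝ (Fin m)) M) (hι : ContMDiff (𝓡 n) (𝓡 m) ∞ ι)
    {V : P → EuclideanSpace ℝ (Fin m)} (hV : ContMDiff (𝓡 n) 𝓘(ℝ, EuclideanSpace ℝ (Fin m)) ∞ V)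
    (hs : tsupport V ⊆ ι ⁻¹' e.source) :
    IsSmoothAlong (n := n) ι
      (fun p => tder (𝓡 m) (𝓡 m) e.symm univ (e (ι p)) (V p)) := by
  intro e' he' p hp
  refine ContMDiffAt.contMDiffWithinAt ?_
  by_cases hpe : ι p ∈ e.source
  · have hmem : ∀ q, ι q ∈ e.source → ι q ∈ e'.source → e (ι q) ∈ (e.symm ≫ₕ e').source := by
      intro q h1 h2
      rw [OpenPartialHomeomorph.trans_source]
      refine ⟨e.map_source h1, ?_⟩
      rw [mem_preimage, e.left_inv h1]
      exact h2
    have h1 : ContMDiffAt (𝓡 n) 𝓘(ℝ, EuclideanSpace ℝ (Fin m)) ∞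
        (fun q => fderiv ℝ (e.symm ≫ₕ e') (e (ι q)) (V q)) p := by
      have h2 : ContDiffAt ℝ ∞ (fderiv ℝ (e.symm ≫ₕ e')) (e (ι p)) :=
        (contDiffAt_transition he he' (hmem p hpe hp)).fderiv_right (m := ∞) (by simp)
      have h3 : ContMDiffAt (𝓡 n) (𝓡 m) ∞ (fun q => e (ι q)) p :=
        (contMDiffAt_chart he hpe).comp p hι.contMDiffAt
      have h4 : ContMDiffAt (𝓡 n) 𝓘(ℝ, EuclideanSpace ℝ (Fin m) →L[ℝ] EuclideanSpace ℝ (Fin m)) ∞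
          (fun q => fderiv ℝ (e.symm ≫ₕ e') (e (ι q))) p :=
        ContMDiffAt.comp p (g := fderiv ℝ (e.symm ≫ₕ e')) (f := fun q => e (ι q))
          (I' := 𝓡 m) h2.contMDiffAt h3
      exact h4.clm_apply hV.contMDiffAt
    refine h1.congr_of_eventuallyEq ?_
    filter_upwards [((e.open_source.inter e'.open_source).preimage hι.continuous).mem_nhds
      ⟨hpe, hp⟩] with q hq
    have h5 := tder_chart_symm he he' (hmem q hq.1 hq.2)
    rw [e.left_inv hq.1] at h5
    rw [h5, ContinuousLinearMap.comp_apply]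
    have h6 := tder_chart_comp_symm he' (e'.map_source hq.2)
    rw [e'.left_inv hq.2] at h6
    exact DFunLike.congr_fun h6 _
  · refine (contMDiffAt_const (c := (0 : EuclideanSpace ℝ (Fin m)))).congr_of_eventuallyEq ?_
    filter_upwards [(isClosed_tsupport V).isOpen_compl.mem_nhds fun hn => hpe (hs hn)] with q hq
    rw [image_eq_zero_of_notMem_tsupport hq, map_zero, map_zero]

/-- A cut-off multiple of a constant field in the preferred chart at `ι p`. At the centre this chart
induces the identity on the tangent space. -/
theorem exists_isSmoothAlong_through [T2Space M] [CompactSpace M]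
    (hι : ContMDiff (𝓡 n) (𝓡 m) ∞ ι) (p : P) (w : EuclideanSpace ℝ (Fin m)) :
    ∃ X, IsSmoothAlong (n := n) ι X ∧ X p = w := by
  let e := chartAt (EuclideanSpace ℝ (Fin m)) (ι p)
  have he : e ∈ atlas (EuclideanSpace ℝ (Fin m)) M := chart_mem_atlas _ _
  obtain ⟨b, hb, hb1, hbs, -⟩ := exists_bump (m := m) (isClosed_singleton (x := ι p)) e.open_source
    (singleton_subset_iff.mpr (mem_chart_source _ _))
  refine ⟨_, isSmoothAlong_chart he hι (V := fun q => b (ι q) • w)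
    ((hb.comp hι).smul contMDiff_const) ?_, ?_⟩
  · refine (closure_minimal (fun q hq => ?_) ((isClosed_tsupport b).preimage hι.continuous)).trans
      (preimage_mono hbs)
    refine subset_tsupport b fun h => hq ?_
    show b (ι q) • w = 0
    rw [h, zero_smul]
  · show tder (𝓡 m) (𝓡 m) e.symm univ (e (ι p)) (b (ι p) • w) = w
    rw [hb1 _ rfl, one_smul, tder_chartAt_symm_self]
    rfl

end SmoothAlong

/-! ### The fundamental lemma for top-degree forms. -/

section FundamentalLemma

variable {n : ℕ} {X : Type*} [TopologicalSpace X] [ChartedSpace (EuclideanSpace ℝ (Fin n)) X]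
  [IsManifold (𝓡 n) ∞ X] [T2Space X] [CompactSpace X]

/-- The test function is a bump supported in the open set where the form is positive. -/
theorem formIntegral_fmul_pos (hX : IsOrientedAtlas n X) {η : Form n X n} (hη : IsContForm η)
    {x₀ : X} (hx₀ : 0 < η.val x₀ (EuclideanSpace.basisFun (Fin n) ℝ)) :
    ∃ f : X → ℝ, ContMDiff (𝓡 n) 𝓘(ℝ, ℝ) ∞ f ∧ 0 < formIntegral (fmul f η) := by
  let e := chartAt (EuclideanSpace ℝ (Fin n)) x₀
  have he : e ∈ atlas (EuclideanSpace ℝ (Fin n)) X := chart_mem_atlas _ _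
  have hrep : ∀ z ∈ e.target, (0 < chartRep η e z (EuclideanSpace.basisFun (Fin n) ℝ) ↔
      0 < η.val (e.symm z) (EuclideanSpace.basisFun (Fin n) ℝ)) := by
    intro z hz
    rw [chartRep_eq, topForm_comp, ContinuousAlternatingMap.smul_apply, smul_eq_mul,
      mul_pos_iff_of_pos_left (tder_chart_symm_det_pos hX he hz)]
  have hU : IsOpen (e.source ∩ e ⁻¹' (e.target ∩
      {z | 0 < chartRep η e z (EuclideanSpace.basisFun (Fin n) ℝ)})) :=
    e.isOpen_inter_preimage ((continuousOn_alternating_apply (hη e he) _).isOpen_inter_preimage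
      e.open_target isOpen_Ioi)
  have hxe : x₀ ∈ e.source := mem_chart_source _ _
  have hpos : ∀ x ∈ e.source ∩ e ⁻¹' (e.target ∩
      {z | 0 < chartRep η e z (EuclideanSpace.basisFun (Fin n) ℝ)}),
      0 < η.val x (EuclideanSpace.basisFun (Fin n) ℝ) := fun x hx => by
    have h1 := (hrep (e x) hx.2.1).mp hx.2.2
    rwa [e.left_inv hx.1] at h1
  obtain ⟨b, hb, hb1, hbs, hb0⟩ := exists_bump (m := n) (isClosed_singleton (x := x₀)) hU
    (singleton_subset_iff.mpr ⟨hxe, e.map_source hxe,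
      (hrep _ (e.map_source hxe)).mpr (by rwa [e.left_inv hxe])⟩)
  refine ⟨b, hb, formIntegral_pos hX (hη.fmul hb.continuous) (fun x => ?_) (x₀ := x₀) ?_⟩
  · rw [fmul_val, ContinuousAlternatingMap.smul_apply, smul_eq_mul]
    by_cases hx : x ∈ tsupport b
    · exact mul_nonneg (hb0 x) (hpos x (hbs hx)).le
    · rw [image_eq_zero_of_notMem_tsupport hx, zero_mul]
  · rw [fmul_val, hb1 _ rfl, one_smul]
    exact hx₀

/-- The fundamental lemma of the calculus of variations. -/
theorem form_eq_zero_of_formIntegral (hX : IsOrientedAtlas n X) {η : Form n X n}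
    (hη : IsContForm η)
    (h : ∀ f : X → ℝ, ContMDiff (𝓡 n) 𝓘(ℝ, ℝ) ∞ f → formIntegral (fmul f η) = 0) : η = 0 := by
  have key : ∀ x, η.val x (EuclideanSpace.basisFun (Fin n) ℝ) = 0 := by
    intro x
    refine le_antisymm (le_of_not_gt fun hx => ?_) (le_of_not_gt fun hx => ?_)
    · obtain ⟨f, hf, hpos⟩ := formIntegral_fmul_pos hX hη hx
      exact hpos.ne' (h f hf)
    · obtain ⟨f, hf, hpos⟩ := formIntegral_fmul_pos hX (hη.smul (-1)) (x₀ := x) (by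
        show 0 < ((-1 : ℝ) • η.val x) _
        rw [ContinuousAlternatingMap.smul_apply, smul_eq_mul]
        linarith)
      have h1 : fmul f ((-1 : ℝ) • η) = (-1 : ℝ) • fmul f η := by
        funext y
        exact smul_comm (f y) (-1 : ℝ) (η.val y)
      rw [h1, formIntegral_smul, h f hf] at hpos
      simp at hpos
  funext x
  show η.val x = 0
  ext v
  rw [topForm_apply, key, mul_zero]
  rfl

end FundamentalLemma

/-! ### Critical points satisfy the equations. -/

section Necessity

variable {P M : Type u}
  [TopologicalSpace P] [ChartedSpace (EuclideanSpace ℝ (Fin 3)) P] [IsManifold (𝓡 3) ∞ P]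
  [CompactSpace P]
  [TopologicalSpace M] [ChartedSpace (EuclideanSpace ℝ (Fin 6)) M] [IsManifold (𝓡 6) ∞ M]
  {ρ : Form 6 M 3} {τ : Form 6 M 4} {κ : H3 P} {A : H3 M} {ι₀ : P → M} {Φ : ℝ → P → M}

theorem isSmoothForm_pullbackForm {k : ℕ} {α : Form 6 M k} (hα : IsSmoothForm α) {ι : P → M}
    (hι : ContMDiff (𝓡 3) (𝓡 6) ∞ ι) : IsSmoothForm (pullbackForm ι α : Form 3 P k) := by
  intro e he
  have hG : ContMDiffOn (𝓘(ℝ, ℝ).prod (𝓡 3)) (𝓡 6) ∞ (fun x : ℝ × P => ι x.2) (univ ×ˢ univ) :=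
    (hι.comp contMDiff_snd).contMDiffOn
  refine ContDiffOn.congr ?_ fun z hz => chartRep_pullback_fam uniqueDiffOn_univ hG he α
    (mem_univ 0) hz
  exact (compCLM (ContinuousLinearMap.inr ℝ ℝ (EuclideanSpace ℝ (Fin 3)))).contDiff.comp_contDiffOn
    (contDiffOn_slice (contDiffOn_pullE_famChart uniqueDiffOn_univ hG he hα) (mem_univ 0))

theorem contr_fmul {k : ℕ} (α : Form 6 M (k + 1)) (ι : P → M) (f : P → ℝ)
    (X : P → EuclideanSpace ℝ (Fin 6)) :
    contr (n := 3) α ι (fun p => f p • X p) = fmul f (contr α ι X) := by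
  funext p
  show (((α.val (ι p)).curryLeft (f p • X p)).compContinuousLinearMap _ :
    EuclideanSpace ℝ (Fin 3) [⋀^Fin k]→L[ℝ] ℝ) = _
  rw [map_smul]
  rfl

theorem wedgeForm_fmul {k : ℕ} (θ : CovectorField 3 P) (f : P → ℝ) (β : Form 3 P k) :
    wedgeForm θ (fmul f β) = fmul f (wedgeForm θ β) := by
  funext p
  exact wedge1_smul_right _ _ _

variable [T2Space P] [T2Space M] [CompactSpace M]

/-- Smooth fields along the endpoint are velocities of curves of paths. -/
theorem IsPath.exists_isVariation_velocity (hP : IsOrientedAtlas 3 P) (hM : IsOrientedAtlas 6 M)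
    (hρ : IsSmoothForm ρ) (hρ_pos : ∀ x, IsPositive (ρ x)) (hΦ : IsPath ρ κ A ι₀ Φ)
    {X : P → EuclideanSpace ℝ (Fin 6)} (hX : IsSmoothAlong (n := 3) (Φ 1) X) :
    ∃ δ Ψ, IsVariation ρ κ A ι₀ Φ δ Ψ ∧ velocity Ψ = X := by
  obtain ⟨ε, φ, hφ, hv⟩ := exists_isotopy_along (hΦ.mem 1 ⟨zero_le_one, le_rfl⟩).embedding hX
  obtain ⟨δ, Ψ, h1, h2⟩ := hΦ.exists_isVariation hP hM hρ hρ_pos hφ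
  exact ⟨δ, Ψ, h1, h2.trans (funext hv)⟩

/-- Varying the function alone forces `ι^*ρ = 0`. Varying the path with velocities `f X`, for all
functions `f`, then forces the multiplier equation by the fundamental lemma. -/
theorem IsCriticalPoint.perturbedSL (hP : IsOrientedAtlas 3 P) (hM : IsOrientedAtlas 6 M)
    (hρ : IsSmoothForm ρ) (hρc : IsClosedForm ρ) (hρ_pos : ∀ x, IsPositive (ρ x))
    (hτ : IsSmoothForm τ) (hτc : IsClosedForm τ) (hΦ : IsPath ρ κ A ι₀ Φ) {lam : P → ℝ}
    (hlam : ContMDiff (𝓡 3) 𝓘(ℝ, ℝ) ∞ lam) (h : IsCriticalPoint ρ τ κ A ι₀ lam Φ) :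
    PerturbedSL ρ τ lam (Φ 1) := by
  have hι : ContMDiff (𝓡 3) (𝓡 6) ∞ (Φ 1) := (hΦ.mem 1 ⟨zero_le_one, le_rfl⟩).embedding.contMDiff
  have key : ∀ X, IsSmoothAlong (n := 3) (Φ 1) X →
      ∀ f : P → ℝ, ContMDiff (𝓡 3) 𝓘(ℝ, ℝ) ∞ f →
      IsSmoothForm (contr (n := 3) τ (Φ 1) X) ∧ IsSmoothForm (contr (n := 3) ρ (Φ 1) X) ∧
      formIntegral (contr τ (Φ 1) X) + (formIntegral (fmul f (pullbackForm (Φ 1) ρ : Form 3 P 3)) -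
        formIntegral (wedgeForm (dfun lam) (contr (n := 3) ρ (Φ 1) X))) = 0 := by
    intro X hX f hf
    obtain ⟨δ, Ψ, hΨ, rfl⟩ := hΦ.exists_isVariation_velocity hP hM hρ hρ_pos hX
    refine ⟨hΨ.isSmoothForm_contr hτ, hΨ.isSmoothForm_contr hρ, ?_⟩
    have hl : IsFunctionVariation lam δ (fun s p => lam p + s * f p) := by
      refine ⟨ContMDiff.contMDiffOn ?_, by funext p; ring⟩
      exact (hlam.comp contMDiff_snd).add (contMDiff_fst.mul (hf.comp contMDiff_snd))
    have h1 := hΨ.hasDerivAt_lagrangeFunctional hP hρ hρc hτ hτc hlam hl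
    have h2 := h1.unique (h δ Ψ _ hΨ hl)
    have h3 : (fun p => deriv (fun s => lam p + s * f p) 0) = f := by
      funext p
      have h4 : HasDerivAt (fun s => lam p + s * f p) (1 * f p) 0 :=
        ((hasDerivAt_id (0 : ℝ)).mul_const (f p)).const_add _
      rw [h4.deriv, one_mul]
    rwa [h3] at h2
  have hz : ∀ f : P → ℝ, ContMDiff (𝓡 3) 𝓘(ℝ, ℝ) ∞ f →
      formIntegral (fmul f (pullbackForm (Φ 1) ρ : Form 3 P 3)) = 0 := by
    intro f hf
    -- The same zero field is used with the function variations `f` and `0`. Subtracting the two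
    -- identities isolates the term with `f`.
    obtain ⟨-, -, h1⟩ := key _ isSmoothAlong_zero f hf
    obtain ⟨-, -, h2⟩ := key _ isSmoothAlong_zero (fun _ => 0) contMDiff_const
    have h3 : fmul (fun _ => 0) (pullbackForm (Φ 1) ρ : Form 3 P 3) = 0 := by
      funext p
      exact zero_smul _ _
    rw [h3, formIntegral_zero] at h2
    linarith
  refine perturbedSL_iff.mpr ⟨fun p w => ?_,
    form_eq_zero_of_formIntegral hP (isSmoothForm_pullbackForm hρ hι).isContForm hz⟩
  -- The equation is pointwise and linear in `w`, so it is enough to test it on a field extending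
  -- `w`.
  obtain ⟨X, hX, rfl⟩ := exists_isSmoothAlong_through hι p w
  obtain ⟨hs1, hs2, -⟩ := key X hX (fun _ => 0) contMDiff_const
  have hs3 := isSmoothForm_wedgeForm (isSmoothCov_dfun hlam) hs2
  have h0 : contr (n := 3) τ (Φ 1) X +
      (-1 : ℝ) • wedgeForm (dfun lam) (contr (n := 3) ρ (Φ 1) X) = 0 := by
    refine form_eq_zero_of_formIntegral hP (hs1.isContForm.add (hs3.isContForm.smul (-1)))
      fun f hf => ?_
    obtain ⟨-, -, h1⟩ := key _ (hX.smul hf) (fun _ => 0) contMDiff_const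
    rw [hz _ contMDiff_const, contr_fmul, contr_fmul, wedgeForm_fmul] at h1
    have h2 : fmul f (contr (n := 3) τ (Φ 1) X +
        (-1 : ℝ) • wedgeForm (dfun lam) (contr (n := 3) ρ (Φ 1) X)) =
        fmul f (contr (n := 3) τ (Φ 1) X) +
          (-1 : ℝ) • fmul f (wedgeForm (dfun lam) (contr (n := 3) ρ (Φ 1) X)) := by
      funext q
      exact (smul_add _ _ _).trans (congrArg _ (smul_comm (f q) (-1 : ℝ)
        ((wedgeForm (dfun lam) (contr (n := 3) ρ (Φ 1) X)).val q)))
    rw [h2, formIntegral_add (hs1.isContForm.fmul hf.continuous)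
      ((hs3.isContForm.fmul hf.continuous).smul _), formIntegral_smul]
    linarith
  have h1 : contrAt τ (Φ 1) p (X p) +
      (-1 : ℝ) • wedge1 (dfun (n := 3) lam p) (contrAt ρ (Φ 1) p (X p)) = 0 := congrFun h0 p
  ext v
  have h2 : contrAt τ (Φ 1) p (X p) v +
      (-1 : ℝ) * wedge1 (dfun (n := 3) lam p) (contrAt ρ (Φ 1) p (X p)) v = 0 :=
    congrArg (fun η => η v) h1
  linarith

end Necessity

/-! ### Functionals on test functions that vanish on derivatives -/

section TestFunctions

variable {n : ℕ}

/-- Smooth functions supported in the interior of the cube with centre `a` and side `2 r`. -/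
def IsTestFun (a : EuclideanSpace ℝ (Fin n)) (r : ℝ) (g : EuclideanSpace ℝ (Fin n) → ℝ) : Prop :=
  ContDiff ℝ ∞ g ∧ ∃ r' < r, ∀ z, g z ≠ 0 → ∀ j, |z j - a j| ≤ r'

variable {a : EuclideanSpace ℝ (Fin n)} {r : ℝ} {g : EuclideanSpace ℝ (Fin n) → ℝ}

theorem isCompact_box (a : EuclideanSpace ℝ (Fin n)) (r : ℝ) :
    IsCompact {z : EuclideanSpace ℝ (Fin n) | ∀ j, |z j - a j| ≤ r} := by
  have h1 : {z : EuclideanSpace ℝ (Fin n) | ∀ j, |z j - a j| ≤ r} =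
      (EuclideanSpace.equiv (Fin n) ℝ) ⁻¹' (univ.pi fun j => Icc (a j - r) (a j + r)) := by
    ext z
    simp only [mem_ofPred_eq, mem_preimage, mem_univ_pi, mem_Icc]
    refine forall_congr' fun j => ?_
    rw [abs_sub_le_iff]
    change _ ↔ a j - r ≤ z j ∧ z j ≤ a j + r
    constructor <;> rintro ⟨h1, h2⟩ <;> constructor <;> linarith
  rw [h1]
  exact (EuclideanSpace.equiv (Fin n) ℝ).toHomeomorph.isCompact_preimage.mpr
    (isCompact_univ_pi fun j => isCompact_Icc)

theorem IsTestFun.tsupport_subset (hg : IsTestFun a r g) :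
    ∃ r' < r, tsupport g ⊆ {z | ∀ j, |z j - a j| ≤ r'} := by
  obtain ⟨r', hr', h⟩ := hg.2
  exact ⟨r', hr', closure_minimal (fun z hz => h z hz) (isCompact_box a r').isClosed⟩

theorem IsTestFun.hasCompactSupport (hg : IsTestFun a r g) : HasCompactSupport g := by
  obtain ⟨r', -, h⟩ := hg.tsupport_subset
  exact (isCompact_box a r').of_isClosed_subset (isClosed_tsupport g) h

theorem single_apply_eq (i j : Fin n) :
    (EuclideanSpace.single i (1 : ℝ) : EuclideanSpace ℝ (Fin n)) j = if j = i then 1 else 0 := by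
  simp

theorem line_apply (z : EuclideanSpace ℝ (Fin n)) (i j : Fin n) (t : ℝ) :
    (z - t • EuclideanSpace.single i (1 : ℝ)) j = if j = i then z j - t else z j := by
  rw [PiLp.sub_apply, PiLp.smul_apply, single_apply_eq]
  split_ifs <;> simp

/-- The integral of a function along the lines in the direction of a basis vector, over the
parameters in `S`. -/
def lineInt (S : Set ℝ) (i : Fin n) (g : EuclideanSpace ℝ (Fin n) → ℝ)
    (z : EuclideanSpace ℝ (Fin n)) : ℝ := ∫ t in S, g (z - t • EuclideanSpace.single i (1 : ℝ))

/-- The line integral is a convolution of `g` with the constant one, for the measure carried by the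
coordinate line. This measure is locally finite, so smoothness passes from `g`. -/
theorem contDiff_lineInt (S : Set ℝ) (i : Fin n) (hg : ContDiff ℝ ∞ g)
    (hc : HasCompactSupport g) : ContDiff ℝ ∞ (lineInt S i g) := by
  let f : ℝ → EuclideanSpace ℝ (Fin n) := fun t => t • EuclideanSpace.single i (1 : ℝ)
  have hf : Continuous f := by fun_prop
  let μ : Measure (EuclideanSpace ℝ (Fin n)) := (volume.restrict S).map f
  have hloc : LocallyIntegrable (fun _ : EuclideanSpace ℝ (Fin n) => (1 : ℝ)) μ := by
    intro x
    refine ⟨Metric.ball x 1, Metric.ball_mem_nhds x one_pos, ?_⟩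
    refine integrableOn_const (hs := ne_of_lt ?_)
    rw [Measure.map_apply hf.measurable Metric.isOpen_ball.measurableSet]
    refine lt_of_le_of_lt (Measure.restrict_apply_le _ _) (lt_of_le_of_lt (measure_mono
      (t := Metric.closedBall 0 (‖x‖ + 1)) fun t ht => ?_) measure_closedBall_lt_top)
    rw [mem_preimage, mem_ball_iff_norm] at ht
    rw [mem_closedBall_zero_iff]
    have h1 : ‖f t‖ = ‖t‖ := by simp [f, norm_smul]
    rw [← h1]
    calc ‖f t‖ = ‖(f t - x) + x‖ := by rw [sub_add_cancel]
      _ ≤ ‖f t - x‖ + ‖x‖ := norm_add_le _ _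
      _ ≤ ‖x‖ + 1 := by linarith
  have h := hc.contDiff_convolution_right (n := ⊤) (ContinuousLinearMap.lsmul ℝ ℝ) hloc hg
  convert h using 1
  funext z
  rw [convolution_def, lineInt, integral_map hf.measurable.aemeasurable]
  · simp [f]
  · refine Continuous.aestronglyMeasurable ?_
    have := hg.continuous
    fun_prop

theorem hasDerivAt_integral_Ioi {u : ℝ → ℝ} (hu : Continuous u) (hc : HasCompactSupport u)
    (s : ℝ) : HasDerivAt (fun s => ∫ t in Ioi (0 : ℝ), u (s - t)) (u s) s := by
  have hi : Integrable u := hu.integrable_of_hasCompactSupport hc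
  have h1 : ∀ s, ∫ t in Ioi (0 : ℝ), u (s - t) =
      (∫ x in Iic (0 : ℝ), u x) + ∫ x in (0 : ℝ)..s, u x := by
    intro s
    have h2 : ∫ t in Ioi (0 : ℝ), u (s - t) = ∫ x in Iio s, u x := by
      rw [← integral_indicator measurableSet_Ioi, ← integral_indicator measurableSet_Iio,
        ← integral_sub_left_eq_self (fun x => (Iio s).indicator u x) volume s]
      congr 1
      funext t
      by_cases ht : 0 < t
      · rw [indicator_of_mem (mem_Ioi.mpr ht), indicator_of_mem (mem_Iio.mpr (by linarith))]
      · rw [indicator_of_notMem (by simpa using ht), indicator_of_notMem (by simpa using ht)]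
    rw [h2, ← integral_Iic_eq_integral_Iio,
      ← intervalIntegral.integral_Iic_sub_Iic hi.integrableOn hi.integrableOn]
    ring
  have h3 : HasDerivAt (fun s => ∫ x in (0 : ℝ)..s, u x) (u s) s :=
    (hu.integral_hasStrictDerivAt 0 s).hasDerivAt
  refine (h3.const_add (∫ x in Iic (0 : ℝ), u x)).congr_of_eventuallyEq ?_
  exact Filter.Eventually.of_forall h1

theorem hasCompactSupport_line (z : EuclideanSpace ℝ (Fin n)) (i : Fin n)
    (hc : HasCompactSupport g) :
    HasCompactSupport fun t : ℝ => g (z - t • EuclideanSpace.single i (1 : ℝ)) := by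
  refine hc.comp_isClosedEmbedding (g := fun t : ℝ => z - t • EuclideanSpace.single i (1 : ℝ)) ?_
  refine Isometry.isClosedEmbedding (Isometry.of_dist_eq fun s t => ?_)
  rw [dist_sub_left, dist_eq_norm, ← sub_smul, norm_smul, dist_eq_norm]
  simp

/-- Over the half-line the line integral is the primitive of `g` in the `i`-th variable starting
from minus infinity. -/
theorem fderiv_lineInt_Ioi (i : Fin n) (hg : ContDiff ℝ ∞ g) (hc : HasCompactSupport g)
    (z : EuclideanSpace ℝ (Fin n)) :
    fderiv ℝ (lineInt (Ioi 0) i g) z (EuclideanSpace.single i 1) = g z := by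
  have h1 : HasDerivAt (fun s : ℝ => lineInt (Ioi 0) i g (z + s • EuclideanSpace.single i (1 : ℝ)))
      (fderiv ℝ (lineInt (Ioi 0) i g) z (EuclideanSpace.single i 1)) 0 := by
    have h2 := ((contDiff_lineInt (Ioi 0) i hg hc).differentiable (by simp)
      (z + (0 : ℝ) • EuclideanSpace.single i (1 : ℝ))).hasFDerivAt
    have h3 : HasDerivAt (fun s : ℝ => z + s • EuclideanSpace.single i (1 : ℝ))
        ((1 : ℝ) • EuclideanSpace.single i (1 : ℝ)) 0 :=
      ((hasDerivAt_id (0 : ℝ)).smul_const _).const_add z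
    have h4 := h2.comp_hasDerivAt (0 : ℝ) h3
    rw [one_smul, zero_smul, add_zero] at h4
    exact h4
  let u : ℝ → ℝ := fun t => g (z - (-t) • EuclideanSpace.single i (1 : ℝ))
  have hu : Continuous u := by
    have := hg.continuous
    fun_prop
  have huc : HasCompactSupport u :=
    (hasCompactSupport_line z i hc).comp_homeomorph (Homeomorph.neg ℝ)
  have h5 := hasDerivAt_integral_Ioi hu huc 0
  have h6 : (fun s : ℝ => lineInt (Ioi 0) i g (z + s • EuclideanSpace.single i (1 : ℝ))) =
      fun s => ∫ t in Ioi (0 : ℝ), u (s - t) := by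
    funext s
    rw [lineInt]
    congr 1
    funext t
    show g _ = g _
    congr 1
    module
  rw [h6] at h1
  rw [h1.unique h5]
  simp [u]

variable {ψ : ℝ → ℝ} {r₁ : ℝ}

theorem lineInt_translate (i : Fin n) (g : EuclideanSpace ℝ (Fin n) → ℝ)
    (z : EuclideanSpace ℝ (Fin n)) (s : ℝ) :
    lineInt univ i g (z - s • EuclideanSpace.single i (1 : ℝ)) = lineInt univ i g z := by
  rw [lineInt, lineInt, setIntegral_univ, setIntegral_univ,
    ← integral_add_left_eq_self (fun t => g (z - t • EuclideanSpace.single i (1 : ℝ))) s]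
  congr 1
  funext t
  congr 1
  module

/-- A test function is, up to a derivative, a multiple of a bump function in one variable. -/
theorem IsTestFun.exists_primitive (hg : IsTestFun a r g) (hψ : ContDiff ℝ ∞ ψ) (hr₁ : r₁ < r)
    (hψs : ∀ t, ψ t ≠ 0 → |t| ≤ r₁) (hψ1 : ∫ t, ψ t = 1) (i : Fin n) :
    IsTestFun a r (fun z => ψ (z i - a i) * lineInt univ i g z) ∧
    ∃ h, IsTestFun a r h ∧ ∀ z, g z - ψ (z i - a i) * lineInt univ i g z =
      fderiv ℝ h z (EuclideanSpace.single i 1) := by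
  have hgc := hg.hasCompactSupport
  obtain ⟨hgd, r', hr', hgs⟩ := hg
  have hproj : ContDiff ℝ ∞ fun z : EuclideanSpace ℝ (Fin n) => z i - a i :=
    (EuclideanSpace.proj (𝕜 := ℝ) i).contDiff.sub contDiff_const
  have hQd : ContDiff ℝ ∞ fun z => ψ (z i - a i) * lineInt univ i g z :=
    (hψ.comp hproj).mul (contDiff_lineInt univ i hgd hgc)
  have hlin : ∀ z, lineInt univ i g z ≠ 0 → ∀ j ≠ i, |z j - a j| ≤ r' := by
    intro z hz j hj
    by_contra hn
    refine hz ?_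
    rw [lineInt]
    refine integral_eq_zero_of_ae (Filter.Eventually.of_forall fun t => ?_)
    by_contra ht
    have := hgs _ ht j
    rw [line_apply, if_neg hj] at this
    exact hn this
  have hm : max r' r₁ < r := max_lt hr' hr₁
  have hQs : ∀ z, ψ (z i - a i) * lineInt univ i g z ≠ 0 → ∀ j, |z j - a j| ≤ max r' r₁ := by
    intro z hz j
    by_cases hj : j = i
    · subst hj
      exact (hψs _ (left_ne_zero_of_mul hz)).trans (le_max_right _ _)
    · exact (hlin z (right_ne_zero_of_mul hz) j hj).trans (le_max_left _ _)
  have hQ : IsTestFun a r (fun z => ψ (z i - a i) * lineInt univ i g z) := ⟨hQd, _, hm, hQs⟩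
  refine ⟨hQ, ?_⟩
  -- Subtracting a multiple of the normalised bump makes every line integral in direction `i` zero.
  -- This is exactly what gives the half-line primitive compact support.
  let G : EuclideanSpace ℝ (Fin n) → ℝ := fun z => g z - ψ (z i - a i) * lineInt univ i g z
  have hGs : ∀ z, G z ≠ 0 → ∀ j, |z j - a j| ≤ max r' r₁ := by
    intro z hz j
    by_cases h1 : g z = 0
    · refine hQs z (fun h2 => hz ?_) j
      show g z - _ = 0
      rw [h1, h2, sub_zero]
    · exact (hgs z h1 j).trans (le_max_left _ _)
  have hG : IsTestFun a r G := ⟨hgd.sub hQd, _, hm, hGs⟩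
  have hG0 : ∀ z, lineInt univ i G z = 0 := by
    intro z
    have h1 : ∀ t : ℝ, G (z - t • EuclideanSpace.single i (1 : ℝ)) =
        g (z - t • EuclideanSpace.single i (1 : ℝ)) - ψ (z i - a i - t) * lineInt univ i g z := by
      intro t
      show g _ - ψ _ * lineInt univ i g _ = _
      rw [lineInt_translate, line_apply, if_pos rfl]
      congr 3
      ring
    have hψc : HasCompactSupport ψ := HasCompactSupport.intro (isCompact_Icc (a := -r₁) (b := r₁))
      fun t ht => by
        by_contra hn
        exact ht (abs_le.mp (hψs t hn))
    have h2 : Integrable fun t => ψ (z i - a i - t) :=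
      (hψ.continuous.integrable_of_hasCompactSupport hψc).comp_sub_left _
    have h3 : Integrable fun t : ℝ => g (z - t • EuclideanSpace.single i (1 : ℝ)) := by
      refine Continuous.integrable_of_hasCompactSupport ?_ (hasCompactSupport_line z i hgc)
      have := hgd.continuous
      fun_prop
    rw [lineInt, setIntegral_univ]
    simp only [h1]
    rw [integral_sub h3 (h2.mul_const _), integral_mul_const,
      integral_sub_left_eq_self ψ volume, hψ1, one_mul, lineInt, setIntegral_univ, sub_self]
  refine ⟨lineInt (Ioi 0) i G, ⟨contDiff_lineInt _ i hG.1 hG.hasCompactSupport, _, hm,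
    fun z hz => ?_⟩, fun z => (fderiv_lineInt_Ioi i hG.1 hG.hasCompactSupport z).symm⟩
  have hex : ∃ t : ℝ, 0 < t ∧ G (z - t • EuclideanSpace.single i (1 : ℝ)) ≠ 0 := by
    by_contra! hn
    exact hz (setIntegral_eq_zero_of_forall_eq_zero fun t ht => hn t ht)
  obtain ⟨t, ht, hGt⟩ := hex
  have h1 := hGs _ hGt
  intro j
  by_cases hj : j = i
  · subst hj
    have h2 := h1 j
    rw [line_apply, if_pos rfl] at h2
    rw [abs_le] at h2 ⊢
    -- Before the support the half-line integral sees nothing. Beyond it, the half-line integral is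
    -- the full line integral, which is zero.
    refine ⟨by linarith, ?_⟩
    by_contra! hn
    refine hz ?_
    refine Eq.trans ?_ ((setIntegral_univ (f := fun t : ℝ =>
      G (z - t • EuclideanSpace.single j (1 : ℝ)))).symm.trans (hG0 z))
    refine setIntegral_eq_integral_of_forall_compl_eq_zero (s := Ioi (0 : ℝ)) fun s hs => ?_
    by_contra hGn
    have h3 := hGs _ hGn j
    rw [line_apply, if_pos rfl, abs_le] at h3
    have h4 : s ≤ 0 := not_lt.mp hs
    linarith
  · have h2 := h1 j
    rwa [line_apply, if_neg hj] at h2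

/-- A functional on test functions which does not see derivatives. -/
def IsDerivInvariant (a : EuclideanSpace ℝ (Fin n)) (r : ℝ)
    (A : (EuclideanSpace ℝ (Fin n) → ℝ) → ℝ) : Prop :=
  ∀ (i : Fin n) (g g' h : EuclideanSpace ℝ (Fin n) → ℝ), IsTestFun a r g → IsTestFun a r g' →
    IsTestFun a r h → (∀ z, g z - g' z = fderiv ℝ h z (EuclideanSpace.single i 1)) → A g = A g'

/-- The variables in `s` are replaced one at a time by the bump, each replacement costing a
derivative that the functional does not see. The choice of `F` precedes that of the functional, so
two functionals can be compared on the same data. -/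
theorem IsTestFun.exists_invariant (hg : IsTestFun a r g) (hψ : ContDiff ℝ ∞ ψ) (hr₁ : r₁ < r)
    (hψs : ∀ t, ψ t ≠ 0 → |t| ≤ r₁) (hψ1 : ∫ t, ψ t = 1) (s : Finset (Fin n)) :
    ∃ F : EuclideanSpace ℝ (Fin n) → ℝ,
      (∀ j ∈ s, ∀ (z : EuclideanSpace ℝ (Fin n)) (t : ℝ), F (z - t • EuclideanSpace.single j (1 : ℝ)) = F z) ∧
      IsTestFun a r (fun z => (∏ j ∈ s, ψ (z j - a j)) * F z) ∧
      ∀ A, IsDerivInvariant a r A → A g = A fun z => (∏ j ∈ s, ψ (z j - a j)) * F z := by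
  induction s using Finset.induction_on with
  | empty =>
    refine ⟨g, by simp, ?_, fun A _ => ?_⟩ <;> simp only [Finset.prod_empty, one_mul]
    exact hg
  | insert i s hi ih =>
    obtain ⟨F, hF1, hF2, hF3⟩ := ih
    obtain ⟨h1, h, h2, h3⟩ := hF2.exists_primitive hψ hr₁ hψs hψ1 i
    have hprod : ∀ z : EuclideanSpace ℝ (Fin n), ∀ t : ℝ,
        ∏ j ∈ s, ψ ((z - t • EuclideanSpace.single i (1 : ℝ)) j - a j) = ∏ j ∈ s, ψ (z j - a j) := by
      intro z t
      refine Finset.prod_congr rfl fun j hj => ?_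
      rw [line_apply, if_neg (ne_of_mem_of_not_mem hj hi)]
    have h4 : (fun z => ψ (z i - a i) * lineInt univ i
        (fun z => (∏ j ∈ s, ψ (z j - a j)) * F z) z) =
        fun z => (∏ j ∈ insert i s, ψ (z j - a j)) * lineInt univ i F z := by
      funext z
      rw [Finset.prod_insert hi, mul_assoc]
      congr 1
      rw [lineInt, lineInt, ← integral_const_mul]
      congr 1
      funext t
      rw [hprod]
    have h5 : ∀ z, ψ (z i - a i) * lineInt univ i (fun z => (∏ j ∈ s, ψ (z j - a j)) * F z) z =
        (∏ j ∈ insert i s, ψ (z j - a j)) * lineInt univ i F z := fun z => congrFun h4 z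
    rw [h4] at h1
    refine ⟨lineInt univ i F, ?_, h1, fun A hA => ?_⟩
    · intro j hj z t
      rcases Finset.mem_insert.mp hj with rfl | hj
      · exact lineInt_translate _ _ _ _
      · rw [lineInt, lineInt]
        congr 1
        funext s'
        rw [sub_right_comm]
        exact hF1 j hj _ _
    · rw [hF3 A hA]
      refine hA i _ _ h hF2 h1 h2 fun z => ?_
      rw [← h3 z, h5]

/-- A homogeneous functional on test functions that does not see derivatives is a multiple of the
integral. -/
theorem exists_eq_mul_integral (hr : 0 < r) {A : (EuclideanSpace ℝ (Fin n) → ℝ) → ℝ}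
    (hA : IsDerivInvariant a r A)
    (hh : ∀ g, IsTestFun a r g → ∀ c : ℝ, A (fun z => g z * c) = A g * c) :
    ∃ C : ℝ, ∀ g, IsTestFun a r g → A g = C * ∫ z, g z := by
  let φ : ContDiffBump (0 : ℝ) := ⟨r / 4, r / 2, by positivity, by linarith⟩
  have hψ : ContDiff ℝ ∞ (φ.normed volume) := φ.contDiff_normed
  have hψ1 : ∫ t, φ.normed volume t = 1 := φ.integral_normed
  have hψs : ∀ t, φ.normed volume t ≠ 0 → |t| ≤ r / 2 := by
    intro t ht
    have h1 : t ∈ support (φ.normed volume) := ht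
    rw [φ.support_normed_eq, mem_ball_zero_iff] at h1
    exact h1.le
  let Ψ : EuclideanSpace ℝ (Fin n) → ℝ := fun z => ∏ j, φ.normed volume (z j - a j)
  have hint : IsDerivInvariant a r fun g => ∫ z, g z := by
    intro i g g' h hg hg' hh h1
    have h2 := integral_fderiv_eq_zero (μ := volume) (hh.1.of_le (by simp)) hh.hasCompactSupport
      (EuclideanSpace.single i (1 : ℝ))
    simp only [← h1] at h2
    rw [integral_sub (hg.1.continuous.integrable_of_hasCompactSupport hg.hasCompactSupport)
      (hg'.1.continuous.integrable_of_hasCompactSupport hg'.hasCompactSupport)] at h2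
    exact sub_eq_zero.mp h2
  have hΨ : IsTestFun a r Ψ := by
    refine ⟨contDiff_prod fun j _ => hψ.comp ((EuclideanSpace.proj (𝕜 := ℝ) j).contDiff.sub
      contDiff_const), r / 2, by linarith, fun z hz j => hψs _ ?_⟩
    exact Finset.prod_ne_zero_iff.mp hz j (Finset.mem_univ j)
  have hpos : 0 < ∫ z, Ψ z := by
    refine (hΨ.1.continuous.integral_pos_of_hasCompactSupport_nonneg_nonzero hΨ.hasCompactSupport
      (fun z => Finset.prod_nonneg fun j _ => φ.nonneg_normed _) (x := a) ?_)
    refine Finset.prod_ne_zero_iff.mpr fun j _ => ?_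
    have h1 : a j - a j ∈ support (φ.normed volume) := by
      rw [φ.support_normed_eq, sub_self]
      exact Metric.mem_ball_self φ.rOut_pos
    exact h1
  -- After all variables have been treated, the remaining factor is invariant under all translations
  -- along the axes, hence constant. Comparison with the functional `∫` evaluates this constant.
  have key : ∀ g, IsTestFun a r g → ∃ c : ℝ, ∀ B, IsDerivInvariant a r B →
      B g = B fun z => Ψ z * c := by
    intro g hg
    obtain ⟨F, hF1, hF2, hF3⟩ := hg.exists_invariant hψ (by linarith : r / 2 < r) hψs hψ1 Finset.univ
    have hconst : ∀ z, F z = F 0 := by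
      intro z
      have h1 : ∀ s : Finset (Fin n),
          F (z - ∑ j ∈ s, z j • EuclideanSpace.single j (1 : ℝ)) = F z := by
        intro s
        induction s using Finset.induction_on with
        | empty => simp
        | insert i s hi ih =>
          rw [Finset.sum_insert hi, add_comm, ← sub_sub, hF1 i (Finset.mem_univ i), ih]
      have h2 : z - ∑ j, z j • EuclideanSpace.single j (1 : ℝ) = 0 := by
        ext k
        simp [Finset.sum_apply, Pi.single_apply]
      rw [← h1 Finset.univ, h2]
    refine ⟨F 0, fun B hB => ?_⟩
    rw [hF3 B hB]
    congr 1
    funext z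
    rw [hconst z]
  refine ⟨A Ψ / ∫ z, Ψ z, fun g hg => ?_⟩
  obtain ⟨c, hc⟩ := key g hg
  have h1 := hc _ hint
  simp only at h1
  rw [hc A hA, hh Ψ hΨ, h1, integral_mul_const]
  field_simp

end TestFunctions

/-! ### The volume form, and forms supported in a chart -/

section VolumeForm

/-- The standard volume form. -/
def volForm (n : ℕ) : EuclideanSpace ℝ (Fin n) [⋀^Fin n]→L[ℝ] ℝ :=
  { (EuclideanSpace.basisFun (Fin n) ℝ).toBasis.det with
    cont := by
      refine Continuous.matrix_det (continuous_matrix fun i j => ?_)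
      exact (EuclideanSpace.proj (𝕜 := ℝ) i).continuous.comp (continuous_apply j) }

theorem volForm_basisFun (n : ℕ) : volForm n (EuclideanSpace.basisFun (Fin n) ℝ) = 1 := by
  have h := (EuclideanSpace.basisFun (Fin n) ℝ).toBasis.det_self
  rw [OrthonormalBasis.coe_toBasis] at h
  exact h

/-- The form `α ∧ vol` has degree above the dimension and vanishes. Expanding it on `(v, w)` gives
the identity. -/
theorem wedge1_volForm {n : ℕ} (α : EuclideanSpace ℝ (Fin (n + 1)) →L[ℝ] ℝ)
    (v : EuclideanSpace ℝ (Fin (n + 1))) :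
    wedge1 α ((volForm (n + 1)).curryLeft v) = α v • volForm (n + 1) := by
  ext w
  have h0 : wedge1 α (volForm (n + 1)) (Fin.cons v w) = 0 := by
    refine (wedge1 α (volForm (n + 1))).toAlternatingMap.map_linearDependent _ fun h => ?_
    have := h.fintype_card_le_finrank
    simp at this
  rw [wedge1_apply, Fin.sum_univ_succ] at h0
  have h1 : (Fin.removeNth 0 (Fin.cons v w : Fin (n + 2) → EuclideanSpace ℝ (Fin (n + 1)))) = w :=
    Fin.removeNth_zero _
  have h2 : ∀ i : Fin (n + 1), (i.succ.removeNth
      (Fin.cons v w : Fin (n + 2) → EuclideanSpace ℝ (Fin (n + 1)))) =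
      Fin.cons v (i.removeNth w) := fun i => by
    funext j
    refine Fin.cases ?_ (fun j => ?_) j
    · rfl
    · simp only [Fin.removeNth, Fin.cons_succ, Fin.succ_succAbove_succ]
  simp only [h1, h2, Fin.cons_succ, Fin.cons_zero, Fin.val_zero, pow_zero, one_mul, Fin.val_succ,
    pow_succ] at h0
  rw [wedge1_apply, ContinuousAlternatingMap.smul_apply, smul_eq_mul]
  have h3 : ∀ i : Fin (n + 1), ((volForm (n + 1)).curryLeft v) (i.removeNth w) =
      volForm (n + 1) (Fin.cons v (i.removeNth w)) := fun i => rfl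
  simp only [h3]
  rw [← sub_eq_zero, ← neg_eq_zero, neg_sub, sub_eq_add_neg, ← Finset.sum_neg_distrib]
  refine Eq.trans ?_ h0
  congr 1
  refine Finset.sum_congr rfl fun i _ => ?_
  ring

theorem eq_smul_volForm {n : ℕ} (η : EuclideanSpace ℝ (Fin n) [⋀^Fin n]→L[ℝ] ℝ) :
    η = η (EuclideanSpace.basisFun (Fin n) ℝ) • volForm n := by
  ext v
  rw [ContinuousAlternatingMap.smul_apply, topForm_apply η, topForm_apply (volForm n),
    volForm_basisFun, smul_eq_mul]
  ring

end VolumeForm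

theorem extDeriv_const_fun {E : Type*} [NormedAddCommGroup E] [NormedSpace ℝ E] {k : ℕ}
    (β : E [⋀^Fin k]→L[ℝ] ℝ) {y : E} : extDeriv (fun _ : E => β) y = 0 := by
  ext v
  simp [extDeriv, ContinuousAlternatingMap.alternatizeUncurryFin_apply]

section OfChart

variable {n k : ℕ} {X : Type*} [TopologicalSpace X] [ChartedSpace (EuclideanSpace ℝ (Fin n)) X]
  {e e' : OpenPartialHomeomorph X (EuclideanSpace ℝ (Fin n))}
  {ζ : EuclideanSpace ℝ (Fin n) → EuclideanSpace ℝ (Fin n) [⋀^Fin k]→L[ℝ] ℝ}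
  {K : Set (EuclideanSpace ℝ (Fin n))}

open Classical in
/-- The form that has the coordinate representation `ζ` in the chart `e` and vanishes outside. -/
def ofChart (e : OpenPartialHomeomorph X (EuclideanSpace ℝ (Fin n)))
    (ζ : EuclideanSpace ℝ (Fin n) → EuclideanSpace ℝ (Fin n) [⋀^Fin k]→L[ℝ] ℝ) : Form n X k :=
  fun x => if x ∈ e.source then
    (ζ (e x)).compContinuousLinearMap (tder (𝓡 n) (𝓡 n) e univ x) else 0

theorem ofChart_val_of_mem {x : X} (hx : x ∈ e.source) : (ofChart e ζ).val x =
    (ζ (e x)).compContinuousLinearMap (tder (𝓡 n) (𝓡 n) e univ x) := if_pos hx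

theorem ofChart_val_of_notMem {x : X} (hx : x ∉ e.source) : (ofChart e ζ).val x = 0 := if_neg hx

theorem ofChart_val_eq_zero (h0 : ∀ y ∉ K, ζ y = 0) {x : X} (hx : x ∉ e.symm '' K) :
    (ofChart e ζ).val x = 0 := by
  by_cases hxe : x ∈ e.source
  · rw [ofChart_val_of_mem hxe, h0 _ fun h => hx ⟨e x, h, e.left_inv hxe⟩]
    rfl
  · exact ofChart_val_of_notMem hxe

variable [IsManifold (𝓡 n) ∞ X]

theorem chartRep_ofChart (he : e ∈ atlas (EuclideanSpace ℝ (Fin n)) X)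
    {y : EuclideanSpace ℝ (Fin n)} (hy : y ∈ e.target) : chartRep (ofChart e ζ) e y = ζ y := by
  rw [chartRep_eq, ofChart_val_of_mem (e.map_target hy), e.right_inv hy]
  have h := tder_chart_comp_symm he hy
  ext v
  simp only [ContinuousAlternatingMap.compContinuousLinearMap_apply]
  congr 1
  funext i
  exact DFunLike.congr_fun h (v i)

theorem ofChart_chartRep (he : e ∈ atlas (EuclideanSpace ℝ (Fin n)) X) {η : Form n X k}
    (h0 : ∀ x ∉ e.source, η.val x = 0) : ofChart e (chartRep η e) = η := by
  funext x
  by_cases hx : x ∈ e.source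
  · exact (ofChart_val_of_mem hx).trans (form_val_eq η he hx).symm
  · exact (ofChart_val_of_notMem hx).trans (h0 x hx).symm

/-- Naturality of the exterior derivative under the transition map, which makes `dη` independent of
the chart. -/
theorem extDeriv_chartRep_transition {η : Form n X k} (hη : IsSmoothForm η)
    (he : e ∈ atlas (EuclideanSpace ℝ (Fin n)) X)
    (he' : e' ∈ atlas (EuclideanSpace ℝ (Fin n)) X) {y : EuclideanSpace ℝ (Fin n)}
    (hy : y ∈ (e.symm ≫ₕ e').source) :
    extDeriv (chartRep η e) y = (extDeriv (chartRep η e') ((e.symm ≫ₕ e') y)).compContinuousLinearMap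
      (fderiv ℝ (e.symm ≫ₕ e') y) := by
  have h1 : chartRep η e =ᶠ[nhds y] fun y => (chartRep η e'
      ((e.symm ≫ₕ e') y)).compContinuousLinearMap (fderiv ℝ (e.symm ≫ₕ e') y) := by
    filter_upwards [(e.symm ≫ₕ e').open_source.mem_nhds hy] with z hz
    exact chartRep_transition η he he' hz
  have hyt : (e.symm ≫ₕ e') y ∈ e'.target := by
    have := (e.symm ≫ₕ e').map_source hy
    rw [OpenPartialHomeomorph.trans_target] at this
    exact this.1
  rw [h1.extDeriv_eq]
  exact extDeriv_pullback (r := ∞)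
    (((hη e' he').contDiffAt (e'.open_target.mem_nhds hyt)).differentiableAt (by simp))
    (contDiffAt_transition he he' hy)
    (by simp only [minSmoothness_of_isRCLikeNormedField]; exact WithTop.coe_le_coe.mpr le_top)

theorem chartRep_ofChart_eventuallyEq_zero [T2Space X] (hK : IsCompact K) (hKe : K ⊆ e.target)
    (h0 : ∀ y ∉ K, ζ y = 0) {y : EuclideanSpace ℝ (Fin n)} (hy : y ∈ e'.target)
    (hye : e'.symm y ∉ e.source) :
    chartRep (ofChart e ζ) e' =ᶠ[nhds y] fun _ => 0 := by
  have hc : IsClosed (e.symm '' K) :=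
    (hK.image_of_continuousOn (e.continuousOn_symm.mono hKe)).isClosed
  have hyK : e'.symm y ∉ e.symm '' K := by
    rintro ⟨z, hz, hzy⟩
    exact hye (hzy ▸ e.map_target (hKe hz))
  filter_upwards [(e'.continuousAt_symm hy).preimage_mem_nhds (hc.isOpen_compl.mem_nhds hyK)]
    with z hz
  exact chartRep_zero_of (ofChart_val_eq_zero h0 hz)

theorem isSmoothForm_ofChart [T2Space X] (he : e ∈ atlas (EuclideanSpace ℝ (Fin n)) X)
    (hζ : ContDiffOn ℝ ∞ ζ e.target) (hK : IsCompact K) (hKe : K ⊆ e.target)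
    (h0 : ∀ y ∉ K, ζ y = 0) : IsSmoothForm (ofChart e ζ) := by
  intro e' he' y hy
  refine ContDiffAt.contDiffWithinAt ?_
  by_cases hye : e'.symm y ∈ e.source
  · have hys : y ∈ (e'.symm ≫ₕ e).source := by
      rw [OpenPartialHomeomorph.trans_source]
      exact ⟨hy, hye⟩
    have hT := contDiffAt_transition he' he hys
    have h1 : ContDiffAt ℝ ∞ (fun z => (ζ ((e'.symm ≫ₕ e) z)).compContinuousLinearMap
        (fderiv ℝ (e'.symm ≫ₕ e) z)) y := by
      rw [← contDiffWithinAt_univ]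
      refine contDiffWithinAt_alternating_comp (ζ := fun z => ζ ((e'.symm ≫ₕ e) z)) ?_ ?_
      · exact ContDiffAt.contDiffWithinAt (ContDiffAt.comp (g := ζ) y
          (hζ.contDiffAt (e.open_target.mem_nhds (e.map_source hye))) hT)
      · exact (hT.fderiv_right (m := ∞) (by simp)).contDiffWithinAt
    refine h1.congr_of_eventuallyEq ?_
    filter_upwards [(e'.symm ≫ₕ e).open_source.mem_nhds hys] with z hz
    have hz' : (e'.symm ≫ₕ e) z ∈ e.target := by
      have := (e'.symm ≫ₕ e).map_source hz
      rw [OpenPartialHomeomorph.trans_target] at this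
      exact this.1
    rw [chartRep_transition _ he' he hz, chartRep_ofChart he hz']
  · exact contDiffAt_const.congr_of_eventuallyEq
      (chartRep_ofChart_eventuallyEq_zero hK hKe h0 hy hye)

/-- The relation `d b = η`. -/
def IsExtDeriv (b : Form n X k) (η : Form n X (k + 1)) : Prop :=
  ∀ e ∈ atlas (EuclideanSpace ℝ (Fin n)) X, ∀ y ∈ e.target,
    extDeriv (chartRep b e) y = chartRep η e y

theorem isExtDeriv_ofChart [T2Space X] (he : e ∈ atlas (EuclideanSpace ℝ (Fin n)) X)
    (hζ : ContDiffOn ℝ ∞ ζ e.target) (hK : IsCompact K) (hKe : K ⊆ e.target)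
    (h0 : ∀ y ∉ K, ζ y = 0) : IsExtDeriv (ofChart e ζ) (ofChart e (extDeriv ζ)) := by
  intro e' he' y hy
  have hd0 : ∀ y ∉ K, extDeriv ζ y = 0 := fun y hy => by
    have h1 : ζ =ᶠ[nhds y] fun _ => 0 := by
      filter_upwards [hK.isClosed.isOpen_compl.mem_nhds hy] with z hz using h0 z hz
    rw [h1.extDeriv_eq]
    exact extDeriv_const_fun 0
  by_cases hye : e'.symm y ∈ e.source
  · have hys : y ∈ (e'.symm ≫ₕ e).source := by
      rw [OpenPartialHomeomorph.trans_source]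
      exact ⟨hy, hye⟩
    have hyt : (e'.symm ≫ₕ e) y ∈ e.target := e.map_source hye
    rw [extDeriv_chartRep_transition (isSmoothForm_ofChart he hζ hK hKe h0) he' he hys,
      chartRep_transition _ he' he hys, chartRep_ofChart he hyt]
    have h1 : chartRep (ofChart e ζ) e =ᶠ[nhds ((e'.symm ≫ₕ e) y)] ζ := by
      filter_upwards [e.open_target.mem_nhds hyt] with z hz using chartRep_ofChart he hz
    rw [h1.extDeriv_eq]
  · have h1 := chartRep_ofChart_eventuallyEq_zero hK hKe h0 hy hye
    rw [h1.extDeriv_eq, (chartRep_ofChart_eventuallyEq_zero hK hKe hd0 hy hye).self_of_nhds]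
    exact extDeriv_const_fun 0

end OfChart

/-! ### Integration by parts and the fundamental lemma on open sets -/

section Parts

variable {E : Type*} [NormedAddCommGroup E] [NormedSpace ℝ E] [MeasurableSpace E] [BorelSpace E]
  [FiniteDimensional ℝ E] {μ : Measure E} [μ.IsAddHaarMeasure] {T K : Set E} {f h : E → ℝ}

theorem setIntegral_mul_fderiv (hT : IsOpen T) (hK : IsCompact K) (hKT : K ⊆ T)
    (hf : ContDiffOn ℝ ∞ f T) (hh : ContDiff ℝ ∞ h) (h0 : ∀ y ∉ K, h y = 0) (v : E) :
    ∫ y in T, f y * fderiv ℝ h y v ∂μ = -∫ y in T, fderiv ℝ f y v * h y ∂μ := by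
  have hd0 : ∀ y ∉ K, fderiv ℝ h y = 0 := fun y hy => by
    have : h =ᶠ[nhds y] fun _ => (0 : ℝ) := by
      filter_upwards [hK.isClosed.isOpen_compl.mem_nhds hy] with z hz using h0 z hz
    rw [this.fderiv_eq]
    simp
  have hF : ContDiff ℝ ∞ (T.indicator fun y => f y * h y) :=
    contDiff_indicator hT hK.isClosed hKT (hf.mul hh.contDiffOn) fun y _ hy => by
      rw [h0 y hy, mul_zero]
  have hFc : HasCompactSupport (T.indicator fun y => f y * h y) :=
    HasCompactSupport.intro hK fun y hy => by
      by_cases hyT : y ∈ T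
      · rw [indicator_of_mem hyT, h0 y hy, mul_zero]
      · exact indicator_of_notMem hyT _
  have h1 := integral_fderiv_eq_zero (μ := μ) (hF.of_le (by simp)) hFc v
  have hFd : ∀ y ∈ T, fderiv ℝ (T.indicator fun y => f y * h y) y v =
      f y * fderiv ℝ h y v + fderiv ℝ f y v * h y := fun y hy => by
    have h2 : (T.indicator fun y => f y * h y) =ᶠ[nhds y] fun y => f y * h y := by
      filter_upwards [hT.mem_nhds hy] with z hz using indicator_of_mem hz _
    rw [h2.fderiv_eq, fderiv_fun_mul ((hf.contDiffAt (hT.mem_nhds hy)).differentiableAt (by simp))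
      (hh.differentiable (by simp) y)]
    simp only [_root_.add_apply, _root_.smul_apply, smul_eq_mul]
    ring
  have h3 : ∫ y, fderiv ℝ (T.indicator fun y => f y * h y) y v ∂μ =
      ∫ y in T, fderiv ℝ (T.indicator fun y => f y * h y) y v ∂μ := by
    symm
    refine setIntegral_eq_integral_of_forall_compl_eq_zero fun y hy => ?_
    have h2 : (T.indicator fun y => f y * h y) =ᶠ[nhds y] fun _ => (0 : ℝ) := by
      filter_upwards [hK.isClosed.isOpen_compl.mem_nhds fun h => hy (hKT h)] with z hz
      by_cases hzT : z ∈ T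
      · rw [indicator_of_mem hzT, h0 z hz, mul_zero]
      · exact indicator_of_notMem hzT _
    rw [h2.fderiv_eq]
    simp
  rw [h3, setIntegral_congr_fun hT.measurableSet hFd, integral_add] at h1
  · linarith
  · exact integrableOn_of_eq_zero_off_compact hT.measurableSet hK hKT
      (hf.continuousOn.mul ((hh.continuous_fderiv (by simp)).clm_apply
        continuous_const).continuousOn) fun y _ hy => by rw [hd0 y hy]; simp
  · exact integrableOn_of_eq_zero_off_compact hT.measurableSet hK hKT
      (((hf.continuousOn_fderiv_of_isOpen hT (by simp)).clm_apply continuousOn_const).mul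
        hh.continuous.continuousOn) fun y _ hy => by rw [h0 y hy, mul_zero]

/-- The function vanishes almost everywhere on the open set, hence everywhere there by continuity.
-/
theorem eq_zero_of_setIntegral_mul (hT : IsOpen T) (hf : ContinuousOn f T)
    (h : ∀ g : E → ℝ, ContDiff ℝ ∞ g → HasCompactSupport g → tsupport g ⊆ T →
      ∫ y in T, f y * g y ∂μ = 0) {y : E} (hy : y ∈ T) : f y = 0 := by
  have h1 : ∀ᵐ x ∂μ, x ∈ T → f x = 0 := by
    refine hT.ae_eq_zero_of_integral_contDiff_smul_eq_zero
      (hf.locallyIntegrableOn hT.measurableSet) fun g hg hgc hgT => ?_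
    rw [← h g hg hgc hgT, ← setIntegral_eq_integral_of_forall_compl_eq_zero (s := T)]
    · simp only [smul_eq_mul, mul_comm]
    · intro x hx
      rw [image_eq_zero_of_notMem_tsupport fun h => hx (hgT h), zero_smul]
  exact Measure.eqOn_open_of_ae_eq (μ := μ) (g := fun _ => 0)
    ((ae_restrict_iff' hT.measurableSet).mpr h1) hT hf continuousOn_const hy

end Parts

/-! ### Closed forms of codimension one and exact covector fields -/

section Functional

variable {n k : ℕ} {X : Type*} [TopologicalSpace X] [ChartedSpace (EuclideanSpace ℝ (Fin n)) X]
  {e : OpenPartialHomeomorph X (EuclideanSpace ℝ (Fin n))}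
  {ζ ζ' : EuclideanSpace ℝ (Fin n) → EuclideanSpace ℝ (Fin n) [⋀^Fin k]→L[ℝ] ℝ}

theorem ofChart_add : ofChart e (fun y => ζ y + ζ' y) = ofChart e ζ + ofChart e ζ' := by
  funext x
  by_cases hx : x ∈ e.source
  · refine (ofChart_val_of_mem hx).trans (Eq.trans ?_
      (congrArg₂ (· + ·) (ofChart_val_of_mem hx) (ofChart_val_of_mem hx)).symm)
    rfl
  · refine (ofChart_val_of_notMem hx).trans (Eq.trans (add_zero _).symm
      (congrArg₂ (· + ·) (ofChart_val_of_notMem hx) (ofChart_val_of_notMem hx)).symm)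

theorem ofChart_smul (c : ℝ) : ofChart e (fun y => c • ζ y) = c • ofChart e ζ := by
  funext x
  by_cases hx : x ∈ e.source
  · refine (ofChart_val_of_mem hx).trans (Eq.trans ?_
      (congrArg (c • ·) (ofChart_val_of_mem hx)).symm)
    rfl
  · refine (ofChart_val_of_notMem hx).trans (Eq.trans (smul_zero c).symm
      (congrArg (c • ·) (ofChart_val_of_notMem hx)).symm)

theorem ofChart_congr (h : ∀ y ∈ e.target, ζ y = ζ' y) : ofChart e ζ = ofChart e ζ' := by
  funext x
  by_cases hx : x ∈ e.source
  · refine (ofChart_val_of_mem hx).trans (Eq.trans ?_ (ofChart_val_of_mem hx).symm)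
    rw [h _ (e.map_source hx)]
  · exact (ofChart_val_of_notMem hx).trans (ofChart_val_of_notMem hx).symm

theorem wedgeForm_add (α : CovectorField n X) (β β' : Form n X k) :
    wedgeForm α (β + β') = wedgeForm α β + wedgeForm α β' :=
  funext fun x => wedge1_add_right (α x) (β.val x) (β'.val x)

theorem wedgeForm_smul (α : CovectorField n X) (c : ℝ) (β : Form n X k) :
    wedgeForm α (c • β) = c • wedgeForm α β :=
  funext fun x => wedge1_smul_right c (α x) (β.val x)

variable [IsManifold (𝓡 n) ∞ X]

theorem IsExtDeriv.add {b b' : Form n X k} {η η' : Form n X (k + 1)} (hb : IsSmoothForm b)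
    (hb' : IsSmoothForm b') (h : IsExtDeriv b η) (h' : IsExtDeriv b' η') :
    IsExtDeriv (b + b') (η + η') := fun e he y hy => by
  have h1 : extDeriv (chartRep b e + chartRep b' e) y =
      extDeriv (chartRep b e) y + extDeriv (chartRep b' e) y :=
    extDeriv_add (((hb e he).contDiffAt (e.open_target.mem_nhds hy)).differentiableAt (by simp))
      (((hb' e he).contDiffAt (e.open_target.mem_nhds hy)).differentiableAt (by simp))
  rw [h e he y hy, h' e he y hy] at h1
  exact h1

theorem IsExtDeriv.smul {b : Form n X k} {η : Form n X (k + 1)} (c : ℝ) (h : IsExtDeriv b η) :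
    IsExtDeriv (c • b) (c • η) := fun e he y hy => by
  have h1 : extDeriv (c • chartRep b e) y = c • extDeriv (chartRep b e) y := extDeriv_smul c _
  rw [h e he y hy] at h1
  exact h1

theorem isExtDeriv_zero : IsExtDeriv (0 : Form n X k) 0 := fun e he y hy => by
  have h1 : chartRep (0 : Form n X k) e = fun _ => 0 := funext fun y => chartRep_zero_of rfl
  rw [h1, extDeriv_const_fun]
  exact (chartRep_zero_of rfl).symm

end Functional

/-! ### The functional dual to a covector field and its local symmetry. -/

section Potential

variable {m : ℕ} {X : Type*} [TopologicalSpace X]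
  [ChartedSpace (EuclideanSpace ℝ (Fin (m + 1))) X] [IsManifold (𝓡 (m + 1)) ∞ X] [T2Space X]
  [CompactSpace X] {θ : CovectorField (m + 1) X}

/-- On exact forms the value does not depend on the primitive, because two primitives differ by a
closed form, which `θ` annihilates. The extension to all top-degree forms is purely algebraic. No
continuity is claimed, and none is used later. -/
theorem exists_dual_functional (hθ : IsSmoothCov θ)
    (h : ∀ c : Form (m + 1) X m, IsSmoothForm c → IsClosedForm c → formIntegral (wedgeForm θ c) = 0) :
    ∃ l : Form (m + 1) X (m + 1) →ₗ[ℝ] ℝ, ∀ (c : Form (m + 1) X m) (μ : Form (m + 1) X (m + 1)),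
      IsSmoothForm c → IsExtDeriv c μ → l μ = formIntegral (wedgeForm θ c) := by
  let G : Submodule ℝ (Form (m + 1) X (m + 1) × ℝ) :=
    { carrier := {z | ∃ c : Form (m + 1) X m, IsSmoothForm c ∧ IsExtDeriv c z.1 ∧
        z.2 = formIntegral (wedgeForm θ c)}
      zero_mem' := by
        refine ⟨0, isSmoothForm_zero, isExtDeriv_zero, ?_⟩
        exact (h 0 isSmoothForm_zero fun e he y hy =>
          (isExtDeriv_zero e he y hy).trans (chartRep_zero_of rfl)).symm
      add_mem' := by
        rintro ⟨μ, r⟩ ⟨μ', r'⟩ ⟨c, hc, hd, hr⟩ ⟨c', hc', hd', hr'⟩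
        refine ⟨c + c', hc.add hc', hd.add hc hc' hd', ?_⟩
        rw [wedgeForm_add, formIntegral_add (isSmoothForm_wedgeForm hθ hc).isContForm
          (isSmoothForm_wedgeForm hθ hc').isContForm, ← hr, ← hr']
        rfl
      smul_mem' := by
        rintro a ⟨μ, r⟩ ⟨c, hc, hd, hr⟩
        refine ⟨a • c, hc.smul a, hd.smul a, ?_⟩
        rw [wedgeForm_smul, formIntegral_smul, ← hr]
        rfl }
  -- `G` is the graph of the partial functional, and the condition says that it is single-valued. A
  -- functional on the product that vanishes on the graph and equals one at `(0, 1)` has minus its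
  -- first component as the extension.
  have hG : ((0 : Form (m + 1) X (m + 1)), (1 : ℝ)) ∉ G := by
    rintro ⟨c, hc, hd, hr⟩
    rw [h c hc fun e he y hy => (hd e he y hy).trans (chartRep_zero_of rfl)] at hr
    exact one_ne_zero hr
  obtain ⟨g, hg, hg1⟩ := LinearMap.exists_extend_of_notMem (0 : G →ₗ[ℝ] ℝ) hG 1
  refine ⟨-(g.comp (LinearMap.inl ℝ _ ℝ)), fun c μ hc hd => ?_⟩
  have h1 : g (μ, formIntegral (wedgeForm θ c)) = 0 := 
    DFunLike.congr_fun hg (⟨(μ, formIntegral (wedgeForm θ c)), c, hc, hd, rfl⟩ : G)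
  have h2 : ((μ, formIntegral (wedgeForm θ c)) : Form (m + 1) X (m + 1) × ℝ) =
      (μ, 0) + formIntegral (wedgeForm θ c) • ((0 : Form (m + 1) X (m + 1)), (1 : ℝ)) := by
    simp
  rw [h2, map_add, map_smul, hg1, smul_eq_mul, mul_one] at h1
  have h3 : (-(g.comp (LinearMap.inl ℝ (Form (m + 1) X (m + 1)) ℝ))) μ = -g (μ, 0) := rfl
  rw [h3]
  linarith

variable {e : OpenPartialHomeomorph X (EuclideanSpace ℝ (Fin (m + 1)))}
  {K : Set (EuclideanSpace ℝ (Fin (m + 1)))} {h : EuclideanSpace ℝ (Fin (m + 1)) → ℝ}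
  {l : Form (m + 1) X (m + 1) →ₗ[ℝ] ℝ}

/-- The form `c = h · i_v vol` satisfies `dc = (∂_v h) vol` and `θ ∧ c = θ(v) h vol`. -/
theorem dual_functional_fderiv (hX : IsOrientedAtlas (m + 1) X) (hθ : IsSmoothCov θ)
    (hl : ∀ (c : Form (m + 1) X m) (μ : Form (m + 1) X (m + 1)),
      IsSmoothForm c → IsExtDeriv c μ → l μ = formIntegral (wedgeForm θ c))
    (he : e ∈ atlas (EuclideanSpace ℝ (Fin (m + 1))) X) (hh : ContDiff ℝ ∞ h) (hK : IsCompact K)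
    (hKe : K ⊆ e.target) (h0 : ∀ y ∉ K, h y = 0) (v : EuclideanSpace ℝ (Fin (m + 1))) :
    l (ofChart e fun y => fderiv ℝ h y v • volForm (m + 1)) =
      ∫ y in e.target, coRep θ e y v * h y := by
  let ζ : EuclideanSpace ℝ (Fin (m + 1)) → EuclideanSpace ℝ (Fin (m + 1)) [⋀^Fin m]→L[ℝ] ℝ :=
    fun y => h y • (volForm (m + 1)).curryLeft v
  have hζ : ContDiffOn ℝ ∞ ζ e.target := (hh.smul contDiff_const).contDiffOn
  have hζ0 : ∀ y ∉ K, ζ y = 0 := fun y hy => by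
    show h y • _ = _
    rw [h0 y hy, zero_smul]
  have hd : extDeriv ζ = fun y => fderiv ℝ h y v • volForm (m + 1) := funext fun y => by
    refine (extDeriv_fun_mul (hh.differentiable (by simp) y) (differentiableAt_const _)).trans ?_
    rw [extDeriv_const_fun, smul_zero, add_zero, wedge1_volForm]
  have hc := isSmoothForm_ofChart he hζ hK hKe hζ0
  have h1 := hl _ _ hc (isExtDeriv_ofChart he hζ hK hKe hζ0)
  rw [hd] at h1
  rw [h1, formIntegral_eq_chartIntegral hX he (isSmoothForm_wedgeForm hθ hc).isContForm
    (hK.image_of_continuousOn (e.continuousOn_symm.mono hKe)) (by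
      rintro _ ⟨y, hy, rfl⟩
      exact e.map_target (hKe hy)) fun x hx => by
        rw [wedgeForm_val, ofChart_val_eq_zero hζ0 hx, wedge1_zero_right]]
  refine setIntegral_congr_fun e.open_target.measurableSet fun y hy => ?_
  show chartRep (wedgeForm θ (ofChart e ζ)) e y _ = _
  rw [chartRep_wedgeForm, chartRep_ofChart he hy, wedge1_smul_right, wedge1_volForm,
    ContinuousAlternatingMap.smul_apply, ContinuousAlternatingMap.smul_apply, volForm_basisFun]
  simp only [smul_eq_mul, mul_one]
  ring

/-- The covector field is weakly closed: evaluating `l` on `∂_v ∂_w g vol` in the two orders and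
integrating by parts shows that the antisymmetric part of the derivative integrates to zero against
every test function `g`. -/
theorem fderiv_coRep_symm (hX : IsOrientedAtlas (m + 1) X) (hθ : IsSmoothCov θ)
    (hl : ∀ (c : Form (m + 1) X m) (μ : Form (m + 1) X (m + 1)),
      IsSmoothForm c → IsExtDeriv c μ → l μ = formIntegral (wedgeForm θ c))
    (he : e ∈ atlas (EuclideanSpace ℝ (Fin (m + 1))) X) {y : EuclideanSpace ℝ (Fin (m + 1))}
    (hy : y ∈ e.target) (v w : EuclideanSpace ℝ (Fin (m + 1))) :
    fderiv ℝ (coRep θ e) y v w = fderiv ℝ (coRep θ e) y w v := by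
  have hθe := hθ e he
  have happ : ∀ u, ContDiffOn ℝ ∞ (fun y => coRep θ e y u) e.target := fun u =>
    hθe.clm_apply contDiffOn_const
  have happd : ∀ u u', ∀ y ∈ e.target, fderiv ℝ (fun y => coRep θ e y u) y u' =
      fderiv ℝ (coRep θ e) y u' u := fun u u' y hy => by
    rw [fderiv_clm_apply ((hθe.contDiffAt (e.open_target.mem_nhds hy)).differentiableAt (by simp))
      (differentiableAt_const _)]
    simp
  have hcont : ∀ u u', ContinuousOn (fun y => fderiv ℝ (coRep θ e) y u u') e.target := fun u u' =>
    ((hθe.continuousOn_fderiv_of_isOpen e.open_target (by simp)).clm_apply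
      continuousOn_const).clm_apply continuousOn_const
  rw [← sub_eq_zero]
  refine eq_zero_of_setIntegral_mul (μ := volume) (T := e.target)
    (f := fun y => fderiv ℝ (coRep θ e) y v w - fderiv ℝ (coRep θ e) y w v) e.open_target
    ((hcont v w).sub (hcont w v)) (fun g hg hgc hgT => ?_) hy
  have hg0 : ∀ y ∉ tsupport g, g y = 0 := fun y hy => image_eq_zero_of_notMem_tsupport hy
  have key : ∀ u u', l (ofChart e fun y => fderiv ℝ (fun z => fderiv ℝ g z u) y u' •
      volForm (m + 1)) = -∫ y in e.target, fderiv ℝ (coRep θ e) y u u' * g y := fun u u' => by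
    have hgu : ContDiff ℝ ∞ fun z => fderiv ℝ g z u :=
      (hg.fderiv_right (m := ∞) (by simp)).clm_apply contDiff_const
    have hgu0 : ∀ y ∉ tsupport g, fderiv ℝ g y u = 0 := fun y hy => by
      rw [fderiv_of_notMem_tsupport ℝ hy]
      rfl
    rw [dual_functional_fderiv hX hθ hl he hgu hgc hgT hgu0, setIntegral_mul_fderiv e.open_target
      hgc hgT (happ u') hg hg0]
    congr 1
    refine setIntegral_congr_fun e.open_target.measurableSet fun y hy => ?_
    show _ * _ = _ * _
    rw [happd u' u y hy]
  have hsymm : (fun y => fderiv ℝ (fun z => fderiv ℝ g z v) y w • volForm (m + 1)) =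
      fun y => fderiv ℝ (fun z => fderiv ℝ g z w) y v • volForm (m + 1) := funext fun y => by
    have h2 : IsSymmSndFDerivAt ℝ g y := hg.contDiffAt.isSymmSndFDerivAt (n := ∞) (by
      simp only [minSmoothness_of_isRCLikeNormedField]; exact WithTop.coe_le_coe.mpr le_top)
    have h3 : ∀ u u', fderiv ℝ (fun z => fderiv ℝ g z u) y u' = fderiv ℝ (fderiv ℝ g) y u' u :=
      fun u u' => by
        rw [fderiv_clm_apply ((hg.fderiv_right (m := ∞) (by simp)).differentiable (by simp) y)
          (differentiableAt_const _)]
        simp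
    rw [h3, h3, h2.eq]
  have h4 := key v w
  rw [hsymm, key w v, neg_inj] at h4
  have hint : ∀ u u', IntegrableOn (fun y => fderiv ℝ (coRep θ e) y u u' * g y) e.target :=
    fun u u' => integrableOn_of_eq_zero_off_compact e.open_target.measurableSet hgc hgT
      ((hcont u u').mul hg.continuous.continuousOn) fun y _ hy => by rw [hg0 y hy, mul_zero]
  simp only [sub_mul]
  rw [integral_sub (hint v w) (hint w v), h4, sub_self]

end Potential

/-! ### The potential of a covector field that annihilates closed forms -/

section Potential

/-- The open cube of half-side `r` around `a`. -/
def openBox {n : ℕ} (a : EuclideanSpace ℝ (Fin n)) (r : ℝ) : Set (EuclideanSpace ℝ (Fin n)) :=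
  {z | ∀ j, |z j - a j| < r}

theorem openBox_eq {n : ℕ} {a : EuclideanSpace ℝ (Fin n)} {r : ℝ} (hr : 0 < r) :
    openBox a r = EuclideanSpace.equiv (Fin n) ℝ ⁻¹'
      Metric.ball (EuclideanSpace.equiv (Fin n) ℝ a) r := by
  ext z
  rw [mem_preimage, Metric.mem_ball, dist_pi_lt_iff hr]
  rfl

theorem isOpen_openBox {n : ℕ} {a : EuclideanSpace ℝ (Fin n)} {r : ℝ} (hr : 0 < r) :
    IsOpen (openBox a r) := by
  rw [openBox_eq hr]
  exact Metric.isOpen_ball.preimage (EuclideanSpace.equiv (Fin n) ℝ).continuous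

theorem convex_openBox {n : ℕ} {a : EuclideanSpace ℝ (Fin n)} {r : ℝ} (hr : 0 < r) :
    Convex ℝ (openBox a r) := by
  rw [openBox_eq hr]
  exact (convex_ball _ _).linear_preimage (EuclideanSpace.equiv (Fin n) ℝ).toLinearMap

theorem exists_openBox_subset {n : ℕ} {a : EuclideanSpace ℝ (Fin n)}
    {T : Set (EuclideanSpace ℝ (Fin n))} (hT : T ∈ nhds a) : ∃ r > 0, openBox a r ⊆ T := by
  have h := (EuclideanSpace.equiv (Fin n) ℝ).symm.continuous.continuousAt
    (x := EuclideanSpace.equiv (Fin n) ℝ a)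
  have h2 : (EuclideanSpace.equiv (Fin n) ℝ).symm ⁻¹' T ∈
      nhds (EuclideanSpace.equiv (Fin n) ℝ a) := h (by simpa using hT)
  obtain ⟨r, hr, hs⟩ := Metric.mem_nhds_iff.mp h2
  refine ⟨r, hr, fun z hz => ?_⟩
  rw [openBox_eq hr] at hz
  simpa using hs hz

variable {m : ℕ} {X : Type*} [TopologicalSpace X]
  [ChartedSpace (EuclideanSpace ℝ (Fin (m + 1))) X] [IsManifold (𝓡 (m + 1)) ∞ X] [T2Space X]
  [CompactSpace X] {θ : CovectorField (m + 1) X} {l : Form (m + 1) X (m + 1) →ₗ[ℝ] ℝ}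

/-- On a box the Poincaré lemma gives a potential `f`. By integration by parts `l + ∫ f ·` does not
see derivatives, so it is a constant `C` times the integral. Replacing `f` by `f - C` absorbs the
constant, which ties the potential to `l`. -/
theorem exists_chart_potential (hX : IsOrientedAtlas (m + 1) X) (hθ : IsSmoothCov θ)
    (hl : ∀ (c : Form (m + 1) X m) (μ : Form (m + 1) X (m + 1)),
      IsSmoothForm c → IsExtDeriv c μ → l μ = formIntegral (wedgeForm θ c))
    {e : OpenPartialHomeomorph X (EuclideanSpace ℝ (Fin (m + 1)))}
    (he : e ∈ atlas (EuclideanSpace ℝ (Fin (m + 1))) X) {a : EuclideanSpace ℝ (Fin (m + 1))}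
    {r : ℝ} (hr : 0 < r) (hrT : openBox a r ⊆ e.target) :
    ∃ f : EuclideanSpace ℝ (Fin (m + 1)) → ℝ, ContDiffOn ℝ ∞ f (openBox a r) ∧
      (∀ y ∈ openBox a r, fderiv ℝ f y = coRep θ e y) ∧
      ∀ g, IsTestFun a r g → l (ofChart e fun y => g y • volForm (m + 1)) =
        -∫ y in openBox a r, f y * g y := by
  have hQ := isOpen_openBox (a := a) hr
  have hθQ := (hθ e he).mono hrT
  obtain ⟨f, hf⟩ := (convex_openBox (a := a) hr).exists_forall_hasFDerivAt_of_fderiv_symmetric hQ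
    (hθQ.differentiableOn (by simp))
    fun y hy v w => fderiv_coRep_symm hX hθ hl he (hrT hy) v w
  have hfs : ContDiffOn ℝ ∞ f (openBox a r) := by
    rw [contDiffOn_infty_iff_fderiv_of_isOpen hQ]
    exact ⟨fun y hy => (hf y hy).differentiableAt.differentiableWithinAt,
      hθQ.congr fun y hy => (hf y hy).fderiv⟩
  have hbox : ∀ g, IsTestFun a r g → ∃ K, IsCompact K ∧ K ⊆ openBox a r ∧ ∀ y ∉ K, g y = 0 := by
    rintro g ⟨-, r', hr', h⟩
    exact ⟨_, isCompact_box a r', fun z hz j => (hz j).trans_lt hr', fun y hy =>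
      of_not_not fun h0 => hy (h y h0)⟩
  have hint : ∀ g, IsTestFun a r g → IntegrableOn (fun y => f y * g y) (openBox a r) := by
    intro g hg
    obtain ⟨K, hK, hKQ, h0⟩ := hbox g hg
    exact integrableOn_of_eq_zero_off_compact hQ.measurableSet hK hKQ
      (hfs.continuousOn.mul hg.1.continuous.continuousOn) fun y _ hy => by rw [h0 y hy, mul_zero]
  let A : (EuclideanSpace ℝ (Fin (m + 1)) → ℝ) → ℝ := fun g =>
    l (ofChart e fun y => g y • volForm (m + 1)) + ∫ y in openBox a r, f y * g y
  have hA : IsDerivInvariant a r A := by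
    intro i g g' h hg hg' hh hd
    obtain ⟨K, hK, hKQ, h0⟩ := hbox h hh
    have h1 := dual_functional_fderiv hX hθ hl he hh.1 hK (hKQ.trans hrT) h0
      (EuclideanSpace.single i 1)
    have h2 := setIntegral_mul_fderiv (μ := volume) hQ hK hKQ hfs hh.1 h0
      (EuclideanSpace.single i 1)
    rw [setIntegral_eq_of_subset_of_forall_sdiff_eq_zero e.open_target.measurableSet hrT
      (fun y hy => by rw [h0 y fun h => hy.2 (hKQ h), mul_zero])] at h1
    have h3 : ∫ y in openBox a r, fderiv ℝ f y (EuclideanSpace.single i 1) * h y =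
        ∫ y in openBox a r, coRep θ e y (EuclideanSpace.single i 1) * h y :=
      setIntegral_congr_fun hQ.measurableSet fun y hy => by
        show _ * _ = _ * _
        rw [(hf y hy).fderiv]
    have h4 : (fun y => g y • volForm (m + 1)) = fun y => g' y • volForm (m + 1) +
        fderiv ℝ h y (EuclideanSpace.single i 1) • volForm (m + 1) := funext fun y => by
      rw [← hd, ← add_smul, add_sub_cancel]
    have h5 : ∫ y in openBox a r, f y * fderiv ℝ h y (EuclideanSpace.single i 1) =
        (∫ y in openBox a r, f y * g y) - ∫ y in openBox a r, f y * g' y := by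
      rw [← integral_sub (hint g hg) (hint g' hg')]
      refine setIntegral_congr_fun hQ.measurableSet fun y hy => ?_
      show _ * _ = _ - _
      rw [← hd]
      ring
    show l _ + _ = l _ + _
    rw [h4, ofChart_add, map_add, h1]
    linarith
  obtain ⟨C, hC⟩ := exists_eq_mul_integral hr hA fun g hg c => by
    show l _ + _ = (l _ + _) * _
    have h1 : (fun y => (g y * c) • volForm (m + 1)) = fun y => c • g y • volForm (m + 1) :=
      funext fun y => by rw [smul_smul, mul_comm]
    rw [h1, ofChart_smul, map_smul, smul_eq_mul, add_mul, mul_comm c, ← integral_mul_const]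
    simp only [mul_assoc]
  refine ⟨fun y => f y - C, hfs.sub contDiffOn_const, fun y hy => ?_, fun g hg => ?_⟩
  · rw [fderiv_sub_const]
    exact (hf y hy).fderiv
  · have h1 : l (ofChart e fun y => g y • volForm (m + 1)) + ∫ y in openBox a r, f y * g y =
      C * ∫ z, g z := hC g hg
    obtain ⟨K, hK, hKQ, h0⟩ := hbox g hg
    have h2 : ∫ z, g z = ∫ z in openBox a r, g z :=
      (setIntegral_eq_integral_of_forall_compl_eq_zero fun y hy => h0 y fun h => hy (hKQ h)).symm
    have h3 : ∫ y in openBox a r, (f y - C) * g y =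
        (∫ y in openBox a r, f y * g y) - C * ∫ y in openBox a r, g y := by
      rw [← integral_const_mul, ← integral_sub (hint g hg)]
      · simp only [sub_mul]
      · exact ((hg.1.continuous.integrable_of_hasCompactSupport hg.hasCompactSupport).integrableOn).const_mul C
    rw [h3, ← h2]
    linarith

theorem exists_local_potential (hX : IsOrientedAtlas (m + 1) X) (hθ : IsSmoothCov θ)
    (hl : ∀ (c : Form (m + 1) X m) (μ : Form (m + 1) X (m + 1)),
      IsSmoothForm c → IsExtDeriv c μ → l μ = formIntegral (wedgeForm θ c)) (p : X) :
    ∃ U : Set X, IsOpen U ∧ p ∈ U ∧ U ⊆ (chartAt (EuclideanSpace ℝ (Fin (m + 1))) p).source ∧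
      ∃ f : X → ℝ, ContMDiffOn (𝓡 (m + 1)) 𝓘(ℝ, ℝ) ∞ f U ∧ (∀ x ∈ U, dfun f x = θ x) ∧
        ∀ (μ : Form (m + 1) X (m + 1)) (K : Set X), IsSmoothForm μ → IsCompact K → K ⊆ U →
          (∀ x ∉ K, μ.val x = 0) →
          l μ = -chartIntegral (chartAt (EuclideanSpace ℝ (Fin (m + 1))) p) (fmul f μ) := by
  have he := chart_mem_atlas (EuclideanSpace ℝ (Fin (m + 1))) p
  have hp := mem_chart_source (EuclideanSpace ℝ (Fin (m + 1))) p
  set e := chartAt (EuclideanSpace ℝ (Fin (m + 1))) p with hedef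
  obtain ⟨r, hr, hrT⟩ := exists_openBox_subset (e.open_target.mem_nhds (e.map_source hp))
  obtain ⟨f, hf, hfd, hfl⟩ := exists_chart_potential hX hθ hl he hr hrT
  -- Half the side leaves a margin, so that forms supported here are test functions for the full
  -- box.
  have hU : IsOpen (e.source ∩ e ⁻¹' openBox (e p) (r / 2)) :=
    e.isOpen_inter_preimage (isOpen_openBox (half_pos hr))
  have hQ := isOpen_openBox (a := e p) hr
  have hsub : ∀ x ∈ e.source ∩ e ⁻¹' openBox (e p) (r / 2), e x ∈ openBox (e p) r :=
    fun x hx j => (hx.2 j).trans (half_lt_self hr)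
  have hfm : ∀ x ∈ e.source ∩ e ⁻¹' openBox (e p) (r / 2),
      ContMDiffAt (𝓡 (m + 1)) 𝓘(ℝ, ℝ) ∞ (fun x => f (e x)) x := fun x hx =>
    ContMDiffAt.comp (I' := 𝓡 (m + 1)) (g := f) x
      ((hf.contDiffAt (hQ.mem_nhds (hsub x hx))).contMDiffAt) (contMDiffAt_chart he hx.1)
  refine ⟨_, hU, ⟨hp, fun j => by simpa using hr⟩, inter_subset_left, fun x => f (e x),
    fun x hx => (hfm x hx).contMDiffWithinAt, fun x hx => ?_, fun μ K hμ hK hKU h0 => ?_⟩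
  · rw [cov_eq (dfun fun x => f (e x)) he hx.1, cov_eq θ he hx.1, coRep_dfun he (e.map_source hx.1)
      (by rw [e.left_inv hx.1]; exact (hfm x hx).mdifferentiableAt (by simp)),
      ← hfd _ (hsub x hx)]
    congr 1
    refine Filter.EventuallyEq.fderiv_eq ?_
    filter_upwards [e.open_target.mem_nhds (e.map_source hx.1)] with z hz
    rw [e.right_inv hz]
  · have hKe : K ⊆ e.source := hKU.trans inter_subset_left
    have heK := hK.image_of_continuousOn (e.continuousOn.mono hKe)
    have heKT : e '' K ⊆ e.target := by
      rintro _ ⟨x, hx, rfl⟩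
      exact e.map_source (hKe hx)
    let g := e.target.indicator fun y => chartRep μ e y (EuclideanSpace.basisFun _ ℝ)
    have hrep0 : ∀ y ∈ e.target, y ∉ e '' K → chartRep μ e y = 0 := fun y hy hyK =>
      chartRep_zero_of (h0 _ fun h => hyK ⟨_, h, e.right_inv hy⟩)
    have hg : IsTestFun (e p) r g := by
      refine ⟨contDiff_indicator e.open_target heK.isClosed heKT (fun y hy =>
        contDiffWithinAt_alternating_apply (v := fun _ => EuclideanSpace.basisFun _ ℝ)
          (hμ e he y hy) fun _ => contDiffWithinAt_const) fun y hy hyK => by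
            rw [hrep0 y hy hyK]; rfl, r / 2, half_lt_self hr, fun z hz j => ?_⟩
      have hzT : z ∈ e.target := of_not_not fun h => hz (indicator_of_notMem h _)
      have hzK : z ∈ e '' K := of_not_not fun h => hz (by
        show e.target.indicator _ z = 0
        rw [indicator_of_mem hzT, hrep0 z hzT h]; rfl)
      obtain ⟨x, hx, rfl⟩ := hzK
      exact ((hKU hx).2 j).le
    have hμe : μ = ofChart e fun y => g y • volForm (m + 1) := by
      refine (ofChart_chartRep he fun x hx => h0 x fun h => hx (hKe h)).symm.trans
        (ofChart_congr fun y hy => ?_)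
      refine (eq_smul_volForm (chartRep μ e y)).trans ?_
      show _ = e.target.indicator _ y • _
      rw [indicator_of_mem hy]
    conv_lhs => rw [hμe]
    rw [hfl g hg, chartIntegral]
    congr 1
    rw [← setIntegral_eq_of_subset_of_forall_sdiff_eq_zero e.open_target.measurableSet hrT
      (f := fun y => f y * g y)]
    · refine setIntegral_congr_fun e.open_target.measurableSet fun y hy => ?_
      show f y * e.target.indicator _ y = _
      rw [indicator_of_mem hy, chartRep_fmul, ContinuousAlternatingMap.smul_apply, smul_eq_mul,
        e.right_inv hy]
    · intro y hy
      have hyK : y ∉ e '' K := by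
        rintro ⟨x, hx, rfl⟩
        exact hy.2 (hsub x (hKU hx))
      show f y * e.target.indicator _ y = 0
      rw [indicator_of_mem hy.1, hrep0 y hy.1 hyK]
      exact mul_zero _

/-- A smooth covector field whose wedge products with all closed forms integrate to zero is
exact. -/
theorem exists_potential (hX : IsOrientedAtlas (m + 1) X) (hθ : IsSmoothCov θ)
    (h : ∀ c : Form (m + 1) X m, IsSmoothForm c → IsClosedForm c →
      formIntegral (wedgeForm θ c) = 0) :
    ∃ f : X → ℝ, ContMDiff (𝓡 (m + 1)) 𝓘(ℝ, ℝ) ∞ f ∧ ∀ x, dfun f x = θ x := by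
  obtain ⟨l, hl⟩ := exists_dual_functional hθ h
  choose U hU hpU hUe f hf hfθ hfl using exists_local_potential hX hθ hl
  -- Two local potentials represent `-l` against the same forms supported in the overlap, so they
  -- coincide there and no constants have to be adjusted.
  have key : ∀ p q x, x ∈ U p → x ∈ U q → f p x = f q x := by
    intro p q x hxp hxq
    have he := chart_mem_atlas (EuclideanSpace ℝ (Fin (m + 1))) p
    have he' := chart_mem_atlas (EuclideanSpace ℝ (Fin (m + 1))) q
    have hUp := hUe p
    have hfp := hfl p
    set e := chartAt (EuclideanSpace ℝ (Fin (m + 1))) p with hedef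
    have hV : IsOpen (e.target ∩ e.symm ⁻¹' (U p ∩ U q)) :=
      e.isOpen_inter_preimage_symm ((hU p).inter (hU q))
    set T := e.target ∩ e.symm ⁻¹' (U p ∩ U q) with hT
    have hcont : ∀ s : X, U p ∩ U q ⊆ U s → ContinuousOn (fun y => f s (e.symm y)) T :=
      fun s hs => (hf s).continuousOn.comp (e.continuousOn_symm.mono inter_subset_left)
        fun y hy => hs hy.2
    have hxT : e x ∈ T := ⟨e.map_source (hUp hxp), by
      rw [mem_preimage, e.left_inv (hUp hxp)]
      exact ⟨hxp, hxq⟩⟩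
    have hcp := hcont p inter_subset_left
    have hcq := hcont q inter_subset_right
    have h1 := eq_zero_of_setIntegral_mul (μ := volume) (T := T)
      (f := fun y => f p (e.symm y) - f q (e.symm y)) hV (hcp.sub hcq) (fun g hg hgc hgT => ?_) hxT
    · simp only [e.left_inv (hUp hxp)] at h1
      exact sub_eq_zero.mp h1
    have hg0 : ∀ y ∉ tsupport g, g y = 0 := fun y hy => image_eq_zero_of_notMem_tsupport hy
    have hgv0 : ∀ y ∉ tsupport g, g y • volForm (m + 1) = 0 := fun y hy => by
      rw [hg0 y hy, zero_smul]
    have hgT' : tsupport g ⊆ e.target := hgT.trans inter_subset_left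
    have hμ := isSmoothForm_ofChart he (ζ := fun y => g y • volForm (m + 1))
      (hg.smul contDiff_const).contDiffOn hgc hgT' hgv0
    have hKc := hgc.image_of_continuousOn (e.continuousOn_symm.mono hgT')
    have hK : e.symm '' tsupport g ⊆ U p ∩ U q := by
      rintro _ ⟨y, hy, rfl⟩
      exact (hgT hy).2
    have hμ0 : ∀ x ∉ e.symm '' tsupport g,
        (ofChart e fun y => g y • volForm (m + 1)).val x = 0 := fun x hx =>
      ofChart_val_eq_zero hgv0 hx
    have h2 := hfp _ _ hμ hKc (hK.trans inter_subset_left) hμ0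
    have h3 := hfl q _ _ hμ hKc (hK.trans inter_subset_right) hμ0
    rw [chartIntegral_eq hX he' he _ fun x hx => ?_, h2, neg_inj] at h3
    swap
    · have hxK : x ∈ e.symm '' tsupport g := of_not_not fun h => hx (by
        rw [fmul_val, hμ0 x h, smul_zero])
      exact ⟨hUe q (hK hxK).2, hUp (hK hxK).1⟩
    have h4 : ∀ s : X, chartIntegral e (fmul (f s) (ofChart e fun y => g y • volForm (m + 1))) =
        ∫ y in T, f s (e.symm y) * g y := fun s => by
      rw [chartIntegral, ← setIntegral_eq_of_subset_of_forall_sdiff_eq_zero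
        e.open_target.measurableSet (inter_subset_left : T ⊆ e.target)
        (f := fun y => f s (e.symm y) * g y)
        (fun y hy => by rw [hg0 y fun h => hy.2 (hgT h), mul_zero])]
      refine setIntegral_congr_fun e.open_target.measurableSet fun y hy => ?_
      show chartRep _ e y _ = _
      rw [chartRep_fmul, chartRep_ofChart he hy, ContinuousAlternatingMap.smul_apply,
        ContinuousAlternatingMap.smul_apply, volForm_basisFun]
      simp
    have h5 : ∀ s, ContinuousOn (fun y => f s (e.symm y)) T →
        IntegrableOn (fun y => f s (e.symm y) * g y) T := fun s hs =>
      integrableOn_of_eq_zero_off_compact hV.measurableSet hgc hgT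
        (hs.mul hg.continuous.continuousOn) fun y _ hy => by rw [hg0 y hy, mul_zero]
    rw [h4, h4] at h3
    simp only [sub_mul]
    rw [integral_sub (h5 p hcp) (h5 q hcq), h3, sub_self]
  have hloc : ∀ p, (fun x => f x x) =ᶠ[nhds p] f p := fun p => by
    filter_upwards [(hU p).mem_nhds (hpU p)] with x hx using key x p x (hpU x) hx
  refine ⟨fun x => f x x, fun p => ?_, fun p => ?_⟩
  · exact ((hf p).contMDiffAt ((hU p).mem_nhds (hpU p))).congr_of_eventuallyEq (hloc p)
  · rw [← hfθ p p (hpU p), dfun, dfun]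
    exact tder_eventuallyEq (by rw [nhdsWithin_univ]; exact hloc p) rfl

end Potential

/-! ### Linear algebra of contractions -/

section Algebra

/-- The coordinates of `v` are recovered by wedging `i_v vol` with the coordinate covectors. -/
theorem volForm_curryLeft_injective {n : ℕ} :
    Injective fun v : EuclideanSpace ℝ (Fin (n + 1)) => (volForm (n + 1)).curryLeft v := by
  intro v w h
  ext i
  have h1 := wedge1_volForm (EuclideanSpace.proj (𝕜 := ℝ) i) v
  have h2 := wedge1_volForm (EuclideanSpace.proj (𝕜 := ℝ) i) w
  have h3 : (volForm (n + 1)).curryLeft v = (volForm (n + 1)).curryLeft w := h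
  rw [h3, h2] at h1
  have h4 := congrArg (fun η => η (EuclideanSpace.basisFun (Fin (n + 1)) ℝ)) h1
  rw [ContinuousAlternatingMap.smul_apply, ContinuousAlternatingMap.smul_apply,
    volForm_basisFun] at h4
  simpa using h4.symm

theorem alternating_two_apply_swap {E : Type*} [NormedAddCommGroup E] [NormedSpace ℝ E]
    (c : E [⋀^Fin 2]→L[ℝ] ℝ) (u v : E) : c ![u, v] = -c ![v, u] := by
  have h := c.toAlternatingMap.map_swap ![v, u] (i := 0) (j := 1) (by decide)
  have h2 : (![v, u] ∘ Equiv.swap (0 : Fin 2) 1) = ![u, v] := by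
    funext i
    fin_cases i <;> rfl
  rw [h2] at h
  exact h

theorem volForm_curryLeft_surjective (c : EuclideanSpace ℝ (Fin 3) [⋀^Fin 2]→L[ℝ] ℝ) :
    ∃ v, (volForm 3).curryLeft v = c := by
  let b := EuclideanSpace.basisFun (Fin 3) ℝ
  -- The coefficients come from `i_{e₀} vol = e¹ ∧ e²`, `i_{e₁} vol = -e⁰ ∧ e²` and `i_{e₂} vol = e⁰
  -- ∧ e¹`.
  refine ⟨c ![b 1, b 2] • b 0 - c ![b 0, b 2] • b 1 + c ![b 0, b 1] • b 2, ?_⟩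
  have hv : ∀ u v w : EuclideanSpace ℝ (Fin 3), volForm 3 ![u, v, w] = frameDet ![u, v, w] :=
    fun u v w => by rw [topForm_apply, volForm_basisFun, mul_one]
  have key : ∀ u i j, ((volForm 3).curryLeft u) ![b i, b j] = frameDet ![u, b i, b j] :=
    fun u i j => by
      rw [← hv]
      rfl
  have hb : ∀ i j : Fin 3, b i j = if j = i then 1 else 0 := fun i j => by
    simp [b]
  apply ContinuousAlternatingMap.toAlternatingMap_injective
  refine Module.Basis.ext_alternating b.toBasis fun v hvi => ?_
  have hvv : (fun i => b.toBasis (v i)) = ![b (v 0), b (v 1)] := by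
    funext i
    fin_cases i <;> simp
  rw [hvv]
  show ((volForm 3).curryLeft _) ![b (v 0), b (v 1)] = c ![b (v 0), b (v 1)]
  have hne : v 0 ≠ v 1 := fun h => by simpa using hvi h
  rw [key]
  generalize v 0 = i at hne
  generalize v 1 = j at hne
  rw [frameDet, Matrix.det_fin_three]
  have s1 := alternating_two_apply_swap c (b 1) (b 0)
  have s2 := alternating_two_apply_swap c (b 2) (b 0)
  have s3 := alternating_two_apply_swap c (b 2) (b 1)
  fin_cases i <;> fin_cases j <;> first | exact absurd rfl hne | simp [hb, s1, s2, s3]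

/-- Contraction with the volume form of `ℝ³`. -/
def volEquiv : EuclideanSpace ℝ (Fin 3) ≃L[ℝ] (EuclideanSpace ℝ (Fin 3) [⋀^Fin 2]→L[ℝ] ℝ) :=
  (LinearEquiv.ofBijective
    { toFun := fun v => (volForm 3).curryLeft v
      map_add' := fun v w => map_add _ v w
      map_smul' := fun a v => map_smul _ a v }
    ⟨volForm_curryLeft_injective, volForm_curryLeft_surjective⟩).toContinuousLinearEquiv

theorem wedge1_volEquiv (α : EuclideanSpace ℝ (Fin 3) →L[ℝ] ℝ) (u : EuclideanSpace ℝ (Fin 3)) :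
    wedge1 α (volEquiv u) = α u • volForm 3 := wedge1_volForm α u

/-- The linear map `w ↦ (i_w α)|_V` for a subspace `V` given by a linear map `D`. -/
def contrLin {n m k : ℕ} (α : EuclideanSpace ℝ (Fin m) [⋀^Fin (k + 1)]→L[ℝ] ℝ)
    (D : EuclideanSpace ℝ (Fin n) →L[ℝ] EuclideanSpace ℝ (Fin m)) :
    EuclideanSpace ℝ (Fin m) →ₗ[ℝ] (EuclideanSpace ℝ (Fin n) [⋀^Fin k]→L[ℝ] ℝ) where
  toFun w := (α.curryLeft w).compContinuousLinearMap D
  map_add' v w := by rw [map_add]; rfl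
  map_smul' a w := by rw [map_smul]; rfl

theorem contrLin_apply {n m k : ℕ} (α : EuclideanSpace ℝ (Fin m) [⋀^Fin (k + 1)]→L[ℝ] ℝ)
    (D : EuclideanSpace ℝ (Fin n) →L[ℝ] EuclideanSpace ℝ (Fin m)) (w : EuclideanSpace ℝ (Fin m))
    (v : Fin k → EuclideanSpace ℝ (Fin n)) :
    contrLin α D w v = α (Fin.cons w fun i => D (v i)) := rfl

theorem contrLin_map {n m k : ℕ} (α : EuclideanSpace ℝ (Fin m) [⋀^Fin (k + 1)]→L[ℝ] ℝ)
    (D : EuclideanSpace ℝ (Fin n) →L[ℝ] EuclideanSpace ℝ (Fin m)) (u : EuclideanSpace ℝ (Fin n)) :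
    contrLin α D (D u) = (α.compContinuousLinearMap D).curryLeft u := by
  ext v
  rw [contrLin_apply]
  show _ = α (D ∘ Fin.cons u v)
  congr 1
  funext j
  refine Fin.cases rfl (fun j => rfl) j

variable {r s : EuclideanSpace ℝ (Fin 6) [⋀^Fin 3]→L[ℝ] ℝ}
  {D : EuclideanSpace ℝ (Fin 3) →L[ℝ] EuclideanSpace ℝ (Fin 6)}

/-- Contracting `r` with `J` of a tangent vector gives minus the contraction of `s` with that
vector. Since `s` restricts to a positive multiple `q` of the volume form, tangent vectors rotated
by `J` already produce all 2-forms. -/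
theorem contrLin_surjective (hs : IsHitchinDual r s)
    (hpos : 0 < s fun i => D (EuclideanSpace.basisFun (Fin 3) ℝ i)) :
    Surjective (contrLin r D) := by
  obtain ⟨J, hJ⟩ := hs.exists_rotation
  intro c
  obtain ⟨u, hu⟩ := volForm_curryLeft_surjective c
  set q := s fun i => D (EuclideanSpace.basisFun (Fin 3) ℝ i) with hq
  refine ⟨J (D ((-q⁻¹) • u)), ?_⟩
  ext v
  have h1 : ∀ (w : EuclideanSpace ℝ (Fin 6)) (v : Fin 2 → EuclideanSpace ℝ (Fin 3)),
      (Fin.cons w fun i => D (v i) : Fin 3 → EuclideanSpace ℝ (Fin 6)) =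
      ![w, D (v 0), D (v 1)] := fun w v => by
    funext i
    fin_cases i <;> rfl
  have h2 : s ![D ((-q⁻¹) • u), D (v 0), D (v 1)] =
      (s.compContinuousLinearMap D) ![(-q⁻¹) • u, v 0, v 1] := by
    show _ = s (D ∘ _)
    congr 1
    funext i
    fin_cases i <;> rfl
  have h3 : s.compContinuousLinearMap D = q • volForm 3 := eq_smul_volForm _
  have h4 : volForm 3 ![(-q⁻¹) • u, v 0, v 1] = (-q⁻¹) * c v := by
    rw [← hu]
    have h5 : ![(-q⁻¹) • u, v 0, v 1] = Fin.cons ((-q⁻¹) • u) v := by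
      funext i
      fin_cases i <;> rfl
    rw [h5]
    have h6 := DFunLike.congr_fun (map_smul (volForm 3).curryLeft (-q⁻¹) u) v
    exact h6
  rw [contrLin_apply, h1, hJ, h2, h3, ContinuousAlternatingMap.smul_apply, h4, smul_eq_mul]
  have : q ≠ 0 := hpos.ne'
  field_simp

/-- The contraction with `r` is onto a space of dimension three, so its kernel has dimension three
and is the image of `D`, on which `r` vanishes. The contraction with `t` also kills this image,
since 4-forms vanish on a space of dimension three. Hence it factors through the contraction with
`r`, and every linear map from 2-forms to 3-forms in dimension three is the wedge product with a
covector. -/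
theorem exists_covector (hs : IsHitchinDual r s)
    (hpos : 0 < s fun i => D (EuclideanSpace.basisFun (Fin 3) ℝ i))
    (h0 : r.compContinuousLinearMap D = 0) (t : EuclideanSpace ℝ (Fin 6) [⋀^Fin 4]→L[ℝ] ℝ) :
    ∃ θ : EuclideanSpace ℝ (Fin 3) →L[ℝ] ℝ,
      ∀ w, contrLin t D w = wedge1 θ (contrLin r D w) := by
  have hsurj := contrLin_surjective hs hpos
  -- A nonzero value of an alternating form forces its arguments to be independent.
  have hD : Injective D := by
    have h1 : LinearIndependent ℝ fun i => D (EuclideanSpace.basisFun (Fin 3) ℝ i) := by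
      by_contra h
      exact hpos.ne' (s.toAlternatingMap.map_linearDependent _ h)
    rw [injective_iff_map_eq_zero]
    intro u hu
    have h2 : ∑ i, u i • D (EuclideanSpace.basisFun (Fin 3) ℝ i) = 0 := by
      rw [← hu]
      conv_rhs => rw [← (EuclideanSpace.basisFun (Fin 3) ℝ).sum_repr u]
      rw [map_sum]
      simp
    ext i
    exact Fintype.linearIndependent_iff.mp h1 _ h2 i
  have hrk : Module.finrank ℝ (EuclideanSpace ℝ (Fin 3) [⋀^Fin 2]→L[ℝ] ℝ) = 3 := by
    rw [← volEquiv.toLinearEquiv.finrank_eq]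
    simp
  have hker : LinearMap.range D.toLinearMap = LinearMap.ker (contrLin r D) := by
    refine Submodule.eq_of_le_of_finrank_eq ?_ ?_
    · rintro _ ⟨u, rfl⟩
      rw [LinearMap.mem_ker]
      refine (contrLin_map r D u).trans ?_
      rw [h0]
      rfl
    · have h1 := LinearMap.finrank_range_add_finrank_ker (contrLin r D)
      rw [LinearMap.range_eq_top.mpr hsurj, finrank_top, hrk] at h1
      rw [LinearMap.finrank_range_of_inj hD]
      simp only [finrank_euclideanSpace, Fintype.card_fin] at h1 ⊢
      omega
  have ht0 : ∀ w, contrLin r D w = 0 → contrLin t D w = 0 := by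
    intro w hw
    have hw' : w ∈ LinearMap.range D.toLinearMap := hker ▸ LinearMap.mem_ker.mpr hw
    obtain ⟨u, rfl⟩ := hw'
    refine (contrLin_map t D u).trans ?_
    have h4 : t.compContinuousLinearMap D = 0 := by
      ext v
      refine (t.compContinuousLinearMap D).toAlternatingMap.map_linearDependent v fun h => ?_
      have := h.fintype_card_le_finrank
      simp at this
    rw [h4]
    rfl
  obtain ⟨S, hS⟩ := (contrLin r D).exists_rightInverse_of_surjective
    (LinearMap.range_eq_top.mpr hsurj)
  have hS' : ∀ c, contrLin r D (S c) = c := fun c => LinearMap.congr_fun hS c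
  let ev : (EuclideanSpace ℝ (Fin 3) [⋀^Fin 3]→L[ℝ] ℝ) →ₗ[ℝ] ℝ :=
    { toFun := fun η => η (EuclideanSpace.basisFun (Fin 3) ℝ)
      map_add' := fun _ _ => rfl
      map_smul' := fun _ _ => rfl }
  -- The covector is the factored map read through the identification `u ↦ i_u vol`, under which `θ
  -- ∧ i_u vol = θ(u) vol`.
  refine ⟨LinearMap.toContinuousLinearMap
    (ev ∘ₗ contrLin t D ∘ₗ S ∘ₗ volEquiv.toLinearEquiv.toLinearMap), fun w => ?_⟩
  have h5 : contrLin t D w = contrLin t D (S (contrLin r D w)) := by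
    rw [← sub_eq_zero, ← map_sub]
    exact ht0 _ (by rw [map_sub, hS', sub_self])
  obtain ⟨u, hu⟩ := volEquiv.surjective (contrLin r D w)
  rw [← hu, wedge1_volEquiv, h5, ← hu]
  exact eq_smul_volForm _

end Algebra

/-! ### Solving for fields with a prescribed contraction -/

section Frames

variable {P M : Type u}
  [TopologicalSpace P] [ChartedSpace (EuclideanSpace ℝ (Fin 3)) P] [IsManifold (𝓡 3) ∞ P]
  [TopologicalSpace M] [ChartedSpace (EuclideanSpace ℝ (Fin 6)) M] [IsManifold (𝓡 6) ∞ M]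
  [T2Space M] [CompactSpace M] {ρ : Form 6 M 3} {τ : Form 6 M 4} {ι : P → M}

/-- Three fields are chosen whose contractions form the standard frame at `y`. They remain a frame
nearby because invertibility is open, and `R` is the smooth inverse of their coefficient matrix. -/
theorem exists_local_frame (hι : ContMDiff (𝓡 3) (𝓡 6) ∞ ι)
    (hsm : ∀ X, IsSmoothAlong (n := 3) (m := 6) ι X → IsSmoothForm (contr (n := 3) ρ ι X))
    (hsurj : ∀ p c, ∃ w, contrAt ρ ι p w = c)
    {e : OpenPartialHomeomorph P (EuclideanSpace ℝ (Fin 3))}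
    (he : e ∈ atlas (EuclideanSpace ℝ (Fin 3)) P) {y : EuclideanSpace ℝ (Fin 3)}
    (hy : y ∈ e.target) :
    ∃ X : Fin 3 → P → EuclideanSpace ℝ (Fin 6), (∀ k, IsSmoothAlong (n := 3) (m := 6) ι (X k)) ∧
      ∃ (W : Set (EuclideanSpace ℝ (Fin 3)))
        (R : EuclideanSpace ℝ (Fin 3) → EuclideanSpace ℝ (Fin 3) →L[ℝ] EuclideanSpace ℝ (Fin 3)),
        IsOpen W ∧ y ∈ W ∧ W ⊆ e.target ∧ ContDiffOn ℝ ∞ R W ∧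
        ∀ z ∈ W, ∀ u, ∑ k, R z u k • chartRep (contr (n := 3) ρ ι (X k)) e z = volEquiv u := by
  have h1 : ∀ k : Fin 3, ∃ X, IsSmoothAlong (n := 3) (m := 6) ι X ∧
      chartRep (contr (n := 3) ρ ι X) e y =
        volEquiv (EuclideanSpace.basisFun (Fin 3) ℝ k) := fun k => by
    obtain ⟨w, hw⟩ := hsurj (e.symm y) ((volEquiv (EuclideanSpace.basisFun (Fin 3) ℝ k)).compContinuousLinearMap
      (tder (𝓡 3) (𝓡 3) e univ (e.symm y)))
    obtain ⟨X, hX, hXw⟩ := exists_isSmoothAlong_through (n := 3) (m := 6) hι (e.symm y) w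
    refine ⟨X, hX, ?_⟩
    rw [chartRep_eq, contr_val_eq, hXw, hw]
    have h := tder_chart_comp_symm he hy
    ext v
    simp only [ContinuousAlternatingMap.compContinuousLinearMap_apply]
    congr 1
    funext i
    exact DFunLike.congr_fun h (v i)
  choose X hX hXy using h1
  let F : EuclideanSpace ℝ (Fin 3) → EuclideanSpace ℝ (Fin 3) →L[ℝ] EuclideanSpace ℝ (Fin 3) :=
    fun z => ∑ k, (EuclideanSpace.proj (𝕜 := ℝ) k).smulRight
      (volEquiv.symm (chartRep (contr (n := 3) ρ ι (X k)) e z))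
  have hF : ContDiffOn ℝ ∞ F e.target := by
    refine ContDiffOn.sum fun k _ => ?_
    exact ContDiffOn.smulRight contDiffOn_const
      (volEquiv.symm.contDiff.comp_contDiffOn (hsm _ (hX k) e he))
  have hFapp : ∀ z u, F z u = ∑ k, u k •
      volEquiv.symm (chartRep (contr (n := 3) ρ ι (X k)) e z) := fun z u => by
    simp only [F, _root_.sum_apply]
    rfl
  have hFy : F y = ContinuousLinearEquiv.refl ℝ (EuclideanSpace ℝ (Fin 3)) := by
    ext1 u
    rw [hFapp]
    simp only [hXy, ContinuousLinearEquiv.symm_apply_apply]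
    exact (EuclideanSpace.basisFun (Fin 3) ℝ).sum_repr u
  let W := e.target ∩ F ⁻¹' range
    ((↑) : (EuclideanSpace ℝ (Fin 3) ≃L[ℝ] EuclideanSpace ℝ (Fin 3)) → _)
  refine ⟨X, hX, W, fun z => (F z).inverse,
    hF.continuousOn.isOpen_inter_preimage e.open_target ContinuousLinearEquiv.isOpen,
    ⟨hy, _, hFy.symm⟩, inter_subset_left, fun z hz => ?_, fun z hz u => ?_⟩
  · obtain ⟨hzT, g, hg⟩ := hz
    have h2 : ContDiffAt ℝ ∞ ContinuousLinearMap.inverse (F z) := by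
      rw [← hg]
      exact contDiffAt_map_inverse g
    exact (h2.comp z (hF.contDiffAt (e.open_target.mem_nhds hzT))).contDiffWithinAt
  · obtain ⟨hzT, g, hg⟩ := hz
    have h3 : F z ((F z).inverse u) = u := by
      rw [← hg, ContinuousLinearMap.inverse_equiv]
      exact g.apply_symm_apply u
    rw [hFapp] at h3
    have h4 := congrArg volEquiv h3
    rw [map_sum] at h4
    simpa only [map_smul, ContinuousLinearEquiv.apply_symm_apply] using h4

/-- In a local frame `θ(u) vol = θ ∧ i_u vol` is a combination, with smooth coefficients, of the
contractions of `τ` with smooth fields. -/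
theorem isSmoothCov_of_contr_eq (hι : ContMDiff (𝓡 3) (𝓡 6) ∞ ι)
    (hsm : ∀ X, IsSmoothAlong (n := 3) (m := 6) ι X → IsSmoothForm (contr (n := 3) ρ ι X))
    (hsmτ : ∀ X, IsSmoothAlong (n := 3) (m := 6) ι X → IsSmoothForm (contr (n := 3) τ ι X))
    (hsurj : ∀ p c, ∃ w, contrAt ρ ι p w = c) {θ : CovectorField 3 P}
    (hθ : ∀ p w, contrAt τ ι p w = wedge1 (θ p) (contrAt ρ ι p w)) : IsSmoothCov θ := by
  intro e he y hy
  obtain ⟨X, hX, W, R, hW, hyW, hWe, hR, hRz⟩ := exists_local_frame hι hsm hsurj he hy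
  have h1 : ∀ z ∈ W, ∀ u, coRep θ e z u =
      ∑ k, R z u k * chartRep (contr (n := 3) τ ι (X k)) e z (EuclideanSpace.basisFun _ ℝ) := by
    intro z hz u
    have h2 : ∀ k, contr (n := 3) τ ι (X k) = wedgeForm θ (contr (n := 3) ρ ι (X k)) := fun k =>
      funext fun p => hθ p (X k p)
    have h3 := wedge1_volEquiv (coRep θ e z) u
    have h4 := congrArg (fun η => wedge1 (coRep θ e z) η (EuclideanSpace.basisFun _ ℝ)) (hRz z hz u)
    simp only [h3, ContinuousAlternatingMap.smul_apply, volForm_basisFun, smul_eq_mul,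
      mul_one, Fin.sum_univ_three, wedge1_add_right, wedge1_smul_right,
      ContinuousAlternatingMap.add_apply] at h4
    rw [Fin.sum_univ_three, h2, h2, h2, chartRep_wedgeForm, chartRep_wedgeForm, chartRep_wedgeForm]
    exact h4.symm
  have h2 : ContDiffOn ℝ ∞ (coRep θ e) W := by
    rw [contDiffOn_clm_apply]
    intro u
    refine ContDiffOn.congr (ContDiffOn.sum fun k _ => ContDiffOn.mul ?_ fun z hz => ?_)
      fun z hz => h1 z hz u
    · exact (EuclideanSpace.proj (𝕜 := ℝ) k).contDiff.comp_contDiffOn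
        (hR.clm_apply contDiffOn_const)
    · exact contDiffWithinAt_alternating_apply (v := fun _ => EuclideanSpace.basisFun _ ℝ)
        ((hsmτ _ (hX k) e he).mono hWe z hz) fun _ => contDiffWithinAt_const
  exact (h2.contDiffAt (hW.mem_nhds hyW)).contDiffWithinAt

theorem exists_local_solution (hι : ContMDiff (𝓡 3) (𝓡 6) ∞ ι)
    (hsm : ∀ X, IsSmoothAlong (n := 3) (m := 6) ι X → IsSmoothForm (contr (n := 3) ρ ι X))
    (hsurj : ∀ p c, ∃ w, contrAt ρ ι p w = c) (p : P) :
    ∃ U : Set P, IsOpen U ∧ p ∈ U ∧ ∀ b : P → ℝ, ContMDiff (𝓡 3) 𝓘(ℝ, ℝ) ∞ b → tsupport b ⊆ U →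
      ∀ c : Form 3 P 2, IsSmoothForm c → ∃ X, IsSmoothAlong (n := 3) (m := 6) ι X ∧
        contr (n := 3) ρ ι X = fmul b c := by
  have he := chart_mem_atlas (EuclideanSpace ℝ (Fin 3)) p
  have hp := mem_chart_source (EuclideanSpace ℝ (Fin 3)) p
  set e := chartAt (EuclideanSpace ℝ (Fin 3)) p with hedef
  obtain ⟨X, hX, W, R, hW, hpW, hWe, hR, hRz⟩ :=
    exists_local_frame hι hsm hsurj he (e.map_source hp)
  refine ⟨e.source ∩ e ⁻¹' W, e.isOpen_inter_preimage hW, ⟨hp, hpW⟩, fun b hb hbs c hc => ?_⟩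
  let a : Fin 3 → P → ℝ := fun k q => b q * R (e q) (volEquiv.symm (chartRep c e (e q))) k
  have ha : ∀ k, ContMDiff (𝓡 3) 𝓘(ℝ, ℝ) ∞ (a k) := by
    intro k q
    by_cases hq : q ∈ tsupport b
    · have hqU := hbs hq
      have h1 : ContDiffAt ℝ ∞ (fun z => R z (volEquiv.symm (chartRep c e z)) k) (e q) := by
        refine (EuclideanSpace.proj (𝕜 := ℝ) k).contDiff.contDiffAt.comp (e q)
          ((hR.contDiffAt (hW.mem_nhds hqU.2)).clm_apply ?_)
        exact volEquiv.symm.contDiff.contDiffAt.comp (e q)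
          ((hc e he).contDiffAt (e.open_target.mem_nhds (e.map_source hqU.1)))
      exact (hb q).mul (ContMDiffAt.comp (I' := 𝓡 3)
        (g := fun z => R z (volEquiv.symm (chartRep c e z)) k) q h1.contMDiffAt
        (contMDiffAt_chart he hqU.1))
    · refine (contMDiffAt_const (c := (0 : ℝ))).congr_of_eventuallyEq ?_
      filter_upwards [(isClosed_tsupport b).isOpen_compl.mem_nhds hq] with z hz
      show b z * _ = 0
      rw [image_eq_zero_of_notMem_tsupport hz, zero_mul]
  refine ⟨fun q => ∑ k, a k q • X k q, isSmoothAlong_sum _ fun k _ => (hX k).smul (ha k), ?_⟩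
  funext q
  show contrLin (ρ.val (ι q)) (tder (𝓡 3) (𝓡 6) ι univ q) (∑ k, a k q • X k q) = b q • c.val q
  rw [map_sum]
  by_cases hq : q ∈ tsupport b
  · have hqU := hbs hq
    have h1 := hRz (e q) hqU.2 (volEquiv.symm (chartRep c e (e q)))
    rw [ContinuousLinearEquiv.apply_symm_apply] at h1
    rw [form_val_eq c he hqU.1, ← h1]
    have h2 : ∀ k, contrLin (ρ.val (ι q)) (tder (𝓡 3) (𝓡 6) ι univ q) (X k q) =
        (chartRep (contr (n := 3) ρ ι (X k)) e (e q)).compContinuousLinearMap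
          (tder (𝓡 3) (𝓡 3) e univ q) := fun k => form_val_eq (contr (n := 3) ρ ι (X k)) he hqU.1
    simp only [map_smul, h2, Fin.sum_univ_three, a]
    ext v
    simp only [ContinuousAlternatingMap.add_apply, ContinuousAlternatingMap.smul_apply,
      ContinuousAlternatingMap.compContinuousLinearMap_apply, smul_eq_mul]
    ring
  · have hb0 : b q = 0 := image_eq_zero_of_notMem_tsupport hq
    simp only [a, hb0, zero_mul, zero_smul, map_zero, Finset.sum_const_zero]

/-- The contraction is linear in the field, so the local solutions for `fᵢ c` add up to a solution
for `c`. -/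
theorem exists_contr_eq [T2Space P] [CompactSpace P] (hι : ContMDiff (𝓡 3) (𝓡 6) ∞ ι)
    (hsm : ∀ X, IsSmoothAlong (n := 3) (m := 6) ι X → IsSmoothForm (contr (n := 3) ρ ι X))
    (hsurj : ∀ p c, ∃ w, contrAt ρ ι p w = c) {c : Form 3 P 2} (hc : IsSmoothForm c) :
    ∃ X, IsSmoothAlong (n := 3) (m := 6) ι X ∧ contr (n := 3) ρ ι X = c := by
  choose U hU hpU hsol using exists_local_solution hι hsm hsurj
  obtain ⟨f, hf⟩ := SmoothPartitionOfUnity.exists_isSubordinate (𝓡 3) isClosed_univ U hU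
    fun p _ => mem_iUnion.mpr ⟨p, hpU p⟩
  choose X hX hXc using fun i => hsol i (f i) (f i).contMDiff (hf i) c hc
  have hfin := f.locallyFinite.finite_nonempty_of_compact
  have hsum : ∀ q, ∑ i ∈ hfin.toFinset, f i q = 1 := fun q => by
    rw [← f.sum_eq_one (mem_univ q)]
    symm
    apply finsum_eq_sum_of_support_subset
    intro i hi
    rw [Finset.mem_coe, Set.Finite.mem_toFinset]
    exact ⟨q, hi⟩
  refine ⟨fun q => ∑ i ∈ hfin.toFinset, X i q, isSmoothAlong_sum _ fun i _ => hX i, ?_⟩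
  funext q
  show contrLin (ρ.val (ι q)) (tder (𝓡 3) (𝓡 6) ι univ q) (∑ i ∈ hfin.toFinset, X i q) = c.val q
  rw [map_sum]
  have h1 : ∀ i, contrLin (ρ.val (ι q)) (tder (𝓡 3) (𝓡 6) ι univ q) (X i q) = f i q • c.val q :=
    fun i => congrFun (hXc i) q
  simp only [h1]
  rw [← Finset.sum_smul, hsum, one_smul]

end Frames

/-! ### The Lagrange multipliers problem -/

section Multipliers

/-- For closed `b` the integrand is `d(f b)`, so this is Stokes' theorem. -/
theorem formIntegral_wedgeForm_dfun {m : ℕ} {X : Type*} [TopologicalSpace X]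
    [ChartedSpace (EuclideanSpace ℝ (Fin (m + 1))) X] [IsManifold (𝓡 (m + 1)) ∞ X] [T2Space X]
    [CompactSpace X] (hX : IsOrientedAtlas (m + 1) X) {f : X → ℝ}
    (hf : ContMDiff (𝓡 (m + 1)) 𝓘(ℝ, ℝ) ∞ f) {b : Form (m + 1) X m} (hb : IsSmoothForm b)
    (hbc : IsClosedForm b) : formIntegral (wedgeForm (dfun f) b) = 0 := by
  rw [formIntegral_eq_sum, ← stokes hX (hb.fmul hf)]
  refine Finset.sum_congr rfl fun i _ => ?_
  have he := chart_mem_atlas (EuclideanSpace ℝ (Fin (m + 1))) i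
  rw [chartIntegral]
  refine setIntegral_congr_fun (OpenPartialHomeomorph.open_target _).measurableSet fun y hy => ?_
  show chartRep _ _ y _ = _ * _
  rw [extDeriv_chartRep_fmul hf hb he hy, hbc _ he y hy, smul_zero, add_zero, chartRep_fmul,
    ContinuousAlternatingMap.smul_apply, smul_eq_mul]

/-- By naturality it suffices to test each point in its preferred chart, where the derivative of the
constraint is computed. -/
theorem isClosedForm_of_chartAt {n k : ℕ} {X : Type*} [TopologicalSpace X]
    [ChartedSpace (EuclideanSpace ℝ (Fin n)) X] [IsManifold (𝓡 n) ∞ X] {η : Form n X k}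
    (hη : IsSmoothForm η)
    (h : ∀ x, extDeriv (chartRep η (chartAt (EuclideanSpace ℝ (Fin n)) x))
      (chartAt (EuclideanSpace ℝ (Fin n)) x x) = 0) : IsClosedForm η := by
  intro e he y hy
  have hx := mem_chart_source (EuclideanSpace ℝ (Fin n)) (e.symm y)
  rw [extDeriv_chartRep_transition hη he (chart_mem_atlas _ (e.symm y)) (y := y) (by
    rw [OpenPartialHomeomorph.trans_source]
    exact ⟨hy, hx⟩)]
  have h1 := h (e.symm y)
  have h2 : (e.symm ≫ₕ chartAt (EuclideanSpace ℝ (Fin n)) (e.symm y)) y =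
      chartAt (EuclideanSpace ℝ (Fin n)) (e.symm y) (e.symm y) := rfl
  rw [h2, h1]
  rfl

variable {P M : Type u}
  [TopologicalSpace P] [ChartedSpace (EuclideanSpace ℝ (Fin 3)) P] [IsManifold (𝓡 3) ∞ P]
  [T2Space P] [CompactSpace P]
  [TopologicalSpace M] [ChartedSpace (EuclideanSpace ℝ (Fin 6)) M] [IsManifold (𝓡 6) ∞ M]
  {ρ : Form 6 M 3} {τ : Form 6 M 4} {κ : H3 P} {A : H3 M} {ι₀ : P → M} {Φ : ℝ → P → M}

/-- Stationarity of the constraint says that `ι^*(i_X ρ)` is closed, and then `∫ dλ ∧ ι^*(i_X ρ)`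
vanishes. -/
theorem PerturbedSL.solvesLagrangeMultipliersProblem (hP : IsOrientedAtlas 3 P)
    (hρ : IsSmoothForm ρ) (hρc : IsClosedForm ρ) (hτ : IsSmoothForm τ) (hτc : IsClosedForm τ)
    {lam : P → ℝ} (hlam : ContMDiff (𝓡 3) 𝓘(ℝ, ℝ) ∞ lam) (h : PerturbedSL ρ τ lam (Φ 1)) :
    SolvesLagrangeMultipliersProblem ρ τ κ A ι₀ Φ := by
  refine ⟨h.constraint, fun ε Ψ hΨ hd => ?_⟩
  refine (hΨ.hasDerivAt_fTau hP hτ hτc).congr_deriv ?_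
  have hs := hΨ.isSmoothForm_contr hρ
  have h3 : contr (n := 3) τ (Φ 1) (velocity Ψ) =
      wedgeForm (dfun lam) (contr (n := 3) ρ (Φ 1) (velocity Ψ)) :=
    funext fun p => (perturbedSL_iff.mp h).1 p (velocity Ψ p)
  rw [h3]
  refine formIntegral_wedgeForm_dfun hP hlam hs (isClosedForm_of_chartAt hs fun p => ?_)
  ext v
  exact (hΨ.hasDerivAt_pullbackForm hρ hρc p v).unique (hd p v)

variable [T2Space M] [CompactSpace M]

theorem SolvesLagrangeMultipliersProblem.exists_perturbedSL (hP : IsOrientedAtlas 3 P)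
    (hM : IsOrientedAtlas 6 M) (hρ : IsSmoothForm ρ) (hρc : IsClosedForm ρ)
    (hρ_pos : ∀ x, IsPositive (ρ x)) (hτ : IsSmoothForm τ) (hτc : IsClosedForm τ)
    (hΦ : IsPath ρ κ A ι₀ Φ) (h : SolvesLagrangeMultipliersProblem ρ τ κ A ι₀ Φ) :
    ∃ lam : P → ℝ, ContMDiff (𝓡 3) 𝓘(ℝ, ℝ) ∞ lam ∧ PerturbedSL ρ τ lam (Φ 1) := by
  have hF := hΦ.mem 1 ⟨zero_le_one, le_rfl⟩
  have hι : ContMDiff (𝓡 3) (𝓡 6) ∞ (Φ 1) := hF.embedding.contMDiff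
  have hsm : ∀ {k : ℕ} {α : Form 6 M (k + 1)}, IsSmoothForm α →
      ∀ X, IsSmoothAlong (n := 3) (m := 6) (Φ 1) X → IsSmoothForm (contr (n := 3) α (Φ 1) X) := by
    intro k α hα X hX
    obtain ⟨δ, Ψ, hΨ, rfl⟩ := hΦ.exists_isVariation_velocity hP hM hρ hρ_pos hX
    exact hΨ.isSmoothForm_contr hα
  have hdual : ∀ p, IsHitchinDual (ρ.val (Φ 1 p)) (hitchinDual (ρ.val (Φ 1 p))) := fun p =>
    (hρ_pos _).isHitchinDual
  have hpos : ∀ p, 0 < hitchinDual (ρ.val (Φ 1 p)) fun i =>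
      tder (𝓡 3) (𝓡 6) (Φ 1) univ p (EuclideanSpace.basisFun (Fin 3) ℝ i) := fun p => by
    have h1 := hF.positive p (EuclideanSpace.basisFun (Fin 3) ℝ)
      (by rw [frameDet_basisFun]; exact one_pos)
    rw [tder_univ]
    exact h1
  have h0 : ∀ p, (ρ.val (Φ 1 p)).compContinuousLinearMap (tder (𝓡 3) (𝓡 6) (Φ 1) univ p) = 0 :=
    fun p => by
      rw [tder_univ]
      exact congrFun h.1 p
  have hsurj : ∀ p c, ∃ w, contrAt ρ (Φ 1) p w = c := fun p c =>
    contrLin_surjective (hdual p) (hpos p) c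
  have hex : ∀ p, ∃ θ : EuclideanSpace ℝ (Fin 3) →L[ℝ] ℝ, ∀ w,
      contrAt τ (Φ 1) p w = wedge1 θ (contrAt ρ (Φ 1) p w) := fun p =>
    exists_covector (hdual p) (hpos p) (h0 p) (τ.val (Φ 1 p))
  choose θ hθ using hex
  have hθs : IsSmoothCov (n := 3) θ := isSmoothCov_of_contr_eq hι (hsm hρ) (hsm hτ) hsurj hθ
  -- Each closed 2-form `c` is the contraction of `ρ` with the velocity of some variation. The
  -- constraint is stationary along it because `dc = 0`, so the hypothesis gives `∫ θ ∧ c = 0`.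
  obtain ⟨lam, hlam, hlamθ⟩ := exists_potential hP hθs fun c hc hcc => by
    obtain ⟨X, hX, hXc⟩ := exists_contr_eq hι (hsm hρ) hsurj hc
    obtain ⟨δ, Ψ, hΨ, rfl⟩ := hΦ.exists_isVariation_velocity hP hM hρ hρ_pos hX
    have h1 := h.2 δ Ψ hΨ fun p v => by
      refine (hΨ.hasDerivAt_pullbackForm hρ hρc p v).congr_deriv ?_
      rw [hXc, hcc _ (chart_mem_atlas _ p) _ (mem_chart_target _ p)]
      rfl
    have h2 := (hΨ.hasDerivAt_fTau hP hτ hτc).unique h1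
    have h3 : contr (n := 3) τ (Φ 1) (velocity Ψ) = wedgeForm θ c := by
      rw [← hXc]
      exact funext fun p => hθ p (velocity Ψ p)
    rwa [h3] at h2
  refine ⟨lam, hlam, perturbedSL_iff.mpr ⟨fun p w => ?_, h.1⟩⟩
  rw [hlamθ]
  exact hθ p w

end Multipliers

end

end SLagrange

open SLagrange in
theorem mainTheorem3
    {P M : Type u}
    [TopologicalSpace P] [ChartedSpace (EuclideanSpace ℝ (Fin 3)) P] [IsManifold (𝓡 3) ∞ P]
    [T2Space P] [CompactSpace P] (hP : IsOrientedAtlas 3 P)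
    [TopologicalSpace M] [ChartedSpace (EuclideanSpace ℝ (Fin 6)) M] [IsManifold (𝓡 6) ∞ M]
    [T2Space M] [CompactSpace M] (hM : IsOrientedAtlas 6 M)
    (ρ : Form 6 M 3) (hρ : IsSmoothForm ρ) (hρ_closed : IsClosedForm ρ)
    (hρ_pos : ∀ x, IsPositive (ρ x))
    (τ : Form 6 M 4) (hτ : IsSmoothForm τ) (hτ_closed : IsClosedForm τ)
    (κ : H3 P) (A : H3 M) (ι₀ : P → M) (Φ : ℝ → P → M) (hΦ : IsPath ρ κ A ι₀ Φ) :
    (∀ lam : P → ℝ, ContMDiff (𝓡 3) 𝓘(ℝ, ℝ) ∞ lam →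
      (IsCriticalPoint ρ τ κ A ι₀ lam Φ ↔ PerturbedSL ρ τ lam (Φ 1))) ∧
    (SolvesLagrangeMultipliersProblem ρ τ κ A ι₀ Φ ↔
      ∃ lam : P → ℝ, ContMDiff (𝓡 3) 𝓘(ℝ, ℝ) ∞ lam ∧ PerturbedSL ρ τ lam (Φ 1)) := by
  refine ⟨fun lam hlam => ⟨fun h => h.perturbedSL hP hM hρ hρ_closed hρ_pos hτ hτ_closed hΦ hlam,
    fun h => h.isCriticalPoint hP hρ hρ_closed hτ hτ_closed hlam⟩, fun h =>
    h.exists_perturbedSL hP hM hρ hρ_closed hρ_pos hτ hτ_closed hΦ, ?_⟩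
  rintro ⟨lam, hlam, h⟩
  exact h.solvesLagrangeMultipliersProblem hP hρ hρ_closed hτ hτ_closed hlam
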